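/- **Setting.** For $n$ qubits and a Hermitian operator $O=\sum_P a_P P$, $P\in\{I,X,Y,Z\}^{\otimes n}$, $a_P=2^{-n}\operatorname{Tr}[OP]$, let $|P|$ be the number of non-identity factors of $P$, $\|O\|$ the operator norm and $\|O\|_{\mathrm{Pauli},2}=(\sum_P|a_P|^2)^{1/2}$. A distribution on $\mathbb U(2^m)$ is *locally scrambling* if $\mathbb E[U^{\otimes2}\otimes U^{*\otimes2}]$ does not change when $U$ is replaced by $(V_1\otimes\dots\otimes V_m)U$ with independent uniformly random single-qubit Clifford gates $V_i$. A random circuit $U=U_LU_{L-1}\cdots U_1$ ($L\ge 1$) is drawn from an *$L$-layered locally scrambling ensemble* if the layers are independent, $U_1$ is locally scrambling on all $n$ qubits, and for $j\ge2$ one has $U_j=V_{A_j}\otimes I$ with $V_{A_j}$ locally scrambling on a set $A_j$ of qubits. The *shallow-layer condition* says that for all $j$ and $P$ the operator $U_j^\dagger PU_j$ has at most $n^{O(|P|)}$ Pauli terms, and these are computable by a subroutine in time $n^{O(|P|)}$ (polynomial in $n$ for $P=I$). For a state $\rho$ put $f_U(O)=\operatorname{Tr}[U\rho U^\dagger O]$.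 *Low-weight Pauli propagation* of order $k$ goes from layer $L$ to layer $1$; at each layer it discards the Pauli terms of weight larger than $k$ of the current observable (initially $O$) and conjugates the rest, $X\mapsto U_j^\dagger XU_j$. If $O_U^{(k)}$ is the final observable, the estimate is $\tilde f^{(k)}_U(O)=\operatorname{Tr}[O^{(k)}_U\rho]$. For $\epsilon,\delta>0$ let $$k(\epsilon,\delta)=\max\Big(0,\Big\lceil\frac{\log\big(2/(3\epsilon^2\delta)\big)}{\log(3/2)}\Big\rceil\Big).$$ Running times are those of a uniform program on a real-number random access machine (exact real arithmetic at unit cost; integer addition, subtraction, comparison and indexing at unit cost), with calls of subroutines charged with their running times and the size of their input and output. The numbers $\operatorname{Tr}[P\rho]$, and in (2) also $2^{-n}\operatorname{Tr}[PO]$, are available for any $P$ in time polynomial in $n$. **Theorem.** (0) For $\epsilon,\delta\in(0,1]$, $k(\epsilon,\delta)\le C\,(1+\log(\epsilon^{-1}\delta^{-1}))$ with an absolute constant $C$. (1) Let $U$ be drawn from an $L$-layered locally scrambling ensemble (the shallow-layer condition is not needed here), let $\rho$ be a state, $O$ an observable, $\epsilon,\delta>0$, and $k=k(\epsilon,\delta)$.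 Then with probability at least $1-\delta$ over $U$, $|f_U(O)-\tilde f_U^{(k)}(O)|\le\epsilon\|O\|_{\mathrm{Pauli},2}$, and $\|O\|_{\mathrm{Pauli},2}\le\|O\|$. (2) There is an algorithm $\mathcal A$ such that for all $n\ge2$, $L\ge1$, $\epsilon,\delta\in(0,1]$, all $L$-layered locally scrambling ensembles that satisfy the shallow-layer condition, all states $\rho$ and all observables $O$ with $\|O\|\le1$: for almost every $U$, $\mathcal A$ outputs $\mathcal A(U)=\tilde f_U^{(k(\epsilon,\delta))}(O)$ within time $L\cdot n^{C(1+\log(\epsilon^{-1}\delta^{-1}))}$, and $|\mathcal A(U)-\operatorname{Tr}[U\rho U^\dagger O]|\le\epsilon$ with probability at least $1-\delta$ over $U$. The constant $C$ depends only on the implied constants of the shallow-layer condition and of the polynomial access times. (3) Let $G$ be a graph on the $n$ qubits. Say that $G$ has geometric dimension $D\ge1$ with constant $K$ if, for every $\ell\ge1$, at most $K\ell^D$ vertices can be reached from a single vertex in $\ell$ steps in each of which every vertex already reached adds at most one of its neighbours. Let almost every $U$ in an $L$-layered locally scrambling ensemble be geometrically local, that is, each layer consists of non-overlapping two-qubit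 gates on edges of $G$ and single-qubit gates; let $O=\sum_{i\le m}a_iP_i$, $a_i\in\mathbb R$, be given by a list of $m\le n^a$ weighted Pauli operators, with $\|O\|\le1$, and let the circuit be given by the positions and matrix entries of its gates. There is an algorithm (independent of $G,D,K,a$) such that for $n,L\ge2$ and $\epsilon,\delta\in(0,1]$ it outputs, for almost every $U$, the value $\mathcal A(U)=\tilde f_U^{(k(\epsilon,\delta))}(O)$ within time $$n^{C}\,L\,\min(n,L^D)^{C(1+\log(\epsilon^{-1}\delta^{-1}))},$$ and $|\mathcal A(U)-\operatorname{Tr}[U\rho U^\dagger O]|\le\epsilon$ with probability at least $1-\delta$ over $U$. The constant $C$ depends only on $a$, $K$ and the polynomial access time of $\operatorname{Tr}[P\rho]$. -/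

import Mathlib

open MeasureTheory

/-! ## Qubits, Pauli operators and norms -/

/-- Operators on a register of qubits labelled by `ι`; the computational basis is `ι → Fin 2`. -/
abbrev QOp (ι : Type) : Type := Matrix (ι → Fin 2) (ι → Fin 2) ℂ

/-- The unitary group `U(2^|ι|)` of the register. -/
abbrev QUnitary (ι : Type) [Fintype ι] [DecidableEq ι] : Type :=
  Matrix.unitaryGroup (ι → Fin 2) ℂ

/-- Unitary groups carry their Borel σ-algebra. -/
noncomputable instance instMeasurableSpaceUnitaryGroup {m : Type} [Fintype m] [DecidableEq m] :
    MeasurableSpace (Matrix.unitaryGroup m ℂ) := borel _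

instance instBorelSpaceUnitaryGroup {m : Type} [Fintype m] [DecidableEq m] :
    BorelSpace (Matrix.unitaryGroup m ℂ) := ⟨rfl⟩

/-- The single-qubit Pauli matrices, in the order `I, X, Y, Z`. -/
def sigma : Fin 4 → Matrix (Fin 2) (Fin 2) ℂ :=
  ![!![1, 0; 0, 1], !![0, 1; 1, 0], !![0, -Complex.I; Complex.I, 0], !![1, 0; 0, -1]]

/-- Tensor product of one single-qubit operator per qubit. -/
def tensorOp {ι : Type} [Fintype ι] (V : ι → Matrix (Fin 2) (Fin 2) ℂ) : QOp ι :=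
  Matrix.of fun x y => ∏ i, V i (x i) (y i)

/-- Pauli strings in `{I, X, Y, Z}^n`, coded by `0, 1, 2, 3`. -/
abbrev PauliString (n : ℕ) : Type := Fin n → Fin 4

/-- The (unnormalized) Pauli operator of a string. -/
noncomputable def pauliOp {n : ℕ} (P : PauliString n) : QOp (Fin n) :=
  tensorOp fun i => sigma (P i)

/-- The number of non-identity factors. -/
def pauliWeight {n : ℕ} (P : PauliString n) : ℕ := (Finset.univ.filter fun i => P i ≠ 0).card

/-- The coefficient `a_P = Tr[O P] / 2^n` of `P` in the Pauli expansion of `O`. -/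
noncomputable def pauliCoeff {n : ℕ} (O : QOp (Fin n)) (P : PauliString n) : ℂ :=
  (O * pauliOp P).trace / 2 ^ n

/-- The Pauli 2-norm `(∑_P |a_P|^2)^(1/2)`. -/
noncomputable def pauliTwoNorm {n : ℕ} (O : QOp (Fin n)) : ℝ :=
  Real.sqrt (∑ P : PauliString n, ‖pauliCoeff O P‖ ^ 2)

/-- The operator norm induced by the Euclidean norm. -/
noncomputable def operatorNorm {n : ℕ} (O : QOp (Fin n)) : ℝ :=
  ‖Matrix.toEuclideanCLM (𝕜 := ℂ) O‖

open scoped ComplexOrder in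
/-- Density matrices. -/
def IsQuantumState {n : ℕ} (ρ : QOp (Fin n)) : Prop := ρ.PosSemidef ∧ ρ.trace = 1

/-! ## Locally scrambling circuits -/

/-- The Hadamard gate. -/
noncomputable def hadamardGate : Matrix (Fin 2) (Fin 2) ℂ :=
  (1 / (Real.sqrt 2 : ℂ)) • !![1, 1; 1, -1]

/-- The phase gate. -/
def phaseGate : Matrix (Fin 2) (Fin 2) ℂ := !![1, 0; 0, Complex.I]

/-- Labels of the 24 elements of the single-qubit Clifford group modulo global phases. -/
abbrev CliffordIndex : Type := Fin 4 × Fin 3 × Fin 2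

/-- One representative for each of the 24 elements of the single-qubit Clifford group modulo
phases. Modulo phases and Pauli matrices, `S H` permutes `X, Y, Z` cyclically and `H` exchanges
`X` and `Z`, so the products `σ (S H)^b H^c` run exactly once through the group. -/
noncomputable def cliffordRep (v : CliffordIndex) : Matrix (Fin 2) (Fin 2) ℂ :=
  sigma v.1 * (phaseGate * hadamardGate) ^ (v.2.1 : ℕ) * hadamardGate ^ (v.2.2 : ℕ)

/-- The entry of `W ⊗ W ⊗ W* ⊗ W*` (`W*` the entrywise conjugate) at rows `x`, columns `y`. -/
noncomputable def secondMomentEntry {ι : Type} (x y : Fin 4 → ι → Fin 2) (W : QOp ι) : ℂ :=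
  W (x 0) (y 0) * W (x 1) (y 1) * star (W (x 2) (y 2)) * star (W (x 3) (y 3))

/-- A distribution on `U(2^|ι|)` is locally scrambling: it is a probability measure, and up to
second moments, `E[U^{⊗2} ⊗ U^{*⊗2}]`, it is invariant under multiplication from the left by a
tensor product of independent uniformly random single-qubit Clifford gates. -/
def IsLocallyScrambling {ι : Type} [Fintype ι] [DecidableEq ι] (ν : Measure (QUnitary ι)) : Prop :=
  IsProbabilityMeasure ν ∧ ∀ x y : Fin 4 → ι → Fin 2,
    ∫ U, secondMomentEntry x y (U : QOp ι) ∂ν =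
      ((24 : ℂ) ^ Fintype.card ι)⁻¹ * ∑ v : ι → CliffordIndex,
        ∫ U, secondMomentEntry x y (tensorOp (fun i => cliffordRep (v i)) * (U : QOp ι)) ∂ν

/-- The bijection between basis states of `ι` and pairs of basis states of `A` and of its
complement. -/
def splitBasis {ι : Type} [DecidableEq ι] (A : Finset ι) :
    (ι → Fin 2) ≃ ({i // i ∈ A} → Fin 2) × ({i // ¬ i ∈ A} → Fin 2) :=
  Equiv.piEquivPiSubtypeProd (fun i => i ∈ A) (fun _ => Fin 2)

open scoped Kronecker in
/-- `V ⊗ I`: the unitary that acts as `V` on the qubits of `A` and trivially on the others. -/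
noncomputable def extendUnitary {ι : Type} [Fintype ι] [DecidableEq ι] (A : Finset ι)
    (V : QUnitary {i // i ∈ A}) : QUnitary ι :=
  ⟨((V : QOp {i // i ∈ A}) ⊗ₖ (1 : QOp {i // ¬ i ∈ A})).submatrix (splitBasis A) (splitBasis A), by
    have h := Matrix.kronecker_mem_unitary V.2
      (one_mem (unitary (QOp {i // ¬ i ∈ A})))
    rw [Matrix.mem_unitaryGroup_iff]
    have h2 := (Unitary.mem_iff.mp h).2
    rw [Matrix.star_eq_conjTranspose] at h2 ⊢
    rw [Matrix.conjTranspose_submatrix, Matrix.submatrix_mul_equiv, h2,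
      Matrix.submatrix_one_equiv]⟩

/-- A circuit of `L` layers on `n` qubits; layer `0` is applied first. -/
abbrev Circuit (n L : ℕ) : Type := Fin L → QUnitary (Fin n)

/-- `μ j` is the distribution of layer `j`, and the layers are sampled independently. The first
layer is locally scrambling on all qubits; each later layer is `V ⊗ I` with `V` locally scrambling
on some set `A` of qubits. -/
structure IsLocallyScramblingEnsemble {n L : ℕ} (μ : Fin L → Measure (QUnitary (Fin n))) :
    Prop where
  first : ∀ j : Fin L, (j : ℕ) = 0 → IsLocallyScrambling (μ j)
  later : ∀ j : Fin L, 0 < (j : ℕ) → ∃ (A : Finset (Fin n)) (ν : Measure (QUnitary {i // i ∈ A})),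
    IsLocallyScrambling ν ∧ μ j = ν.map (extendUnitary A)

/-- The law of the random circuit with independent layers. -/
noncomputable def circuitLaw {n L : ℕ} (μ : Fin L → Measure (QUnitary (Fin n))) :
    Measure (Circuit n L) := Measure.pi μ

/-- The unitary `U_L ⋯ U_1` of a circuit. -/
noncomputable def circuitUnitary {n : ℕ} : (L : ℕ) → Circuit n L → QOp (Fin n)
  | 0, _ => 1
  | L + 1, U => (U (Fin.last L) : QOp (Fin n)) * circuitUnitary L (fun j => U j.castSucc)

/-- The exact expectation value `Tr[U ρ U† O]`. -/
noncomputable def expectationValue {n L : ℕ} (U : Circuit n L) (ρ O : QOp (Fin n)) : ℂ :=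
  (circuitUnitary L U * ρ * (circuitUnitary L U).conjTranspose * O).trace

/-! ## Low-weight Pauli propagation -/

/-- The part of `O` made of the Pauli terms of weight at most `k`. -/
noncomputable def lowPart {n : ℕ} (k : ℕ) (O : QOp (Fin n)) : QOp (Fin n) :=
  ∑ P ∈ Finset.univ.filter (fun P : PauliString n => pauliWeight P ≤ k), pauliCoeff O P • pauliOp P

/-- The truncated Heisenberg evolution: going from the last layer to the first, the observable is
truncated to weight at most `k` and then conjugated by the layer. The observable that leaves the
first layer is not truncated. -/
noncomputable def truncatedObservable {n : ℕ} (k : ℕ) :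
    (L : ℕ) → Circuit n L → QOp (Fin n) → QOp (Fin n)
  | 0, _, O => O
  | L + 1, U, O => truncatedObservable k L (fun j => U j.castSucc)
      ((U (Fin.last L) : QOp (Fin n)).conjTranspose * lowPart k O * (U (Fin.last L) : QOp (Fin n)))

/-- The low-weight Pauli propagation estimate `Tr[O_U^{(k)} ρ]`. -/
noncomputable def propagationEstimate {n L : ℕ} (k : ℕ) (U : Circuit n L) (ρ O : QOp (Fin n)) : ℂ :=
  (truncatedObservable k L U O * ρ).trace

/-- The truncation order `⌈log(2 / (3 ε² δ)) / log(3 / 2)⌉` (zero if this is negative). -/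
noncomputable def truncationOrder (ε δ : ℝ) : ℕ :=
  ⌈Real.log (2 / (3 * ε ^ 2 * δ)) / Real.log (3 / 2)⌉₊

/-! ## The machine model: a real RAM with access to subroutines

A program is a fixed finite piece of code working on finitely many arrays of natural numbers and
finitely many arrays of real numbers. Array names are constants of the program, indices are
computed. Integer operations are addition and truncated subtraction, with comparison; real
operations are `+`, `-`, `*` with rational constants, and comparison. Every elementary statement
and every test costs one step. A call costs its declared running time plus the size of the data
that it reads and writes. -/

/-- Memory: `ints a i` and `reals a i` are the entries with index `i` of the arrays named `a`. -/
structure Memory where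
  ints : ℕ → ℕ → ℕ
  reals : ℕ → ℕ → ℝ

/-- Integer expressions. -/
inductive IntExpr : Type
  | const (c : ℕ)
  | read (a : ℕ) (i : IntExpr)
  | add (e f : IntExpr)
  | sub (e f : IntExpr)

/-- Value of an integer expression. -/
def IntExpr.eval (σ : Memory) : IntExpr → ℕ
  | .const c => c
  | .read a i => σ.ints a (i.eval σ)
  | .add e f => e.eval σ + f.eval σ
  | .sub e f => e.eval σ - f.eval σ

/-- Real expressions. -/
inductive RealExpr : Type
  | const (c : ℚ)
  | read (a : ℕ) (i : IntExpr)
  | add (e f : RealExpr)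
  | sub (e f : RealExpr)
  | mul (e f : RealExpr)

/-- Value of a real expression. -/
noncomputable def RealExpr.eval (σ : Memory) : RealExpr → ℝ
  | .const c => (c : ℝ)
  | .read a i => σ.reals a (i.eval σ)
  | .add e f => e.eval σ + f.eval σ
  | .sub e f => e.eval σ - f.eval σ
  | .mul e f => e.eval σ * f.eval σ

/-- Tests. -/
inductive TestExpr : Type
  | intLt (e f : IntExpr)
  | realLt (e f : RealExpr)
  | neg (b : TestExpr)
  | conj (b c : TestExpr)

/-- Truth of a test. -/
def TestExpr.Holds (σ : Memory) : TestExpr → Prop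
  | .intLt e f => e.eval σ < f.eval σ
  | .realLt e f => e.eval σ < f.eval σ
  | .neg b => ¬ b.Holds σ
  | .conj b c => b.Holds σ ∧ c.Holds σ

/-- Programs. `call o src len dst` hands the first `len` entries of the integer array `src` to
subroutine `o`, and has the reply written to the beginning of the integer and the real array
`dst`. -/
inductive Program : Type
  | skip
  | setInt (a : ℕ) (i e : IntExpr)
  | setReal (a : ℕ) (i : IntExpr) (e : RealExpr)
  | call (o src : ℕ) (len : IntExpr) (dst : ℕ)
  | seq (s t : Program)
  | ite (b : TestExpr) (s t : Program)
  | loop (b : TestExpr) (s : Program)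

/-- The reply of a subroutine, with its running time. -/
structure Reply where
  ints : List ℕ
  reals : List ℝ
  time : ℕ

/-- The reply to a malformed call. -/
def Reply.empty : Reply := ⟨[], [], 0⟩

/-- The subroutines available to a program, by number and input. -/
abbrev Subroutines : Type := ℕ → List ℕ → Reply

/-- Assignment to one integer cell. -/
def Memory.setInt (σ : Memory) (a i v : ℕ) : Memory :=
  { σ with ints := Function.update σ.ints a (Function.update (σ.ints a) i v) }

/-- Assignment to one real cell. -/
noncomputable def Memory.setReal (σ : Memory) (a i : ℕ) (v : ℝ) : Memory :=
  { σ with reals := Function.update σ.reals a (Function.update (σ.reals a) i v) }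

/-- The first `len` entries of the integer array `a`. -/
def Memory.readBlock (σ : Memory) (a len : ℕ) : List ℕ := (List.range len).map (σ.ints a)

/-- Write a reply to the beginning of the arrays named `a`; later entries are kept. -/
def Memory.writeReply (σ : Memory) (a : ℕ) (r : Reply) : Memory where
  ints := Function.update σ.ints a fun i => r.ints.getD i (σ.ints a i)
  reals := Function.update σ.reals a fun i => r.reals.getD i (σ.reals a i)

/-- `Exec S p σ t σ'`: with subroutines `S`, program `p` started in memory `σ` halts after exactly
`t` steps with memory `σ'`. -/
inductive Exec (S : Subroutines) : Program → Memory → ℕ → Memory → Prop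
  | skip (σ : Memory) : Exec S .skip σ 1 σ
  | setInt (σ : Memory) (a : ℕ) (i e : IntExpr) :
      Exec S (.setInt a i e) σ 1 (σ.setInt a (i.eval σ) (e.eval σ))
  | setReal (σ : Memory) (a : ℕ) (i : IntExpr) (e : RealExpr) :
      Exec S (.setReal a i e) σ 1 (σ.setReal a (i.eval σ) (e.eval σ))
  | call (σ : Memory) (o src : ℕ) (len : IntExpr) (dst : ℕ) (r : Reply)
      (hr : r = S o (σ.readBlock src (len.eval σ))) :
      Exec S (.call o src len dst) σ (1 + len.eval σ + r.ints.length + r.reals.length + r.time)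
        (σ.writeReply dst r)
  | seq {p q : Program} {σ σ' σ'' : Memory} {t t' : ℕ} (hp : Exec S p σ t σ')
      (hq : Exec S q σ' t' σ'') : Exec S (.seq p q) σ (t + t') σ''
  | iteTrue {b : TestExpr} {p q : Program} {σ σ' : Memory} {t : ℕ} (hb : b.Holds σ)
      (hp : Exec S p σ t σ') : Exec S (.ite b p q) σ (t + 1) σ'
  | iteFalse {b : TestExpr} {p q : Program} {σ σ' : Memory} {t : ℕ} (hb : ¬ b.Holds σ)
      (hq : Exec S q σ t σ') : Exec S (.ite b p q) σ (t + 1) σ'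
  | loopEnd {b : TestExpr} {p : Program} {σ : Memory} (hb : ¬ b.Holds σ) :
      Exec S (.loop b p) σ 1 σ
  | loopStep {b : TestExpr} {p : Program} {σ σ' σ'' : Memory} {t t' : ℕ} (hb : b.Holds σ)
      (hp : Exec S p σ t σ') (hl : Exec S (.loop b p) σ' t' σ'') :
      Exec S (.loop b p) σ (t + t' + 1) σ''

/-- The initial memory: the given parameters at the beginning of the two arrays named `0`, and
zeros elsewhere. -/
noncomputable def initialMemory (is : List ℕ) (rs : List ℝ) : Memory where
  ints a i := if a = 0 then is.getD i 0 else 0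
  reals a i := if a = 0 then rs.getD i 0 else 0

/-- Program `p`, with subroutines `S` and parameters `is`, `rs`, halts within `T` steps with
`value` in cell `0` of the real array `0`. -/
def ComputesWithin (p : Program) (S : Subroutines) (is : List ℕ) (rs : List ℝ) (T : ℝ)
    (value : ℂ) : Prop :=
  ∃ (t : ℕ) (σ : Memory), Exec S p (initialMemory is rs) t σ ∧ (t : ℝ) ≤ T ∧
    ((σ.reals 0 0 : ℝ) : ℂ) = value

/-! ## How circuits, states and observables are presented to a program -/

/-- A Pauli string as a list of codes `0, 1, 2, 3`. -/
def encodePauli {n : ℕ} (P : PauliString n) : List ℕ := List.ofFn fun i => (P i : ℕ)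

/-- The Pauli string of a list of codes; entries are read modulo `4` and missing
entries as the identity. -/
def decodePauli (n : ℕ) (l : List ℕ) : PauliString n := fun i => Fin.ofNat 4 (l.getD i 0)

/-- The shallow-layer condition, first half: for all layers and Pauli operators `P`, the operator
`U_j† P U_j` has at most `n^{c |P|}` Pauli terms. -/
def HasSparseLayers {n L : ℕ} (c : ℕ) (U : Circuit n L) : Prop :=
  ∀ (j : Fin L) (P : PauliString n),
    (Finset.univ.filter fun Q : PauliString n =>
      pauliCoeff ((U j : QOp (Fin n)).conjTranspose * pauliOp P * (U j : QOp (Fin n))) Q ≠ 0).card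
        ≤ n ^ (c * pauliWeight P)

/-- The shallow-layer condition, second half: a subroutine which, for given `j` and `P`, lists the
Pauli terms of `U_j† P U_j` with their coefficients (in any order) in time `n^{O(|P|)}`; the
exponent is `c (|P| + 1)` because even for the identity an answer of length `n` is written. -/
structure LayerAccess {n L : ℕ} (c : ℕ) (U : Circuit n L) where
  terms : Fin L → PauliString n → List (PauliString n × ℝ)
  time : Fin L → PauliString n → ℕ
  nodup : ∀ j P, ((terms j P).map Prod.fst).Nodup
  mem_terms_iff : ∀ j P Q a, (Q, a) ∈ terms j P ↔ a ≠ 0 ∧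
    pauliCoeff ((U j : QOp (Fin n)).conjTranspose * pauliOp P * (U j : QOp (Fin n))) Q = (a : ℂ)
  time_le : ∀ j P, time j P ≤ n ^ (c * (pauliWeight P + 1))

/-- Running times, polynomial in `n`, of a subroutine with a Pauli string as input. -/
structure PauliAccess (c n : ℕ) where
  time : PauliString n → ℕ
  time_le : ∀ P, time P ≤ n ^ c

/-- Reply of the state subroutine: `Tr[P ρ]`. -/
noncomputable def stateReply {n c : ℕ} (ρ : QOp (Fin n)) (acc : PauliAccess c n) (q : List ℕ) :
    Reply :=
  ⟨[], [(pauliOp (decodePauli n q) * ρ).trace.re], acc.time (decodePauli n q)⟩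

/-- Access to a general instance. Subroutine `0` gets a layer and a Pauli string `P`, and returns
the number of terms of `U_j† P U_j`, their Pauli strings one after the other, and their
coefficients. Subroutine `1` returns `Tr[P ρ]`, and subroutine `2` returns `Tr[P O] / 2^n`. -/
noncomputable def generalInstance {n L c : ℕ} {U : Circuit n L} (layers : LayerAccess c U)
    (ρ O : QOp (Fin n)) (state obs : PauliAccess c n) : Subroutines
  | 0, q =>
    if h : q.headD 0 < L then
      let P := decodePauli n q.tail
      let ts := layers.terms ⟨q.headD 0, h⟩ P
      ⟨ts.length :: ts.flatMap (fun t => encodePauli t.1), ts.map Prod.snd,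
        layers.time ⟨q.headD 0, h⟩ P⟩
    else Reply.empty
  | 1, q => stateReply ρ state q
  | 2, q => ⟨[], [(pauliCoeff O (decodePauli n q)).re], obs.time (decodePauli n q)⟩
  | _, _ => Reply.empty

/-! ## Geometrically local circuits -/

/-- `GrowsTo G x ℓ S`: the vertex set `S` is obtained from `{x}` in `ℓ` steps, where in each step
each vertex of the current set adds at most one of its neighbours. -/
inductive GrowsTo {V : Type} [DecidableEq V] (G : SimpleGraph V) (x : V) : ℕ → Finset V → Prop
  | start : GrowsTo G x 0 {x}
  | step {ℓ : ℕ} {S : Finset V} (f : V → V) (hf : ∀ p ∈ S, f p = p ∨ G.Adj p (f p))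
      (hS : GrowsTo G x ℓ S) : GrowsTo G x (ℓ + 1) (S ∪ S.image f)

/-- Geometric dimension `D`, with the constant `K` in `γ_G(ℓ) = O(ℓ^D)` made explicit. -/
def HasGeometricDimension {V : Type} [DecidableEq V] (G : SimpleGraph V) (D K : ℕ) : Prop :=
  ∀ (ℓ : ℕ), 1 ≤ ℓ → ∀ (x : V) (S : Finset V), GrowsTo G x ℓ S → S.card ≤ K * ℓ ^ D

/-- The description of a circuit embedded in `G`. In layer `j`, qubit `q` shares a two-qubit gate
with its neighbour `partner j q` (the gate `two j q` of the smaller of the two qubits, which is its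
first tensor factor), or it carries the single-qubit gate `one j q` if `partner j q = q`. -/
structure LocalCircuit {n : ℕ} (G : SimpleGraph (Fin n)) (L : ℕ) where
  partner : Fin L → Fin n → Fin n
  partner_partner : ∀ j q, partner j (partner j q) = q
  adj : ∀ j q, partner j q ≠ q → G.Adj q (partner j q)
  one : Fin L → Fin n → Matrix.unitaryGroup (Fin 2) ℂ
  two : Fin L → Fin n → Matrix.unitaryGroup (Fin 2 × Fin 2) ℂ

/-- Layer `j`: the tensor product of its gates. -/
noncomputable def LocalCircuit.layer {n L : ℕ} {G : SimpleGraph (Fin n)} (d : LocalCircuit G L)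
    (j : Fin L) : QOp (Fin n) :=
  Matrix.of fun x y => ∏ q, if d.partner j q = q then (d.one j q).1 (x q) (y q)
    else if q < d.partner j q then
      (d.two j q).1 (x q, x (d.partner j q)) (y q, y (d.partner j q))
    else 1

/-- `d` describes the circuit `U`. -/
def LocalCircuit.Describes {n L : ℕ} {G : SimpleGraph (Fin n)} (d : LocalCircuit G L)
    (U : Circuit n L) : Prop := ∀ j, (U j : QOp (Fin n)) = d.layer j

/-- The entries of a square matrix, row by row, each as real part followed by imaginary part. -/
noncomputable def matrixEntries {d : ℕ} (M : Matrix (Fin d) (Fin d) ℂ) : List ℝ :=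
  (List.finRange d).flatMap fun r => (List.finRange d).flatMap fun s => [(M r s).re, (M r s).im]

/-- The numbers that specify the gate stored at qubit `q` of layer `j`. The rows and columns of a
two-qubit gate are in the order `00, 01, 10, 11`. -/
noncomputable def LocalCircuit.gateEntries {n L : ℕ} {G : SimpleGraph (Fin n)}
    (d : LocalCircuit G L) (j : Fin L) (q : Fin n) : List ℝ :=
  if d.partner j q = q then matrixEntries (d.one j q).1
  else if q < d.partner j q then
    matrixEntries ((d.two j q).1.submatrix (finProdFinEquiv (m := 2) (n := 2)).symm
      (finProdFinEquiv (m := 2) (n := 2)).symm)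
  else []

/-- The observable `∑ a_i P_i` given by a list of weighted Pauli operators. -/
noncomputable def sparseObservable {n m : ℕ} (O : Fin m → PauliString n × ℝ) : QOp (Fin n) :=
  ∑ i, ((O i).2 : ℂ) • pauliOp (O i).1

/-- Access to a geometrically local instance. Subroutine `0` gets `j, q` and looks up the partner
of qubit `q` in layer `j` and the matrix entries of its gate; subroutine `1` returns `Tr[P ρ]`;
subroutine `2` looks up the `i`-th Pauli string of the observable and its coefficient. -/
noncomputable def localInstance {n L m c : ℕ} {G : SimpleGraph (Fin n)} (d : LocalCircuit G L)
    (ρ : QOp (Fin n)) (O : Fin m → PauliString n × ℝ) (state : PauliAccess c n) : Subroutines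
  | 0, q =>
    if h : q.headD 0 < L ∧ q.tail.headD 0 < n then
      ⟨[(d.partner ⟨q.headD 0, h.1⟩ ⟨q.tail.headD 0, h.2⟩ : ℕ)],
        d.gateEntries ⟨q.headD 0, h.1⟩ ⟨q.tail.headD 0, h.2⟩, 0⟩
    else Reply.empty
  | 1, q => stateReply ρ state q
  | 2, q =>
    if h : q.headD 0 < m then
      ⟨encodePauli (O ⟨q.headD 0, h⟩).1, [(O ⟨q.headD 0, h⟩).2], 0⟩
    else Reply.empty
  | _, _ => Reply.empty

/-! Accuracy. Let v_P = Tr[U ρ U† P] be the exact value of a Pauli string and e_P its truncation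
error (`pauliValue`, `pauliError`). By linearity the error of O is ∑ a_P e_P. One layer V turns P
into ∑_R T_{PR} R, where T_{PR} is the coefficient of R in V† P V (`transferCoeff`). If |P| ≤ k,
then e_P = ∑_R T_{PR} e_R, with e_R taken for the earlier layers. If |P| > k, then P is discarded
and e_P = -v_P.

Local scrambling allows second moments to be averaged over single-qubit Clifford gates, and this has
two effects. The Pauli part of the Clifford group multiplies strings by signs, and the orthogonality
of these characters makes distinct strings uncorrelated (`IsLocallyScrambling.integral_of_ne`). The
rest of the group permutes X, Y, Z, so that second moments depend on a string only through its
support (`IsLocallyScrambling.integral_congr`). On the other hand, a reduced state has purity at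
most 1. Hence ∑ |Tr[σ Q]|² ≤ 2^w for every state σ, where Q runs over the 3^w strings with a given
support of size w (`sum_norm_sq_trace_sameSupport_le`). As these strings have the same mean square,
E|v_P|² ≤ (2/3)^|P|.

The induction over the layers is stated in `ErrorControl`. A discarded string has mean square error
at most (2/3)^(k+1). For a retained string the cross terms vanish and E|e_P|² = ∑_R E|T_{PR}|²
E|e_R|². This is a weighted average, since ∑_R |T_{PR}|² = 1 by unitarity, so the bound (2/3)^(k+1)
survives every layer without any loss in L. Orthogonality in the last step gives the mean square
error (2/3)^(k+1) ‖O‖²_{Pauli,2} (`integral_norm_sq_error_le`). Markov's inequality and the choice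
of k, for which (2/3)^(k+1) ≤ ε²δ, conclude.

Running time. An observable is kept as a table: a list of the occupied strings, and an array of
coefficients indexed by the base-4 codes of the strings. A sweep sends each entry to a few new terms
and costs time proportional to the number of entries (`runs_sweepProg`), never to 4^n. Correctness
is linearity of conjugation and truncation (`tableOp_sweep_eq`), so only the sizes of the tables
have to be controlled.

With access to layers, just the strings of weight at most k produce terms, each at most n^(ck). The
table after any layer therefore has at most n^(3k+2) · n^(ck) entries.

For geometrically local circuits a layer is applied gate by gate. Pairing the qubits at most doubles
the weight before the next truncation, and all supports stay in the light cone of a string of O of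
weight at most k. The light cone has at most min(n, k K L^D) qubits. The generating function ∑ z^|P|
= (1+3z)^|A| bounds the number of strings of weight w on a set A by x^w exp(3|A|/x). With x a
multiple of M = min(n, L^D) and w = 2k this is M^(O(k+1)) (`card_lowStrings_le_pow`). -/

open scoped Kronecker

/-! ## Pauli operators on an arbitrary register -/

section PauliAlgebra

variable {ι : Type} [Fintype ι]

theorem tensorOp_mul [DecidableEq ι] (V W : ι → Matrix (Fin 2) (Fin 2) ℂ) :
    tensorOp V * tensorOp W = tensorOp fun i => V i * W i := by
  ext x y
  simp only [tensorOp, Matrix.mul_apply, Matrix.of_apply, ← Finset.prod_mul_distrib]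
  rw [Finset.prod_univ_sum]
  simp [Fintype.piFinset_univ]

theorem trace_tensorOp [DecidableEq ι] (V : ι → Matrix (Fin 2) (Fin 2) ℂ) :
    (tensorOp V).trace = ∏ i, (V i).trace := by
  simp only [tensorOp, Matrix.trace, Matrix.diag, Matrix.of_apply]
  rw [Finset.prod_univ_sum]
  simp [Fintype.piFinset_univ]

theorem conjTranspose_tensorOp (V : ι → Matrix (Fin 2) (Fin 2) ℂ) :
    (tensorOp V).conjTranspose = tensorOp fun i => (V i).conjTranspose := by
  ext x y
  simp [tensorOp, Matrix.conjTranspose_apply]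

theorem tensorOp_one [DecidableEq ι] : tensorOp (fun _ : ι => (1 : Matrix (Fin 2) (Fin 2) ℂ)) = 1 := by
  ext x y
  simp only [tensorOp, Matrix.of_apply, Matrix.one_apply, Finset.prod_ite_zero, Finset.prod_const_one]
  simp [funext_iff]

/-- The Pauli operator of a string indexed by an arbitrary register. -/
noncomputable def pauliG (P : ι → Fin 4) : QOp ι := tensorOp fun i => sigma (P i)

/-- Pauli coefficients on an arbitrary register. -/
noncomputable def coefG [DecidableEq ι] (O : QOp ι) (P : ι → Fin 4) : ℂ :=
  (O * pauliG P).trace / 2 ^ Fintype.card ι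

theorem pauliOp_eq_pauliG {n : ℕ} (P : PauliString n) : pauliOp P = pauliG P := rfl

theorem pauliCoeff_eq_coefG {n : ℕ} (O : QOp (Fin n)) (P : PauliString n) :
    pauliCoeff O P = coefG O P := by
  simp [pauliCoeff, coefG, pauliOp_eq_pauliG]

theorem sigma_zero : sigma 0 = 1 := by
  ext i j; fin_cases i <;> fin_cases j <;> simp [sigma]

theorem conjTranspose_sigma (a : Fin 4) : (sigma a).conjTranspose = sigma a := by
  ext i j
  fin_cases a <;> fin_cases i <;> fin_cases j <;> simp [sigma, Matrix.conjTranspose_apply]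

theorem sigma_mul_self (a : Fin 4) : sigma a * sigma a = 1 := by
  ext i j
  fin_cases a <;> fin_cases i <;> fin_cases j <;> simp [sigma, Matrix.mul_apply]

theorem trace_sigma_mul (a b : Fin 4) : (sigma a * sigma b).trace = if a = b then 2 else 0 := by
  fin_cases a <;> fin_cases b <;>
    simp [sigma, Matrix.trace, Fin.sum_univ_two] <;> norm_num

/-- ∑ σ_a ⊗ σ_a is twice the swap operator. This completeness relation is the source of the Pauli
expansion. -/
theorem sum_sigma_mul_sigma (x y z w : Fin 2) :
    ∑ a, sigma a x y * sigma a z w = if x = w ∧ y = z then 2 else 0 := by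
  fin_cases x <;> fin_cases y <;> fin_cases z <;> fin_cases w <;>
    simp [sigma, Fin.sum_univ_four] <;> norm_num

theorem conjTranspose_pauliG (P : ι → Fin 4) : (pauliG P).conjTranspose = pauliG P := by
  simp [pauliG, conjTranspose_tensorOp, conjTranspose_sigma]

variable [DecidableEq ι]

theorem pauliG_zero : pauliG (0 : ι → Fin 4) = 1 := by
  rw [pauliG, ← tensorOp_one]
  congr 1; funext i; exact sigma_zero

theorem pauliG_mul_self (P : ι → Fin 4) : pauliG P * pauliG P = 1 := by
  simp [pauliG, tensorOp_mul, sigma_mul_self, tensorOp_one]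

theorem trace_pauliG_mul (P Q : ι → Fin 4) :
    (pauliG P * pauliG Q).trace = if P = Q then 2 ^ Fintype.card ι else 0 := by
  simp only [pauliG, tensorOp_mul, trace_tensorOp, trace_sigma_mul, Finset.prod_ite_zero]
  simp [funext_iff, Finset.card_univ]

theorem coefG_pauliG (P Q : ι → Fin 4) : coefG (pauliG P) Q = if P = Q then 1 else 0 := by
  rw [coefG, trace_pauliG_mul]
  split_ifs <;> simp

theorem sum_pauliG_mul_pauliG (x y z w : ι → Fin 2) :
    ∑ P : ι → Fin 4, pauliG P x y * pauliG P z w =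
      if x = w ∧ y = z then 2 ^ Fintype.card ι else 0 := by
  have h := Finset.prod_univ_sum (fun _ : ι => (Finset.univ : Finset (Fin 4)))
    (fun i a => sigma a (x i) (y i) * sigma a (z i) (w i))
  simp only [Fintype.piFinset_univ, sum_sigma_mul_sigma, Finset.prod_mul_distrib,
    Finset.prod_ite_zero] at h
  simp only [pauliG, tensorOp, Matrix.of_apply]
  rw [← h]
  simp [funext_iff, Finset.card_univ, forall_and]

/-- Pauli operators span. -/
theorem sum_coefG_smul (O : QOp ι) : ∑ P, coefG O P • pauliG P = O := by
  ext x y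
  have h2 : (2 : ℂ) ^ Fintype.card ι ≠ 0 := pow_ne_zero _ two_ne_zero
  simp only [Matrix.sum_apply, Matrix.smul_apply, coefG, Matrix.trace, Matrix.diag,
    Matrix.mul_apply, smul_eq_mul]
  have : ∀ P : ι → Fin 4, (∑ a, ∑ b, O a b * pauliG P b a) / 2 ^ Fintype.card ι * pauliG P x y =
      ∑ a, ∑ b, O a b / 2 ^ Fintype.card ι * (pauliG P b a * pauliG P x y) := by
    intro P
    rw [Finset.sum_div, Finset.sum_mul]
    refine Finset.sum_congr rfl fun a _ => ?_
    rw [Finset.sum_div, Finset.sum_mul]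
    exact Finset.sum_congr rfl fun b _ => by ring
  simp only [this]
  -- With the sum over strings innermost, the completeness relation leaves only the entry of O in
  -- row x and column y.
  rw [Finset.sum_comm]
  simp_rw [Finset.sum_comm (s := (Finset.univ : Finset (ι → Fin 4))), ← Finset.mul_sum,
    sum_pauliG_mul_pauliG]
  rw [Finset.sum_eq_single x, Finset.sum_eq_single y]
  · simp [h2]
  · intro b _ hb; simp [hb]
  · simp
  · intro a _ ha
    refine Finset.sum_eq_zero fun b _ => ?_
    simp [ha]
  · simp

theorem coefG_add (A B : QOp ι) (P : ι → Fin 4) : coefG (A + B) P = coefG A P + coefG B P := by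
  simp [coefG, add_mul, add_div]

theorem coefG_smul (c : ℂ) (A : QOp ι) (P : ι → Fin 4) : coefG (c • A) P = c * coefG A P := by
  simp [coefG, mul_div_assoc]

theorem coefG_sum {κ : Type*} (s : Finset κ) (A : κ → QOp ι) (P : ι → Fin 4) :
    coefG (∑ k ∈ s, A k) P = ∑ k ∈ s, coefG (A k) P := by
  simp [coefG, Finset.sum_mul, Matrix.trace_sum, Finset.sum_div]

theorem coefG_sum_smul (f : (ι → Fin 4) → ℂ) (Q : ι → Fin 4) :
    coefG (∑ P, f P • pauliG P) Q = f Q := by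
  simp [coefG_sum, coefG_smul, coefG_pauliG]

theorem star_coefG (A : QOp ι) (P : ι → Fin 4) : star (coefG A P) = coefG A.conjTranspose P := by
  have : star ((A * pauliG P).trace) = (A.conjTranspose * pauliG P).trace := by
    rw [← Matrix.trace_conjTranspose, Matrix.conjTranspose_mul, conjTranspose_pauliG,
      Matrix.trace_mul_comm]
  rw [coefG, coefG, ← this]
  simp [star_div₀]

/-- This is why the programs may keep Pauli coefficients in arrays of real numbers. -/
theorem coefG_real {A : QOp ι} (hA : A.IsHermitian) (P : ι → Fin 4) :
    ((coefG A P).re : ℂ) = coefG A P := by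
  have h := star_coefG A P
  rw [hA.eq] at h
  exact Complex.conj_eq_iff_re.mp h

theorem sum_norm_sq_eq_trace {m : Type} [Fintype m] (A : Matrix m m ℂ) :
    ((∑ x, ∑ y, ‖A x y‖ ^ 2 : ℝ) : ℂ) = (A * A.conjTranspose).trace := by
  push_cast
  simp only [Matrix.trace, Matrix.diag, Matrix.mul_apply, Matrix.conjTranspose_apply]
  refine Finset.sum_congr rfl fun x _ => Finset.sum_congr rfl fun y _ => ?_
  exact (Complex.mul_conj' _).symm

/-- Parseval's identity for the Pauli basis. -/
theorem sum_norm_coefG_sq (A : QOp ι) :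
    ∑ P, ‖coefG A P‖ ^ 2 = (∑ x, ∑ y, ‖A x y‖ ^ 2) / 2 ^ Fintype.card ι := by
  have h2 : (2 : ℂ) ^ Fintype.card ι ≠ 0 := pow_ne_zero _ two_ne_zero
  have h : ((∑ P, ‖coefG A P‖ ^ 2 : ℝ) : ℂ) =
      (((∑ x, ∑ y, ‖A x y‖ ^ 2) / 2 ^ Fintype.card ι : ℝ) : ℂ) := by
    rw [Complex.ofReal_div, sum_norm_sq_eq_trace, Matrix.trace_mul_comm]
    conv_rhs => rw [← sum_coefG_smul A, Matrix.mul_sum, Matrix.trace_sum]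
    rw [sum_coefG_smul A]
    push_cast
    rw [Finset.sum_div]
    refine Finset.sum_congr rfl fun P _ => ?_
    rw [← Complex.mul_conj', Matrix.mul_smul, Matrix.trace_smul, smul_eq_mul, mul_div_assoc]
    congr 1
    rw [← coefG, ← star_coefG]; rfl
  exact_mod_cast h

end PauliAlgebra

/-! ### Unitaries in the Pauli basis and comparison of the two norms. -/

theorem sum_norm_sq_unitary {m : Type} [Fintype m] [DecidableEq m] {U : Matrix m m ℂ}
    (hU : U ∈ Matrix.unitaryGroup m ℂ) : ∑ x, ∑ y, ‖U x y‖ ^ 2 = (Fintype.card m : ℝ) := by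
  have h := sum_norm_sq_eq_trace U
  rw [← Matrix.star_eq_conjTranspose, Matrix.mem_unitaryGroup_iff.mp hU, Matrix.trace_one] at h
  exact_mod_cast h

theorem pauliG_mem_unitaryGroup {ι : Type} [Fintype ι] [DecidableEq ι] (P : ι → Fin 4) :
    pauliG P ∈ Matrix.unitaryGroup (ι → Fin 2) ℂ := by
  rw [Matrix.mem_unitaryGroup_iff, Matrix.star_eq_conjTranspose, conjTranspose_pauliG,
    pauliG_mul_self]

/-- Conjugating a Pauli operator by a unitary gives coefficients of unit 2-norm. -/
theorem sum_norm_coefG_conj_sq {ι : Type} [Fintype ι] [DecidableEq ι] (U : QUnitary ι)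
    (P : ι → Fin 4) :
    ∑ R, ‖coefG ((U : QOp ι).conjTranspose * pauliG P * (U : QOp ι)) R‖ ^ 2 = 1 := by
  rw [sum_norm_coefG_sq, sum_norm_sq_unitary]
  · simp
  · have h := mul_mem (mul_mem (Unitary.star_mem U.2) (pauliG_mem_unitaryGroup P)) U.2
    rwa [Matrix.star_eq_conjTranspose] at h

/-- By Parseval the squared Pauli norm is the average of the squared lengths of the 2^n columns of
O, and each column is the image of a unit vector. -/
theorem pauliTwoNorm_le_operatorNorm {n : ℕ} (O : QOp (Fin n)) :
    pauliTwoNorm O ≤ operatorNorm O := by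
  unfold pauliTwoNorm
  refine Real.sqrt_le_iff.mpr ⟨norm_nonneg _, ?_⟩
  simp only [pauliCoeff_eq_coefG]
  rw [sum_norm_coefG_sq, div_le_iff₀ (by positivity), Finset.sum_comm]
  have hcol : ∀ y : Fin n → Fin 2, ∑ x, ‖O x y‖ ^ 2 ≤ operatorNorm O ^ 2 := by
    intro y
    have h := (Matrix.toEuclideanCLM (𝕜 := ℂ) O).le_opNorm (EuclideanSpace.single y (1 : ℂ))
    rw [PiLp.norm_single, norm_one, mul_one] at h
    have h2 : ‖Matrix.toEuclideanCLM (𝕜 := ℂ) O (EuclideanSpace.single y (1 : ℂ))‖ ^ 2 =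
        ∑ x, ‖O x y‖ ^ 2 := by
      rw [EuclideanSpace.norm_sq_eq]
      refine Finset.sum_congr rfl fun x _ => ?_
      simp [Matrix.ofLp_toEuclideanCLM]
    rw [← h2]
    exact pow_le_pow_left₀ (norm_nonneg _) h 2
  calc ∑ y, ∑ x, ‖O x y‖ ^ 2 ≤ ∑ _y : Fin n → Fin 2, operatorNorm O ^ 2 :=
        Finset.sum_le_sum fun y _ => hcol y
    _ = _ := by simp [mul_comm]

/-! ## Splitting a register into two parts -/

section Blocks

variable {ι : Type} [Fintype ι] [DecidableEq ι]

/-- `V ⊗ I` for an arbitrary operator `V` on the qubits of `A`. -/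
def extendOp (A : Finset ι) (V : QOp {i // i ∈ A}) : QOp ι :=
  (V ⊗ₖ (1 : QOp {i // ¬ i ∈ A})).submatrix (splitBasis A) (splitBasis A)

theorem coe_extendUnitary (A : Finset ι) (V : QUnitary {i // i ∈ A}) :
    (extendUnitary A V : QOp ι) = extendOp A V := rfl

/-- The restriction of a Pauli string to the qubits that satisfy `p`. -/
def restrictString (p : ι → Prop) (P : ι → Fin 4) : {i // p i} → Fin 4 := fun i => P i

theorem pauliG_eq_kronecker (A : Finset ι) (P : ι → Fin 4) :
    pauliG P = (pauliG (restrictString (· ∈ A) P) ⊗ₖ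
      pauliG (restrictString (fun i => ¬ i ∈ A) P)).submatrix (splitBasis A) (splitBasis A) := by
  ext x y
  simp only [pauliG, tensorOp, Matrix.of_apply, Matrix.submatrix_apply, Matrix.kroneckerMap_apply]
  rw [← Fintype.prod_subtype_mul_prod_subtype (· ∈ A) fun i => sigma (P i) (x i) (y i)]
  congr 1
  exact Finset.prod_congr (by ext; simp) fun _ _ => rfl

theorem extendOp_conj_pauliG (A : Finset ι) (V : QOp {i // i ∈ A}) (P : ι → Fin 4) :
    (extendOp A V).conjTranspose * pauliG P * extendOp A V =
      ((V.conjTranspose * pauliG (restrictString (· ∈ A) P) * V) ⊗ₖ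
        pauliG (restrictString (fun i => ¬ i ∈ A) P)).submatrix (splitBasis A) (splitBasis A) := by
  rw [pauliG_eq_kronecker A P, extendOp, Matrix.conjTranspose_submatrix,
    Matrix.submatrix_mul_equiv, Matrix.submatrix_mul_equiv, Matrix.conjTranspose_kronecker,
    ← Matrix.mul_kronecker_mul, ← Matrix.mul_kronecker_mul]
  simp

theorem trace_submatrix_equiv' {m n : Type} [Fintype m] [Fintype n] (e : m ≃ n)
    (M : Matrix n n ℂ) : (M.submatrix e e).trace = M.trace := by
  simp only [Matrix.trace, Matrix.diag, Matrix.submatrix_apply]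
  exact Equiv.sum_comp e fun i => M i i

theorem card_eq_card_add_card_compl (A : Finset ι) :
    Fintype.card ι = Fintype.card {i // i ∈ A} + Fintype.card {i // ¬ i ∈ A} := by
  rw [← Fintype.card_sum]
  exact Fintype.card_congr (Equiv.sumCompl (· ∈ A)).symm

/-- V ⊗ I cannot change letters outside A, and inside A the coefficient is that of V alone. All
questions on a layer reduce to the register on which it acts. -/
theorem coefG_extendOp_conj (A : Finset ι) (V : QOp {i // i ∈ A}) (P R : ι → Fin 4) :
    coefG ((extendOp A V).conjTranspose * pauliG P * extendOp A V) R =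
      coefG (V.conjTranspose * pauliG (restrictString (· ∈ A) P) * V) (restrictString (· ∈ A) R) *
        if restrictString (fun i => ¬ i ∈ A) P = restrictString (fun i => ¬ i ∈ A) R
          then 1 else 0 := by
  rw [extendOp_conj_pauliG, coefG, pauliG_eq_kronecker A R, Matrix.submatrix_mul_equiv,
    trace_submatrix_equiv', ← Matrix.mul_kronecker_mul, Matrix.trace_kronecker,
    card_eq_card_add_card_compl A, pow_add, mul_div_mul_comm]
  congr 1
  exact coefG_pauliG _ _

/-- The partial trace onto the qubits of `A`. -/
noncomputable def partialTrace (A : Finset ι) (σ : QOp ι) : QOp {i // i ∈ A} :=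
  Matrix.of fun x y => ∑ b, σ ((splitBasis A).symm (x, b)) ((splitBasis A).symm (y, b))

/-- This duality characterizes the partial trace. It turns expectations of strings supported on A
into expectations in the reduced state. -/
theorem trace_mul_kronecker_one (A : Finset ι) (σ : QOp ι) (X : QOp {i // i ∈ A}) :
    (σ * extendOp A X).trace = (partialTrace A σ * X).trace := by
  have h : σ = (σ.submatrix (splitBasis A).symm (splitBasis A).symm).submatrix
      (splitBasis A) (splitBasis A) := by ext; simp
  rw [extendOp]
  conv_lhs => rw [h]
  rw [Matrix.submatrix_mul_equiv, trace_submatrix_equiv']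
  simp only [Matrix.trace, Matrix.diag, Matrix.mul_apply, Fintype.sum_prod_type,
    Matrix.submatrix_apply, Matrix.kroneckerMap_apply, Matrix.one_apply, partialTrace,
    Matrix.of_apply, mul_ite, mul_one, mul_zero, Finset.sum_ite_eq', Finset.mem_univ, if_true]
  refine Finset.sum_congr rfl fun x _ => ?_
  simp only [Finset.sum_mul]
  rw [Finset.sum_comm]

theorem pauliG_eq_extendOp (A : Finset ι) {P : ι → Fin 4} (hP : ∀ i, i ∉ A → P i = 0) :
    pauliG P = extendOp A (pauliG (restrictString (· ∈ A) P)) := by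
  have h : restrictString (fun i => ¬ i ∈ A) P = 0 := by
    funext i; exact hP i i.2
  rw [pauliG_eq_kronecker A P, h, pauliG_zero, extendOp]

-- Purity of a reduced state. With σ = B†B the entries of the partial trace are inner products of
-- vectors u_x, the trace condition reads ∑ ‖u_x‖² = 1, and the Cauchy–Schwarz inequality gives the
-- bound.
open scoped ComplexOrder MatrixOrder in
theorem sum_norm_sq_partialTrace_le (A : Finset ι) {σ : QOp ι} (hσ : σ.PosSemidef)
    (htr : σ.trace = 1) : ∑ x, ∑ y, ‖partialTrace A σ x y‖ ^ 2 ≤ 1 := by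
  obtain ⟨B, hB⟩ := CStarAlgebra.nonneg_iff_eq_star_mul_self.mp hσ.nonneg
  rw [Matrix.star_eq_conjTranspose] at hB
  let u : ({i // i ∈ A} → Fin 2) → EuclideanSpace ℂ (({i // ¬ i ∈ A} → Fin 2) × (ι → Fin 2)) :=
    fun x => WithLp.toLp 2 fun q => B q.2 ((splitBasis A).symm (x, q.1))
  have hu : ∀ x y, partialTrace A σ x y = inner ℂ (u x) (u y) := by
    intro x y
    simp only [partialTrace, Matrix.of_apply, hB, Matrix.mul_apply, Matrix.conjTranspose_apply,
      PiLp.inner_apply, Fintype.sum_prod_type, u]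
    refine Finset.sum_congr rfl fun b _ => Finset.sum_congr rfl fun z _ => ?_
    simp [mul_comm]
  have hsum : ∑ x, ‖u x‖ ^ 2 = 1 := by
    have h1 : (∑ x, partialTrace A σ x x) = 1 := by
      have h := trace_mul_kronecker_one A σ 1
      rw [mul_one, extendOp, Matrix.one_kronecker_one, Matrix.submatrix_one_equiv, mul_one,
        htr] at h
      exact h.symm
    have h2 : ((∑ x, ‖u x‖ ^ 2 : ℝ) : ℂ) = 1 := by
      rw [← h1]
      push_cast
      refine Finset.sum_congr rfl fun x _ => ?_
      rw [hu, inner_self_eq_norm_sq_to_K]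
      rfl
    exact_mod_cast h2
  calc ∑ x, ∑ y, ‖partialTrace A σ x y‖ ^ 2 ≤ ∑ x, ∑ y, ‖u x‖ ^ 2 * ‖u y‖ ^ 2 := by
        refine Finset.sum_le_sum fun x _ => Finset.sum_le_sum fun y _ => ?_
        rw [hu, ← mul_pow]
        exact pow_le_pow_left₀ (norm_nonneg _) (norm_inner_le_norm _ _) 2
    _ = 1 := by simp_rw [← Finset.mul_sum, hsum, mul_one, hsum]

/-- The Pauli strings with the same support as `P`. -/
def sameSupport (P : ι → Fin 4) : Finset (ι → Fin 4) :=
  Fintype.piFinset fun i => Finset.univ.filter fun a => a = 0 ↔ P i = 0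

theorem mem_sameSupport {P Q : ι → Fin 4} : Q ∈ sameSupport P ↔ ∀ i, Q i = 0 ↔ P i = 0 := by
  simp [sameSupport]

theorem card_sameSupport (P : ι → Fin 4) :
    (sameSupport P).card = 3 ^ (Finset.univ.filter fun i => P i ≠ 0).card := by
  rw [sameSupport, Fintype.card_piFinset]
  have : ∀ i, (Finset.univ.filter fun a : Fin 4 => a = 0 ↔ P i = 0).card =
      if P i ≠ 0 then 3 else 1 := by
    intro i
    by_cases h : P i = 0 <;> simp [h] <;> decide
  simp_rw [this]
  rw [Finset.prod_ite]
  simp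

open scoped ComplexOrder in
/-- The Pauli expectations of a state with a given support have bounded square sum. -/
theorem sum_norm_sq_trace_sameSupport_le {σ : QOp ι} (hσ : σ.PosSemidef)
    (htr : σ.trace = 1) (P : ι → Fin 4) :
    ∑ Q ∈ sameSupport P, ‖(σ * pauliG Q).trace‖ ^ 2 ≤
      2 ^ (Finset.univ.filter fun i => P i ≠ 0).card := by
  set A := Finset.univ.filter fun i => P i ≠ 0 with hA
  have hcard : Fintype.card {i // i ∈ A} = A.card := Fintype.card_coe A
  have hQ : ∀ Q ∈ sameSupport P, ∀ i, i ∉ A → Q i = 0 := by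
    intro Q hQ i hi
    rw [mem_sameSupport] at hQ
    rw [hQ]
    simpa [hA] using hi
  -- Each expectation is 2^|A| times a Pauli coefficient of the reduced state. Parseval contributes
  -- 2^(-|A|) times the purity, which leaves 4^|A| · 2^(-|A|) = 2^|A|.
  have h1 : ∀ Q ∈ sameSupport P, ‖(σ * pauliG Q).trace‖ ^ 2 =
      4 ^ A.card * ‖coefG (partialTrace A σ) (restrictString (· ∈ A) Q)‖ ^ 2 := by
    intro Q hQ'
    rw [pauliG_eq_extendOp A (hQ Q hQ'), trace_mul_kronecker_one, coefG, norm_div, div_pow,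
      norm_pow, hcard, ← pow_mul, mul_comm A.card 2, pow_mul]
    norm_num
    field_simp
  rw [Finset.sum_congr rfl h1, ← Finset.mul_sum]
  -- Strings with the support of P are trivial off A, so no information is lost by restriction.
  have hinj : Set.InjOn (restrictString (· ∈ A)) (sameSupport P : Set (ι → Fin 4)) := by
    intro Q hq Q' hq' h
    funext i
    by_cases hi : i ∈ A
    · exact congrFun h ⟨i, hi⟩
    · rw [hQ Q hq i hi, hQ Q' hq' i hi]
  rw [← Finset.sum_image (f := fun R => ‖coefG (partialTrace A σ) R‖ ^ 2) hinj]
  calc _ ≤ 4 ^ A.card * ∑ R, ‖coefG (partialTrace A σ) R‖ ^ 2 := by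
        gcongr
        exact Finset.subset_univ _
    _ ≤ 4 ^ A.card * (1 / 2 ^ A.card) := by
        rw [sum_norm_coefG_sq, hcard]
        gcongr
        exact sum_norm_sq_partialTrace_le A hσ htr
    _ = 2 ^ A.card := by
        rw [mul_one_div, ← div_pow]; norm_num

end Blocks

/-! ## Averages over single-qubit Clifford gates -/

/-- A cyclic permutation of X, Y, Z without signs. Together with the exchange of X and Z by the
Hadamard gate it generates all permutations of the three letters. -/
theorem phase_hadamard_conj_sigma (a : Fin 4) :
    (phaseGate * hadamardGate).conjTranspose * sigma a * (phaseGate * hadamardGate) =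
      sigma (![0, 2, 3, 1] a) := by
  have h : ((Real.sqrt 2 : ℂ))⁻¹ * ((Real.sqrt 2 : ℂ))⁻¹ = 1 / 2 := by
    rw [← mul_inv, ← Complex.ofReal_mul, Real.mul_self_sqrt (by norm_num)]; norm_num
  have hT : phaseGate * hadamardGate =
      (Real.sqrt 2 : ℂ)⁻¹ • !![1, 1; Complex.I, -Complex.I] := by
    ext i j
    fin_cases i <;> fin_cases j <;> simp [phaseGate, hadamardGate, mul_comm]
  rw [hT, Matrix.conjTranspose_smul]
  simp only [Matrix.smul_mul, Matrix.mul_smul, smul_smul]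
  have h' : star ((Real.sqrt 2 : ℂ)⁻¹) = (Real.sqrt 2 : ℂ)⁻¹ := by simp
  rw [h', h]
  ext i j
  fin_cases a <;> fin_cases i <;> fin_cases j <;>
    simp [sigma, Matrix.mul_apply, Fin.sum_univ_two, Matrix.conjTranspose_apply] <;> ring_nf

/-- The sign at Y is harmless: in second moments it occurs together with its conjugate. -/
theorem hadamard_conj_sigma (a : Fin 4) :
    hadamardGate.conjTranspose * sigma a * hadamardGate =
      (![1, 1, -1, 1] a : ℂ) • sigma (![0, 3, 2, 1] a) := by
  have h : ((Real.sqrt 2 : ℂ))⁻¹ * ((Real.sqrt 2 : ℂ))⁻¹ = 1 / 2 := by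
    rw [← mul_inv, ← Complex.ofReal_mul, Real.mul_self_sqrt (by norm_num)]; norm_num
  have hT : hadamardGate = (Real.sqrt 2 : ℂ)⁻¹ • !![1, 1; 1, -1] := by
    simp [hadamardGate]
  rw [hT, Matrix.conjTranspose_smul]
  simp only [Matrix.smul_mul, Matrix.mul_smul, smul_smul]
  have h' : star ((Real.sqrt 2 : ℂ)⁻¹) = (Real.sqrt 2 : ℂ)⁻¹ := by simp
  rw [h', h]
  ext i j
  fin_cases a <;> fin_cases i <;> fin_cases j <;>
    simp [sigma, Matrix.mul_apply, Fin.sum_univ_two, Matrix.conjTranspose_apply] <;> ring_nf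

/-- The sign in `σ_p σ_a σ_p = ± σ_a`. -/
def commSign (p a : Fin 4) : ℂ := if a = 0 ∨ p = 0 ∨ p = a then 1 else -1

theorem sigma_conj_sigma (p a : Fin 4) : sigma p * sigma a * sigma p = commSign p a • sigma a := by
  ext i j
  fin_cases p <;> fin_cases a <;> fin_cases i <;> fin_cases j <;>
    simp [sigma, commSign, Matrix.mul_apply, Fin.sum_univ_two]

/-- Modulo phases the Pauli matrices form a Klein four-group, and `p ↦ commSign p a` are its four
characters. This is their orthogonality. -/
theorem sum_commSign (a b : Fin 4) :
    ∑ p, commSign p a * star (commSign p b) = if a = b then 4 else 0 := by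
  fin_cases a <;> fin_cases b <;> simp [commSign, Fin.sum_univ_four] <;> norm_num

/-- The image of a Pauli matrix under conjugation with one Clifford gate. -/
noncomputable def cliffordConj (v : CliffordIndex) (a : Fin 4) : Matrix (Fin 2) (Fin 2) ℂ :=
  (cliffordRep v).conjTranspose * sigma a * cliffordRep v

/-- `cliffordConj` without the Pauli factor. -/
noncomputable def properConj (b : Fin 3) (c : Fin 2) (a : Fin 4) : Matrix (Fin 2) (Fin 2) ℂ :=
  ((phaseGate * hadamardGate) ^ (b : ℕ) * hadamardGate ^ (c : ℕ)).conjTranspose * sigma a *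
    ((phaseGate * hadamardGate) ^ (b : ℕ) * hadamardGate ^ (c : ℕ))

theorem cliffordConj_eq (v : CliffordIndex) (a : Fin 4) :
    cliffordConj v a = commSign v.1 a • properConj v.2.1 v.2.2 a := by
  simp only [cliffordConj, cliffordRep, properConj, Matrix.conjTranspose_mul, conjTranspose_sigma]
  rw [← Matrix.smul_mul, ← Matrix.mul_smul, ← sigma_conj_sigma]
  simp only [mul_assoc]

/-- The six gates without Pauli factor realize the six permutations of X, Y, Z, up to sign. A
non-identity letter therefore visits each of X, Y, Z exactly twice, whatever the letter was. -/
theorem sum_properConj (a a' : Fin 4) (h : a = 0 ↔ a' = 0) (x y z w : Fin 2) :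
    ∑ q : Fin 3 × Fin 2, properConj q.1 q.2 a x y * star (properConj q.1 q.2 a z w) =
      ∑ q : Fin 3 × Fin 2, properConj q.1 q.2 a' x y * star (properConj q.1 q.2 a' z w) := by
  have h0 : ∀ a, properConj 0 0 a = sigma a := fun a => by simp [properConj]
  have h1 : ∀ a, properConj 1 0 a = sigma (![0, 2, 3, 1] a) := fun a => by
    rw [← phase_hadamard_conj_sigma]; simp [properConj]
  have h2 : ∀ a, properConj 2 0 a = sigma (![0, 2, 3, 1] (![0, 2, 3, 1] a)) := fun a => by
    rw [← phase_hadamard_conj_sigma, ← phase_hadamard_conj_sigma]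
    simp [properConj, pow_two, mul_assoc]
  have h3 : ∀ b a, properConj b 1 a =
      hadamardGate.conjTranspose * properConj b 0 a * hadamardGate := fun b a => by
    simp [properConj, mul_assoc]
  have key : ∀ a, ∑ q : Fin 3 × Fin 2, properConj q.1 q.2 a x y * star (properConj q.1 q.2 a z w) =
      if a = 0 then 6 * (sigma 0 x y * star (sigma 0 z w)) else
        2 * (sigma 1 x y * star (sigma 1 z w) + sigma 2 x y * star (sigma 2 z w) +
          sigma 3 x y * star (sigma 3 z w)) := by
    intro a
    simp only [Fintype.sum_prod_type, Fin.sum_univ_three, Fin.sum_univ_two, h3, h0, h1, h2,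
      hadamard_conj_sigma]
    fin_cases a <;> simp <;> ring
  rw [key, key]
  simp only [h]

/-- The sum over the Pauli factor separates. Its characters remove the terms with a ≠ b and
contribute the factor 4 otherwise. -/
theorem sum_cliffordConj (a b : Fin 4) (x y z w : Fin 2) :
    ∑ v, cliffordConj v a x y * star (cliffordConj v b z w) =
      if a = b then 4 * ∑ q : Fin 3 × Fin 2,
        properConj q.1 q.2 a x y * star (properConj q.1 q.2 a z w) else 0 := by
  have : ∀ v : CliffordIndex, cliffordConj v a x y * star (cliffordConj v b z w) =
      (commSign v.1 a * star (commSign v.1 b)) *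
        (properConj v.2.1 v.2.2 a x y * star (properConj v.2.1 v.2.2 b z w)) := by
    intro v
    rw [cliffordConj_eq, cliffordConj_eq, Matrix.smul_apply, Matrix.smul_apply]
    simp only [smul_eq_mul, star_mul']
    ring
  simp only [this]
  rw [Fintype.sum_prod_type]
  simp_rw [← Finset.mul_sum]
  rw [← Finset.sum_mul, sum_commSign]
  split_ifs with h
  · subst h; rfl
  · simp

theorem sum_cliffordConj_of_ne {a b : Fin 4} (hab : a ≠ b) (x y z w : Fin 2) :
    ∑ v, cliffordConj v a x y * star (cliffordConj v b z w) = 0 := by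
  rw [sum_cliffordConj, if_neg hab]

theorem sum_cliffordConj_congr {a a' : Fin 4} (h : a = 0 ↔ a' = 0) (x y z w : Fin 2) :
    ∑ v, cliffordConj v a x y * star (cliffordConj v a z w) =
      ∑ v, cliffordConj v a' x y * star (cliffordConj v a' z w) := by
  rw [sum_cliffordConj, sum_cliffordConj, if_pos rfl, if_pos rfl, sum_properConj a a' h]

section CliffordStrings

variable {ι : Type} [Fintype ι] [DecidableEq ι]

/-- A tensor product of Clifford gates. -/
noncomputable def cliffordOp (v : ι → CliffordIndex) : QOp ι := tensorOp fun i => cliffordRep (v i)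

theorem cliffordOp_conj_pauliG (v : ι → CliffordIndex) (P : ι → Fin 4) :
    (cliffordOp v).conjTranspose * pauliG P * cliffordOp v =
      tensorOp fun i => cliffordConj (v i) (P i) := by
  simp only [cliffordOp, pauliG, conjTranspose_tensorOp, tensorOp_mul, cliffordConj]

/-- Since the gates on the qubits are chosen independently, the average is a product. One qubit on
which two strings differ is enough to make it vanish, and equal supports make it equal factor by
factor. -/
theorem sum_cliffordOp_conj (P Q : ι → Fin 4) (x y z w : ι → Fin 2) :
    ∑ v : ι → CliffordIndex, ((cliffordOp v).conjTranspose * pauliG P * cliffordOp v) x y *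
        star (((cliffordOp v).conjTranspose * pauliG Q * cliffordOp v) z w) =
      ∏ i, ∑ v, cliffordConj v (P i) (x i) (y i) * star (cliffordConj v (Q i) (z i) (w i)) := by
  rw [Finset.prod_univ_sum]
  simp only [Fintype.piFinset_univ, cliffordOp_conj_pauliG, tensorOp, Matrix.of_apply, star_prod,
    Finset.prod_mul_distrib]

theorem sum_cliffordOp_conj_of_ne {P Q : ι → Fin 4} (h : P ≠ Q) (x y z w : ι → Fin 2) :
    ∑ v : ι → CliffordIndex, ((cliffordOp v).conjTranspose * pauliG P * cliffordOp v) x y *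
        star (((cliffordOp v).conjTranspose * pauliG Q * cliffordOp v) z w) = 0 := by
  rw [sum_cliffordOp_conj]
  obtain ⟨i, hi⟩ := Function.ne_iff.mp h
  exact Finset.prod_eq_zero (Finset.mem_univ i) (sum_cliffordConj_of_ne hi _ _ _ _)

theorem sum_cliffordOp_conj_congr {P Q : ι → Fin 4} (h : Q ∈ sameSupport P)
    (x y z w : ι → Fin 2) :
    ∑ v : ι → CliffordIndex, ((cliffordOp v).conjTranspose * pauliG Q * cliffordOp v) x y *
        star (((cliffordOp v).conjTranspose * pauliG Q * cliffordOp v) z w) =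
    ∑ v : ι → CliffordIndex, ((cliffordOp v).conjTranspose * pauliG P * cliffordOp v) x y *
        star (((cliffordOp v).conjTranspose * pauliG P * cliffordOp v) z w) := by
  rw [sum_cliffordOp_conj, sum_cliffordOp_conj]
  rw [mem_sameSupport] at h
  exact Finset.prod_congr rfl fun i _ => sum_cliffordConj_congr (h i) _ _ _ _

end CliffordStrings

/-! ## Bounded measurable functions -/

/-- Bounded measurable complex functions. -/
structure Tame {α : Type*} [MeasurableSpace α] (f : α → ℂ) : Prop where
  measurable : Measurable f
  bounded : ∃ C : ℝ, ∀ a, ‖f a‖ ≤ C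

namespace Tame

variable {α β : Type*} [MeasurableSpace α] [MeasurableSpace β]

theorem const (c : ℂ) : Tame fun _ : α => c := ⟨measurable_const, ‖c‖, fun _ => le_rfl⟩

theorem add {f g : α → ℂ} (hf : Tame f) (hg : Tame g) : Tame fun a => f a + g a := by
  obtain ⟨C, hC⟩ := hf.bounded
  obtain ⟨D, hD⟩ := hg.bounded
  exact ⟨hf.measurable.add hg.measurable, C + D, fun a =>
    (norm_add_le _ _).trans (add_le_add (hC a) (hD a))⟩

theorem mul {f g : α → ℂ} (hf : Tame f) (hg : Tame g) : Tame fun a => f a * g a := by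
  obtain ⟨C, hC⟩ := hf.bounded
  obtain ⟨D, hD⟩ := hg.bounded
  refine ⟨hf.measurable.mul hg.measurable, C * D, fun a => ?_⟩
  rw [norm_mul]
  exact mul_le_mul (hC a) (hD a) (norm_nonneg _) ((norm_nonneg _).trans (hC a))

theorem neg {f : α → ℂ} (hf : Tame f) : Tame fun a => -f a := by
  simpa using (const (-1)).mul hf

theorem sub {f g : α → ℂ} (hf : Tame f) (hg : Tame g) : Tame fun a => f a - g a := by
  simpa [sub_eq_add_neg] using hf.add hg.neg

theorem star {f : α → ℂ} (hf : Tame f) : Tame fun a => Star.star (f a) := by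
  obtain ⟨C, hC⟩ := hf.bounded
  exact ⟨Complex.continuous_conj.measurable.comp hf.measurable, C, fun a => by
    rw [norm_star]; exact hC a⟩

theorem sum {κ : Type*} {s : Finset κ} {f : κ → α → ℂ} (hf : ∀ k ∈ s, Tame (f k)) :
    Tame fun a => ∑ k ∈ s, f k a := by
  classical
  induction s using Finset.induction_on with
  | empty => simpa using const 0
  | insert k s hk ih =>
    simp only [Finset.sum_insert hk]
    exact (hf k (Finset.mem_insert_self _ _)).add
      (ih fun k' hk' => hf k' (Finset.mem_insert_of_mem hk'))

theorem comp {f : β → ℂ} (hf : Tame f) {g : α → β} (hg : Measurable g) : Tame fun a => f (g a) := by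
  obtain ⟨C, hC⟩ := hf.bounded
  exact ⟨hf.measurable.comp hg, C, fun a => hC _⟩

theorem integrable {f : α → ℂ} (hf : Tame f) (μ : Measure α) [IsFiniteMeasure μ] :
    Integrable f μ := by
  obtain ⟨C, hC⟩ := hf.bounded
  exact Integrable.of_bound hf.measurable.aestronglyMeasurable C (Filter.Eventually.of_forall hC)

theorem matrix_mul {m n p : Type*} [Fintype n] {A : α → Matrix m n ℂ} {B : α → Matrix n p ℂ}
    (hA : ∀ i j, Tame fun a => A a i j) (hB : ∀ i j, Tame fun a => B a i j) (i : m) (j : p) :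
    Tame fun a => (A a * B a) i j := by
  simp only [Matrix.mul_apply]
  exact sum fun k _ => (hA i k).mul (hB k j)

theorem matrix_conjTranspose {m n : Type*} {A : α → Matrix m n ℂ}
    (hA : ∀ i j, Tame fun a => A a i j) (i : n) (j : m) :
    Tame fun a => (A a).conjTranspose i j := by
  simp only [Matrix.conjTranspose_apply]
  exact (hA j i).star

theorem matrix_trace {m : Type*} [Fintype m] {A : α → Matrix m m ℂ}
    (hA : ∀ i j, Tame fun a => A a i j) : Tame fun a => (A a).trace := by
  simp only [Matrix.trace, Matrix.diag]
  exact sum fun k _ => hA k k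

theorem matrix_coefG {ι : Type} [Fintype ι] [DecidableEq ι] {A : α → QOp ι}
    (hA : ∀ i j, Tame fun a => A a i j) (P : ι → Fin 4) : Tame fun a => coefG (A a) P := by
  simp only [coefG, div_eq_mul_inv]
  exact (matrix_trace (A := fun a => A a * pauliG P)
    (matrix_mul hA (B := fun _ => pauliG P) fun i j => const _)).mul (const _)

/-- Every random variable below is built from these entries and their conjugates by sums and
products. Boundedness of the entries makes all integrals exist. -/
theorem unitary_entry {m : Type} [Fintype m] [DecidableEq m] (i j : m) :
    Tame fun U : Matrix.unitaryGroup m ℂ => (U : Matrix m m ℂ) i j := by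
  refine ⟨Continuous.measurable ?_, 1, fun U => entry_norm_bound_of_unitary U.2 i j⟩
  exact (continuous_apply_apply i j).comp continuous_subtype_val

end Tame

/-! ## Second moments of locally scrambling distributions -/

section Scrambling

variable {ι : Type} [Fintype ι] [DecidableEq ι]

theorem trace_conj_eq_sum (A W X : QOp ι) :
    (W.conjTranspose * A * W * X).trace =
      ∑ a, ∑ b, ∑ c, ∑ d, star (W b a) * A b c * W c d * X d a := by
  simp only [Matrix.trace, Matrix.diag, Matrix.mul_apply, Matrix.conjTranspose_apply,
    Finset.sum_mul]
  refine Finset.sum_congr rfl fun a _ => ?_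
  calc _ = ∑ d, ∑ b, ∑ c, star (W b a) * A b c * W c d * X d a :=
        Finset.sum_congr rfl fun d _ => Finset.sum_comm
    _ = ∑ b, ∑ d, ∑ c, star (W b a) * A b c * W c d * X d a := Finset.sum_comm
    _ = _ := Finset.sum_congr rfl fun b _ => Finset.sum_comm

/-- Products of two Heisenberg-picture expectations are linear in the second moments. -/
theorem exists_secondMoment_expansion (A B X Y : QOp ι) :
    ∃ (K : (Fin 8 → ι → Fin 2) → ℂ) (x y : (Fin 8 → ι → Fin 2) → Fin 4 → ι → Fin 2),
      ∀ W : QOp ι, (W.conjTranspose * A * W * X).trace *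
        star ((W.conjTranspose * B * W * Y).trace) = ∑ k, K k * secondMomentEntry (x k) (y k) W := by
  -- The indices 0–3 are the summation indices of the first trace and 4–7 those of the second.
  -- Conjugating the second trace exchanges the roles of W and its conjugate there, hence the order
  -- 2, 5 for the plain factors and 1, 6 for the conjugated ones.
  refine ⟨fun k => A (k 1) (k 2) * X (k 3) (k 0) * star (B (k 5) (k 6)) * star (Y (k 7) (k 4)),
    fun k => ![k 2, k 5, k 1, k 6], fun k => ![k 3, k 4, k 0, k 7], fun W => ?_⟩
  let e : (Fin 8 → ι → Fin 2) ≃ ((ι → Fin 2) × (ι → Fin 2) × (ι → Fin 2) × (ι → Fin 2)) ×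
      ((ι → Fin 2) × (ι → Fin 2) × (ι → Fin 2) × (ι → Fin 2)) :=
    { toFun := fun k => ((k 0, k 1, k 2, k 3), (k 4, k 5, k 6, k 7))
      invFun := fun p => ![p.1.1, p.1.2.1, p.1.2.2.1, p.1.2.2.2, p.2.1, p.2.2.1, p.2.2.2.1,
        p.2.2.2.2]
      left_inv := fun k => by
        funext i; fin_cases i <;> rfl
      right_inv := fun p => rfl }
  have hsymm : ∀ a b c d a' b' c' d', e.symm ((a, b, c, d), (a', b', c', d')) =
      ![a, b, c, d, a', b', c', d'] := fun _ _ _ _ _ _ _ _ => rfl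
  rw [trace_conj_eq_sum, trace_conj_eq_sum]
  rw [← Equiv.sum_comp e.symm]
  rw [Fintype.sum_prod_type]
  simp only [Fintype.sum_prod_type, star_sum, Finset.sum_mul]
  simp only [Finset.mul_sum]
  refine Finset.sum_congr rfl fun a _ => Finset.sum_congr rfl fun b _ => Finset.sum_congr rfl
    fun c _ => Finset.sum_congr rfl fun d _ => Finset.sum_congr rfl fun a' _ =>
    Finset.sum_congr rfl fun b' _ => Finset.sum_congr rfl fun c' _ =>
    Finset.sum_congr rfl fun d' _ => ?_
  simp only [hsymm, secondMomentEntry, Matrix.cons_val, star_mul', star_star]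
  ring

theorem tame_secondMomentEntry (x y : Fin 4 → ι → Fin 2) (C : QOp ι) :
    Tame fun U : QUnitary ι => secondMomentEntry x y (C * (U : QOp ι)) := by
  have h : ∀ i j, Tame fun U : QUnitary ι => (C * (U : QOp ι)) i j :=
    Tame.matrix_mul (fun _ _ => Tame.const _) Tame.unitary_entry
  exact (((h _ _).mul (h _ _)).mul (h _ _).star).mul (h _ _).star

theorem tame_trace_conj (A X : QOp ι) :
    Tame fun U : QUnitary ι => ((U : QOp ι).conjTranspose * A * (U : QOp ι) * X).trace :=
  Tame.matrix_trace (Tame.matrix_mul (Tame.matrix_mul (Tame.matrix_mul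
    (Tame.matrix_conjTranspose Tame.unitary_entry) fun _ _ => Tame.const _)
    Tame.unitary_entry) fun _ _ => Tame.const _)

/-- Both sides are linear in the second moments, to which the defining invariance applies. A
Clifford factor C to the left of U acts on the observable as A ↦ C† A C. -/
theorem IsLocallyScrambling.integral_conj {ν : Measure (QUnitary ι)} (hν : IsLocallyScrambling ν)
    (A B X Y : QOp ι) :
    ∫ U, ((U : QOp ι).conjTranspose * A * (U : QOp ι) * X).trace *
        star (((U : QOp ι).conjTranspose * B * (U : QOp ι) * Y).trace) ∂ν =
      ((24 : ℂ) ^ Fintype.card ι)⁻¹ * ∑ v : ι → CliffordIndex, ∫ U,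
        ((U : QOp ι).conjTranspose * ((cliffordOp v).conjTranspose * A * cliffordOp v) *
          (U : QOp ι) * X).trace *
        star (((U : QOp ι).conjTranspose * ((cliffordOp v).conjTranspose * B * cliffordOp v) *
          (U : QOp ι) * Y).trace) ∂ν := by
  have := hν.1
  obtain ⟨K, x, y, h⟩ := exists_secondMoment_expansion A B X Y
  have hint : ∀ C : QOp ι, ∫ U : QUnitary ι, ∑ k, K k * secondMomentEntry (x k) (y k)
      (C * (U : QOp ι)) ∂ν = ∑ k, K k * ∫ U : QUnitary ι, secondMomentEntry (x k) (y k)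
      (C * (U : QOp ι)) ∂ν := by
    intro C
    rw [integral_finsetSum]
    · simp_rw [integral_const_mul]
    · intro k _
      exact ((tame_secondMomentEntry _ _ C).integrable ν).const_mul _
  have h1 : ∀ (C : QOp ι) (U : QUnitary ι), ((U : QOp ι).conjTranspose * (C.conjTranspose * A * C) *
          (U : QOp ι) * X).trace *
        star (((U : QOp ι).conjTranspose * (C.conjTranspose * B * C) *
          (U : QOp ι) * Y).trace) = ∑ k, K k * secondMomentEntry (x k) (y k) (C * (U : QOp ι)) := by
    intro C U
    rw [← h (C * (U : QOp ι))]
    simp only [Matrix.conjTranspose_mul, mul_assoc]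
  have h2 := hint 1
  simp only [one_mul] at h2
  simp_rw [h1, hint, h, h2]
  rw [Finset.sum_comm]
  simp_rw [← Finset.mul_sum]
  rw [Finset.mul_sum]
  refine Finset.sum_congr rfl fun k _ => ?_
  rw [hν.2]
  simp only [cliffordOp]
  ring

/-- Cyclicity of the trace isolates the sum over v. With M and N conjugated by Clifford gates, the
inner sum is the one computed qubit by qubit above. -/
theorem sum_trace_conj_mul_star {κ : Type*} [Fintype κ] (M N : κ → QOp ι) (U V X Y : QOp ι) :
    ∑ v, (U * M v * V * X).trace * star ((U * N v * V * Y).trace) =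
      ∑ z, ∑ w, ∑ x, ∑ y, (V * X * U) y x * star ((V * Y * U) w z) *
        ∑ v, M v x y * star (N v z w) := by
  have h : ∀ (M X : QOp ι), (U * M * V * X).trace = ∑ x, ∑ y, M x y * (V * X * U) y x := by
    intro M X
    have : (U * M * V * X).trace = (M * (V * X * U)).trace := by
      rw [mul_assoc, mul_assoc, Matrix.trace_mul_comm, mul_assoc, mul_assoc]
    rw [this]
    simp only [Matrix.trace, Matrix.diag, Matrix.mul_apply (M := M)]
  simp only [h]
  simp only [Finset.mul_sum, star_sum, Finset.sum_mul]
  rw [Finset.sum_comm]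
  refine Finset.sum_congr rfl fun z _ => ?_
  rw [Finset.sum_comm]
  refine Finset.sum_congr rfl fun w _ => ?_
  rw [Finset.sum_comm]
  refine Finset.sum_congr rfl fun x _ => ?_
  rw [Finset.sum_comm]
  refine Finset.sum_congr rfl fun y _ => Finset.sum_congr rfl fun v _ => ?_
  rw [star_mul']
  ring

theorem integral_sum_clifford {ν : Measure (QUnitary ι)} [IsProbabilityMeasure ν]
    (A B X Y : QOp ι) :
    ∑ v : ι → CliffordIndex, ∫ U : QUnitary ι,
        ((U : QOp ι).conjTranspose * ((cliffordOp v).conjTranspose * A * cliffordOp v) *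
          (U : QOp ι) * X).trace *
        star (((U : QOp ι).conjTranspose * ((cliffordOp v).conjTranspose * B * cliffordOp v) *
          (U : QOp ι) * Y).trace) ∂ν =
      ∫ U : QUnitary ι, ∑ z, ∑ w, ∑ x, ∑ y, ((U : QOp ι) * X * (U : QOp ι).conjTranspose) y x *
        star (((U : QOp ι) * Y * (U : QOp ι).conjTranspose) w z) *
        ∑ v : ι → CliffordIndex, ((cliffordOp v).conjTranspose * A * cliffordOp v) x y *
          star (((cliffordOp v).conjTranspose * B * cliffordOp v) z w) ∂ν := by
  rw [← integral_finsetSum]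
  · simp_rw [sum_trace_conj_mul_star]
  · intro v _
    exact ((tame_trace_conj _ _).mul (tame_trace_conj _ _).star).integrable ν

/-- Distinct Pauli operators are uncorrelated after a locally scrambling unitary. -/
theorem IsLocallyScrambling.integral_of_ne {ν : Measure (QUnitary ι)} (hν : IsLocallyScrambling ν)
    {P Q : ι → Fin 4} (h : P ≠ Q) (X Y : QOp ι) :
    ∫ U, ((U : QOp ι).conjTranspose * pauliG P * (U : QOp ι) * X).trace *
        star (((U : QOp ι).conjTranspose * pauliG Q * (U : QOp ι) * Y).trace) ∂ν = 0 := by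
  have := hν.1
  rw [hν.integral_conj, integral_sum_clifford]
  simp_rw [sum_cliffordOp_conj_of_ne h]
  simp

/-- Second moments depend on a Pauli operator only through its support. -/
theorem IsLocallyScrambling.integral_congr {ν : Measure (QUnitary ι)} (hν : IsLocallyScrambling ν)
    {P Q : ι → Fin 4} (h : Q ∈ sameSupport P) (X Y : QOp ι) :
    ∫ U, ((U : QOp ι).conjTranspose * pauliG Q * (U : QOp ι) * X).trace *
        star (((U : QOp ι).conjTranspose * pauliG Q * (U : QOp ι) * Y).trace) ∂ν =
      ∫ U, ((U : QOp ι).conjTranspose * pauliG P * (U : QOp ι) * X).trace *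
        star (((U : QOp ι).conjTranspose * pauliG P * (U : QOp ι) * Y).trace) ∂ν := by
  have := hν.1
  rw [hν.integral_conj, integral_sum_clifford, hν.integral_conj, integral_sum_clifford]
  simp_rw [sum_cliffordOp_conj_congr h]

end Scrambling

/-! ## Heisenberg evolution of circuits -/

/-- The coefficient of `R` in the Pauli expansion of `U† P U`. -/
noncomputable def transferCoeff {ι : Type} [Fintype ι] [DecidableEq ι] (U : QOp ι)
    (P R : ι → Fin 4) : ℂ := coefG (U.conjTranspose * pauliG P * U) R

theorem sum_transferCoeff_smul {ι : Type} [Fintype ι] [DecidableEq ι] (U : QOp ι)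
    (P : ι → Fin 4) : ∑ R, transferCoeff U P R • pauliG R = U.conjTranspose * pauliG P * U :=
  sum_coefG_smul _

section Circuits

variable {n L : ℕ}

theorem expectationValue_succ (U : Circuit n (L + 1)) (ρ O : QOp (Fin n)) :
    expectationValue U ρ O = expectationValue (fun j => U j.castSucc) ρ
      ((U (Fin.last L) : QOp (Fin n)).conjTranspose * O * (U (Fin.last L) : QOp (Fin n))) := by
  simp only [expectationValue, circuitUnitary, Matrix.conjTranspose_mul]
  simp only [mul_assoc]
  rw [Matrix.trace_mul_comm]
  simp only [mul_assoc]

theorem expectationValue_sum_smul {κ : Type*} (s : Finset κ) (U : Circuit n L) (ρ : QOp (Fin n))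
    (a : κ → ℂ) (O : κ → QOp (Fin n)) : expectationValue U ρ (∑ i ∈ s, a i • O i) =
      ∑ i ∈ s, a i * expectationValue U ρ (O i) := by
  simp [expectationValue, Finset.mul_sum, Matrix.trace_sum]

theorem lowPart_eq (k : ℕ) (O : QOp (Fin n)) : lowPart k O =
    ∑ P : PauliString n, (if pauliWeight P ≤ k then coefG O P else 0) • pauliG P := by
  rw [lowPart, Finset.sum_filter]
  refine Finset.sum_congr rfl fun P _ => ?_
  split_ifs
  · rw [pauliCoeff_eq_coefG, pauliOp_eq_pauliG]
  · simp

theorem lowPart_pauliG (k : ℕ) (P : PauliString n) :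
    lowPart k (pauliG P) = if pauliWeight P ≤ k then pauliG P else 0 := by
  rw [lowPart_eq, Finset.sum_eq_single P]
  · simp [coefG_pauliG]
  · intro Q _ hQ
    simp [coefG_pauliG, hQ.symm]
  · simp

theorem lowPart_sum_smul {κ : Type*} (s : Finset κ) (k : ℕ) (a : κ → ℂ) (O : κ → QOp (Fin n)) :
    lowPart k (∑ i ∈ s, a i • O i) = ∑ i ∈ s, a i • lowPart k (O i) := by
  simp only [lowPart_eq, coefG_sum, coefG_smul, Finset.smul_sum, smul_smul]
  rw [Finset.sum_comm]
  refine Finset.sum_congr rfl fun P _ => ?_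
  rw [← Finset.sum_smul]
  congr 1
  split_ifs <;> simp

theorem truncatedObservable_sum_smul {κ : Type*} (s : Finset κ) (k : ℕ) (a : κ → ℂ) (L : ℕ)
    (U : Circuit n L) (O : κ → QOp (Fin n)) : truncatedObservable k L U (∑ i ∈ s, a i • O i) =
      ∑ i ∈ s, a i • truncatedObservable k L U (O i) := by
  induction L generalizing O with
  | zero => rfl
  | succ L ih =>
    simp only [truncatedObservable]
    rw [lowPart_sum_smul, Finset.mul_sum, Finset.sum_mul]
    simp only [Matrix.mul_smul, Matrix.smul_mul]
    exact ih _ _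

theorem propagationEstimate_sum_smul {κ : Type*} (s : Finset κ) (k : ℕ) (U : Circuit n L)
    (ρ : QOp (Fin n)) (a : κ → ℂ) (O : κ → QOp (Fin n)) :
    propagationEstimate k U ρ (∑ i ∈ s, a i • O i) =
      ∑ i ∈ s, a i * propagationEstimate k U ρ (O i) := by
  simp [propagationEstimate, truncatedObservable_sum_smul, Finset.sum_mul, Matrix.trace_sum]

theorem propagationEstimate_succ (k : ℕ) (U : Circuit n (L + 1)) (ρ O : QOp (Fin n)) :
    propagationEstimate k U ρ O = propagationEstimate k (fun j => U j.castSucc) ρ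
      ((U (Fin.last L) : QOp (Fin n)).conjTranspose * lowPart k O *
        (U (Fin.last L) : QOp (Fin n))) := rfl

/-- Heisenberg-picture value of a Pauli operator. -/
noncomputable def pauliValue (U : Circuit n L) (ρ : QOp (Fin n)) (P : PauliString n) : ℂ :=
  expectationValue U ρ (pauliG P)

/-- Truncation error of a Pauli operator. -/
noncomputable def pauliError (k : ℕ) (U : Circuit n L) (ρ : QOp (Fin n)) (P : PauliString n) : ℂ :=
  propagationEstimate k U ρ (pauliG P) - expectationValue U ρ (pauliG P)

theorem error_eq_sum (k : ℕ) (U : Circuit n L) (ρ O : QOp (Fin n)) :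
    propagationEstimate k U ρ O - expectationValue U ρ O =
      ∑ P, coefG O P * pauliError k U ρ P := by
  conv_lhs => rw [← sum_coefG_smul O]
  rw [propagationEstimate_sum_smul, expectationValue_sum_smul, ← Finset.sum_sub_distrib]
  exact Finset.sum_congr rfl fun P _ => (mul_sub _ _ _).symm

theorem pauliValue_succ (U : Circuit n (L + 1)) (ρ : QOp (Fin n)) (P : PauliString n) :
    pauliValue U ρ P = ∑ R, transferCoeff (U (Fin.last L) : QOp (Fin n)) P R *
      pauliValue (fun j => U j.castSucc) ρ R := by
  rw [pauliValue, expectationValue_succ, ← sum_transferCoeff_smul, expectationValue_sum_smul]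
  rfl

/-- The error obeys a dichotomy. A retained string passes on the errors of its images, while a
discarded one, treated below, has its whole value as error and no contribution from earlier
truncations. -/
theorem pauliError_succ_of_le {k : ℕ} (U : Circuit n (L + 1)) (ρ : QOp (Fin n))
    {P : PauliString n} (h : pauliWeight P ≤ k) :
    pauliError k U ρ P = ∑ R, transferCoeff (U (Fin.last L) : QOp (Fin n)) P R *
      pauliError k (fun j => U j.castSucc) ρ R := by
  rw [pauliError, propagationEstimate_succ, lowPart_pauliG, if_pos h, expectationValue_succ,
    ← sum_transferCoeff_smul, propagationEstimate_sum_smul, expectationValue_sum_smul,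
    ← Finset.sum_sub_distrib]
  exact Finset.sum_congr rfl fun P _ => (mul_sub _ _ _).symm

theorem propagationEstimate_zero_right (k : ℕ) (U : Circuit n L) (ρ : QOp (Fin n)) :
    propagationEstimate k U ρ 0 = 0 := by
  simpa using propagationEstimate_sum_smul (∅ : Finset (Fin 0)) k U ρ (fun _ => 0) (fun _ => 0)

theorem pauliError_succ_of_lt {k : ℕ} (U : Circuit n (L + 1)) (ρ : QOp (Fin n))
    {P : PauliString n} (h : ¬ pauliWeight P ≤ k) :
    pauliError k U ρ P = -pauliValue U ρ P := by
  rw [pauliError, propagationEstimate_succ, lowPart_pauliG, if_neg h]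
  simp [propagationEstimate_zero_right, pauliValue]

/-- The observable that leaves the first layer is not truncated, so the recursion starts without
error. -/
theorem pauliError_zero (k : ℕ) (U : Circuit n 0) (ρ : QOp (Fin n)) (P : PauliString n) :
    pauliError k U ρ P = 0 := by
  rw [pauliError, propagationEstimate, truncatedObservable, expectationValue, circuitUnitary,
    Matrix.trace_mul_comm]
  simp

theorem circuitUnitary_mem (L : ℕ) (U : Circuit n L) :
    circuitUnitary L U ∈ Matrix.unitaryGroup (Fin n → Fin 2) ℂ := by
  induction L with
  | zero => exact one_mem _
  | succ L ih => exact mul_mem (U (Fin.last L)).2 (ih _)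

open scoped ComplexOrder in
theorem IsQuantumState.conj {ρ : QOp (Fin n)} (hρ : IsQuantumState ρ) {V : QOp (Fin n)}
    (hV : V ∈ Matrix.unitaryGroup (Fin n → Fin 2) ℂ) :
    IsQuantumState (V * ρ * V.conjTranspose) := by
  refine ⟨hρ.1.mul_mul_conjTranspose_same V, ?_⟩
  rw [Matrix.trace_mul_comm, ← mul_assoc, ← Matrix.star_eq_conjTranspose,
    Matrix.mem_unitaryGroup_iff'.mp hV, one_mul, hρ.2]

theorem sum_norm_sq_pauliValue_le {ρ : QOp (Fin n)} (hρ : IsQuantumState ρ) (U : Circuit n L)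
    (P : PauliString n) :
    ∑ Q ∈ sameSupport P, ‖pauliValue U ρ Q‖ ^ 2 ≤ 2 ^ pauliWeight P := by
  have h := hρ.conj (circuitUnitary_mem L U)
  exact sum_norm_sq_trace_sameSupport_le h.1 h.2 P

theorem tame_transferCoeff (P R : PauliString n) :
    Tame fun U : QUnitary (Fin n) => transferCoeff (U : QOp (Fin n)) P R := by
  have h : ∀ i j, Tame fun U : QUnitary (Fin n) =>
      ((U : QOp (Fin n)).conjTranspose * pauliG P * (U : QOp (Fin n))) i j :=
    Tame.matrix_mul (Tame.matrix_mul
      (Tame.matrix_conjTranspose Tame.unitary_entry) fun _ _ => Tame.const _) Tame.unitary_entry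
  exact Tame.matrix_coefG h R

theorem tame_pauliValue (ρ : QOp (Fin n)) (L : ℕ) (P : PauliString n) :
    Tame fun U : Circuit n L => pauliValue U ρ P := by
  induction L generalizing P with
  | zero =>
    simp only [pauliValue, expectationValue, circuitUnitary]
    exact Tame.const _
  | succ L ih =>
    simp only [pauliValue_succ]
    refine Tame.sum fun R _ => ((tame_transferCoeff P R).comp (measurable_pi_apply _)).mul
      ((ih R).comp (measurable_pi_lambda _ fun j => measurable_pi_apply _))

theorem tame_pauliError (k : ℕ) (ρ : QOp (Fin n)) (L : ℕ) (P : PauliString n) :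
    Tame fun U : Circuit n L => pauliError k U ρ P := by
  induction L generalizing P with
  | zero =>
    simp only [pauliError_zero]
    exact Tame.const _
  | succ L ih =>
    by_cases h : pauliWeight P ≤ k
    · simp only [pauliError_succ_of_le _ _ h]
      refine Tame.sum fun R _ => ((tame_transferCoeff P R).comp (measurable_pi_apply _)).mul
        ((ih R).comp (measurable_pi_lambda _ fun j => measurable_pi_apply _))
    · simp only [pauliError_succ_of_lt _ _ h]
      exact (tame_pauliValue ρ _ P).neg

end Circuits

/-! ## Random layers -/

theorem continuous_unitary_entry {m : Type} [Fintype m] [DecidableEq m] (i j : m) :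
    Continuous fun U : Matrix.unitaryGroup m ℂ => (U : Matrix m m ℂ) i j :=
  (continuous_apply_apply i j).comp continuous_subtype_val

theorem measurable_unitary_map {m m' : Type} [Fintype m] [DecidableEq m] [Fintype m']
    [DecidableEq m'] (F : Matrix.unitaryGroup m ℂ → Matrix.unitaryGroup m' ℂ)
    (h : ∀ i j, Continuous fun U => (F U : Matrix m' m' ℂ) i j) : Measurable F := by
  have hc : Continuous F := Continuous.subtype_mk
    (f := fun U => (F U : Matrix m' m' ℂ)) (continuous_pi fun x => continuous_pi fun y => h x y) _
  exact hc.measurable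

theorem measurable_extendUnitary {n : ℕ} (A : Finset (Fin n)) :
    Measurable (extendUnitary A : QUnitary {i // i ∈ A} → QUnitary (Fin n)) := by
  refine measurable_unitary_map _ fun x y => ?_
  exact (continuous_unitary_entry _ _).mul continuous_const

/-- What the error analysis uses about the distribution of a layer. -/
structure IsScramblingLayer {n : ℕ} (ν : Measure (QUnitary (Fin n))) : Prop where
  prob : IsProbabilityMeasure ν
  -- Only coefficients of the same string R are compared: mixed terms R ≠ S are removed by the
  -- uncorrelatedness of the earlier layers.
  orthogonal : ∀ P Q : PauliString n, P ≠ Q → ∀ R,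
    ∫ U, transferCoeff (U : QOp (Fin n)) P R * star (transferCoeff (U : QOp (Fin n)) Q R) ∂ν = 0
  -- A layer that acts on A only does not scramble the letters outside A, so its transfer moments
  -- alone are not invariant. They become so after summation against a weight M that depends only on
  -- supports, such as the second moments of the earlier circuit.
  invariant : ∀ M : PauliString n → ℂ, (∀ P, ∀ Q ∈ sameSupport P, M Q = M P) →
    ∀ P, ∀ Q ∈ sameSupport P,
      ∑ R, (∫ U, transferCoeff (U : QOp (Fin n)) Q R *
        star (transferCoeff (U : QOp (Fin n)) Q R) ∂ν) * M R =
      ∑ R, (∫ U, transferCoeff (U : QOp (Fin n)) P R *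
        star (transferCoeff (U : QOp (Fin n)) P R) ∂ν) * M R

section LocalScrambling

variable {ι : Type} [Fintype ι] [DecidableEq ι]

theorem IsLocallyScrambling.integral_transferCoeff_of_ne {ν : Measure (QUnitary ι)}
    (hν : IsLocallyScrambling ν) {P Q : ι → Fin 4} (h : P ≠ Q) (R : ι → Fin 4) :
    ∫ U, transferCoeff (U : QOp ι) P R * star (transferCoeff (U : QOp ι) Q R) ∂ν = 0 := by
  simp only [transferCoeff, coefG, star_div₀, div_mul_div_comm]
  rw [integral_div, hν.integral_of_ne h, zero_div]

theorem IsLocallyScrambling.integral_transferCoeff_congr {ν : Measure (QUnitary ι)}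
    (hν : IsLocallyScrambling ν) {P Q : ι → Fin 4} (h : Q ∈ sameSupport P) (R : ι → Fin 4) :
    ∫ U, transferCoeff (U : QOp ι) Q R * star (transferCoeff (U : QOp ι) Q R) ∂ν =
      ∫ U, transferCoeff (U : QOp ι) P R * star (transferCoeff (U : QOp ι) P R) ∂ν := by
  simp only [transferCoeff, coefG, star_div₀, div_mul_div_comm]
  rw [integral_div, integral_div, hν.integral_congr h]

end LocalScrambling

/-- Letters outside A are carried along unchanged, and inside A the moments of ν apply. Both
properties follow by splitting strings into these two parts. -/
theorem IsLocallyScrambling.isScramblingLayer_map {n : ℕ} {A : Finset (Fin n)}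
    {ν : Measure (QUnitary {i // i ∈ A})} (hν : IsLocallyScrambling ν) :
    IsScramblingLayer (ν.map (extendUnitary A)) := by
  have := hν.1
  have hmap : ∀ P Q R : PauliString n,
      ∫ U, transferCoeff (U : QOp (Fin n)) P R * star (transferCoeff (U : QOp (Fin n)) Q R)
        ∂(ν.map (extendUnitary A)) =
      (∫ V, transferCoeff (V : QOp {i // i ∈ A}) (restrictString (· ∈ A) P)
          (restrictString (· ∈ A) R) * star (transferCoeff (V : QOp {i // i ∈ A})
          (restrictString (· ∈ A) Q) (restrictString (· ∈ A) R)) ∂ν) *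
        if restrictString (fun i => ¬ i ∈ A) P = restrictString (fun i => ¬ i ∈ A) R ∧
          restrictString (fun i => ¬ i ∈ A) Q = restrictString (fun i => ¬ i ∈ A) R
          then 1 else 0 := by
    intro P Q R
    rw [integral_map (measurable_extendUnitary A).aemeasurable]
    · rw [← integral_mul_const]
      congr 1
      funext V
      simp only [transferCoeff, coe_extendUnitary, coefG_extendOp_conj]
      split_ifs <;> simp_all
    · exact ((tame_transferCoeff P R).mul (tame_transferCoeff Q R).star).measurable.aestronglyMeasurable
  refine ⟨Measure.isProbabilityMeasure_map (measurable_extendUnitary A).aemeasurable, ?_, ?_⟩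
  · intro P Q hPQ R
    rw [hmap]
    -- Distinct strings differ inside A, where ν makes them uncorrelated, or else outside A, where
    -- they cannot both agree with R.
    by_cases h : restrictString (· ∈ A) P = restrictString (· ∈ A) Q
    · rw [if_neg, mul_zero]
      rintro ⟨h1, h2⟩
      apply hPQ
      funext i
      by_cases hi : i ∈ A
      · exact congrFun h ⟨i, hi⟩
      · exact congrFun (h1.trans h2.symm) ⟨i, hi⟩
    · rw [hν.integral_transferCoeff_of_ne h, zero_mul]
  · intro M hM P Q hQ
    -- Only the R that agree with P outside A contribute, so the sum runs over the letters r inside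
    -- A.
    have hsum : ∀ P : PauliString n, ∑ R, (∫ U, transferCoeff (U : QOp (Fin n)) P R *
        star (transferCoeff (U : QOp (Fin n)) P R) ∂(ν.map (extendUnitary A))) * M R =
        ∑ r, (∫ V, transferCoeff (V : QOp {i // i ∈ A}) (restrictString (· ∈ A) P) r *
          star (transferCoeff (V : QOp {i // i ∈ A}) (restrictString (· ∈ A) P) r) ∂ν) *
          M ((Equiv.piEquivPiSubtypeProd (fun i => i ∈ A) (fun _ => Fin 4)).symm
            (r, restrictString (fun i => ¬ i ∈ A) P)) := by
      intro P
      let e := Equiv.piEquivPiSubtypeProd (fun i : Fin n => i ∈ A) (fun _ => Fin 4)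
      have h1 : ∀ r b, restrictString (· ∈ A) (e.symm (r, b)) = r := fun r b =>
        congrArg Prod.fst (e.apply_symm_apply (r, b))
      have h2 : ∀ r b, restrictString (fun i => ¬ i ∈ A) (e.symm (r, b)) = b := fun r b =>
        congrArg Prod.snd (e.apply_symm_apply (r, b))
      rw [← Equiv.sum_comp e.symm, Fintype.sum_prod_type]
      refine Finset.sum_congr rfl fun r _ => ?_
      simp only [hmap, h1, h2, and_self]
      rw [Finset.sum_eq_single (restrictString (fun i => ¬ i ∈ A) P)]
      · simp [e]
      · intro b _ hb
        rw [if_neg hb.symm]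
        simp
      · simp
    rw [mem_sameSupport] at hQ
    rw [hsum, hsum]
    refine Finset.sum_congr rfl fun r _ => ?_
    rw [hν.integral_transferCoeff_congr (P := restrictString (· ∈ A) P)
      (Q := restrictString (· ∈ A) Q)]
    · congr 1
      -- The two arguments of M have the same letters r inside A, and outside A they have the
      -- letters of P and Q, whose supports agree.
      apply hM
      rw [mem_sameSupport]
      intro i
      by_cases hi : i ∈ A
      · simp [Equiv.piEquivPiSubtypeProd, hi]
      · simp [Equiv.piEquivPiSubtypeProd, hi, restrictString, hQ]
    · rw [mem_sameSupport]
      exact fun i => hQ i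

theorem integral_circuitLaw_succ {n L : ℕ} (μ : Fin (L + 1) → Measure (QUnitary (Fin n)))
    [∀ j, IsProbabilityMeasure (μ j)] (g : QUnitary (Fin n) × Circuit n L → ℂ) :
    ∫ U, g (U (Fin.last L), fun j => U j.castSucc) ∂circuitLaw μ =
      ∫ p, g p ∂((μ (Fin.last L)).prod (circuitLaw fun j => μ j.castSucc)) := by
  have h := (measurePreserving_piFinSuccAbove (fun j => μ j) (Fin.last L)).integral_comp' g
  simp only [Fin.succAbove_last] at h
  rw [circuitLaw, circuitLaw, ← h]
  congr 1
  funext U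
  congr 2
  funext j
  exact congrArg U (Fin.succAbove_last_apply j).symm

/-- Independence factors each of the κ² mixed terms, and the orthogonality of the second factors
leaves only the diagonal. Orthogonality of a and b is not required. -/
theorem integral_prod_sum_mul_star {α β κ : Type*} [MeasurableSpace α] [MeasurableSpace β]
    [Fintype κ] (ν : Measure α) (π : Measure β) [IsProbabilityMeasure ν] [IsProbabilityMeasure π]
    {a b : κ → α → ℂ} {S T : κ → β → ℂ} (ha : ∀ r, Tame (a r)) (hb : ∀ r, Tame (b r))
    (hS : ∀ r, Tame (S r)) (hT : ∀ r, Tame (T r))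
    (horth : ∀ r s, r ≠ s → ∫ c, S r c * star (T s c) ∂π = 0) :
    ∫ p, (∑ r, a r p.1 * S r p.2) * star (∑ s, b s p.1 * T s p.2) ∂(ν.prod π) =
      ∑ r, (∫ u, a r u * star (b r u) ∂ν) * ∫ c, S r c * star (T r c) ∂π := by
  have h : ∀ p : α × β, (∑ r, a r p.1 * S r p.2) * star (∑ s, b s p.1 * T s p.2) =
      ∑ r, ∑ s, (a r p.1 * star (b s p.1)) * (S r p.2 * star (T s p.2)) := by
    intro p
    rw [star_sum, Finset.sum_mul_sum]
    refine Finset.sum_congr rfl fun r _ => Finset.sum_congr rfl fun s _ => ?_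
    rw [star_mul']
    ring
  have hint : ∀ r s, Integrable (fun p : α × β =>
      (a r p.1 * star (b s p.1)) * (S r p.2 * star (T s p.2))) (ν.prod π) := fun r s =>
    ((((ha r).comp measurable_fst).mul ((hb s).comp measurable_fst).star).mul
      (((hS r).comp measurable_snd).mul ((hT s).comp measurable_snd).star)).integrable _
  simp_rw [h]
  rw [integral_finsetSum _ fun r _ => integrable_finsetSum _ fun s _ => hint r s]
  refine Finset.sum_congr rfl fun r _ => ?_
  rw [integral_finsetSum _ fun s _ => hint r s]
  rw [Finset.sum_eq_single r]
  · exact integral_prod_mul (L := ℂ) (μ := ν) (ν := π) (fun u => a r u * star (b r u))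
      (fun c => S r c * star (T r c))
  · intro s _ hs
    have := integral_prod_mul (L := ℂ) (μ := ν) (ν := π) (fun u => a r u * star (b s u))
      (fun c => S r c * star (T s c))
    rw [this, horth r s hs.symm, mul_zero]
  · simp

theorem integral_mul_star_self {α : Type*} [MeasurableSpace α] (μ : Measure α) (f : α → ℂ) :
    ∫ a, f a * star (f a) ∂μ = ((∫ a, ‖f a‖ ^ 2 ∂μ : ℝ) : ℂ) := by
  refine Eq.trans ?_ (integral_ofReal (𝕜 := ℂ))
  congr 1
  funext a
  exact (Complex.mul_conj' _).trans (Complex.ofReal_pow _ _).symm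

/-! ## Accuracy of low-weight Pauli propagation -/

section Accuracy

variable {n : ℕ}

/-- Two families of random variables indexed by Pauli strings are uncorrelated off the diagonal. -/
def Uncorrelated {α : Type*} [MeasurableSpace α] (π : Measure α)
    (S T : α → PauliString n → ℂ) : Prop :=
  ∀ P Q, P ≠ Q → ∫ c, S c P * star (T c Q) ∂π = 0

theorem Uncorrelated.symm {α : Type*} [MeasurableSpace α] {π : Measure α}
    {S T : α → PauliString n → ℂ} (h : Uncorrelated π S T) : Uncorrelated π T S := by
  intro P Q hPQ
  have h1 : ∀ c, T c P * star (S c Q) = star (S c Q * star (T c P)) := fun c => by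
    rw [star_mul', star_star, mul_comm]
  simp_rw [h1]
  rw [show (fun c => star (S c Q * star (T c P))) =
    fun c => (starRingEnd ℂ) (S c Q * star (T c P)) from rfl, integral_conj, h Q P hPQ.symm,
    map_zero]

/-- Composition of a random functional with an independent random layer. -/
noncomputable def withLayer {α : Type*} (S : α → PauliString n → ℂ)
    (p : QUnitary (Fin n) × α) (P : PauliString n) : ℂ :=
  ∑ R, transferCoeff (p.1 : QOp (Fin n)) P R * S p.2 R

variable {α : Type*} [MeasurableSpace α] {π : Measure α} [IsProbabilityMeasure π]
  {ν : Measure (QUnitary (Fin n))}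

theorem IsScramblingLayer.integral_withLayer (hν : IsScramblingLayer ν)
    {S T : α → PauliString n → ℂ} (hS : ∀ P, Tame fun c => S c P) (hT : ∀ P, Tame fun c => T c P)
    (h : Uncorrelated π S T) (P Q : PauliString n) :
    ∫ p, withLayer S p P * star (withLayer T p Q) ∂(ν.prod π) =
      ∑ R, (∫ U, transferCoeff (U : QOp (Fin n)) P R *
        star (transferCoeff (U : QOp (Fin n)) Q R) ∂ν) * ∫ c, S c R * star (T c R) ∂π := by
  have := hν.prob
  exact integral_prod_sum_mul_star ν π
    (a := fun R (U : QUnitary (Fin n)) => transferCoeff (U : QOp (Fin n)) P R)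
    (b := fun R (U : QUnitary (Fin n)) => transferCoeff (U : QOp (Fin n)) Q R)
    (S := fun R c => S c R) (T := fun R c => T c R) (fun R => tame_transferCoeff P R)
    (fun R => tame_transferCoeff Q R) hS hT h

/-- The earlier layers make the double sum diagonal, and then the new layer makes each diagonal term
vanish. -/
theorem IsScramblingLayer.uncorrelated (hν : IsScramblingLayer ν)
    {S T : α → PauliString n → ℂ} (hS : ∀ P, Tame fun c => S c P) (hT : ∀ P, Tame fun c => T c P)
    (h : Uncorrelated π S T) : Uncorrelated (ν.prod π) (withLayer S) (withLayer T) := by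
  intro P Q hPQ
  rw [hν.integral_withLayer hS hT h]
  exact Finset.sum_eq_zero fun R _ => by rw [hν.orthogonal P Q hPQ, zero_mul]

/-- The hypothesis of the induction over the layers. -/
structure ErrorControl {L : ℕ} (μ : Fin L → Measure (QUnitary (Fin n))) (k : ℕ)
    (ρ : QOp (Fin n)) : Prop where
  valueValue : Uncorrelated (circuitLaw μ) (fun U => pauliValue U ρ) (fun U => pauliValue U ρ)
  valueError : Uncorrelated (circuitLaw μ) (fun U => pauliValue U ρ) (fun U => pauliError k U ρ)
  errorError : Uncorrelated (circuitLaw μ) (fun U => pauliError k U ρ) (fun U => pauliError k U ρ)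
  invariant : ∀ P, ∀ Q ∈ sameSupport P,
    ∫ U, pauliValue U ρ Q * star (pauliValue U ρ Q) ∂(circuitLaw μ) =
      ∫ U, pauliValue U ρ P * star (pauliValue U ρ P) ∂(circuitLaw μ)
  bound : ∀ P, ∫ U, ‖pauliError k U ρ P‖ ^ 2 ∂(circuitLaw μ) ≤ (2 / 3) ^ (k + 1)

theorem Tame.integrable_norm_sq {f : α → ℂ} (hf : Tame f) : Integrable (fun a => ‖f a‖ ^ 2) π := by
  obtain ⟨C, hC⟩ := hf.bounded
  refine Integrable.of_bound (hf.measurable.norm.pow_const 2).aestronglyMeasurable (C ^ 2)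
    (Filter.Eventually.of_forall fun a => ?_)
  rw [Real.norm_of_nonneg (by positivity)]
  exact pow_le_pow_left₀ (norm_nonneg _) (hC a) 2

/-- For each fixed circuit the squares sum to at most 2^w over the 3^w strings with the support of
P. By invariance these strings share the mean equally. -/
theorem integral_norm_sq_pauliValue_le {L : ℕ} {μ : Fin L → Measure (QUnitary (Fin n))}
    [∀ j, IsProbabilityMeasure (μ j)] {ρ : QOp (Fin n)} (hρ : IsQuantumState ρ)
    (hinv : ∀ P, ∀ Q ∈ sameSupport P,
      ∫ U, pauliValue U ρ Q * star (pauliValue U ρ Q) ∂(circuitLaw μ) =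
        ∫ U, pauliValue U ρ P * star (pauliValue U ρ P) ∂(circuitLaw μ)) (P : PauliString n) :
    ∫ U, ‖pauliValue U ρ P‖ ^ 2 ∂(circuitLaw μ) ≤ (2 / 3) ^ pauliWeight P := by
  have : IsProbabilityMeasure (circuitLaw μ) := by unfold circuitLaw; infer_instance
  have h1 : ∀ Q ∈ sameSupport P, ∫ U, ‖pauliValue U ρ Q‖ ^ 2 ∂(circuitLaw μ) =
      ∫ U, ‖pauliValue U ρ P‖ ^ 2 ∂(circuitLaw μ) := by
    intro Q hQ
    have h := hinv P Q hQ
    rw [integral_mul_star_self, integral_mul_star_self] at h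
    exact_mod_cast h
  have h2 : ∑ Q ∈ sameSupport P, ∫ U, ‖pauliValue U ρ Q‖ ^ 2 ∂(circuitLaw μ) ≤
      2 ^ pauliWeight P := by
    rw [← integral_finsetSum _ fun Q _ => (tame_pauliValue ρ L Q).integrable_norm_sq]
    calc _ ≤ ∫ _U, (2 : ℝ) ^ pauliWeight P ∂(circuitLaw μ) := by
          refine integral_mono (integrable_finsetSum _ fun Q _ =>
            (tame_pauliValue ρ L Q).integrable_norm_sq) (integrable_const _) fun U => ?_
          exact sum_norm_sq_pauliValue_le hρ U P
      _ = _ := by simp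
  rw [Finset.sum_congr rfl h1, Finset.sum_const, card_sameSupport, nsmul_eq_mul] at h2
  rw [div_pow, le_div_iff₀ (by positivity), mul_comm]
  exact_mod_cast h2

/-- After a new layer an error is the propagated error or minus the propagated value, according to
the weight. Correlations between errors can thus be of any of the four types, which is why the
induction has to carry all three uncorrelatedness statements. -/
theorem ErrorControl.of_withLayer {L : ℕ} {μ : Fin (L + 1) → Measure (QUnitary (Fin n))}
    [∀ j, IsProbabilityMeasure (μ j)] {k : ℕ} {ρ : QOp (Fin n)} (hρ : IsQuantumState ρ)
    (hvv : Uncorrelated ((μ (Fin.last L)).prod (circuitLaw fun j => μ j.castSucc))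
      (withLayer fun U => pauliValue U ρ) (withLayer fun U => pauliValue U ρ))
    (hve : Uncorrelated ((μ (Fin.last L)).prod (circuitLaw fun j => μ j.castSucc))
      (withLayer fun U => pauliValue U ρ) (withLayer fun U => pauliError k U ρ))
    (hee : Uncorrelated ((μ (Fin.last L)).prod (circuitLaw fun j => μ j.castSucc))
      (withLayer fun U => pauliError k U ρ) (withLayer fun U => pauliError k U ρ))
    (hinv : ∀ P, ∀ Q ∈ sameSupport P,
      ∫ p, withLayer (fun U => pauliValue U ρ) p Q * star (withLayer (fun U => pauliValue U ρ) p Q)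
        ∂((μ (Fin.last L)).prod (circuitLaw fun j => μ j.castSucc)) =
      ∫ p, withLayer (fun U => pauliValue U ρ) p P * star (withLayer (fun U => pauliValue U ρ) p P)
        ∂((μ (Fin.last L)).prod (circuitLaw fun j => μ j.castSucc)))
    (hb : ∀ P, ∫ p, ‖withLayer (fun U => pauliError k U ρ) p P‖ ^ 2
        ∂((μ (Fin.last L)).prod (circuitLaw fun j => μ j.castSucc)) ≤ (2 / 3) ^ (k + 1)) :
    ErrorControl μ k ρ := by
  have hV : ∀ (U : Circuit n (L + 1)) P, pauliValue U ρ P =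
      withLayer (fun U => pauliValue U ρ) (U (Fin.last L), fun j => U j.castSucc) P :=
    fun U P => pauliValue_succ U ρ P
  have hE : ∀ (U : Circuit n (L + 1)) P, pauliError k U ρ P = if pauliWeight P ≤ k then
      withLayer (fun U => pauliError k U ρ) (U (Fin.last L), fun j => U j.castSucc) P
      else -withLayer (fun U => pauliValue U ρ) (U (Fin.last L), fun j => U j.castSucc) P := by
    intro U P
    split_ifs with h
    · exact pauliError_succ_of_le U ρ h
    · rw [pauliError_succ_of_lt U ρ h, hV]
  have hI := fun g => integral_circuitLaw_succ μ g
  have hinv' : ∀ P, ∀ Q ∈ sameSupport P,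
    ∫ U, pauliValue U ρ Q * star (pauliValue U ρ Q) ∂(circuitLaw μ) =
      ∫ U, pauliValue U ρ P * star (pauliValue U ρ P) ∂(circuitLaw μ) := by
    intro P Q hQ
    simp only [hV]
    rw [hI fun p => withLayer (fun U => pauliValue U ρ) p Q *
      star (withLayer (fun U => pauliValue U ρ) p Q), hI fun p =>
      withLayer (fun U => pauliValue U ρ) p P * star (withLayer (fun U => pauliValue U ρ) p P)]
    exact hinv P Q hQ
  refine ⟨?_, ?_, ?_, hinv', ?_⟩
  · intro P Q hPQ
    simp only [hV]
    rw [hI fun p => withLayer (fun U => pauliValue U ρ) p P *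
      star (withLayer (fun U => pauliValue U ρ) p Q)]
    exact hvv P Q hPQ
  · intro P Q hPQ
    simp only [hV, hE]
    split_ifs
    · rw [hI fun p => withLayer (fun U => pauliValue U ρ) p P *
        star (withLayer (fun U => pauliError k U ρ) p Q)]
      exact hve P Q hPQ
    · simp only [star_neg, mul_neg, integral_neg, neg_eq_zero]
      rw [hI fun p => withLayer (fun U => pauliValue U ρ) p P *
        star (withLayer (fun U => pauliValue U ρ) p Q)]
      exact hvv P Q hPQ
  · intro P Q hPQ
    simp only [hE]
    split_ifs
    · rw [hI fun p => withLayer (fun U => pauliError k U ρ) p P *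
        star (withLayer (fun U => pauliError k U ρ) p Q)]
      exact hee P Q hPQ
    · simp only [star_neg, mul_neg, integral_neg, neg_eq_zero]
      rw [hI fun p => withLayer (fun U => pauliError k U ρ) p P *
        star (withLayer (fun U => pauliValue U ρ) p Q)]
      exact hve.symm P Q hPQ
    · simp only [neg_mul, integral_neg, neg_eq_zero]
      rw [hI fun p => withLayer (fun U => pauliValue U ρ) p P *
        star (withLayer (fun U => pauliError k U ρ) p Q)]
      exact hve P Q hPQ
    · simp only [star_neg, neg_mul_neg]
      rw [hI fun p => withLayer (fun U => pauliValue U ρ) p P *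
        star (withLayer (fun U => pauliValue U ρ) p Q)]
      exact hvv P Q hPQ
  · intro P
    by_cases h : pauliWeight P ≤ k
    · have h1 := hI fun p => withLayer (fun U => pauliError k U ρ) p P *
        star (withLayer (fun U => pauliError k U ρ) p P)
      rw [integral_mul_star_self, integral_mul_star_self] at h1
      simp only [hE, if_pos h]
      exact (Complex.ofReal_injective h1).trans_le (hb P)
    -- A discarded string has weight at least k + 1, the exponent in the bound.
    · simp only [pauliError_succ_of_lt _ _ h, norm_neg]
      refine (integral_norm_sq_pauliValue_le hρ hinv' P).trans ?_
      exact pow_le_pow_of_le_one (by norm_num) (by norm_num) (by omega)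

/-- The values in the bare state ρ are constants and need not be uncorrelated, so the general step
does not apply to the first layer. Instead its moments are taken directly, with ρ as the second
argument of the traces; here it matters that the first layer scrambles all qubits. -/
theorem ErrorControl.single {μ : Fin 1 → Measure (QUnitary (Fin n))}
    (hμ : IsLocallyScrambling (μ (Fin.last 0))) (k : ℕ) {ρ : QOp (Fin n)}
    (hρ : IsQuantumState ρ) : ErrorControl μ k ρ := by
  have := hμ.1
  have : ∀ j, IsProbabilityMeasure (μ j) := fun j => by
    rw [Subsingleton.elim j (Fin.last 0)]; infer_instance
  have : IsProbabilityMeasure (circuitLaw fun j : Fin 0 => μ j.castSucc) := by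
    unfold circuitLaw; infer_instance
  have hv : ∀ (p : QUnitary (Fin n) × Circuit n 0) P, withLayer (fun U => pauliValue U ρ) p P =
      ((p.1 : QOp (Fin n)).conjTranspose * pauliG P * (p.1 : QOp (Fin n)) * ρ).trace := by
    intro p P
    have h : ∀ R, pauliValue p.2 ρ R = (ρ * pauliG R).trace := fun R => by
      simp [pauliValue, expectationValue, circuitUnitary]
    simp only [withLayer, h]
    rw [← sum_transferCoeff_smul, Matrix.trace_mul_comm, Finset.mul_sum, Matrix.trace_sum]
    simp
  have he : ∀ (p : QUnitary (Fin n) × Circuit n 0) P,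
      withLayer (fun U => pauliError k U ρ) p P = 0 := by
    intro p P
    simp [withLayer, pauliError_zero]
  have hint : ∀ P Q, ∫ p, withLayer (fun U => pauliValue U ρ) p P *
      star (withLayer (fun U => pauliValue U ρ) p Q)
        ∂((μ (Fin.last 0)).prod (circuitLaw fun j => μ j.castSucc)) =
      ∫ U, ((U : QOp (Fin n)).conjTranspose * pauliG P * (U : QOp (Fin n)) * ρ).trace *
        star (((U : QOp (Fin n)).conjTranspose * pauliG Q * (U : QOp (Fin n)) * ρ).trace)
        ∂(μ (Fin.last 0)) := by
    intro P Q
    simp only [hv]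
    have := integral_prod_mul (L := ℂ) (μ := μ (Fin.last 0))
      (ν := circuitLaw fun j : Fin 0 => μ j.castSucc)
      (fun U => ((U : QOp (Fin n)).conjTranspose * pauliG P * (U : QOp (Fin n)) * ρ).trace *
        star (((U : QOp (Fin n)).conjTranspose * pauliG Q * (U : QOp (Fin n)) * ρ).trace))
      (fun _ => 1)
    simpa using this
  refine ErrorControl.of_withLayer hρ ?_ ?_ ?_ ?_ ?_
  · intro P Q hPQ
    rw [hint]
    exact hμ.integral_of_ne hPQ ρ ρ
  · intro P Q _
    simp [he]
  · intro P Q _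
    simp [he]
  · intro P Q hQ
    rw [hint, hint]
    exact hμ.integral_congr hQ ρ ρ
  · intro P
    simp only [he]
    simp only [norm_zero, ne_eq, OfNat.ofNat_ne_zero, not_false_eq_true, zero_pow,
      integral_zero]
    positivity

theorem ErrorControl.succ {L : ℕ} {μ : Fin (L + 1) → Measure (QUnitary (Fin n))}
    [∀ j, IsProbabilityMeasure (μ j)] {k : ℕ} {ρ : QOp (Fin n)} (hρ : IsQuantumState ρ)
    (h : ErrorControl (fun j => μ j.castSucc) k ρ) (hν : IsScramblingLayer (μ (Fin.last L))) :
    ErrorControl μ k ρ := by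
  have : IsProbabilityMeasure (circuitLaw fun j => μ (Fin.castSucc j)) := by
    unfold circuitLaw; infer_instance
  have tv := fun P => tame_pauliValue ρ L P
  have te := fun P => tame_pauliError k ρ L P
  refine ErrorControl.of_withLayer hρ (hν.uncorrelated tv tv h.valueValue)
    (hν.uncorrelated tv te h.valueError) (hν.uncorrelated te te h.errorError) ?_ ?_
  · intro P Q hQ
    rw [hν.integral_withLayer tv tv h.valueValue, hν.integral_withLayer tv tv h.valueValue]
    exact hν.invariant _ (fun P Q hQ => h.invariant P Q hQ) P Q hQ
  · intro P
    have h1 := hν.integral_withLayer te te h.errorError P P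
    simp only [integral_mul_star_self] at h1
    -- The squared transfer coefficients of a string are the weights of an average, because
    -- conjugation by a unitary preserves the 2-norm. Hence a bound common to all strings does not
    -- deteriorate.
    have h2 : ∑ R, (∫ U, ‖transferCoeff (U : QOp (Fin n)) P R‖ ^ 2 ∂(μ (Fin.last L))) = 1 := by
      rw [← integral_finsetSum _ fun R _ => (tame_transferCoeff P R).integrable_norm_sq]
      have : ∀ U : QUnitary (Fin n), ∑ R, ‖transferCoeff (U : QOp (Fin n)) P R‖ ^ 2 = 1 :=
        fun U => sum_norm_coefG_conj_sq U P
      simp [this]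
    have h3 : ∫ p, ‖withLayer (fun U => pauliError k U ρ) p P‖ ^ 2
        ∂((μ (Fin.last L)).prod (circuitLaw fun j => μ j.castSucc)) =
        ∑ R, (∫ U, ‖transferCoeff (U : QOp (Fin n)) P R‖ ^ 2 ∂(μ (Fin.last L))) *
          ∫ U, ‖pauliError k U ρ R‖ ^ 2 ∂(circuitLaw fun j => μ j.castSucc) := by
      exact_mod_cast h1
    rw [h3]
    calc _ ≤ ∑ R, (∫ U, ‖transferCoeff (U : QOp (Fin n)) P R‖ ^ 2 ∂(μ (Fin.last L))) *
          (2 / 3) ^ (k + 1) := by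
          refine Finset.sum_le_sum fun R _ => mul_le_mul_of_nonneg_left (h.bound R) ?_
          exact integral_nonneg fun _ => by positivity
      _ = _ := by rw [← Finset.sum_mul, h2, one_mul]

theorem IsLocallyScramblingEnsemble.isProbabilityMeasure {L : ℕ}
    {μ : Fin L → Measure (QUnitary (Fin n))} (hμ : IsLocallyScramblingEnsemble μ) (j : Fin L) :
    IsProbabilityMeasure (μ j) := by
  rcases Nat.eq_zero_or_pos (j : ℕ) with hj | hj
  · exact (hμ.first j hj).1
  · obtain ⟨A, ν, hν, h⟩ := hμ.later j hj
    rw [h]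
    exact hν.isScramblingLayer_map.prob

theorem IsLocallyScramblingEnsemble.errorControl {L : ℕ}
    {μ : Fin (L + 1) → Measure (QUnitary (Fin n))} (hμ : IsLocallyScramblingEnsemble μ) (k : ℕ)
    {ρ : QOp (Fin n)} (hρ : IsQuantumState ρ) : ErrorControl μ k ρ := by
  induction L with
  | zero => exact ErrorControl.single (hμ.first _ rfl) k hρ
  | succ L ih =>
    have := hμ.isProbabilityMeasure
    refine ErrorControl.succ hρ (ih ⟨fun j hj => hμ.first j.castSucc hj,
      fun j hj => hμ.later j.castSucc hj⟩) ?_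
    obtain ⟨A, ν, hν, h⟩ := hμ.later (Fin.last (L + 1)) (by simp)
    rw [h]
    exact hν.isScramblingLayer_map

theorem tame_error {L : ℕ} (k : ℕ) (ρ O : QOp (Fin n)) : Tame fun U : Circuit n L =>
    propagationEstimate k U ρ O - expectationValue U ρ O := by
  simp only [error_eq_sum]
  exact Tame.sum fun P _ => (Tame.const _).mul (tame_pauliError k ρ L P)

theorem pauliTwoNorm_sq (O : QOp (Fin n)) : pauliTwoNorm O ^ 2 = ∑ P, ‖coefG O P‖ ^ 2 := by
  rw [pauliTwoNorm, Real.sq_sqrt (by positivity)]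
  simp only [pauliCoeff_eq_coefG]

/-- The mean square error of low-weight Pauli propagation. -/
theorem integral_norm_sq_error_le {L : ℕ} {μ : Fin L → Measure (QUnitary (Fin n))}
    (hμ : IsLocallyScramblingEnsemble μ) (k : ℕ) {ρ : QOp (Fin n)} (hρ : IsQuantumState ρ)
    (O : QOp (Fin n)) :
    ∫ U, ‖propagationEstimate k U ρ O - expectationValue U ρ O‖ ^ 2 ∂(circuitLaw μ) ≤
      (2 / 3) ^ (k + 1) * pauliTwoNorm O ^ 2 := by
  have := hμ.isProbabilityMeasure
  have : IsProbabilityMeasure (circuitLaw μ) := by unfold circuitLaw; infer_instance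
  -- Without layers nothing is truncated; the induction needs at least one layer.
  cases L with
  | zero =>
    simp only [error_eq_sum, pauliError_zero]
    simp only [mul_zero, Finset.sum_const_zero, norm_zero, ne_eq, OfNat.ofNat_ne_zero,
      not_false_eq_true, zero_pow, integral_zero]
    positivity
  | succ L =>
    have hc := hμ.errorControl k hρ
    have h1 : ∫ U, (∑ P, coefG O P * pauliError k U ρ P) *
        star (∑ P, coefG O P * pauliError k U ρ P) ∂(circuitLaw μ) =
        ∑ P, (coefG O P * star (coefG O P)) *
          ∫ U, pauliError k U ρ P * star (pauliError k U ρ P) ∂(circuitLaw μ) := by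
      -- The fixed coefficients of O are treated as random variables on a one-point space, which
      -- makes the same diagonalization applicable.
      have := integral_prod_sum_mul_star (Measure.dirac ()) (circuitLaw μ)
        (a := fun P _ => coefG O P) (b := fun P _ => coefG O P)
        (S := fun P U => pauliError k U ρ P) (T := fun P U => pauliError k U ρ P)
        (fun _ => Tame.const _) (fun _ => Tame.const _) (tame_pauliError k ρ _)
        (tame_pauliError k ρ _) hc.errorError
      rw [integral_prod] at this
      · simpa using this
      · exact ((Tame.sum fun P _ => (Tame.const _).mul
          ((tame_pauliError k ρ _ P).comp measurable_snd)).mul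
          (Tame.sum fun P _ => (Tame.const _).mul
          ((tame_pauliError k ρ _ P).comp measurable_snd)).star).integrable _
    simp only [integral_mul_star_self] at h1
    have h2 : ∀ P, coefG O P * star (coefG O P) = ((‖coefG O P‖ ^ 2 : ℝ) : ℂ) := fun P => by
      rw [Complex.ofReal_pow]; exact Complex.mul_conj' _
    simp only [h2] at h1
    have h3 : ∫ U, ‖∑ P, coefG O P * pauliError k U ρ P‖ ^ 2 ∂(circuitLaw μ) =
        ∑ P, ‖coefG O P‖ ^ 2 * ∫ U, ‖pauliError k U ρ P‖ ^ 2 ∂(circuitLaw μ) := by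
      exact_mod_cast h1
    simp only [error_eq_sum]
    rw [h3, pauliTwoNorm_sq, Finset.mul_sum]
    refine Finset.sum_le_sum fun P _ => ?_
    rw [mul_comm]
    exact mul_le_mul_of_nonneg_right (hc.bound P) (by positivity)

/-- By definition of k, (3/2)^k ≥ 2/(3ε²δ). The factor 2/3 inside the logarithm is paid for by the
extra factor in the exponent k + 1. -/
theorem two_thirds_pow_truncationOrder_le {ε δ : ℝ} (hε : 0 < ε) (hδ : 0 < δ) :
    ((2 : ℝ) / 3) ^ (truncationOrder ε δ + 1) ≤ ε ^ 2 * δ := by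
  have hl : 0 < Real.log (3 / 2) := Real.log_pos (by norm_num)
  have h1 : Real.log (2 / (3 * ε ^ 2 * δ)) ≤ truncationOrder ε δ * Real.log (3 / 2) := by
    rw [← div_le_iff₀ hl]
    exact Nat.le_ceil _
  rw [← Real.log_pow] at h1
  have h2 := (Real.log_le_log_iff (by positivity) (by positivity)).mp h1
  rw [div_le_iff₀ (by positivity)] at h2
  rw [pow_succ]
  have h3 : ((2 : ℝ) / 3) ^ truncationOrder ε δ * (3 / 2) ^ truncationOrder ε δ = 1 := by
    rw [← mul_pow]; norm_num
  have h4 : (0 : ℝ) < (2 / 3) ^ truncationOrder ε δ := by positivity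
  have h5 := mul_le_mul_of_nonneg_left h2 h4.le
  rw [← mul_assoc, h3] at h5
  linarith

/-- Low-weight Pauli propagation is accurate with high probability. -/
theorem le_circuitLaw_error_le {L : ℕ} {μ : Fin L → Measure (QUnitary (Fin n))}
    (hμ : IsLocallyScramblingEnsemble μ) {ρ : QOp (Fin n)} (hρ : IsQuantumState ρ)
    (O : QOp (Fin n)) {ε δ : ℝ} (hε : 0 < ε) (hδ : 0 < δ) :
    ENNReal.ofReal (1 - δ) ≤ circuitLaw μ {U |
      ‖propagationEstimate (truncationOrder ε δ) U ρ O - expectationValue U ρ O‖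
        ≤ ε * pauliTwoNorm O} := by
  have := hμ.isProbabilityMeasure
  have : IsProbabilityMeasure (circuitLaw μ) := by unfold circuitLaw; infer_instance
  set f := fun U : Circuit n L =>
    propagationEstimate (truncationOrder ε δ) U ρ O - expectationValue U ρ O with hf
  have htame : Tame f := tame_error _ ρ O
  have hN : 0 ≤ pauliTwoNorm O := Real.sqrt_nonneg _
  set S := {U | ‖f U‖ ≤ ε * pauliTwoNorm O} with hS
  have hmeas : MeasurableSet S := measurableSet_le htame.measurable.norm measurable_const
  have hmse := integral_norm_sq_error_le hμ (truncationOrder ε δ) hρ O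
  have hcompl : (circuitLaw μ).real Sᶜ ≤ δ := by
    -- If the norm vanishes, then O = 0 and there is no error at all. Markov's inequality would have
    -- the threshold 0 in this case.
    rcases hN.eq_or_lt with h0 | hpos
    · have hO : ∀ P, coefG O P = 0 := by
        intro P
        have h := pauliTwoNorm_sq O
        rw [← h0] at h
        have h' := (Finset.sum_eq_zero_iff_of_nonneg (fun P _ => by positivity)).mp
          (h.symm.trans (by norm_num)) P (Finset.mem_univ _)
        simpa using h'
      have : Sᶜ = ∅ := by
        rw [Set.compl_empty_iff, Set.eq_univ_iff_forall]
        intro U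
        simp only [hS, hf, Set.mem_ofPred_eq, error_eq_sum, hO, ← h0]
        simp
      rw [this]
      simpa using hδ.le
    -- Markov's inequality for the squared error with threshold (ε ‖O‖)².
    · have hM := mul_meas_ge_le_integral_of_nonneg (μ := circuitLaw μ)
        (f := fun U => ‖f U‖ ^ 2) (Filter.Eventually.of_forall fun U => by positivity)
        htame.integrable_norm_sq ((ε * pauliTwoNorm O) ^ 2)
      have hsub : (circuitLaw μ).real Sᶜ ≤
          (circuitLaw μ).real {U | (ε * pauliTwoNorm O) ^ 2 ≤ ‖f U‖ ^ 2} := by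
        refine measureReal_mono (fun U hU => ?_)
        simp only [hS, Set.mem_compl_iff, Set.mem_ofPred_eq, not_le] at hU
        exact pow_le_pow_left₀ (by positivity) hU.le 2
      have h5 : (ε * pauliTwoNorm O) ^ 2 *
          (circuitLaw μ).real {U | (ε * pauliTwoNorm O) ^ 2 ≤ ‖f U‖ ^ 2} ≤
          (ε * pauliTwoNorm O) ^ 2 * δ := by
        refine (hM.trans hmse).trans ?_
        have := mul_le_mul_of_nonneg_right (two_thirds_pow_truncationOrder_le hε hδ)
          (sq_nonneg (pauliTwoNorm O))
        calc _ ≤ _ := this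
          _ = _ := by ring
      exact hsub.trans (le_of_mul_le_mul_left h5 (by positivity))
  have h6 : (circuitLaw μ).real S = 1 - (circuitLaw μ).real Sᶜ := by
    rw [probReal_compl_eq_one_sub hmeas]; ring
  rw [ENNReal.ofReal_le_iff_le_toReal (measure_ne_top _ _)]
  change 1 - δ ≤ (circuitLaw μ).real S
  linarith

end Accuracy

/-! ## Reasoning about programs -/

infixr:60 " ;; " => Program.seq

/-- The integer arrays that a program may modify. -/
def Program.intTargets : Program → List ℕ
  | .skip => []
  | .setInt a _ _ => [a]
  | .setReal _ _ _ => []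
  | .call _ _ _ d => [d]
  | .seq s t => s.intTargets ++ t.intTargets
  | .ite _ s t => s.intTargets ++ t.intTargets
  | .loop _ s => s.intTargets

/-- The real arrays that a program may modify. -/
def Program.realTargets : Program → List ℕ
  | .skip => []
  | .setInt _ _ _ => []
  | .setReal a _ _ => [a]
  | .call _ _ _ d => [d]
  | .seq s t => s.realTargets ++ t.realTargets
  | .ite _ s t => s.realTargets ++ t.realTargets
  | .loop _ s => s.realTargets

/-- Two memories agree on all arrays that `p` does not modify. -/
structure Agree (p : Program) (σ σ' : Memory) : Prop where
  ints : ∀ a, a ∉ p.intTargets → σ'.ints a = σ.ints a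
  reals : ∀ a, a ∉ p.realTargets → σ'.reals a = σ.reals a

theorem Agree.refl (p : Program) (σ : Memory) : Agree p σ σ := ⟨fun _ _ => rfl, fun _ _ => rfl⟩

theorem Agree.trans {p : Program} {σ σ' σ'' : Memory} (h : Agree p σ σ') (h' : Agree p σ' σ'') :
    Agree p σ σ'' :=
  ⟨fun a ha => (h'.ints a ha).trans (h.ints a ha), fun a ha => (h'.reals a ha).trans (h.reals a ha)⟩

theorem Agree.mono {p q : Program} {σ σ' : Memory} (h : Agree p σ σ')
    (hi : p.intTargets ⊆ q.intTargets) (hr : p.realTargets ⊆ q.realTargets) : Agree q σ σ' :=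
  ⟨fun a ha => h.ints a fun h' => ha (hi h'), fun a ha => h.reals a fun h' => ha (hr h')⟩

@[simp] theorem Memory.setInt_ints (σ : Memory) (a i v : ℕ) : (σ.setInt a i v).ints =
    Function.update σ.ints a (Function.update (σ.ints a) i v) := rfl

@[simp] theorem Memory.setInt_reals (σ : Memory) (a i v : ℕ) :
    (σ.setInt a i v).reals = σ.reals := rfl

@[simp] theorem Memory.setReal_reals (σ : Memory) (a i : ℕ) (v : ℝ) : (σ.setReal a i v).reals =
    Function.update σ.reals a (Function.update (σ.reals a) i v) := rfl

@[simp] theorem Memory.setReal_ints (σ : Memory) (a i : ℕ) (v : ℝ) :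
    (σ.setReal a i v).ints = σ.ints := rfl

/-- The frame rule. The targets can be read off from the code, so that for a concrete program
`decide` shows that an array is unchanged. -/
theorem Exec.agree {S : Subroutines} {p : Program} {σ σ' : Memory} {t : ℕ} (h : Exec S p σ t σ') :
    Agree p σ σ' := by
  induction h with
  | skip σ => exact Agree.refl _ _
  | setInt σ a i e =>
    refine ⟨fun b hb => ?_, fun _ _ => rfl⟩
    simp only [Program.intTargets, List.mem_singleton] at hb
    simp [hb]
  | setReal σ a i e =>
    refine ⟨fun _ _ => rfl, fun b hb => ?_⟩
    simp only [Program.realTargets, List.mem_singleton] at hb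
    simp [hb]
  | call σ o src len dst r hr =>
    refine ⟨fun b hb => ?_, fun b hb => ?_⟩
    · simp only [Program.intTargets, List.mem_singleton] at hb
      simp [Memory.writeReply, hb]
    · simp only [Program.realTargets, List.mem_singleton] at hb
      simp [Memory.writeReply, hb]
  | seq _ _ ih1 ih2 =>
    exact (ih1.mono (by simp [Program.intTargets]) (by simp [Program.realTargets])).trans
      (ih2.mono (by simp [Program.intTargets]) (by simp [Program.realTargets]))
  | iteTrue _ _ ih => exact ih.mono (by simp [Program.intTargets]) (by simp [Program.realTargets])
  | iteFalse _ _ ih => exact ih.mono (by simp [Program.intTargets]) (by simp [Program.realTargets])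
  | loopEnd _ => exact Agree.refl _ _
  | loopStep _ _ _ ih1 ih2 =>
    exact (ih1.mono (by simp [Program.intTargets]) (by simp [Program.realTargets])).trans ih2

/-- Total correctness with a time bound. -/
def Runs (S : Subroutines) (p : Program) (σ : Memory) (T : ℕ) (Q : Memory → Prop) : Prop :=
  ∃ t σ', Exec S p σ t σ' ∧ t ≤ T ∧ Q σ'

namespace Runs

variable {S : Subroutines} {p q : Program} {σ : Memory} {T T' : ℕ} {Q R : Memory → Prop}

/-- The implication between the postconditions may use the frame rule, so that specifications need
not mention arrays that are left alone. -/
theorem mono (h : Runs S p σ T Q) (hT : T ≤ T') (hQ : ∀ σ', Agree p σ σ' → Q σ' → R σ') :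
    Runs S p σ T' R := by
  obtain ⟨t, σ', he, ht, hq⟩ := h
  exact ⟨t, σ', he, ht.trans hT, hQ σ' he.agree hq⟩

theorem le (h : Runs S p σ T Q) (hT : T ≤ T') : Runs S p σ T' Q := h.mono hT fun _ _ h => h

theorem skip (h : Q σ) : Runs S .skip σ 1 Q := ⟨1, σ, .skip σ, le_rfl, h⟩

theorem setInt {a : ℕ} {i e : IntExpr} (h : Q (σ.setInt a (i.eval σ) (e.eval σ))) :
    Runs S (.setInt a i e) σ 1 Q := ⟨1, _, .setInt σ a i e, le_rfl, h⟩

theorem setReal {a : ℕ} {i : IntExpr} {e : RealExpr}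
    (h : Q (σ.setReal a (i.eval σ) (e.eval σ))) :
    Runs S (.setReal a i e) σ 1 Q := ⟨1, _, .setReal σ a i e, le_rfl, h⟩

theorem call {o src dst : ℕ} {len : IntExpr} {r : Reply}
    (hr : S o (σ.readBlock src (len.eval σ)) = r)
    (hT : 1 + len.eval σ + r.ints.length + r.reals.length + r.time ≤ T)
    (h : Q (σ.writeReply dst r)) : Runs S (.call o src len dst) σ T Q :=
  ⟨_, _, .call σ o src len dst r hr.symm, hT, h⟩

theorem seq (h : Runs S p σ T fun σ' => Agree p σ σ' → Runs S q σ' T' Q) :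
    Runs S (p ;; q) σ (T + T') Q := by
  obtain ⟨t, σ', he, ht, hq⟩ := h
  obtain ⟨t', σ'', he', ht', hq'⟩ := hq he.agree
  exact ⟨t + t', σ'', .seq he he', Nat.add_le_add ht ht', hq'⟩

theorem seqInt {a : ℕ} {i e : IntExpr}
    (h : Runs S q (σ.setInt a (i.eval σ) (e.eval σ)) T Q) :
    Runs S (.setInt a i e ;; q) σ (T + 1) Q :=
  (seq (setInt fun _ => h)).le (by omega)

theorem seqReal {a : ℕ} {i : IntExpr} {e : RealExpr}
    (h : Runs S q (σ.setReal a (i.eval σ) (e.eval σ)) T Q) :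
    Runs S (.setReal a i e ;; q) σ (T + 1) Q :=
  (seq (setReal fun _ => h)).le (by omega)

theorem ite {b : TestExpr} (h1 : b.Holds σ → Runs S p σ T Q) (h2 : ¬ b.Holds σ → Runs S q σ T Q) :
    Runs S (.ite b p q) σ (T + 1) Q := by
  by_cases hb : b.Holds σ
  · obtain ⟨t, σ', he, ht, hq⟩ := h1 hb
    exact ⟨t + 1, σ', .iteTrue hb he, by omega, hq⟩
  · obtain ⟨t, σ', he, ht, hq⟩ := h2 hb
    exact ⟨t + 1, σ', .iteFalse hb he, by omega, hq⟩

/-- The invariant is indexed by the number of completed rounds, and the number N of rounds is fixed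
in advance. Termination and the time bound are thereby obtained together. -/
theorem loop {b : TestExpr} {I : ℕ → Memory → Prop} (N : ℕ)
    (hstep : ∀ j < N, ∀ σ, I j σ → b.Holds σ ∧ Runs S p σ T (I (j + 1)))
    (hend : ∀ σ, I N σ → ¬ b.Holds σ) (h0 : I 0 σ) :
    Runs S (.loop b p) σ (N * (T + 1) + 1) (I N) := by
  have key : ∀ m j, j + m = N → ∀ σ, I j σ → Runs S (.loop b p) σ (m * (T + 1) + 1) (I N) := by
    intro m
    induction m with
    | zero =>
      intro j hj σ h
      obtain rfl : j = N := by omega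
      exact ⟨1, σ, .loopEnd (hend σ h), by omega, h⟩
    | succ m ih =>
      intro j hj σ h
      obtain ⟨hb, t, σ', he, ht, hq⟩ := hstep j (by omega) σ h
      obtain ⟨t', σ'', he', ht', hq'⟩ := ih (j + 1) (by omega) σ' hq
      refine ⟨t + t' + 1, σ'', .loopStep hb he he', ?_, hq'⟩
      have : (m + 1) * (T + 1) = m * (T + 1) + (T + 1) := by ring
      omega
  exact key N 0 (by omega) σ h0

end Runs

/-! ### Variables and counted loops. -/

/-- The integer variable kept in cell `0` of the array `a`. -/
abbrev IntExpr.var (a : ℕ) : IntExpr := .read a (.const 0)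

/-- The real variable kept in cell `0` of the array `a`. -/
abbrev RealExpr.var (a : ℕ) : RealExpr := .read a (.const 0)

/-- Assignment to an integer variable. -/
abbrev Program.assign (a : ℕ) (e : IntExpr) : Program := .setInt a (.const 0) e

/-- Assignment to a real variable. -/
abbrev Program.assignReal (a : ℕ) (e : RealExpr) : Program := .setReal a (.const 0) e

/-- `for i := 0, ..., bound - 1 do body`. -/
def Program.forUp (i : ℕ) (bound : IntExpr) (body : Program) : Program :=
  .assign i (.const 0) ;;
    .loop (.intLt (.var i) bound) (body ;; .assign i (.add (.var i) (.const 1)))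

theorem Program.intTargets_forUp (i : ℕ) (bound : IntExpr) (body : Program) :
    (Program.forUp i bound body).intTargets = i :: (body.intTargets ++ [i]) := rfl

theorem Program.realTargets_forUp (i : ℕ) (bound : IntExpr) (body : Program) :
    (Program.forUp i bound body).realTargets = body.realTargets ++ [] := rfl

/-- A round costs the body, the increment and the test; the initialization and the last test add 2.
The bound is evaluated in every round, hence `hb` for all memories within the frame, and the
increment must not disturb the invariant, hence `hI`. -/
theorem Runs.forUp {S : Subroutines} {σ₀ : Memory} {i : ℕ} {bound : IntExpr} {body : Program}
    {I : ℕ → Memory → Prop} (N T : ℕ) (hi : i ∉ body.intTargets)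
    (hI : ∀ j σ v, I j σ → I j (σ.setInt i 0 v)) (h0 : I 0 σ₀)
    (hb : ∀ σ, Agree (Program.forUp i bound body) σ₀ σ → bound.eval σ = N)
    (hstep : ∀ j < N, ∀ σ, Agree (Program.forUp i bound body) σ₀ σ → I j σ → σ.ints i 0 = j →
      Runs S body σ T (I (j + 1))) :
    Runs S (Program.forUp i bound body) σ₀ (N * (T + 2) + 2) (I N) := by
  have hset : ∀ σ v, Agree (Program.forUp i bound body) σ (σ.setInt i 0 v) := by
    intro σ v
    refine ⟨fun a ha => ?_, fun _ _ => rfl⟩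
    have : a ≠ i := by
      rintro rfl
      exact ha (by simp [Program.intTargets_forUp])
    simp [this]
  have h := Runs.loop (S := S) (b := .intLt (.var i) bound)
    (p := body ;; .assign i (.add (.var i) (.const 1)))
    (I := fun j σ => Agree (Program.forUp i bound body) σ₀ σ ∧ I j σ ∧ σ.ints i 0 = j)
    (σ := σ₀.setInt i 0 0) (T := T + 1) N ?_ ?_ ?_
  · refine (Runs.seqInt (T := N * (T + 2) + 1) ?_)
    exact h.mono (by ring_nf; omega) fun _ _ h => h.2.1
  · rintro j hj σ ⟨hA, hIj, hij⟩
    refine ⟨?_, ?_⟩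
    · simp only [TestExpr.Holds, IntExpr.eval, hb σ hA, hij]
      exact hj
    · refine Runs.seq ((hstep j hj σ hA hIj hij).mono le_rfl fun σ' hA' hI' _ => ?_)
      have hij' : σ'.ints i 0 = j := by rw [hA'.ints i hi, hij]
      refine Runs.setInt ⟨?_, hI _ _ _ hI', ?_⟩
      · refine (hA.trans (hA'.mono ?_ ?_)).trans (hset _ _)
        · simp only [Program.intTargets_forUp]
          intro x hx; simp [hx]
        · simp [Program.realTargets_forUp]
      · simp [IntExpr.eval, hij']
  · rintro σ ⟨hA, -, hij⟩
    simp [TestExpr.Holds, IntExpr.eval, hb σ hA, hij]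
  · exact ⟨hset _ _, hI _ _ _ h0, by simp⟩

/-! ## Pauli strings as numbers -/

/-- The code of qubit `i`, extended by zero. -/
def PauliString.digit {n : ℕ} (P : PauliString n) (i : ℕ) : ℕ := if h : i < n then P ⟨i, h⟩ else 0

/-- The number with base-4 digits `P 0, ..., P (r - 1)`. -/
def PauliString.partialCode {n : ℕ} (P : PauliString n) (r : ℕ) : ℕ :=
  ∑ i ∈ Finset.range r, PauliString.digit P i * 4 ^ i

/-- The number whose base-4 digits are the letters of `P`. -/
def PauliString.code {n : ℕ} (P : PauliString n) : ℕ := PauliString.partialCode P n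

namespace PauliString

variable {n : ℕ}

theorem digit_lt (P : PauliString n) (i : ℕ) : digit P i < 4 := by
  unfold digit
  split_ifs <;> omega

theorem digit_val (P : PauliString n) (i : Fin n) : digit P i = P i := by
  simp [digit]

theorem partialCode_succ (P : PauliString n) (r : ℕ) :
    partialCode P (r + 1) = partialCode P r + digit P r * 4 ^ r := Finset.sum_range_succ _ _

theorem partialCode_lt (P : PauliString n) (r : ℕ) : partialCode P r < 4 ^ r := by
  induction r with
  | zero => simp [partialCode]
  | succ r ih =>
    rw [partialCode_succ, pow_succ]
    have := digit_lt P r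
    nlinarith

/-- Uniqueness of base-4 expansions: the most significant digit is recovered by division, the others
by induction. Array cells of different strings are therefore different. -/
theorem code_injective : Function.Injective (code : PauliString n → ℕ) := by
  intro P Q h
  have key : ∀ r, partialCode P r = partialCode Q r → ∀ i < r, digit P i = digit Q i := by
    intro r
    induction r with
    | zero => intro _ i hi; omega
    | succ r ih =>
      intro h i hi
      rw [partialCode_succ, partialCode_succ] at h
      have hp : 0 < 4 ^ r := by positivity
      have h1 : digit P r = digit Q r := by
        have := congrArg (· / 4 ^ r) h
        simpa [Nat.add_mul_div_right _ _ hp, Nat.div_eq_of_lt (partialCode_lt _ r)] using this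
      rcases Nat.lt_succ_iff_lt_or_eq.mp hi with hi | rfl
      · rw [h1] at h
        exact ih (by omega) i hi
      · exact h1
  funext i
  have := key n h i i.2
  rw [digit_val, digit_val] at this
  exact Fin.ext this

theorem encodePauli_eq (P : PauliString n) : encodePauli P = (List.range n).map (digit P) := by
  apply List.ext_getElem
  · simp [encodePauli]
  · intro i h1 h2
    simp only [encodePauli, List.length_ofFn] at h1
    simp [encodePauli, digit, h1]

theorem decodePauli_encodePauli (P : PauliString n) : decodePauli n (encodePauli P) = P := by
  funext i
  simp [decodePauli, encodePauli]

theorem pauliWeight_eq (P : PauliString n) :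
    pauliWeight P = ∑ i ∈ Finset.range n, if digit P i = 0 then 0 else 1 := by
  rw [← Fin.sum_univ_eq_sum_range fun i => if digit P i = 0 then 0 else 1]
  simp only [digit_val]
  rw [pauliWeight, Finset.card_filter]
  refine Finset.sum_congr rfl fun i _ => ?_
  have : (P i : ℕ) = 0 ↔ P i = 0 := by
    rw [Fin.ext_iff]; rfl
  by_cases h : P i = 0 <;> simp [h]

/-- Changing one letter changes the code by a multiple of a power of four. -/
theorem code_update (P : PauliString n) (q : Fin n) (d : Fin 4) :
    code (Function.update P q d) + (P q : ℕ) * 4 ^ (q : ℕ) = code P + (d : ℕ) * 4 ^ (q : ℕ) := by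
  have hc : ∀ P : PauliString n, code P = ∑ i : Fin n, (P i : ℕ) * 4 ^ (i : ℕ) := by
    intro P
    rw [code, partialCode, ← Fin.sum_univ_eq_sum_range fun i => digit P i * 4 ^ i]
    simp only [digit_val]
  rw [hc, hc, ← Finset.add_sum_erase _ _ (Finset.mem_univ q),
    ← Finset.add_sum_erase _ (fun i => (P i : ℕ) * 4 ^ (i : ℕ)) (Finset.mem_univ q)]
  have : ∑ i ∈ Finset.univ.erase q, (Function.update P q d i : ℕ) * 4 ^ (i : ℕ) =
      ∑ i ∈ Finset.univ.erase q, (P i : ℕ) * 4 ^ (i : ℕ) := by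
    refine Finset.sum_congr rfl fun i hi => ?_
    rw [Function.update_of_ne (Finset.ne_of_mem_erase hi)]
  rw [this, Function.update_self]
  ring

end PauliString

/-! ## Memory layout -/

notation "aPow" => (1 : ℕ)
notation "aCur" => (2 : ℕ)
notation "aCurLen" => (3 : ℕ)
notation "aNew" => (4 : ℕ)
notation "aNewLen" => (5 : ℕ)
notation "aMark" => (6 : ℕ)
notation "vCode" => (7 : ℕ)
notation "aBuf" => (8 : ℕ)
notation "aBufShift" => (9 : ℕ)
notation "vWeight" => (10 : ℕ)
notation "vOut" => (11 : ℕ)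
notation "vTmp" => (12 : ℕ)
notation "vDigitLoop" => (13 : ℕ)
notation "vSweepLoop" => (14 : ℕ)
notation "vLayerLoop" => (15 : ℕ)
notation "vLayer" => (16 : ℕ)
notation "vQubit" => (17 : ℕ)
notation "aLayerReply" => (18 : ℕ)
notation "vOffset" => (19 : ℕ)
notation "vTermLoop" => (20 : ℕ)
notation "vOrder" => (21 : ℕ)
notation "aQuery" => (22 : ℕ)
notation "aStateReply" => (23 : ℕ)
notation "aObsReply" => (24 : ℕ)
notation "vSwapLoop" => (25 : ℕ)
notation "vPos" => (26 : ℕ)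
notation "rCur" => (1 : ℕ)
notation "rNew" => (2 : ℕ)
notation "rVal" => (3 : ℕ)
notation "rOut" => (4 : ℕ)
notation "rAcc" => (5 : ℕ)
notation "rTmp" => (6 : ℕ)

/-- The list of codes in the integer arrays `a`, `len` and the real array `r` represent a function
that vanishes off `s`. -/
structure IsTable {n : ℕ} (a len r : ℕ) (σ : Memory) (s : Finset (PauliString n))
    (f : PauliString n → ℝ) : Prop where
  list : ∃ l : List (PauliString n), l.Nodup ∧ l.toFinset = s ∧ σ.ints len 0 = l.length ∧
    ∀ (i : ℕ) (h : i < l.length), σ.ints a i = PauliString.code l[i]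
  val : ∀ P, σ.reals r (PauliString.code P) = f P
  supp : ∀ P, P ∉ s → f P = 0

/-- The current table. -/
abbrev CurTable {n : ℕ} (σ : Memory) (s : Finset (PauliString n)) (f : PauliString n → ℝ) : Prop :=
  IsTable aCur aCurLen rCur σ s f

/-- The table under construction, whose entries are marked. -/
structure NewTable {n : ℕ} (σ : Memory) (s : Finset (PauliString n)) (f : PauliString n → ℝ) :
    Prop extends IsTable aNew aNewLen rNew σ s f where
  mark : ∀ P, σ.ints aMark (PauliString.code P) = if P ∈ s then 1 else 0

theorem IsTable.congr {n a len r : ℕ} {σ σ' : Memory} {s : Finset (PauliString n)}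
    {f : PauliString n → ℝ} (h : IsTable a len r σ s f) (h1 : σ'.ints a = σ.ints a)
    (h2 : σ'.ints len = σ.ints len) (h3 : σ'.reals r = σ.reals r) : IsTable a len r σ' s f := by
  obtain ⟨hl, hv, hs⟩ := h
  exact ⟨by rw [h1, h2]; exact hl, by rw [h3]; exact hv, hs⟩

theorem NewTable.congr {n : ℕ} {σ σ' : Memory} {s : Finset (PauliString n)}
    {f : PauliString n → ℝ} (h : NewTable σ s f) (h1 : σ'.ints aNew = σ.ints aNew)
    (h2 : σ'.ints aNewLen = σ.ints aNewLen) (h3 : σ'.reals rNew = σ.reals rNew)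
    (h4 : σ'.ints aMark = σ.ints aMark) : NewTable σ' s f :=
  ⟨h.toIsTable.congr h1 h2 h3, by rw [h4]; exact h.mark⟩

theorem IsTable.card_eq {n a len r : ℕ} {σ : Memory} {s : Finset (PauliString n)}
    {f : PauliString n → ℝ} (h : IsTable a len r σ s f) : σ.ints len 0 = s.card := by
  obtain ⟨l, hl, rfl, hlen, -⟩ := h.list
  rw [hlen, List.toFinset_card_of_nodup hl]

/-! ## Elementary table programs -/

/-- Add the value of `rOut` to the entry with code `vOut` of the new table. -/
def emitProg : Program :=
  .ite (.intLt (.read aMark (.var vOut)) (.const 1))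
    (.setInt aMark (.var vOut) (.const 1) ;;
      .setInt aNew (.var aNewLen) (.var vOut) ;;
      .assign aNewLen (.add (.var aNewLen) (.const 1)))
    .skip ;;
  .setReal rNew (.var vOut) (.add (.read rNew (.var vOut)) (.var rOut))

/-- The marks decide in constant time whether a string is already listed, so the list stays free of
repetitions. Terms of the same string are added up; a listed string may well have coefficient 0. -/
theorem runs_emitProg {n : ℕ} (S : Subroutines) {σ : Memory} {s : Finset (PauliString n)}
    {f : PauliString n → ℝ} (h : NewTable σ s f) {Q : PauliString n} {x : ℝ}
    (hE : σ.ints vOut 0 = PauliString.code Q) (hx : σ.reals rOut 0 = x) :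
    Runs S emitProg σ 5 fun σ' => NewTable σ' (insert Q s) (f + Pi.single Q x) := by
  obtain ⟨⟨⟨l, hl, hls, hlen, hget⟩, hval, hsupp⟩, hmark⟩ := h
  -- The accumulation of the value is common to both branches, which differ only in the list and the
  -- marks.
  have hupd : ∀ σ' : Memory, σ'.ints vOut 0 = PauliString.code Q → σ'.reals = σ.reals →
      (∃ l : List (PauliString n), l.Nodup ∧ l.toFinset = insert Q s ∧
        σ'.ints aNewLen 0 = l.length ∧
        ∀ (i : ℕ) (h : i < l.length), σ'.ints aNew i = PauliString.code l[i]) →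
      (∀ P, σ'.ints aMark (PauliString.code P) = if P ∈ insert Q s then 1 else 0) →
      Runs S (.setReal rNew (.var vOut) (.add (.read rNew (.var vOut)) (.var rOut))) σ' 1
        fun σ' => NewTable σ' (insert Q s) (f + Pi.single Q x) := by
    intro σ' h1 h2 h3 h4
    refine Runs.setReal ⟨⟨by simpa using h3, ?_, ?_⟩, by simpa using h4⟩
    · intro P
      simp only [IntExpr.eval, RealExpr.eval, h1, h2, Memory.setReal_reals, Function.update_self,
        Pi.add_apply, hx, hval]
      by_cases hPQ : P = Q
      · subst hPQ; simp
      · rw [Function.update_of_ne (PauliString.code_injective.ne hPQ), hval]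
        simp [hPQ]
    · intro P hP
      rw [Finset.mem_insert, not_or] at hP
      simp [hsupp P hP.2, hP.1]
  refine (Runs.seq (T := 4) (T' := 1) (Runs.ite (T := 3) (fun hb => ?_) fun hb => ?_))
  · simp only [TestExpr.Holds, IntExpr.eval, hE, hmark] at hb
    have hQ : Q ∉ s := by
      intro hQ; simp [hQ] at hb
    refine Runs.seqInt (Runs.seqInt (Runs.setInt fun _ => hupd _ ?_ ?_ ⟨l ++ [Q], ?_, ?_, ?_, ?_⟩ ?_))
    · simp [hE]
    · simp
    · rw [List.nodup_append]
      refine ⟨hl, by simp, ?_⟩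
      intro a ha b hb
      rw [List.mem_singleton] at hb
      subst hb
      rintro rfl
      exact hQ (by rw [← hls]; simpa using ha)
    · rw [List.toFinset_append, hls]
      ext; simp
    · simp [IntExpr.eval, hlen]
    · intro i hi
      simp only [IntExpr.eval, Memory.setInt_ints, hE]
      rw [List.length_append, List.length_singleton] at hi
      rcases Nat.lt_succ_iff_lt_or_eq.mp hi with hi' | rfl
      · rw [List.getElem_append_left hi']
        simp [hE, hlen, hi'.ne, hget i hi']
      · simp [hE, hlen]
    · intro P
      simp only [IntExpr.eval, Memory.setInt_ints, hE]
      by_cases hPQ : P = Q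
      · subst hPQ; simp
      · have := PauliString.code_injective.ne hPQ
        simp [hPQ, this, hmark]
  · simp only [TestExpr.Holds, IntExpr.eval, hE, hmark] at hb
    have hQ : Q ∈ s := by
      by_contra hQ; simp [hQ] at hb
    have hins : insert Q s = s := Finset.insert_eq_of_mem hQ
    refine (Runs.skip fun _ => hupd _ hE rfl ?_ ?_).le (by norm_num)
    · rw [hins]; exact ⟨l, hl, hls, hlen, hget⟩
    · rw [hins]; exact hmark

/-- Clear the current table and replace it by the new one, which becomes empty. -/
def swapProg : Program :=
  .forUp vSwapLoop (.var aCurLen)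
    (.setReal rCur (.read aCur (.var vSwapLoop)) (.const 0)) ;;
  .forUp vSwapLoop (.var aNewLen)
    (.assign vTmp (.read aNew (.var vSwapLoop)) ;;
      .setInt aCur (.var vSwapLoop) (.var vTmp) ;;
      .setReal rCur (.var vTmp) (.read rNew (.var vTmp)) ;;
      .setReal rNew (.var vTmp) (.const 0) ;;
      .setInt aMark (.var vTmp) (.const 0)) ;;
  .assign aCurLen (.var aNewLen) ;;
  .assign aNewLen (.const 0)

/-- Only cells of listed strings are ever nonzero, so clearing them one by one takes time linear in
the sizes of the tables. -/
theorem runs_swapProg {n : ℕ} (S : Subroutines) {σ₀ : Memory} {s s' : Finset (PauliString n)}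
    {f f' : PauliString n → ℝ} (hc : CurTable σ₀ s f) (hn : NewTable σ₀ s' f') :
    Runs S swapProg σ₀ (s.card * 3 + s'.card * 7 + 6) fun σ' =>
      CurTable σ' s' f' ∧ NewTable σ' (∅ : Finset (PauliString n)) 0 := by
  have hcard := hc.card_eq
  have hcard' := hn.card_eq
  obtain ⟨⟨l, hl, hls, hlen, hget⟩, hval, hsupp⟩ := hc
  obtain ⟨⟨⟨l', hl', hls', hlen', hget'⟩, hval', hsupp'⟩, hmark'⟩ := hn
  have hmem : ∀ P, P ∈ s ↔ P ∈ l := by intro P; rw [← hls]; simp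
  have hmem' : ∀ P, P ∈ s' ↔ P ∈ l' := by intro P; rw [← hls']; simp
  have hsl : s.card = l.length := by rw [← hcard, hlen]
  have hsl' : s'.card = l'.length := by rw [← hcard', hlen']
  refine (Runs.seq (T := s.card * (1 + 2) + 2) (T' := (s'.card * (5 + 2) + 2) + 2)
    (Q := fun σ' => CurTable σ' s' f' ∧ NewTable σ' (∅ : Finset (PauliString n)) 0) ?_).le
    (by omega)
  -- The first loop has erased the values of the first j listed strings and kept the others. As the
  -- list has no repetitions, this describes the array completely.
  refine (Runs.forUp (I := fun j σ => ∀ P, σ.reals rCur (PauliString.code P) =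
    if P ∈ l.drop j then f P else 0) s.card 1 (by decide) (fun j σ v h => h) ?_ ?_ ?_).mono le_rfl ?_
  · intro P
    rw [List.drop_zero, hval]
    split_ifs with h
    · rfl
    · exact hsupp P (by rwa [hmem])
  · intro σ hA
    simp only [IntExpr.eval]
    rw [hA.ints _ (by decide), hcard]
  · intro j hj σ hA hI hij
    rw [hsl] at hj
    refine Runs.setReal fun P => ?_
    simp only [IntExpr.eval, RealExpr.eval, Memory.setReal_reals, Function.update_self, hij,
      hA.ints aCur (by decide), hget j hj]
    by_cases hP : P = l[j]
    · subst hP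
      have : l[j] ∉ l.drop (j + 1) := by
        have h := hl.sublist (List.drop_sublist j l)
        rw [List.drop_eq_getElem_cons hj, List.nodup_cons] at h
        exact h.1
      simp [this]
    · rw [Function.update_of_ne (PauliString.code_injective.ne hP), hI P]
      simp only [List.drop_eq_getElem_cons hj, List.mem_cons, hP, false_or]
  intro σ₁ hA₁ hI₁ hA₁'
  have hzero : ∀ P : PauliString n, σ₁.reals rCur (PauliString.code P) = 0 := by
    intro P
    rw [hI₁ P, hsl, List.drop_length]
    simp
  -- The strings in `l'.take j` have moved to the current table, those in `l'.drop j` still have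
  -- their values and marks in the new one. The two parts are disjoint since `l'` has no
  -- repetitions.
  refine Runs.seq ((Runs.forUp (I := fun j σ =>
    (∀ i (h : i < l'.length), i < j → σ.ints aCur i = PauliString.code l'[i]) ∧
    (∀ P, σ.reals rCur (PauliString.code P) = if P ∈ l'.take j then f' P else 0) ∧
    (∀ P, σ.reals rNew (PauliString.code P) = if P ∈ l'.drop j then f' P else 0) ∧
    (∀ P, σ.ints aMark (PauliString.code P) = if P ∈ l'.drop j then 1 else 0))
    s'.card 5 (by decide) ?_ ?_ ?_ ?_).mono le_rfl ?_)
  · rintro j σ v ⟨h1, h2, h3, h4⟩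
    refine ⟨?_, h2, h3, ?_⟩ <;> simpa
  · refine ⟨fun i h hi => absurd hi (by omega), fun P => by simp [hzero], fun P => ?_, fun P => ?_⟩
    · rw [hA₁.reals _ (by decide), List.drop_zero, hval']
      split_ifs with h
      · rfl
      · exact hsupp' P (by rwa [hmem'])
    · rw [hA₁.ints _ (by decide), List.drop_zero, hmark']
      simp only [hmem']
  · intro σ hA
    simp only [IntExpr.eval]
    rw [hA.ints _ (by decide), hA₁.ints _ (by decide), hcard']
  · rintro j hj σ hA ⟨h1, h2, h3, h4⟩ hij
    rw [hsl'] at hj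
    have hgetj : σ.ints aNew j = PauliString.code l'[j] := by
      rw [hA.ints _ (by decide), hA₁.ints _ (by decide), hget' j hj]
    have hd := List.drop_eq_getElem_cons hj
    have hnot : l'[j] ∉ l'.drop (j + 1) := by
      have h := hl'.sublist (List.drop_sublist j l')
      rw [hd, List.nodup_cons] at h
      exact h.1
    have ht : ∀ P, P ∈ l'.take (j + 1) ↔ P ∈ l'.take j ∨ P = l'[j] := by
      intro P
      rw [List.take_succ_eq_append_getElem hj, List.mem_append, List.mem_singleton]
    have hdm : ∀ P, P ∈ l'.drop j ↔ P = l'[j] ∨ P ∈ l'.drop (j + 1) := by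
      intro P
      rw [hd, List.mem_cons]
    refine Runs.seqInt (Runs.seqInt (Runs.seqReal (Runs.seqReal (Runs.setInt ⟨?_, ?_, ?_, ?_⟩))))
    · intro i hi hij'
      simp only [IntExpr.eval, RealExpr.eval, Memory.setInt_ints, Memory.setReal_ints]
      rcases Nat.lt_succ_iff_lt_or_eq.mp hij' with h | rfl
      · simp [hij, h.ne, h1 i hi h]
      · simp [hij, hgetj]
    · intro P
      simp only [ht]
      by_cases hP : P = l'[j]
      · subst hP
        simp [IntExpr.eval, RealExpr.eval, hij, hgetj, h3, hdm]
      · have hne := PauliString.code_injective.ne hP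
        simp [IntExpr.eval, RealExpr.eval, hij, hgetj, hne, h2, hP]
    · intro P
      by_cases hP : P = l'[j]
      · subst hP
        simp [IntExpr.eval, RealExpr.eval, hij, hgetj, hnot]
      · have hne := PauliString.code_injective.ne hP
        simp [IntExpr.eval, RealExpr.eval, hij, hgetj, hne, h3, hdm, hP]
    · intro P
      by_cases hP : P = l'[j]
      · subst hP
        simp [IntExpr.eval, RealExpr.eval, hij, hgetj, hnot]
      · have hne := PauliString.code_injective.ne hP
        simp [IntExpr.eval, RealExpr.eval, hij, hgetj, hne, h4, hdm, hP]
  · rintro σ₂ hA₂ ⟨h1, h2, h3, h4⟩ -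
    rw [hsl'] at h1 h2 h3 h4
    have hlen₂ : σ₂.ints aNewLen 0 = l'.length := by
      rw [hA₂.ints _ (by decide), hA₁.ints _ (by decide), hlen']
    refine Runs.seqInt (Runs.setInt ⟨⟨⟨l', hl', hls', ?_, ?_⟩, ?_, hsupp'⟩,
      ⟨⟨[], List.nodup_nil, rfl, ?_, ?_⟩, ?_, fun _ _ => rfl⟩, ?_⟩)
    · simp [IntExpr.eval, hlen₂]
    · intro i hi
      simpa using h1 i hi hi
    · intro P
      simp only [Memory.setInt_reals, h2, List.take_length]
      split_ifs with h
      · rfl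
      · exact (hsupp' P (by rwa [hmem'])).symm
    · simp [IntExpr.eval]
    · intro i hi; simp at hi
    · intro P; simp [h3]
    · intro P; simp [h4]

/-- Run `body` for all entries of the current table, and make the table of emitted terms the
current one. -/
def sweepProg (body : Program) : Program :=
  .forUp vSweepLoop (.var aCurLen)
    (.assign vCode (.read aCur (.var vSweepLoop)) ;;
      .assignReal rVal (.read rCur (.var vCode)) ;; body) ;;
  swapProg

theorem intTargets_sweepProg (body : Program) : (sweepProg body).intTargets =
    (vSweepLoop :: (vCode :: body.intTargets ++ [vSweepLoop])) ++ swapProg.intTargets := by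
  simp [sweepProg, Program.intTargets, Program.intTargets_forUp]

theorem realTargets_sweepProg (body : Program) : (sweepProg body).realTargets =
    ((rVal :: body.realTargets) ++ []) ++ swapProg.realTargets := by
  simp [sweepProg, Program.realTargets, Program.realTargets_forUp]

/-- The terms `g P` describe the linear action of the body, the sets `G P` where its terms may lie.
Keeping both apart gives the exact new observable by linearity and a size bound B that does not see
cancellations. -/
theorem runs_sweepProg {n : ℕ} (S : Subroutines) {body : Program} {σ₀ : Memory}
    {s : Finset (PauliString n)} {f : PauliString n → ℝ}
    (hbi : ∀ a ∈ [vSweepLoop, aCur, aCurLen], a ∉ body.intTargets) (hbr : rCur ∉ body.realTargets)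
    (hc : CurTable σ₀ s f) (hn : NewTable σ₀ (∅ : Finset (PauliString n)) 0)
    (g : PauliString n → PauliString n → ℝ) (G : PauliString n → Finset (PauliString n)) (T B : ℕ)
    (hB : (s.biUnion G).card ≤ B)
    (hbody : ∀ P ∈ s, ∀ σ s₂ f₂, Agree (sweepProg body) σ₀ σ →
      σ.ints vCode 0 = PauliString.code P → σ.reals rVal 0 = f P → NewTable σ s₂ f₂ →
      Runs S body σ T fun σ' => ∃ s₂', s₂' ⊆ s₂ ∪ G P ∧ NewTable σ' s₂' (f₂ + f P • g P)) :
    Runs S (sweepProg body) σ₀ (s.card * (T + 10) + B * 7 + 10) fun σ' =>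
      ∃ s' ⊆ s.biUnion G, CurTable σ' s' (∑ P ∈ s, f P • g P) ∧
        NewTable σ' (∅ : Finset (PauliString n)) 0 := by
  have hcard := hc.card_eq
  obtain ⟨l, hl, hls, hlen, hget⟩ := hc.list
  have hsl : s.card = l.length := by rw [← hcard, hlen]
  have hmem : ∀ P, P ∈ s ↔ P ∈ l := by intro P; rw [← hls]; simp
  set inner := (.assign vCode (.read aCur (.var vSweepLoop)) ;;
      .assignReal rVal (.read rCur (.var vCode)) ;; body : Program) with hinner
  have hii : inner.intTargets = vCode :: body.intTargets := by simp [hinner, Program.intTargets]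
  have hir : inner.realTargets = rVal :: body.realTargets := by simp [hinner, Program.realTargets]
  have hloopi : ∀ a ∈ [aCur, aCurLen], a ∉ (Program.forUp vSweepLoop (.var aCurLen) inner).intTargets := by
    intro a ha
    have h1 := hbi a (List.mem_cons_of_mem _ ha)
    simp only [Program.intTargets_forUp, hii]
    simp only [List.mem_cons, List.not_mem_nil, or_false] at ha
    rcases ha with rfl | rfl <;> simp [h1]
  have hloopr : rCur ∉ (Program.forUp vSweepLoop (.var aCurLen) inner).realTargets := by
    simp [Program.realTargets_forUp, hir, hbr]
  refine (Runs.seq (T := s.card * ((T + 2) + 2) + 2) (T' := s.card * 3 + B * 7 + 6)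
    (Runs.forUp (I := fun j σ => ∃ s₂, s₂ ⊆ (l.take j).toFinset.biUnion G ∧
      NewTable σ s₂ (∑ P ∈ (l.take j).toFinset, f P • g P)) s.card (T + 2) ?_ ?_ ?_ ?_ ?_ |>.mono
      le_rfl ?_)).le (by ring_nf; omega)
  · rw [hii]
    have := hbi vSweepLoop (by simp)
    simp [this]
  · rintro j σ v ⟨s₂, h1, h2⟩
    exact ⟨s₂, h1, h2.congr (by simp) (by simp) (by simp) (by simp)⟩
  · exact ⟨∅, by simp, by simpa using hn⟩
  · intro σ hA
    simp only [IntExpr.eval]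
    rw [hA.ints _ (hloopi _ (by simp)), hcard]
  · rintro j hj σ hA ⟨s₂, hs₂, hN⟩ hij
    rw [hsl] at hj
    have hPs : l[j] ∈ s := (hmem _).mpr (List.getElem_mem hj)
    have hcode : σ.ints aCur j = PauliString.code l[j] := by
      rw [hA.ints _ (hloopi _ (by simp)), hget j hj]
    have hrv : σ.reals rCur (PauliString.code l[j]) = f l[j] := by
      rw [hA.reals _ hloopr, hc.val]
    refine Runs.seqInt (Runs.seqReal ((hbody l[j] hPs _ s₂
      (∑ P ∈ (l.take j).toFinset, f P • g P) ?_ ?_ ?_ ?_).mono le_rfl ?_))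
    · have hA' : Agree (sweepProg body) σ₀ σ := by
        refine hA.mono ?_ ?_
        · rw [intTargets_sweepProg, Program.intTargets_forUp, hii]
          intro x hx; simp only [List.mem_append]; left; simpa using hx
        · rw [realTargets_sweepProg, Program.realTargets_forUp, hir]
          intro x hx; simp only [List.mem_append]; left; simpa using hx
      refine hA'.trans ⟨fun a ha => ?_, fun a ha => ?_⟩
      · have : a ≠ vCode := by
          rintro rfl; exact ha (by rw [intTargets_sweepProg]; simp)
        simp [this]
      · have : a ≠ rVal := by
          rintro rfl; exact ha (by rw [realTargets_sweepProg]; simp)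
        simp [this]
    · simp [IntExpr.eval, hij, hcode]
    · simp [IntExpr.eval, RealExpr.eval, hij, hcode, hrv]
    · exact hN.congr (by simp) (by simp) (by simp) (by simp)
    · rintro σ' - ⟨s₂', hsub, hN'⟩
      have hnot : l[j] ∉ (l.take j).toFinset := by
        have h := hl.sublist (List.take_sublist (j + 1) l)
        rw [List.take_succ_eq_append_getElem hj, List.nodup_append] at h
        rw [List.mem_toFinset]
        intro hm
        exact h.2.2 _ hm _ (by simp) rfl
      have htake : (l.take (j + 1)).toFinset = insert l[j] (l.take j).toFinset := by
        rw [List.take_succ_eq_append_getElem hj, List.toFinset_append]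
        ext; simp [or_comm]
      refine ⟨s₂', ?_, ?_⟩
      · rw [htake, Finset.biUnion_insert]
        refine hsub.trans (Finset.union_subset ?_ Finset.subset_union_left)
        exact hs₂.trans Finset.subset_union_right
      · rw [htake, Finset.sum_insert hnot, add_comm]
        exact hN'
  · rintro σ₁ hA₁ ⟨s₂, hs₂, hN⟩ -
    rw [hsl, List.take_length, hls] at hs₂ hN
    have hc₁ : CurTable σ₁ s f := hc.congr (hA₁.ints _ (hloopi _ (by simp)))
      (hA₁.ints _ (hloopi _ (by simp))) (hA₁.reals _ hloopr)
    have hle : s₂.card ≤ B := (Finset.card_le_card hs₂).trans hB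
    exact (runs_swapProg S hc₁ hN).mono (by omega) fun σ' _ h => ⟨s₂, hs₂, h⟩

/-! ## Coding programs -/

/-- The number of qubits, the first parameter. -/
abbrev qubitsExpr : IntExpr := .read 0 (.const 0)

/-- `d * e`. -/
def IntExpr.times : ℕ → IntExpr → IntExpr
  | 0, _ => .const 0
  | d + 1, e => .add (IntExpr.times d e) e

theorem IntExpr.eval_times (σ : Memory) (d : ℕ) (e : IntExpr) :
    (IntExpr.times d e).eval σ = d * e.eval σ := by
  induction d with
  | zero => simp [IntExpr.times, IntExpr.eval]
  | succ d ih => simp only [IntExpr.times, IntExpr.eval, ih]; ring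

/-- The parameter `n` and the table of powers of four are in place. -/
structure Ready (n : ℕ) (σ : Memory) : Prop where
  qubits : σ.ints 0 0 = n
  pow : ∀ i ≤ n, σ.ints aPow i = 4 ^ i

theorem Ready.congr {n : ℕ} {σ σ' : Memory} (h : Ready n σ) (h0 : σ'.ints 0 = σ.ints 0)
    (h1 : σ'.ints aPow = σ.ints aPow) : Ready n σ' :=
  ⟨by rw [h0, h.qubits], by rw [h1]; exact h.pow⟩

/-- Compute the powers of four. -/
def powersProg : Program :=
  .setInt aPow (.const 0) (.const 1) ;;
  .forUp vDigitLoop qubitsExpr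
    (.setInt aPow (.add (.var vDigitLoop) (.const 1)) (IntExpr.times 4 (.read aPow (.var vDigitLoop))))

/-- Integers can only be added and subtracted, so a power of four is the fourfold sum of the
previous one. -/
theorem runs_powersProg (S : Subroutines) {σ₀ : Memory} {n : ℕ} (hn : σ₀.ints 0 0 = n) :
    Runs S powersProg σ₀ (n * 3 + 3) (Ready n) := by
  refine Runs.seqInt ((Runs.forUp (I := fun j σ => ∀ i ≤ j, σ.ints aPow i = 4 ^ i) n 1
    (by decide) ?_ ?_ ?_ ?_).mono le_rfl ?_)
  · intro j σ v h
    simpa using h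
  · intro i hi
    obtain rfl : i = 0 := by omega
    simp [IntExpr.eval]
  · intro σ hA
    simp only [IntExpr.eval]
    rw [hA.ints 0 (by decide)]
    simp [hn]
  · intro j hj σ _ hI hij
    refine Runs.setInt fun i hi => ?_
    simp only [IntExpr.eval, IntExpr.eval_times, hij, Memory.setInt_ints, Function.update_self,
      hI j le_rfl]
    rcases Nat.le_succ_iff_eq_or_le.mp hi with rfl | h
    · simp; ring
    · rw [Function.update_of_ne (by omega), hI i h]
  · intro σ hA hI
    refine ⟨?_, hI⟩
    rw [hA.ints 0 (by decide)]
    simp [hn]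

/-- Store the digit `d` at position `vPos` and remove it from `vTmp`. -/
def digitBranch (d : ℕ) : Program :=
  .setInt aBuf (.var vPos) (.const d) ;;
  .assign vTmp (.sub (.var vTmp) (IntExpr.times d (.read aPow (.var vPos))))

/-- Split off the leading digit of `vTmp`. -/
def digitProg : Program :=
  .ite (.intLt (.var vTmp) (IntExpr.times 1 (.read aPow (.var vPos)))) (digitBranch 0)
    (.ite (.intLt (.var vTmp) (IntExpr.times 2 (.read aPow (.var vPos)))) (digitBranch 1)
      (.ite (.intLt (.var vTmp) (IntExpr.times 3 (.read aPow (.var vPos)))) (digitBranch 2)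
        (digitBranch 3)))

theorem runs_digitBranch (S : Subroutines) {σ : Memory} {r c d p : ℕ} (hr : σ.ints vPos 0 = r)
    (hp : σ.ints aPow r = p) (hc : σ.ints vTmp 0 = c + d * p) :
    Runs S (digitBranch d) σ 2 fun σ' => σ' = (σ.setInt aBuf r d).setInt vTmp 0 c := by
  refine Runs.seqInt (Runs.setInt ?_)
  simp [IntExpr.eval, IntExpr.eval_times, hr, hp, hc]

/-- In place of a division, the number c + d p with c < p is compared with p, 2p and 3p. At most
three tests and two assignments are needed. -/
theorem runs_digitProg (S : Subroutines) {σ : Memory} {r c d p : ℕ} (hr : σ.ints vPos 0 = r)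
    (hp : σ.ints aPow r = p) (hc : σ.ints vTmp 0 = c + d * p) (hcp : c < p) (hd : d < 4) :
    Runs S digitProg σ 5 fun σ' => σ' = (σ.setInt aBuf r d).setInt vTmp 0 c := by
  have hcond : ∀ e : ℕ, (TestExpr.intLt (.var vTmp)
      (IntExpr.times e (.read aPow (.var vPos)))).Holds σ ↔ d < e := by
    intro e
    simp only [TestExpr.Holds, IntExpr.eval, IntExpr.eval_times, hr, hp, hc]
    constructor
    · intro h
      by_contra hde
      have : e * p ≤ d * p := Nat.mul_le_mul_right _ (by omega)
      omega
    · intro h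
      have : (d + 1) * p ≤ e * p := Nat.mul_le_mul_right _ h
      rw [add_mul] at this
      omega
  have hb := fun d hc => runs_digitBranch (d := d) (c := c) S hr hp hc
  refine Runs.ite (T := 4) (fun h => ?_) fun h => Runs.ite (T := 3) (fun h' => ?_) fun h' =>
    Runs.ite (T := 2) (fun h'' => ?_) fun h'' => ?_
  all_goals simp only [hcond] at *
  · obtain rfl : d = 0 := by omega
    exact (hb 0 hc).le (by norm_num)
  · obtain rfl : d = 1 := by omega
    exact (hb 1 hc).le (by norm_num)
  · obtain rfl : d = 2 := by omega
    exact (hb 2 hc).le (by norm_num)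
  · obtain rfl : d = 3 := by omega
    exact (hb 3 hc).le (by norm_num)

/-- Unpack the code `vCode` and compute the weight of the string. -/
def decodeProg : Program :=
  .assign vTmp (.var vCode) ;; .assign vWeight (.const 0) ;;
  .forUp vDigitLoop qubitsExpr
    (.assign vPos (.sub (.sub qubitsExpr (.const 1)) (.var vDigitLoop)) ;;
      digitProg ;;
      .setInt aBufShift (.add (.var vPos) (.const 1)) (.read aBuf (.var vPos)) ;;
      .ite (.intLt (.read aBuf (.var vPos)) (.const 1)) .skip
        (.assign vWeight (.add (.var vWeight) (.const 1))))

/-- The letters and the weight of `P` are in memory. -/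
structure Decoded {n : ℕ} (P : PauliString n) (σ : Memory) : Prop where
  buf : ∀ i < n, σ.ints aBuf i = PauliString.digit P i
  shift : ∀ i < n, σ.ints aBufShift (i + 1) = PauliString.digit P i
  weight : σ.ints vWeight 0 = pauliWeight P

theorem Decoded.congr {n : ℕ} {P : PauliString n} {σ σ' : Memory} (h : Decoded P σ)
    (h1 : σ'.ints aBuf = σ.ints aBuf) (h2 : σ'.ints aBufShift = σ.ints aBufShift)
    (h3 : σ'.ints vWeight = σ.ints vWeight) : Decoded P σ' :=
  ⟨by rw [h1]; exact h.buf, by rw [h2]; exact h.shift, by rw [h3]; exact h.weight⟩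

/-- Digits are split off from the most significant one downwards: after j rounds `vTmp` holds the
number formed by the n - j lowest digits. The shifted copy leaves its cell 0 free for the layer
number that precedes a string in a query. -/
theorem runs_decodeProg (S : Subroutines) {n : ℕ} {σ₀ : Memory} (hR : Ready n σ₀)
    {P : PauliString n} (hP : σ₀.ints vCode 0 = PauliString.code P) :
    Runs S decodeProg σ₀ (n * 11 + 4) fun σ' => Decoded P σ' ∧
      σ'.ints aBufShift 0 = σ₀.ints aBufShift 0 := by
  refine Runs.seqInt (Runs.seqInt ((Runs.forUp (I := fun j σ =>
    σ.ints vTmp 0 = PauliString.partialCode P (n - j) ∧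
    (∀ i < n, n - j ≤ i → σ.ints aBuf i = PauliString.digit P i ∧
      σ.ints aBufShift (i + 1) = PauliString.digit P i) ∧
    σ.ints vWeight 0 + (∑ i ∈ Finset.range (n - j), if PauliString.digit P i = 0 then 0 else 1) =
      pauliWeight P ∧
    σ.ints aBufShift 0 = σ₀.ints aBufShift 0) n 9 (by decide) ?_ ?_ ?_ ?_).mono le_rfl ?_))
  · intro j σ v h
    simpa using h
  · refine ⟨?_, ?_, ?_, ?_⟩
    · simp [IntExpr.eval, hP, PauliString.code]
    · intro i hi hi'; omega
    · simp [IntExpr.eval, PauliString.pauliWeight_eq]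
    · simp
  · intro σ hA
    simp only [IntExpr.eval]
    rw [hA.ints 0 (by decide)]
    simp [hR.qubits]
  · rintro j hj σ hA ⟨h1, h2, h3, h4⟩ hij
    obtain ⟨r, hr⟩ : ∃ r, n - j = r + 1 := ⟨n - j - 1, by omega⟩
    have hr' : n - (j + 1) = r := by omega
    have hn : σ.ints 0 0 = n := by
      rw [hA.ints 0 (by decide)]; simp [hR.qubits]
    have hp : σ.ints aPow r = 4 ^ r := by
      rw [hA.ints _ (by decide)]
      simpa using hR.pow r (by omega)
    rw [hr, PauliString.partialCode_succ] at h1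
    rw [hr, Finset.sum_range_succ] at h3
    rw [hr] at h2
    have hpos : n - 1 - j = r := by omega
    refine Runs.seqInt (Runs.seq (T := 5) (T' := 3) ((runs_digitProg S (r := r)
      (c := PauliString.partialCode P r) (d := PauliString.digit P r) (p := 4 ^ r)
      ?_ ?_ ?_ (PauliString.partialCode_lt P r) (PauliString.digit_lt P r)).mono le_rfl ?_))
    · simp [IntExpr.eval, hn, hij, hpos]
    · simpa using hp
    · simpa using h1
    · rintro σ' - rfl -
      have key : ∀ σ'' : Memory, σ''.ints vTmp 0 = PauliString.partialCode P r →
          (σ''.ints aBuf = Function.update (σ.ints aBuf) r (PauliString.digit P r)) →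
          (σ''.ints aBufShift = Function.update (σ.ints aBufShift) (r + 1) (PauliString.digit P r)) →
          (σ''.ints vWeight 0 = σ.ints vWeight 0 + if PauliString.digit P r = 0 then 0 else 1) →
          (σ''.ints vTmp 0 = PauliString.partialCode P (n - (j + 1)) ∧
            (∀ i < n, n - (j + 1) ≤ i → σ''.ints aBuf i = PauliString.digit P i ∧
              σ''.ints aBufShift (i + 1) = PauliString.digit P i) ∧
            σ''.ints vWeight 0 + (∑ i ∈ Finset.range (n - (j + 1)),
              if PauliString.digit P i = 0 then 0 else 1) = pauliWeight P ∧
            σ''.ints aBufShift 0 = σ₀.ints aBufShift 0) := by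
        intro σ'' e1 e2 e3 e4
        rw [hr']
        refine ⟨e1, fun i hi hri => ?_, ?_, ?_⟩
        · rcases hri.eq_or_lt with rfl | hlt
          · simp [e2, e3]
          · obtain ⟨a, b⟩ := h2 i hi hlt
            rw [e2, e3, Function.update_of_ne (by omega), Function.update_of_ne (by omega)]
            exact ⟨a, b⟩
        · rw [e4]; omega
        · rw [e3, Function.update_of_ne (by omega), h4]
      refine Runs.seqInt (Runs.ite (T := 1) (fun hb => Runs.skip (key _ ?_ ?_ ?_ ?_))
        fun hb => Runs.setInt (key _ ?_ ?_ ?_ ?_))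
      all_goals
        simp [IntExpr.eval, TestExpr.Holds, hn, hij, hpos] at hb
        simp [IntExpr.eval, hn, hij, hpos, hb]
  · rintro σ - ⟨-, h2, h3, h4⟩
    refine ⟨⟨fun i hi => (h2 i hi (by omega)).1, fun i hi => (h2 i hi (by omega)).2, ?_⟩, h4⟩
    simpa using h3

/-- Pack the string stored in the array `src` from position `vOffset` on into `vOut`. -/
def encodeProg (src : ℕ) : Program :=
  .assign vOut (.const 0) ;;
  .forUp vDigitLoop qubitsExpr
    (.assign vOut (.add (IntExpr.times 4 (.var vOut)) (.read src (.add (.var vOffset)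
      (.sub (.sub qubitsExpr (.const 1)) (.var vDigitLoop))))))

/-- Horner's scheme from the most significant digit on; the invariant is that the digits read so far
and those still to come make up the whole code. -/
theorem runs_encodeProg (S : Subroutines) {n : ℕ} {σ₀ : Memory} (hn : σ₀.ints 0 0 = n) {src o : ℕ}
    (hsrc : src ≠ vOut) (hsrc' : src ≠ vDigitLoop) {P : PauliString n}
    (ho : σ₀.ints vOffset 0 = o) (hP : ∀ i < n, σ₀.ints src (o + i) = PauliString.digit P i) :
    Runs S (encodeProg src) σ₀ (n * 3 + 3) fun σ' => σ'.ints vOut 0 = PauliString.code P := by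
  refine Runs.seqInt ((Runs.forUp (I := fun j σ => σ.ints vOut 0 * 4 ^ (n - j) +
    PauliString.partialCode P (n - j) = PauliString.code P) n 1 (by simp [Program.intTargets]) ?_ ?_ ?_ ?_).mono
    le_rfl ?_)
  · intro j σ v h
    simpa using h
  · simp [IntExpr.eval, PauliString.code]
  · intro σ hA
    simp only [IntExpr.eval]
    rw [hA.ints 0 (by simp [Program.intTargets_forUp, Program.intTargets])]
    simp [hn]
  · intro j hj σ hA hI hij
    obtain ⟨r, hr⟩ : ∃ r, n - j = r + 1 := ⟨n - j - 1, by omega⟩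
    have hr' : n - (j + 1) = r := by omega
    have hpos : n - 1 - j = r := by omega
    have hn' : σ.ints 0 0 = n := by rw [hA.ints 0 (by simp [Program.intTargets_forUp, Program.intTargets])]; simp [hn]
    have ho' : σ.ints vOffset 0 = o := by rw [hA.ints _ (by simp [Program.intTargets_forUp, Program.intTargets])]; simp [ho]
    have hs : σ.ints src (o + r) = PauliString.digit P r := by
      rw [hA.ints src]
      · simpa [hsrc] using hP r (by omega)
      · simp [Program.intTargets_forUp, Program.intTargets, hsrc, hsrc']
    refine Runs.setInt ?_
    rw [hr, PauliString.partialCode_succ, pow_succ] at hI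
    rw [hr']
    simp only [IntExpr.eval, IntExpr.eval_times, Memory.setInt_ints, Function.update_self, hn',
      ho', hij, hpos, hs]
    rw [← hI]
    ring
  · intro σ _ h
    simpa [PauliString.partialCode] using h

/-- Compute the truncation order. -/
def orderProg : Program :=
  .assignReal rTmp (.mul (.const 3) (.mul (.mul (.read 0 (.const 0)) (.read 0 (.const 0)))
    (.read 0 (.const 1)))) ;;
  .assign vOrder (.const 0) ;;
  .loop (.realLt (.var rTmp) (.const 2))
    (.assignReal rTmp (.mul (.const (3 / 2)) (.var rTmp)) ;;
      .assign vOrder (.add (.var vOrder) (.const 1)))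

/-- The machine has no logarithms. This form of the inequality lets it find k by multiplying 3ε²δ by
3/2 until the value 2 is reached. -/
theorem lt_truncationOrder_iff {ε δ : ℝ} (hε : 0 < ε) (hδ : 0 < δ) (j : ℕ) :
    j < truncationOrder ε δ ↔ 3 * (ε * ε * δ) * (3 / 2) ^ j < 2 := by
  have hl : 0 < Real.log (3 / 2) := Real.log_pos (by norm_num)
  rw [truncationOrder, Nat.lt_ceil, lt_div_iff₀ hl, ← Real.log_pow,
    Real.log_lt_log_iff (by positivity) (by positivity), lt_div_iff₀ (by positivity)]
  constructor <;> intro h <;> linarith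

theorem runs_orderProg (S : Subroutines) {σ₀ : Memory} {ε δ : ℝ} (hε : 0 < ε) (hδ : 0 < δ)
    (h0 : σ₀.reals 0 0 = ε) (h1 : σ₀.reals 0 1 = δ) :
    Runs S orderProg σ₀ (truncationOrder ε δ * 3 + 3)
      fun σ' => σ'.ints vOrder 0 = truncationOrder ε δ := by
  refine Runs.seqReal (Runs.seqInt ((Runs.loop (T := 2) (I := fun j σ =>
    σ.reals rTmp 0 = 3 * (ε * ε * δ) * (3 / 2) ^ j ∧ σ.ints vOrder 0 = j) (truncationOrder ε δ)
    ?_ ?_ ?_).mono le_rfl ?_))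
  · rintro j hj σ ⟨h2, h3⟩
    refine ⟨?_, Runs.seqReal (Runs.setInt ⟨?_, ?_⟩)⟩
    · simpa [TestExpr.Holds, RealExpr.eval, IntExpr.eval, h2] using
        (lt_truncationOrder_iff hε hδ j).mp hj
    · simp [RealExpr.eval, IntExpr.eval, h2]
      ring
    · simp [IntExpr.eval, h3]
  · rintro σ ⟨h2, -⟩
    have := mt (lt_truncationOrder_iff hε hδ (truncationOrder ε δ)).mpr (lt_irrefl _)
    simpa [TestExpr.Holds, RealExpr.eval, IntExpr.eval, h2] using this
  · refine ⟨?_, ?_⟩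
    · simp [RealExpr.eval, IntExpr.eval, h0, h1]
    · simp [IntExpr.eval]
  · rintro σ - ⟨-, h⟩
    exact h

theorem readBlock_eq_encodePauli {n : ℕ} {P : PauliString n} {σ : Memory} {a : ℕ}
    (h : ∀ i < n, σ.ints a i = PauliString.digit P i) : σ.readBlock a n = encodePauli P := by
  rw [PauliString.encodePauli_eq, Memory.readBlock]
  refine List.map_congr_left fun i hi => h i (List.mem_range.mp hi)

theorem readBlock_eq_cons_encodePauli {n : ℕ} {P : PauliString n} {σ : Memory} {a : ℕ}
    (h : ∀ i < n, σ.ints a (i + 1) = PauliString.digit P i) :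
    σ.readBlock a (n + 1) = σ.ints a 0 :: encodePauli P := by
  rw [PauliString.encodePauli_eq, Memory.readBlock, List.range_succ_eq_map, List.map_cons,
    List.map_map]
  congr 1
  refine List.map_congr_left fun i hi => h i (List.mem_range.mp hi)

/-- Look up the expectation value of the decoded string in the state. -/
def stateCallProg : Program := .call 1 aBuf qubitsExpr aStateReply

theorem runs_stateCallProg {S : Subroutines} {n c : ℕ} {ρ : QOp (Fin n)} {state : PauliAccess c n}
    (hS : ∀ q, S 1 q = stateReply ρ state q) {σ : Memory} (hn : σ.ints 0 0 = n)
    {P : PauliString n} (hP : ∀ i < n, σ.ints aBuf i = PauliString.digit P i) :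
    Runs S stateCallProg σ (n + n ^ c + 2) fun σ' =>
      σ'.reals aStateReply 0 = (pauliOp P * ρ).trace.re := by
  have hlen : qubitsExpr.eval σ = n := by simp [IntExpr.eval, hn]
  refine Runs.call (r := stateReply ρ state (encodePauli P)) ?_ ?_ ?_
  · rw [hlen, readBlock_eq_encodePauli hP, hS]
  · rw [hlen]
    simp only [stateReply, PauliString.decodePauli_encodePauli, List.length_nil, List.length_cons]
    have := state.time_le P
    omega
  · simp [Memory.writeReply, stateReply, PauliString.decodePauli_encodePauli]

/-- Evaluate the current table in the state. -/
def finishProg : Program :=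
  .assignReal rAcc (.const 0) ;;
  .forUp vSweepLoop (.var aCurLen)
    (.assign vCode (.read aCur (.var vSweepLoop)) ;; decodeProg ;; stateCallProg ;;
      .assignReal rAcc (.add (.var rAcc) (.mul (.read rCur (.var vCode)) (.var aStateReply)))) ;;
  .assignReal 0 (.var rAcc)

theorem runs_finishProg {S : Subroutines} {n c : ℕ} {ρ : QOp (Fin n)} {state : PauliAccess c n}
    (hS : ∀ q, S 1 q = stateReply ρ state q) {σ₀ : Memory} (hR : Ready n σ₀)
    {s : Finset (PauliString n)} {f : PauliString n → ℝ} (hc : CurTable σ₀ s f) :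
    Runs S finishProg σ₀ (s.card * (n * 12 + n ^ c + 10) + 4) fun σ' =>
      σ'.reals 0 0 = ∑ P ∈ s, f P * (pauliOp P * ρ).trace.re := by
  have hcard := hc.card_eq
  obtain ⟨l, hl, hls, hlen, hget⟩ := hc.list
  have hsl : s.card = l.length := by rw [← hcard, hlen]
  refine (Runs.seqReal (T := (s.card * ((n * 12 + n ^ c + 8) + 2) + 2) + 1)
    (Runs.seq ((Runs.forUp (I := fun j σ =>
    σ.reals rAcc 0 = ∑ P ∈ (l.take j).toFinset, f P * (pauliOp P * ρ).trace.re) s.card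
    (n * 12 + n ^ c + 8) (by decide) ?_ ?_ ?_ ?_).mono le_rfl ?_))).le
    (le_of_eq (by ring))
  · intro j σ v h
    simpa using h
  · simp [RealExpr.eval, IntExpr.eval]
  · intro σ hA
    simp only [IntExpr.eval]
    rw [hA.ints _ (by decide)]
    simpa using hcard
  · intro j hj σ hA hI hij
    rw [hsl] at hj
    have hcode : σ.ints aCur j = PauliString.code l[j] := by
      rw [hA.ints _ (by decide)]
      simpa using hget j hj
    have hrv : σ.reals rCur (PauliString.code l[j]) = f l[j] := by
      rw [hA.reals _ (by decide)]
      simpa using hc.val l[j]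
    have hR' : Ready n σ := by
      refine hR.congr ?_ ?_
      · rw [hA.ints _ (by decide)]; simp
      · rw [hA.ints _ (by decide)]; simp
    have hnot : l[j] ∉ (l.take j).toFinset := by
      have h := hl.sublist (List.take_sublist (j + 1) l)
      rw [List.take_succ_eq_append_getElem hj, List.nodup_append] at h
      rw [List.mem_toFinset]
      intro hm
      exact h.2.2 _ hm _ (by simp) rfl
    have htake : (l.take (j + 1)).toFinset = insert l[j] (l.take j).toFinset := by
      rw [List.take_succ_eq_append_getElem hj, List.toFinset_append]
      ext; simp [or_comm]
    refine (Runs.seqInt (T := (n * 11 + 4) + ((n + n ^ c + 2) + 1)) (Runs.seq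
      ((runs_decodeProg S (P := l[j]) (hR'.congr (by simp) (by simp)) ?_).mono le_rfl ?_))).le
      (by omega)
    · simp [IntExpr.eval, hij, hcode]
    · rintro σ₁ - ⟨hD, -⟩ hA₁
      have hR₁ : Ready n σ₁ := hR'.congr (by rw [hA₁.ints _ (by decide)]; simp)
        (by rw [hA₁.ints _ (by decide)]; simp)
      refine Runs.seq ((runs_stateCallProg hS hR₁.qubits hD.buf).mono le_rfl ?_)
      rintro σ₂ - hval hA₂
      have hv : σ₂.ints vCode 0 = PauliString.code l[j] := by
        rw [hA₂.ints _ (by decide), hA₁.ints _ (by decide)]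
        simp [IntExpr.eval, hij, hcode]
      refine Runs.setReal ?_
      simp only [RealExpr.eval, IntExpr.eval, Memory.setReal_reals, Function.update_self, hv, hval]
      rw [hA₂.reals rAcc (by decide), hA₁.reals rAcc (by decide), hA₂.reals rCur (by decide),
        hA₁.reals rCur (by decide), htake, Finset.sum_insert hnot, Memory.setInt_reals, hI, hrv,
        add_comm]
  · rintro σ - hI -
    refine Runs.setReal ?_
    rw [hsl, List.take_length, hls] at hI
    simp [RealExpr.eval, IntExpr.eval, hI]

/-! ## Observables stored in tables -/

/-- The operator with given real Pauli coefficients. -/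
noncomputable def tableOp {n : ℕ} (f : PauliString n → ℝ) : QOp (Fin n) :=
  ∑ P, (f P : ℂ) • pauliG P

theorem coefG_tableOp {n : ℕ} (f : PauliString n → ℝ) (P : PauliString n) :
    coefG (tableOp f) P = f P := coefG_sum_smul _ _

theorem ext_coefG {n : ℕ} {A B : QOp (Fin n)} (h : ∀ P, coefG A P = coefG B P) : A = B := by
  rw [← sum_coefG_smul A, ← sum_coefG_smul B]
  simp only [h]

theorem tableOp_eq_of_coefG {n : ℕ} {A : QOp (Fin n)} (hA : A.IsHermitian)
    {f : PauliString n → ℝ} (h : ∀ P, f P = (coefG A P).re) : tableOp f = A := by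
  refine ext_coefG fun P => ?_
  rw [coefG_tableOp, h, coefG_real hA]

theorem isHermitian_pauliG {n : ℕ} (P : PauliString n) : (pauliG P).IsHermitian :=
  conjTranspose_pauliG P

theorem isHermitian_conj {m : Type} [Fintype m] {A : Matrix m m ℂ} (hA : A.IsHermitian)
    (U : Matrix m m ℂ) : (U.conjTranspose * A * U).IsHermitian := by
  rw [Matrix.IsHermitian, Matrix.conjTranspose_mul, Matrix.conjTranspose_mul,
    Matrix.conjTranspose_conjTranspose, hA.eq, mul_assoc]

theorem tableOp_sum_smul {n : ℕ} (s : Finset (PauliString n)) (f : PauliString n → ℝ)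
    (g : PauliString n → PauliString n → ℝ) :
    tableOp (∑ P ∈ s, f P • g P) = ∑ P ∈ s, (f P : ℂ) • tableOp (g P) := by
  refine ext_coefG fun Q => ?_
  rw [coefG_tableOp, coefG_sum]
  simp only [coefG_smul, coefG_tableOp, Finset.sum_apply, Pi.smul_apply, smul_eq_mul]
  push_cast
  rfl

theorem lowPart_tableOp {n : ℕ} (k : ℕ) {s : Finset (PauliString n)} {f : PauliString n → ℝ}
    (hf : ∀ P, P ∉ s → f P = 0) :
    lowPart k (tableOp f) = ∑ P ∈ s, (f P : ℂ) • if pauliWeight P ≤ k then pauliG P else 0 := by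
  rw [lowPart_eq]
  simp only [coefG_tableOp]
  rw [← Finset.sum_subset (Finset.subset_univ s)]
  · refine Finset.sum_congr rfl fun P _ => ?_
    split_ifs <;> simp
  · intro P _ hP
    simp [hf P hP]

/-- A sweep that conjugates the low-weight entries performs one step of the propagation. -/
theorem tableOp_sweep_eq {n : ℕ} (k : ℕ) {s : Finset (PauliString n)} {f : PauliString n → ℝ}
    (hf : ∀ P, P ∉ s → f P = 0) (U : QOp (Fin n)) {g : PauliString n → PauliString n → ℝ}
    (hg : ∀ P ∈ s, tableOp (g P) =
      if pauliWeight P ≤ k then U.conjTranspose * pauliG P * U else 0) :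
    tableOp (∑ P ∈ s, f P • g P) = U.conjTranspose * lowPart k (tableOp f) * U := by
  rw [tableOp_sum_smul, lowPart_tableOp k hf, Finset.mul_sum, Finset.sum_mul]
  refine Finset.sum_congr rfl fun P hP => ?_
  rw [hg P hP, Matrix.mul_smul, Matrix.smul_mul]
  split_ifs <;> simp

/-- The first `r` layers of a circuit. -/
def prefixCircuit {n L : ℕ} (U : Circuit n L) (r : ℕ) (h : r ≤ L) : Circuit n r :=
  fun i => U (Fin.castLE h i)

/-- The propagation consumes layers from the last one, so its remaining task always concerns a
prefix of the circuit. The loop invariants for both algorithms are stated for these prefixes. -/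
theorem propagationEstimate_prefix_succ {n L : ℕ} (k : ℕ) (U : Circuit n L) {r : ℕ}
    (h : r + 1 ≤ L) (ρ O : QOp (Fin n)) :
    propagationEstimate k (prefixCircuit U (r + 1) h) ρ O =
      propagationEstimate k (prefixCircuit U r (by omega)) ρ
        ((U ⟨r, h⟩ : QOp (Fin n)).conjTranspose * lowPart k O * (U ⟨r, h⟩ : QOp (Fin n))) := rfl

theorem trace_pauliG_mul_real {n : ℕ} {ρ : QOp (Fin n)} (hρ : ρ.IsHermitian) (P : PauliString n) :
    (((pauliG P * ρ).trace.re : ℝ) : ℂ) = (pauliG P * ρ).trace := by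
  have h : star ((pauliG P * ρ).trace) = (pauliG P * ρ).trace := by
    rw [← Matrix.trace_conjTranspose, Matrix.conjTranspose_mul, conjTranspose_pauliG, hρ.eq,
      Matrix.trace_mul_comm]
  exact Complex.conj_eq_iff_re.mp h

/-- After the first layer no truncation follows, so the final sum is over all entries of the table,
whatever their weights. -/
theorem propagationEstimate_zero_tableOp {n : ℕ} (k : ℕ) (U : Circuit n 0) {ρ : QOp (Fin n)}
    (hρ : IsQuantumState ρ) {s : Finset (PauliString n)} {f : PauliString n → ℝ}
    (hf : ∀ P, P ∉ s → f P = 0) :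
    propagationEstimate k U ρ (tableOp f) =
      ((∑ P ∈ s, f P * (pauliOp P * ρ).trace.re : ℝ) : ℂ) := by
  rw [propagationEstimate, truncatedObservable, tableOp, Finset.sum_mul, Matrix.trace_sum]
  push_cast
  rw [← Finset.sum_subset (Finset.subset_univ s)]
  · refine Finset.sum_congr rfl fun P _ => ?_
    rw [Matrix.smul_mul, Matrix.trace_smul, smul_eq_mul, pauliOp_eq_pauliG,
      trace_pauliG_mul_real hρ.1.1]
  · intro P _ hP
    simp [hf P hP]

/-! ## Counting low-weight Pauli strings -/

/-- Pauli strings of weight at most `w` supported on `A`. -/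
def lowStrings {n : ℕ} (A : Finset (Fin n)) (w : ℕ) : Finset (PauliString n) :=
  Finset.univ.filter fun P => pauliWeight P ≤ w ∧ ∀ i, i ∉ A → P i = 0

theorem mem_lowStrings {n : ℕ} {A : Finset (Fin n)} {w : ℕ} {P : PauliString n} :
    P ∈ lowStrings A w ↔ pauliWeight P ≤ w ∧ ∀ i, i ∉ A → P i = 0 := by
  simp [lowStrings]

/-- The generating function of the weights is a product over the qubits: one identity and three
other letters on each qubit of A. -/
theorem sum_pow_pauliWeight {n : ℕ} (A : Finset (Fin n)) (z : ℝ) :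
    ∑ P ∈ Finset.univ.filter (fun P : PauliString n => ∀ i, i ∉ A → P i = 0),
      z ^ pauliWeight P = (1 + 3 * z) ^ A.card := by
  have h1 : ∀ P : PauliString n, z ^ pauliWeight P = ∏ i, if P i = 0 then 1 else z := by
    intro P
    rw [Finset.prod_ite]
    simp [pauliWeight]
  have h2 : Finset.univ.filter (fun P : PauliString n => ∀ i, i ∉ A → P i = 0) =
      Fintype.piFinset fun i => if i ∈ A then Finset.univ else {0} := by
    ext P
    simp only [Finset.mem_filter, Finset.mem_univ, true_and, Fintype.mem_piFinset]
    refine forall_congr' fun i => ?_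
    by_cases hi : i ∈ A <;> simp [hi]
  simp only [h1]
  rw [h2, ← Finset.prod_univ_sum (fun i => if i ∈ A then Finset.univ else {0})
    (fun _ a => if a = 0 then (1 : ℝ) else z)]
  have h3 : ∀ i, (∑ a ∈ if i ∈ A then (Finset.univ : Finset (Fin 4)) else {0},
      if a = 0 then (1 : ℝ) else z) = if i ∈ A then 1 + 3 * z else 1 := by
    intro i
    by_cases hi : i ∈ A
    · simp [hi, Fin.sum_univ_four]; ring
    · simp [hi]
  simp only [h3]
  rw [Finset.prod_ite]
  simp

/-- A Chernoff-type bound. Each counted string contributes at least x^(-w) to the generating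
function at z = 1/x, which is at most exp(3|A|/x). The parameter x can be adapted to the size of A.
-/
theorem card_lowStrings_le {n : ℕ} (A : Finset (Fin n)) (w : ℕ) {x : ℝ} (hx : 1 ≤ x) :
    ((lowStrings A w).card : ℝ) ≤ x ^ w * Real.exp (3 * A.card / x) := by
  have hx0 : 0 < x := by linarith
  have h1 : ((lowStrings A w).card : ℝ) * (x⁻¹) ^ w ≤ (1 + 3 * x⁻¹) ^ A.card := by
    rw [← sum_pow_pauliWeight, ← nsmul_eq_mul, ← Finset.sum_const]
    calc _ ≤ ∑ P ∈ lowStrings A w, x⁻¹ ^ pauliWeight P := by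
          refine Finset.sum_le_sum fun P hP => ?_
          exact pow_le_pow_of_le_one (by positivity) (inv_le_one_of_one_le₀ hx)
            (mem_lowStrings.mp hP).1
      _ ≤ _ := by
          refine Finset.sum_le_sum_of_subset_of_nonneg (fun P hP => ?_) fun _ _ _ => by positivity
          simpa using (mem_lowStrings.mp hP).2
  have h2 : (1 + 3 * x⁻¹) ^ A.card ≤ Real.exp (3 * A.card / x) := by
    calc (1 + 3 * x⁻¹) ^ A.card ≤ (Real.exp (3 * x⁻¹)) ^ A.card := by
          gcongr
          rw [add_comm]
          exact Real.add_one_le_exp _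
      _ = _ := by
          rw [← Real.exp_nat_mul]
          congr 1
          field_simp
  have h3 := h1.trans h2
  rw [inv_pow, ← div_eq_mul_inv, div_le_iff₀ (by positivity)] at h3
  linarith

/-- With x = 3n the bound is (3n)^k e. For n ≥ 2 one has 3n ≤ n³ and e ≤ n². -/
theorem card_lowStrings_univ_le {n : ℕ} (hn : 2 ≤ n) (k : ℕ) :
    (lowStrings (Finset.univ : Finset (Fin n)) k).card ≤ n ^ (3 * k + 2) := by
  have hn' : (2 : ℝ) ≤ n := by exact_mod_cast hn
  have h := card_lowStrings_le (Finset.univ : Finset (Fin n)) k (x := 3 * n) (by linarith)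
  have h1 : 3 * ((Finset.univ : Finset (Fin n)).card : ℝ) / (3 * n) = 1 := by
    rw [Finset.card_univ, Fintype.card_fin]
    exact div_self (by positivity)
  rw [h1] at h
  have h2 : (3 * n : ℝ) ^ k ≤ (n : ℝ) ^ (3 * k) := by
    rw [pow_mul]
    gcongr
    have h4 : (4 : ℝ) ≤ (n : ℝ) ^ 2 := by nlinarith
    nlinarith [mul_le_mul_of_nonneg_left h4 (show (0 : ℝ) ≤ n by linarith)]
  have h3 : Real.exp 1 ≤ (n : ℝ) ^ 2 := by
    have := Real.exp_one_lt_d9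
    nlinarith
  have h4 : ((lowStrings (Finset.univ : Finset (Fin n)) k).card : ℝ) ≤ (n : ℝ) ^ (3 * k + 2) := by
    rw [pow_add]
    exact h.trans (mul_le_mul h2 h3 (Real.exp_pos _).le (by positivity))
  exact_mod_cast h4

/-! ## The truncation order -/

theorem one_le_inv_mul_inv {ε δ : ℝ} (hε : 0 < ε) (hε' : ε ≤ 1) (hδ : 0 < δ) (hδ' : δ ≤ 1) :
    1 ≤ ε⁻¹ * δ⁻¹ := by
  have h1 := (one_le_inv₀ hε).mpr hε'
  have h2 := (one_le_inv₀ hδ).mpr hδ'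
  nlinarith

/-- With y = log(1/(εδ)), the logarithm in the definition is at most 2y and log(3/2) ≥ 1/3. This
gives 6y, and rounding up costs at most 1. -/
theorem truncationOrder_le {ε δ : ℝ} (hε : 0 < ε) (hε' : ε ≤ 1) (hδ : 0 < δ) (hδ' : δ ≤ 1) :
    (truncationOrder ε δ : ℝ) ≤ 6 * (1 + Real.log (ε⁻¹ * δ⁻¹)) := by
  have hl : 1 / 3 ≤ Real.log (3 / 2) := by
    have := Real.one_sub_inv_le_log_of_pos (show (0 : ℝ) < 3 / 2 by norm_num)
    norm_num at this
    linarith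
  have hy := Real.log_nonneg (one_le_inv_mul_inv hε hε' hδ hδ')
  set y := Real.log (ε⁻¹ * δ⁻¹)
  have h1 : Real.log (2 / (3 * ε ^ 2 * δ)) ≤ 2 * y := by
    have h2 : 2 * y = Real.log ((ε⁻¹ * δ⁻¹) ^ 2) := by
      rw [Real.log_pow]; push_cast; rfl
    rw [h2]
    refine Real.log_le_log (by positivity) ?_
    rw [mul_pow, inv_pow, inv_pow, ← mul_inv, ← one_div,
      div_le_div_iff₀ (by positivity) (by positivity)]
    have : ε ^ 2 * δ ^ 2 ≤ ε ^ 2 * δ := by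
      gcongr
      nlinarith
    nlinarith [sq_nonneg ε, mul_pos (pow_pos hε 2) hδ]
  rcases le_or_gt (Real.log (2 / (3 * ε ^ 2 * δ)) / Real.log (3 / 2)) 0 with h | h
  · have : truncationOrder ε δ = 0 := Nat.ceil_eq_zero.mpr h
    rw [this]
    push_cast
    positivity
  · have h2 := (Nat.ceil_lt_add_one h.le).le
    have h3 : Real.log (2 / (3 * ε ^ 2 * δ)) / Real.log (3 / 2) ≤ 6 * y := by
      rw [div_le_iff₀ (by linarith)]
      nlinarith
    unfold truncationOrder
    linarith

/-- Running times that are powers with exponent linear in the truncation order. -/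
theorem pow_truncationOrder_le_rpow {ε δ : ℝ} (hε : 0 < ε) (hε' : ε ≤ 1) (hδ : 0 < δ) (hδ' : δ ≤ 1)
    {b : ℕ} (hb : 1 ≤ b) (e : ℕ) : ((b ^ (e * (truncationOrder ε δ + 1)) : ℕ) : ℝ) ≤
      (b : ℝ) ^ (((7 * e : ℕ) : ℝ) * (1 + Real.log (ε⁻¹ * δ⁻¹))) := by
  have hy := Real.log_nonneg (one_le_inv_mul_inv hε hε' hδ hδ')
  have hk := truncationOrder_le hε hε' hδ hδ'
  push_cast
  rw [← Real.rpow_natCast]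
  refine Real.rpow_le_rpow_of_exponent_le (by exact_mod_cast hb) ?_
  push_cast
  -- The bound 6(1 + y) on k absorbs the additional 1 when 6 is raised to 7.
  have : (truncationOrder ε δ : ℝ) + 1 ≤ 7 * (1 + Real.log (ε⁻¹ * δ⁻¹)) := by linarith
  calc (e : ℝ) * (truncationOrder ε δ + 1) ≤ e * (7 * (1 + Real.log (ε⁻¹ * δ⁻¹))) := by gcongr
    _ = _ := by ring

/-! ## Unrolled loops -/

/-- Sequential composition of a list of programs. -/
def Program.seqAll : List Program → Program
  | [] => .skip
  | p :: l => p ;; Program.seqAll l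

theorem Program.intTargets_seqAll (l : List Program) :
    (Program.seqAll l).intTargets = l.flatMap Program.intTargets := by
  induction l with
  | nil => rfl
  | cons p l ih => simp [Program.seqAll, Program.intTargets, ih]

theorem Program.realTargets_seqAll (l : List Program) :
    (Program.seqAll l).realTargets = l.flatMap Program.realTargets := by
  induction l with
  | nil => rfl
  | cons p l ih => simp [Program.seqAll, Program.realTargets, ih]

/-- The program `p` is never run. It only provides target lists that contain those of all `F t`, and
thus a common frame. -/
theorem runs_seqAll_emit {n : ℕ} (S : Subroutines) {κ : Type*} (F : κ → Program)
    (h : κ → PauliString n → ℝ) (A : Finset (PauliString n)) (T : ℕ) (p : Program) (σ₀ : Memory)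
    (l : List κ) (hp : ∀ t ∈ l, (F t).intTargets ⊆ p.intTargets ∧
      (F t).realTargets ⊆ p.realTargets)
    (hF : ∀ t ∈ l, ∀ σ s₂ f₂, Agree p σ₀ σ → NewTable σ s₂ f₂ →
      Runs S (F t) σ T fun σ' => ∃ s₂', s₂' ⊆ s₂ ∪ A ∧ NewTable σ' s₂' (f₂ + h t))
    {σ : Memory} (hA : Agree p σ₀ σ) {s₂ : Finset (PauliString n)} {f₂ : PauliString n → ℝ}
    (hN : NewTable σ s₂ f₂) :
    Runs S (Program.seqAll (l.map F)) σ (l.length * T + 1) fun σ' =>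
      ∃ s₂', s₂' ⊆ s₂ ∪ A ∧ NewTable σ' s₂' (f₂ + (l.map h).sum) := by
  induction l generalizing σ s₂ f₂ with
  | nil =>
    refine (Runs.skip ⟨s₂, Finset.subset_union_left, by simpa using hN⟩).le (by simp)
  | cons t l ih =>
    have h1 := hF t (by simp) σ s₂ f₂ hA hN
    refine (Runs.seq (T := T) (T' := l.length * T + 1) (h1.mono le_rfl ?_)).le
      (le_of_eq (by rw [List.length_cons]; ring))
    rintro σ' hA' ⟨s₂', hs, hN'⟩ -
    have hpt := hp t (by simp)
    refine (ih (fun t ht => hp t (by simp [ht])) (fun t ht => hF t (by simp [ht]))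
      (hA.trans (hA'.mono hpt.1 hpt.2)) hN').mono le_rfl ?_
    rintro σ'' - ⟨s₃, hs₃, hN''⟩
    refine ⟨s₃, hs₃.trans (Finset.union_subset hs Finset.subset_union_right), ?_⟩
    rw [List.map_cons, List.sum_cons, ← add_assoc]
    exact hN''

/-! ## Low-weight Pauli propagation with access to the layers -/

/-- Emit the current entry with qubit `vQubit`, which carries the identity, replaced by `d`. -/
def growProg (d : ℕ) : Program :=
  .ite (.neg (.conj (.intLt (.const 0) (.const d)) (.neg (.intLt (.var vWeight) (.var vOrder)))))
    (.assign vOut (.add (.var vCode) (IntExpr.times d (.read aPow (.var vQubit)))) ;;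
      .assignReal rOut (.var rVal) ;; emitProg)
    .skip

/-- One step of the enumeration of low-weight strings. -/
def enumBody : Program :=
  decodeProg ;; Program.seqAll ((List.finRange 4).map fun d : Fin 4 => growProg (d : ℕ))

/-- Multiply the current entry with the corresponding coefficient of the observable. -/
def loadBody : Program :=
  decodeProg ;; .call 2 aBuf qubitsExpr aObsReply ;;
  .assign vOut (.var vCode) ;; .assignReal rOut (.mul (.var rVal) (.var aObsReply)) ;; emitProg

/-- Emit the terms that the layer subroutine has returned. -/
def emitTermsProg : Program :=
  .assign vOffset (.const 1) ;;
  .forUp vTermLoop (.read aLayerReply (.const 0))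
    (encodeProg aLayerReply ;;
      .assignReal rOut (.mul (.var rVal) (.read aLayerReply (.var vTermLoop))) ;;
      emitProg ;;
      .assign vOffset (.add (.var vOffset) qubitsExpr))

/-- Conjugate the current entry by the layer `vLayer` if its weight is not too large. -/
def layerBody : Program :=
  decodeProg ;;
  .ite (.intLt (.var vOrder) (.var vWeight)) .skip
    (.setInt aBufShift (.const 0) (.var vLayer) ;;
      .call 0 aBufShift (.add qubitsExpr (.const 1)) aLayerReply ;;
      emitTermsProg)

/-- Low-weight Pauli propagation for circuits with the shallow-layer condition. -/
def generalProg : Program :=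
  orderProg ;; powersProg ;;
  .assign vOut (.const 0) ;; .assignReal rOut (.const 1) ;; emitProg ;; swapProg ;;
  .forUp vQubit qubitsExpr (sweepProg enumBody) ;;
  sweepProg loadBody ;;
  .forUp vLayerLoop (.read 0 (.const 1))
    (.assign vLayer (.sub (.sub (.read 0 (.const 1)) (.const 1)) (.var vLayerLoop)) ;;
      sweepProg layerBody) ;;
  finishProg

/-! ### Enumeration of the low-weight strings, qubit by qubit. -/

section Enumeration

variable {n : ℕ}

/-- The strings that are emitted for `P` when qubit `q` is enumerated. -/
def grown (k : ℕ) (q : Fin n) (P : PauliString n) : Finset (PauliString n) :=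
  (Finset.univ.filter fun d : Fin 4 => d = 0 ∨ pauliWeight P < k).image (Function.update P q)

/-- The terms that are emitted for `P` when qubit `q` is enumerated. -/
noncomputable def growTerms (k : ℕ) (q : Fin n) (P : PauliString n) : PauliString n → ℝ :=
  ∑ d : Fin 4, if d = 0 ∨ pauliWeight P < k then Pi.single (Function.update P q d) 1 else 0

theorem runs_enumBody (S : Subroutines) {σ₀ : Memory} (hR : Ready n σ₀) {k : ℕ}
    (hk : σ₀.ints vOrder 0 = k) {q : Fin n} (hq : σ₀.ints vQubit 0 = q) {P : PauliString n}
    (hPq : P q = 0) (hP : σ₀.ints vCode 0 = PauliString.code P) {x : ℝ}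
    (hx : σ₀.reals rVal 0 = x) {s : Finset (PauliString n)} {f : PauliString n → ℝ}
    (hN : NewTable σ₀ s f) :
    Runs S enumBody σ₀ (n * 11 + 37) fun σ' => ∃ s', s' ⊆ s ∪ grown k q P ∧
      NewTable σ' s' (f + x • growTerms k q P) := by
  refine (Runs.seq (T := n * 11 + 4) (T' := (List.finRange 4).length * 8 + 1)
    ((runs_decodeProg S hR hP).mono le_rfl ?_)).le (by simp)
  rintro σ₁ - ⟨hD, -⟩ hA₁
  have hN₁ : NewTable σ₁ s f := hN.congr (hA₁.ints _ (by decide)) (hA₁.ints _ (by decide))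
    (hA₁.reals _ (by decide)) (hA₁.ints _ (by decide))
  have hsum : x • growTerms k q P = ((List.finRange 4).map fun d : Fin 4 =>
      if d = 0 ∨ pauliWeight P < k then Pi.single (Function.update P q d) x else 0).sum := by
    rw [← Fin.sum_univ_def, growTerms, Finset.smul_sum]
    refine Finset.sum_congr rfl fun d _ => ?_
    split_ifs
    · rw [← Pi.single_smul, smul_eq_mul, mul_one]
    · simp
  rw [hsum]
  -- The targets of `growProg d` do not depend on d, so any one of these programs serves as the
  -- frame.
  refine runs_seqAll_emit S _ _ _ 8 (growProg 0) σ₁ _ ?_ ?_ (Agree.refl _ _) hN₁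
  · exact fun t _ => ⟨List.Subset.refl _, List.Subset.refl _⟩
  · intro d _ σ s₂ f₂ hA hN₂
    have hW : σ.ints vWeight 0 = pauliWeight P := by rw [hA.ints _ (by decide), hD.weight]
    have hk' : σ.ints vOrder 0 = k := by
      rw [hA.ints _ (by decide), hA₁.ints _ (by decide), hk]
    have hpow : σ.ints aPow q = 4 ^ (q : ℕ) := by
      rw [hA.ints _ (by decide), hA₁.ints _ (by decide), hR.pow _ q.2.le]
    have hcond : (TestExpr.neg (.conj (.intLt (.const 0) (.const (d : ℕ)))
        (.neg (.intLt (.var vWeight) (.var vOrder))))).Holds σ ↔ (d = 0 ∨ pauliWeight P < k) := by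
      simp only [TestExpr.Holds, IntExpr.eval, hW, hk', Fin.ext_iff]
      have : ((0 : Fin 4) : ℕ) = 0 := rfl
      rw [this]
      omega
    refine Runs.ite (T := 7) (fun hb => ?_) fun hb => ?_
    · rw [hcond] at hb
      rw [if_pos hb]
      refine Runs.seqInt (Runs.seqReal ((runs_emitProg S (Q := Function.update P q d) (x := x)
        (hN₂.congr (by simp) (by simp) (by simp) (by simp)) ?_ ?_).mono le_rfl ?_))
      · have := PauliString.code_update P q d
        rw [hPq] at this
        simp only [IntExpr.eval, IntExpr.eval_times, Memory.setReal_ints, Memory.setInt_ints,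
          Function.update_self]
        rw [hA.ints vCode (by decide), hA.ints vQubit (by decide), hA₁.ints vCode (by decide),
          hA₁.ints vQubit (by decide), hP, hq, hpow]
        simpa using this.symm
      · simp only [RealExpr.eval, IntExpr.eval, Memory.setReal_reals, Function.update_self,
          Memory.setInt_reals]
        rw [hA.reals rVal (by decide), hA₁.reals rVal (by decide), hx]
      · intro σ' _ h
        refine ⟨_, ?_, h⟩
        rw [Finset.insert_eq, Finset.union_comm]
        refine Finset.union_subset_union le_rfl ?_
        rw [Finset.singleton_subset_iff, grown, Finset.mem_image]
        exact ⟨d, by simpa using hb, rfl⟩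
    · rw [hcond] at hb
      rw [if_neg hb, add_zero]
      exact (Runs.skip ⟨s₂, Finset.subset_union_left, hN₂⟩).le (by norm_num)

/-- Low-weight strings supported on the first `r` qubits. -/
def lowStringsBelow (n r k : ℕ) : Finset (PauliString n) :=
  lowStrings (Finset.univ.filter fun i : Fin n => (i : ℕ) < r) k

theorem mem_lowStringsBelow {r k : ℕ} {P : PauliString n} :
    P ∈ lowStringsBelow n r k ↔ pauliWeight P ≤ k ∧ ∀ i : Fin n, r ≤ i → P i = 0 := by
  simp [lowStringsBelow, mem_lowStrings]

theorem lowStringsBelow_subset (r k : ℕ) :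
    lowStringsBelow n r k ⊆ lowStrings Finset.univ k := by
  intro P hP
  rw [mem_lowStringsBelow] at hP
  exact mem_lowStrings.mpr ⟨hP.1, fun i hi => absurd (Finset.mem_univ i) hi⟩

theorem lowStringsBelow_self (k : ℕ) : lowStringsBelow n n k = lowStrings Finset.univ k := by
  refine (lowStringsBelow_subset n k).antisymm fun P hP => ?_
  rw [mem_lowStringsBelow]
  exact ⟨(mem_lowStrings.mp hP).1, fun i hi => absurd i.2 (by omega)⟩

theorem pauliWeight_update_of_ne {P : PauliString n} {q : Fin n} (hP : P q = 0) {d : Fin 4}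
    (hd : d ≠ 0) : pauliWeight (Function.update P q d) = pauliWeight P + 1 := by
  have : (Finset.univ.filter fun i => Function.update P q d i ≠ 0) =
      insert q (Finset.univ.filter fun i => P i ≠ 0) := by
    ext i
    by_cases hi : i = q
    · subst hi; simp [hd]
    · simp [hi]
  rw [pauliWeight, this, Finset.card_insert_of_notMem (by simp [hP]), pauliWeight]

theorem grown_subset {k : ℕ} {q : Fin n} {P : PauliString n} (hP : P ∈ lowStringsBelow n q k) :
    grown k q P ⊆ lowStringsBelow n (q + 1) k := by
  intro Q hQ
  rw [mem_lowStringsBelow] at hP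
  simp only [grown, Finset.mem_image, Finset.mem_filter, Finset.mem_univ, true_and] at hQ
  obtain ⟨d, hd, rfl⟩ := hQ
  have hPq := hP.2 q le_rfl
  rw [mem_lowStringsBelow]
  refine ⟨?_, fun i hi => ?_⟩
  · by_cases h0 : d = 0
    · subst h0
      rw [← hPq, Function.update_eq_self]
      exact hP.1
    · rw [pauliWeight_update_of_ne hPq h0]
      have := hd.resolve_left h0
      omega
  · have : i ≠ q := by
      rintro rfl; omega
    rw [Function.update_of_ne this]
    exact hP.2 i (by omega)

/-- A string on the first q + 1 qubits has exactly one parent, obtained by resetting its letter at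
q. Hence each string is emitted once and has coefficient exactly 1. -/
theorem sum_growTerms (k : ℕ) (q : Fin n) :
    ∑ P ∈ lowStringsBelow n q k, growTerms k q P =
      fun Q => if Q ∈ lowStringsBelow n (q + 1) k then (1 : ℝ) else 0 := by
  funext Q
  rw [Finset.sum_apply]
  have happ : ∀ P, growTerms k q P Q =
      ∑ d : Fin 4, if (d = 0 ∨ pauliWeight P < k) ∧ Q = Function.update P q d then 1 else 0 := by
    intro P
    rw [growTerms, Finset.sum_apply]
    refine Finset.sum_congr rfl fun d _ => ?_
    by_cases h : d = 0 ∨ pauliWeight P < k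
    · by_cases h' : Q = Function.update P q d
      · simp [h, ← h']
      · simp [h, h']
    · simp [h]
  split_ifs with hQ
  · have hQ' := mem_lowStringsBelow.mp hQ
    have hP0q : Function.update Q q 0 q = 0 := Function.update_self _ _ _
    have hw : pauliWeight (Function.update Q q 0) + (if Q q = 0 then 0 else 1) = pauliWeight Q := by
      split_ifs with h
      · rw [← h, Function.update_eq_self, add_zero]
      · rw [← pauliWeight_update_of_ne hP0q h]
        simp
    have hP0 : Function.update Q q 0 ∈ lowStringsBelow n q k := by
      rw [mem_lowStringsBelow]
      refine ⟨by omega, fun i hi => ?_⟩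
      by_cases hiq : i = q
      · subst hiq; simp
      · rw [Function.update_of_ne hiq]
        refine hQ'.2 i ?_
        have : (i : ℕ) ≠ q := fun h => hiq (Fin.ext h)
        omega
    rw [Finset.sum_eq_single_of_mem _ hP0, happ, Finset.sum_eq_single (Q q)]
    · rw [if_pos]
      refine ⟨?_, by simp⟩
      by_cases h : Q q = 0
      · exact Or.inl h
      · rw [if_neg h] at hw
        right
        have := hQ'.1
        omega
    · intro d _ hd
      rw [if_neg]
      rintro ⟨-, h⟩
      apply hd
      rw [h]
      simp
    · simp
    · intro P hP hne
      rw [happ]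
      refine Finset.sum_eq_zero fun d _ => ?_
      rw [if_neg]
      rintro ⟨-, h⟩
      apply hne
      rw [h, Function.update_idem, ← (mem_lowStringsBelow.mp hP).2 q le_rfl,
        Function.update_eq_self]
  · refine Finset.sum_eq_zero fun P hP => ?_
    rw [happ]
    refine Finset.sum_eq_zero fun d _ => ?_
    rw [if_neg]
    rintro ⟨hd, rfl⟩
    apply hQ
    apply grown_subset hP
    simp only [grown, Finset.mem_image, Finset.mem_filter, Finset.mem_univ, true_and]
    exact ⟨d, hd, rfl⟩

theorem runs_enumLoop (S : Subroutines) {σ₀ : Memory} (hR : Ready n σ₀) {k : ℕ}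
    (hk : σ₀.ints vOrder 0 = k)
    (hC : CurTable σ₀ (lowStringsBelow n 0 k) fun P => if P ∈ lowStringsBelow n 0 k then 1 else 0)
    (hN : NewTable σ₀ (∅ : Finset (PauliString n)) 0) {B : ℕ}
    (hB : (lowStrings (Finset.univ : Finset (Fin n)) k).card ≤ B) :
    Runs S (.forUp vQubit qubitsExpr (sweepProg enumBody)) σ₀
      (n * (B * (n * 11 + 47) + B * 7 + 12) + 2) fun σ' =>
      CurTable σ' (lowStrings (Finset.univ : Finset (Fin n)) k)
        (fun P : PauliString n =>
          if P ∈ lowStrings (Finset.univ : Finset (Fin n)) k then 1 else 0) ∧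
        NewTable σ' (∅ : Finset (PauliString n)) 0 := by
  refine (Runs.forUp (I := fun j σ => CurTable σ (lowStringsBelow n j k)
    (fun P => if P ∈ lowStringsBelow n j k then 1 else 0) ∧
    NewTable σ (∅ : Finset (PauliString n)) 0) n (B * (n * 11 + 47) + B * 7 + 10) (by decide)
    ?_ ⟨hC, hN⟩ ?_ ?_).mono le_rfl ?_
  · rintro j σ v ⟨h1, h2⟩
    exact ⟨h1.congr (by simp) (by simp) (by simp),
      h2.congr (by simp) (by simp) (by simp) (by simp)⟩
  · intro σ hA
    simp only [IntExpr.eval]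
    rw [hA.ints 0 (by decide), hR.qubits]
  · rintro j hj σ hA ⟨h1, h2⟩ hij
    have hR' : Ready n σ := hR.congr (hA.ints _ (by decide)) (hA.ints _ (by decide))
    have hk' : σ.ints vOrder 0 = k := by rw [hA.ints _ (by decide), hk]
    have hsub : (lowStringsBelow n j k).biUnion (grown k ⟨j, hj⟩) ⊆ lowStringsBelow n (j + 1) k :=
      Finset.biUnion_subset.mpr fun P hP => grown_subset (q := ⟨j, hj⟩) hP
    have hcard : ∀ r, (lowStringsBelow n r k).card ≤ B := fun r =>
      (Finset.card_le_card (lowStringsBelow_subset r k)).trans hB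
    refine (runs_sweepProg S (by decide) (by decide) h1 h2 (growTerms k ⟨j, hj⟩)
      (grown k ⟨j, hj⟩) (n * 11 + 37) B ((Finset.card_le_card hsub).trans (hcard _)) ?_).mono ?_ ?_
    · intro P hP σ₁ s₂ f₂ hA₁ hcode hval hN₁
      exact runs_enumBody S (hR'.congr (hA₁.ints _ (by decide)) (hA₁.ints _ (by decide)))
        (by rw [hA₁.ints _ (by decide), hk']) (by rw [hA₁.ints _ (by decide), hij])
        ((mem_lowStringsBelow.mp hP).2 ⟨j, hj⟩ le_rfl) hcode hval hN₁
    · have := Nat.mul_le_mul_right (n * 11 + 37 + 10) (hcard j)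
      have e : B * (n * 11 + 47) = B * (n * 11 + 37 + 10) := by ring
      omega
    · rintro σ' - ⟨s', hs', hc', hn'⟩
      refine ⟨?_, hn'⟩
      have hf : ∑ P ∈ lowStringsBelow n j k, (if P ∈ lowStringsBelow n j k then (1 : ℝ) else 0) •
          growTerms k ⟨j, hj⟩ P =
          fun Q => if Q ∈ lowStringsBelow n (j + 1) k then (1 : ℝ) else 0 := by
        rw [← sum_growTerms k ⟨j, hj⟩]
        refine Finset.sum_congr rfl fun P hP => ?_
        rw [if_pos hP, one_smul]
      rw [hf] at hc'
      -- A priori the listed strings are only bounded from above. Equality holds since unlisted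
      -- strings have coefficient 0, while all low-weight strings have coefficient 1.
      have hs : s' = lowStringsBelow n (j + 1) k := by
        refine (hs'.trans hsub).antisymm fun P hP => ?_
        by_contra hPs
        have := hc'.supp P hPs
        simp [hP] at this
      rw [hs] at hc'
      exact hc'
  · rintro σ - h
    rwa [lowStringsBelow_self] at h

end Enumeration

/-! ### Loading the observable and conjugating by a layer. -/

section GeneralSweeps

variable {n : ℕ}

theorem runs_loadBody {S : Subroutines} {c : ℕ} {O : QOp (Fin n)} {obs : PauliAccess c n}
    (hS : ∀ q, S 2 q = ⟨[], [(pauliCoeff O (decodePauli n q)).re], obs.time (decodePauli n q)⟩)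
    {σ₀ : Memory} (hR : Ready n σ₀) {P : PauliString n}
    (hP : σ₀.ints vCode 0 = PauliString.code P) {x : ℝ} (hx : σ₀.reals rVal 0 = x)
    {s : Finset (PauliString n)} {f : PauliString n → ℝ} (hN : NewTable σ₀ s f) :
    Runs S loadBody σ₀ (n * 12 + n ^ c + 13) fun σ' => ∃ s', s' ⊆ s ∪ {P} ∧
      NewTable σ' s' (f + x • Pi.single P (coefG O P).re) := by
  refine (Runs.seq (T := n * 11 + 4) (T' := (n + n ^ c + 2) + (5 + 1 + 1))
    ((runs_decodeProg S hR hP).mono le_rfl ?_)).le (by omega)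
  rintro σ₁ - ⟨hD, -⟩ hA₁
  have hN₁ : NewTable σ₁ s f := hN.congr (hA₁.ints _ (by decide)) (hA₁.ints _ (by decide))
    (hA₁.reals _ (by decide)) (hA₁.ints _ (by decide))
  have hlen : qubitsExpr.eval σ₁ = n := by
    simp only [IntExpr.eval]
    rw [hA₁.ints 0 (by decide), hR.qubits]
  refine Runs.seq ((Runs.call (S := S) (o := 2) (src := aBuf) (len := qubitsExpr)
    (dst := aObsReply) (T := n + n ^ c + 2)
    (Q := fun σ' => σ'.reals aObsReply 0 = (coefG O P).re)
    (r := ⟨[], [(coefG O P).re], obs.time P⟩) ?_ ?_ ?_).mono le_rfl ?_)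
  · rw [hlen, readBlock_eq_encodePauli hD.buf, hS, PauliString.decodePauli_encodePauli,
      pauliCoeff_eq_coefG]
  · rw [hlen]
    simp only [List.length_nil, List.length_cons]
    have := obs.time_le P
    omega
  · simp [Memory.writeReply]
  · rintro σ₂ - hval hA₂
    refine Runs.seqInt (Runs.seqReal ((runs_emitProg S (Q := P) (x := x * (coefG O P).re)
      (hN₁.congr ?_ ?_ ?_ ?_) ?_ ?_).mono le_rfl ?_))
    · rw [← hA₂.ints aNew (by decide)]; simp
    · rw [← hA₂.ints aNewLen (by decide)]; simp
    · rw [← hA₂.reals rNew (by decide)]; simp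
    · rw [← hA₂.ints aMark (by decide)]; simp
    · simp only [IntExpr.eval, Memory.setReal_ints, Memory.setInt_ints, Function.update_self]
      rw [hA₂.ints vCode (by decide), hA₁.ints vCode (by decide), hP]
    · simp only [RealExpr.eval, IntExpr.eval, Memory.setReal_reals, Function.update_self,
        Memory.setInt_reals, hval]
      rw [hA₂.reals rVal (by decide), hA₁.reals rVal (by decide), hx]
    · intro σ' _ h
      refine ⟨insert P s, ?_, ?_⟩
      · rw [Finset.insert_eq, Finset.union_comm]
      · rw [← Pi.single_smul, smul_eq_mul]
        exact h

/-- The coefficients described by a list of weighted strings. -/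
noncomputable def listTerms (ts : List (PauliString n × ℝ)) : PauliString n → ℝ :=
  (ts.map fun t => Pi.single t.1 t.2).sum

theorem listTerms_apply_of_notMem {ts : List (PauliString n × ℝ)} {Q : PauliString n}
    (h : Q ∉ ts.map Prod.fst) : listTerms ts Q = 0 := by
  induction ts with
  | nil => rfl
  | cons t ts ih =>
    rw [List.map_cons, List.mem_cons, not_or] at h
    have := ih h.2
    rw [listTerms] at this ⊢
    rw [List.map_cons, List.sum_cons, Pi.add_apply, this, Pi.single_eq_of_ne h.1, add_zero]

theorem listTerms_apply_of_mem {ts : List (PauliString n × ℝ)} (hts : (ts.map Prod.fst).Nodup)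
    {Q : PauliString n} {a : ℝ} (h : (Q, a) ∈ ts) : listTerms ts Q = a := by
  induction ts with
  | nil => simp at h
  | cons t ts ih =>
    rw [List.map_cons, List.nodup_cons] at hts
    have e : listTerms (t :: ts) Q = Pi.single (M := fun _ => ℝ) t.1 t.2 Q + listTerms ts Q := by
      rw [listTerms, List.map_cons, List.sum_cons, Pi.add_apply]; rfl
    rw [e]
    rcases List.mem_cons.mp h with h | h
    · subst h
      rw [listTerms_apply_of_notMem hts.1, Pi.single_eq_same, add_zero]
    · have : Q ≠ t.1 := by
        rintro rfl
        exact hts.1 (List.mem_map.mpr ⟨_, h, rfl⟩)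
      rw [Pi.single_eq_of_ne this, zero_add, ih hts.2 h]

theorem tableOp_terms {L c : ℕ} {U : Circuit n L} (layers : LayerAccess c U) (j : Fin L)
    (P : PauliString n) : tableOp (listTerms (layers.terms j P)) =
      (U j : QOp (Fin n)).conjTranspose * pauliG P * (U j : QOp (Fin n)) := by
  have hH := isHermitian_conj (isHermitian_pauliG P) (U j : QOp (Fin n))
  refine tableOp_eq_of_coefG hH fun Q => ?_
  have hre := coefG_real hH Q
  by_cases h0 : (coefG ((U j : QOp (Fin n)).conjTranspose * pauliG P * (U j : QOp (Fin n))) Q).re = 0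
  · rw [h0]
    refine listTerms_apply_of_notMem fun h => ?_
    obtain ⟨⟨Q', a⟩, hmem, rfl⟩ := List.mem_map.mp h
    obtain ⟨ha, hc⟩ := (layers.mem_terms_iff j P Q' a).mp hmem
    rw [pauliCoeff_eq_coefG, pauliOp_eq_pauliG] at hc
    apply ha
    simp only at h0
    rw [hc] at h0
    simpa using h0
  · refine listTerms_apply_of_mem (layers.nodup j P) ((layers.mem_terms_iff _ _ _ _).mpr ⟨h0, ?_⟩)
    rw [pauliCoeff_eq_coefG, pauliOp_eq_pauliG, hre]

theorem length_terms_le {L c : ℕ} {U : Circuit n L} (hU : HasSparseLayers c U)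
    (layers : LayerAccess c U) (j : Fin L) (P : PauliString n) :
    (layers.terms j P).length ≤ n ^ (c * pauliWeight P) := by
  rw [← List.length_map (f := Prod.fst), ← List.toFinset_card_of_nodup (layers.nodup j P)]
  refine (Finset.card_le_card fun Q hQ => ?_).trans (hU j P)
  rw [List.mem_toFinset, List.mem_map] at hQ
  obtain ⟨⟨Q', a⟩, hmem, rfl⟩ := hQ
  obtain ⟨ha, hc⟩ := (layers.mem_terms_iff j P Q' a).mp hmem
  rw [Finset.mem_filter]
  refine ⟨Finset.mem_univ _, ?_⟩
  rw [hc]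
  exact_mod_cast ha

theorem getD_flatMap_encodePauli (ts : List (PauliString n × ℝ)) {j : ℕ} (hj : j < ts.length)
    {i : ℕ} (hi : i < n) (d : ℕ) :
    (ts.flatMap fun t => encodePauli t.1).getD (j * n + i) d = PauliString.digit ts[j].1 i := by
  induction ts generalizing j with
  | nil => simp at hj
  | cons t ts ih =>
    have hl : (encodePauli t.1).length = n := by simp [encodePauli]
    rw [List.flatMap_cons]
    cases j with
    | zero =>
      rw [zero_mul, zero_add, List.getD_append _ _ _ _ (by omega), PauliString.encodePauli_eq]
      simp [hi]
    | succ j =>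
      rw [List.getD_append_right _ _ _ _ (by rw [hl]; nlinarith), hl]
      have : (j + 1) * n + i - n = j * n + i := by
        rw [add_mul, one_mul]; omega
      rw [this, ih (by simpa using hj)]
      rfl

theorem length_flatMap_encodePauli (ts : List (PauliString n × ℝ)) :
    (ts.flatMap fun t => encodePauli t.1).length = ts.length * n := by
  induction ts with
  | nil => simp
  | cons t ts ih =>
    rw [List.flatMap_cons, List.length_append, ih, List.length_cons]
    simp [encodePauli]
    ring

/-- The reply starts with the number of terms, so the strings begin at position 1. As there is no
multiplication, the position of the j-th string is obtained by adding n in every round. -/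
theorem runs_emitTermsProg (S : Subroutines) {σ₀ : Memory} (hR : Ready n σ₀)
    (ts : List (PauliString n × ℝ)) (h0 : σ₀.ints aLayerReply 0 = ts.length)
    (hint : ∀ j (hj : j < ts.length), ∀ i < n,
      σ₀.ints aLayerReply (1 + j * n + i) = PauliString.digit ts[j].1 i)
    (hreal : ∀ j (hj : j < ts.length), σ₀.reals aLayerReply j = ts[j].2)
    {x : ℝ} (hx : σ₀.reals rVal 0 = x)
    {s : Finset (PauliString n)} {f : PauliString n → ℝ} (hN : NewTable σ₀ s f) :
    Runs S emitTermsProg σ₀ (ts.length * (n * 3 + 12) + 3) fun σ' => ∃ s',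
      s' ⊆ s ∪ (ts.map Prod.fst).toFinset ∧ NewTable σ' s' (f + x • listTerms ts) := by
  refine Runs.seqInt ((Runs.forUp (I := fun j σ => σ.ints vOffset 0 = 1 + j * n ∧
    ∃ s', s' ⊆ s ∪ (ts.map Prod.fst).toFinset ∧ NewTable σ s' (f + x • listTerms (ts.take j)))
    ts.length (n * 3 + 10) (by decide) ?_ ?_ ?_ ?_).mono (by simp) ?_)
  · rintro j σ v ⟨h1, s', hs, h2⟩
    exact ⟨by simpa using h1, s', hs, h2.congr (by simp) (by simp) (by simp) (by simp)⟩
  · refine ⟨by simp [IntExpr.eval], s, Finset.subset_union_left, ?_⟩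
    have : f + x • listTerms (ts.take 0) = f := by simp [listTerms]
    rw [this]
    exact hN.congr (by simp) (by simp) (by simp) (by simp)
  · intro σ hA
    simp only [IntExpr.eval]
    rw [hA.ints _ (by decide)]
    simpa using h0
  · rintro j hj σ hA ⟨ho, s', hs, hN'⟩ hij
    have hrep : σ.ints aLayerReply = σ₀.ints aLayerReply := by
      rw [hA.ints _ (by decide)]; simp
    have hrep' : σ.reals aLayerReply = σ₀.reals aLayerReply := by
      rw [hA.reals _ (by decide)]; simp
    have hval : σ.reals rVal 0 = x := by
      rw [hA.reals _ (by decide)]; simpa using hx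
    have hn : σ.ints 0 0 = n := by
      rw [hA.ints _ (by decide)]; simpa using hR.qubits
    refine (Runs.seq (T := n * 3 + 3) (T' := (5 + 1) + 1) ((runs_encodeProg S hn (by decide)
      (by decide) (P := ts[j].1) ho fun i hi => by rw [hrep]; exact hint j hj i hi).mono
      le_rfl ?_)).le (by omega)
    intro σ₁ _ hout hA₁
    refine Runs.seqReal (Runs.seq ((runs_emitProg S (Q := ts[j].1) (x := x * ts[j].2)
      (s := s') (f := f + x • listTerms (ts.take j)) (hN'.congr ?_ ?_ ?_ ?_) ?_ ?_).mono
      le_rfl ?_))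
    · rw [← hA₁.ints aNew (by decide)]; simp
    · rw [← hA₁.ints aNewLen (by decide)]; simp
    · rw [← hA₁.reals rNew (by decide)]; simp
    · rw [← hA₁.ints aMark (by decide)]; simp
    · simpa using hout
    · simp only [RealExpr.eval, IntExpr.eval, Memory.setReal_reals, Function.update_self]
      rw [hA₁.reals rVal (by decide), hA₁.reals aLayerReply (by decide),
        hA₁.ints vTermLoop (by decide), hval, hij, hrep', hreal j hj]
    · rintro σ₂ hA₂ hN₂ -
      refine Runs.setInt ⟨?_, insert ts[j].1 s', ?_, ?_⟩
      · simp only [IntExpr.eval, Memory.setInt_ints, Function.update_self]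
        rw [hA₂.ints vOffset (by decide), hA₂.ints 0 (by decide), Memory.setReal_ints,
          hA₁.ints vOffset (by decide), hA₁.ints 0 (by decide), ho, hn]
        ring
      · refine Finset.insert_subset (Finset.mem_union_right _ ?_) hs
        rw [List.mem_toFinset]
        exact List.mem_map.mpr ⟨_, List.getElem_mem hj, rfl⟩
      · have e : f + x • listTerms (ts.take (j + 1)) =
            f + x • listTerms (ts.take j) + Pi.single ts[j].1 (x * ts[j].2) := by
          rw [listTerms, List.take_succ_eq_append_getElem hj, List.map_append, List.sum_append,
            smul_add, add_assoc]
          congr 2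
          simp [← Pi.single_smul]
        rw [e]
        exact hN₂.congr (by simp) (by simp) (by simp) (by simp)
  · rintro σ - ⟨-, h⟩
    rwa [List.take_length] at h

/-- The strings that are emitted for `P` in a sweep with layer `j`. -/
noncomputable def layerKeys {L c : ℕ} {U : Circuit n L} (k : ℕ) (layers : LayerAccess c U)
    (j : Fin L) (P : PauliString n) : Finset (PauliString n) :=
  if pauliWeight P ≤ k then ((layers.terms j P).map Prod.fst).toFinset else ∅

/-- The terms that are emitted for `P` in a sweep with layer `j`. -/
noncomputable def layerTerms {L c : ℕ} {U : Circuit n L} (k : ℕ) (layers : LayerAccess c U)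
    (j : Fin L) (P : PauliString n) : PauliString n → ℝ :=
  if pauliWeight P ≤ k then listTerms (layers.terms j P) else 0

theorem card_layerKeys_le {L c : ℕ} {U : Circuit n L} (hU : HasSparseLayers c U) (hn : 1 ≤ n)
    (k : ℕ) (layers : LayerAccess c U) (j : Fin L) (P : PauliString n) :
    (layerKeys k layers j P).card ≤ n ^ (c * k) := by
  rw [layerKeys]
  split_ifs with h
  · refine (List.toFinset_card_le _).trans ?_
    rw [List.length_map]
    exact (length_terms_le hU layers j P).trans
      (Nat.pow_le_pow_right hn (Nat.mul_le_mul_left _ h))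
  · simp

theorem tableOp_layerTerms {L c : ℕ} {U : Circuit n L} (k : ℕ) (layers : LayerAccess c U)
    (j : Fin L) (P : PauliString n) : tableOp (layerTerms k layers j P) =
      if pauliWeight P ≤ k then
        (U j : QOp (Fin n)).conjTranspose * pauliG P * (U j : QOp (Fin n)) else 0 := by
  rw [layerTerms]
  split_ifs
  · exact tableOp_terms layers j P
  · simp [tableOp]

theorem runs_layerBody {S : Subroutines} {L c : ℕ} {U : Circuit n L} (hU : HasSparseLayers c U)
    (hn : 1 ≤ n) {layers : LayerAccess c U}
    (hS : ∀ (j : Fin L) (P : PauliString n), S 0 ((j : ℕ) :: encodePauli P) =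
      ⟨(layers.terms j P).length :: (layers.terms j P).flatMap (fun t => encodePauli t.1),
        (layers.terms j P).map Prod.snd, layers.time j P⟩)
    {σ₀ : Memory} (hR : Ready n σ₀) {k : ℕ} (hk : σ₀.ints vOrder 0 = k) {j : Fin L}
    (hj : σ₀.ints vLayer 0 = j) {P : PauliString n}
    (hP : σ₀.ints vCode 0 = PauliString.code P) {x : ℝ} (hx : σ₀.reals rVal 0 = x)
    {s : Finset (PauliString n)} {f : PauliString n → ℝ} (hN : NewTable σ₀ s f) :
    Runs S layerBody σ₀ (n * 12 + n ^ (c * k) * (n * 4 + 13) + n ^ (c * (k + 1)) + 12)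
      fun σ' => ∃ s', s' ⊆ s ∪ layerKeys k layers j P ∧
        NewTable σ' s' (f + x • layerTerms k layers j P) := by
  set Λ := n ^ (c * k) with hΛ
  set Θ := n ^ (c * (k + 1)) with hΘ
  have hΛ1 : 1 ≤ Λ := Nat.one_le_pow _ _ hn
  refine (Runs.seq (T := n * 11 + 4) (T' := (n + Λ * (n * 4 + 13) + Θ + 7) + 1)
    ((runs_decodeProg S hR hP).mono le_rfl ?_)).le (by omega)
  rintro σ₁ - ⟨hD, -⟩ hA₁
  have hN₁ : NewTable σ₁ s f := hN.congr (hA₁.ints _ (by decide)) (hA₁.ints _ (by decide))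
    (hA₁.reals _ (by decide)) (hA₁.ints _ (by decide))
  have hR₁ : Ready n σ₁ := hR.congr (hA₁.ints _ (by decide)) (hA₁.ints _ (by decide))
  have hk₁ : σ₁.ints vOrder 0 = k := by rw [hA₁.ints _ (by decide), hk]
  have hcond : (TestExpr.intLt (.var vOrder) (.var vWeight)).Holds σ₁ ↔ ¬ pauliWeight P ≤ k := by
    simp only [TestExpr.Holds, IntExpr.eval, hk₁, hD.weight]
    omega
  refine Runs.ite (fun hb => ?_) fun hb => ?_
  · rw [hcond] at hb
    rw [layerTerms, if_neg hb, layerKeys, if_neg hb, smul_zero, add_zero, Finset.union_empty]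
    exact (Runs.skip ⟨s, Finset.Subset.refl _, hN₁⟩).le (by omega)
  · rw [hcond, not_not] at hb
    rw [layerTerms, if_pos hb, layerKeys, if_pos hb]
    set ts := layers.terms j P with hts
    have hlen : ts.length ≤ Λ := (length_terms_le hU layers j P).trans
      (Nat.pow_le_pow_right hn (Nat.mul_le_mul_left _ hb))
    have htime : layers.time j P ≤ Θ := (layers.time_le j P).trans
      (Nat.pow_le_pow_right hn (Nat.mul_le_mul_left _ (by omega)))
    refine Runs.seqInt (T := n + Λ * (n * 4 + 13) + Θ + 6) ?_
    set σ₂ := σ₁.setInt aBufShift ((IntExpr.const 0).eval σ₁) ((IntExpr.var vLayer).eval σ₁)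
      with hσ₂
    have h20 : σ₂.ints aBufShift 0 = j := by
      simp only [hσ₂, IntExpr.eval, Memory.setInt_ints, Function.update_self]
      rw [hA₁.ints vLayer (by decide), hj]
    have h2n : ((IntExpr.add qubitsExpr (.const 1)).eval σ₂) = n + 1 := by
      simp [IntExpr.eval, hσ₂, hR₁.qubits]
    -- The call costs 1, its input n + 1, its reply at most 1 + Λ n integers and Λ reals, and its
    -- running time at most Θ.
    refine (Runs.seq (T := Λ * (n + 1) + n + Θ + 3) (T' := Λ * (n * 3 + 12) + 3)
      ((Runs.call (T := Λ * (n + 1) + n + Θ + 3) (r := ⟨ts.length :: ts.flatMap (fun t => encodePauli t.1), ts.map Prod.snd,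
        layers.time j P⟩) (Q := fun σ' => σ'.ints aLayerReply 0 = ts.length ∧
        (∀ j (hj : j < ts.length), ∀ i < n,
          σ'.ints aLayerReply (1 + j * n + i) = PauliString.digit ts[j].1 i) ∧
        (∀ j (hj : j < ts.length), σ'.reals aLayerReply j = ts[j].2)) ?_ ?_ ?_).mono
        le_rfl ?_)).le ?_
    · rw [h2n, readBlock_eq_cons_encodePauli (P := P), h20, hS]
      intro i hi
      have := hD.shift i hi
      simpa [hσ₂, IntExpr.eval] using this
    · rw [h2n]
      simp only [List.length_cons, length_flatMap_encodePauli, List.length_map]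
      have := Nat.mul_le_mul_right (n + 1) hlen
      have e : ts.length * (n + 1) = ts.length * n + ts.length := by ring
      omega
    · refine ⟨by simp [Memory.writeReply], fun j hj i hi => ?_, fun j hj => ?_⟩
      · have e : 1 + j * n + i = (j * n + i) + 1 := by ring
        simp only [Memory.writeReply, Function.update_self]
        rw [e, List.getD_cons_succ, getD_flatMap_encodePauli ts hj hi]
      · simp [Memory.writeReply, hj]
    · rintro σ₃ - ⟨h1, h2, h3⟩ hA₃
      have hN₃ : NewTable σ₃ s f := hN₁.congr (by rw [hA₃.ints _ (by decide)]; simp [hσ₂])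
        (by rw [hA₃.ints _ (by decide)]; simp [hσ₂]) (by rw [hA₃.reals _ (by decide)]; simp [hσ₂])
        (by rw [hA₃.ints _ (by decide)]; simp [hσ₂])
      have hR₃ : Ready n σ₃ := hR₁.congr (by rw [hA₃.ints _ (by decide)]; simp [hσ₂])
        (by rw [hA₃.ints _ (by decide)]; simp [hσ₂])
      have hx₃ : σ₃.reals rVal 0 = x := by
        rw [hA₃.reals _ (by decide), hσ₂, Memory.setInt_reals, hA₁.reals _ (by decide), hx]
      refine (runs_emitTermsProg S hR₃ ts h1 h2 h3 hx₃ hN₃).le ?_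
      have := Nat.mul_le_mul_right (n * 3 + 12) hlen
      omega
    · have e : Λ * (n * 4 + 13) = Λ * (n + 1) + Λ * (n * 3 + 12) := by ring
      omega

end GeneralSweeps

/-! ## The general algorithm -/

theorem initialMemory_tables {n : ℕ} (is : List ℕ) (rs : List ℝ) :
    CurTable (initialMemory is rs) (∅ : Finset (PauliString n)) 0 ∧
      NewTable (initialMemory is rs) (∅ : Finset (PauliString n)) 0 := by
  refine ⟨⟨⟨[], List.nodup_nil, rfl, rfl, fun i hi => by simp at hi⟩, fun _ => rfl, fun _ _ => rfl⟩,
    ⟨⟨[], List.nodup_nil, rfl, rfl, fun i hi => by simp at hi⟩, fun _ => rfl, fun _ _ => rfl⟩,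
    fun _ => ?_⟩
  simp [initialMemory]

theorem generalInstance_zero {n L c : ℕ} {U : Circuit n L} (layers : LayerAccess c U)
    (ρ O : QOp (Fin n)) (state obs : PauliAccess c n) (j : Fin L) (P : PauliString n) :
    generalInstance layers ρ O state obs 0 ((j : ℕ) :: encodePauli P) =
      ⟨(layers.terms j P).length :: (layers.terms j P).flatMap (fun t => encodePauli t.1),
        (layers.terms j P).map Prod.snd, layers.time j P⟩ := by
  have h : (((j : ℕ) :: encodePauli P).headD 0) < L := j.2
  simp only [generalInstance]
  rw [dif_pos h]
  simp only [List.tail_cons, PauliString.decodePauli_encodePauli]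
  rfl

theorem lowPart_lowPart {n : ℕ} (k : ℕ) (O : QOp (Fin n)) :
    lowPart k (lowPart k O) = lowPart k O := by
  conv_lhs => rw [lowPart_eq k O]
  rw [lowPart_sum_smul, lowPart_eq]
  refine Finset.sum_congr rfl fun P _ => ?_
  rw [lowPart_pauliG]
  split_ifs <;> simp

/-- The first step of the propagation truncates anyway, so the algorithm has to load only the
low-weight coefficients of O. At least one layer is needed for this. -/
theorem propagationEstimate_lowPart {n L : ℕ} (hL : 1 ≤ L) (k : ℕ) (U : Circuit n L)
    (ρ O : QOp (Fin n)) :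
    propagationEstimate k U ρ (lowPart k O) = propagationEstimate k U ρ O := by
  obtain ⟨L, rfl⟩ : ∃ l, L = l + 1 := ⟨L - 1, by omega⟩
  have h := fun O => propagationEstimate_prefix_succ k U le_rfl ρ O
  have e : prefixCircuit U (L + 1) le_rfl = U := rfl
  rw [e] at h
  rw [h, h, lowPart_lowPart]

theorem tableOp_single {n : ℕ} (P : PauliString n) (a : ℝ) :
    tableOp (Pi.single P a) = (a : ℂ) • pauliG P := by
  rw [tableOp, Finset.sum_eq_single P]
  · simp
  · intro Q _ hQ
    simp [hQ]
  · simp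

theorem tableOp_load {n : ℕ} (k : ℕ) {O : QOp (Fin n)} (hO : O.IsHermitian) :
    tableOp (∑ P ∈ lowStrings (Finset.univ : Finset (Fin n)) k,
      (if P ∈ lowStrings (Finset.univ : Finset (Fin n)) k then (1 : ℝ) else 0) •
        Pi.single P (coefG O P).re) = lowPart k O := by
  rw [tableOp_sum_smul, lowPart]
  have hs : Finset.univ.filter (fun P : PauliString n => pauliWeight P ≤ k) =
      lowStrings Finset.univ k := by
    ext P
    simp [mem_lowStrings]
  rw [hs]
  refine Finset.sum_congr rfl fun P hP => ?_
  rw [if_pos hP, tableOp_single, pauliCoeff_eq_coefG, pauliOp_eq_pauliG, coefG_real hO]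
  simp

section LayerLoop

variable {n L c : ℕ} {U : Circuit n L} {S : Subroutines}

/-- The counter j runs upwards while the layer L - 1 - j runs downwards. The invariant is that the
first L - j layers, applied to the current table, still give the estimate that is sought. -/
theorem runs_layerLoop (hU : HasSparseLayers c U) (hn : 1 ≤ n) {layers : LayerAccess c U}
    (hS : ∀ (j : Fin L) (P : PauliString n), S 0 ((j : ℕ) :: encodePauli P) =
      ⟨(layers.terms j P).length :: (layers.terms j P).flatMap (fun t => encodePauli t.1),
        (layers.terms j P).map Prod.snd, layers.time j P⟩)
    {σ₀ : Memory} (hR : Ready n σ₀) (hL : σ₀.ints 0 1 = L) {k : ℕ} (hk : σ₀.ints vOrder 0 = k)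
    {s₀ : Finset (PauliString n)} {f₀ : PauliString n → ℝ} (hC : CurTable σ₀ s₀ f₀)
    (hN : NewTable σ₀ (∅ : Finset (PauliString n)) 0) (ρ : QOp (Fin n)) {B : ℕ}
    (hs₀ : s₀.card ≤ B)
    (hB : (lowStrings (Finset.univ : Finset (Fin n)) k).card * n ^ (c * k) ≤ B) :
    Runs S (.forUp vLayerLoop (.read 0 (.const 1))
      (.assign vLayer (.sub (.sub (.read 0 (.const 1)) (.const 1)) (.var vLayerLoop)) ;;
        sweepProg layerBody)) σ₀
      (L * (B * (n * 12 + n ^ (c * k) * (n * 4 + 13) + n ^ (c * (k + 1)) + 22) + B * 7 + 13) + 2)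
      fun σ' => ∃ (s : Finset (PauliString n)) (f : PauliString n → ℝ), s.card ≤ B ∧
        CurTable σ' s f ∧ propagationEstimate k (prefixCircuit U 0 (Nat.zero_le _)) ρ (tableOp f) =
          propagationEstimate k U ρ (tableOp f₀) := by
  refine (Runs.forUp (I := fun j σ => ∃ (s : Finset (PauliString n)) (f : PauliString n → ℝ),
    s.card ≤ B ∧ CurTable σ s f ∧ NewTable σ (∅ : Finset (PauliString n)) 0 ∧
    ∀ r (h : r + j = L), propagationEstimate k (prefixCircuit U r (by omega)) ρ (tableOp f) =
      propagationEstimate k U ρ (tableOp f₀)) L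
    (B * (n * 12 + n ^ (c * k) * (n * 4 + 13) + n ^ (c * (k + 1)) + 22) + B * 7 + 11)
    (by decide) ?_ ⟨s₀, f₀, hs₀, hC, hN, ?_⟩ ?_ ?_).mono le_rfl ?_
  · rintro j σ v ⟨s, f, h1, h2, h3, h4⟩
    exact ⟨s, f, h1, h2.congr (by simp) (by simp) (by simp),
      h3.congr (by simp) (by simp) (by simp) (by simp), h4⟩
  · rintro r h
    obtain rfl : r = L := by omega
    rfl
  · intro σ hA
    simp only [IntExpr.eval]
    rw [hA.ints 0 (by decide), hL]
  · rintro j hj σ hA ⟨s, f, hsB, hc, hn', hest⟩ hij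
    have hj' : L - 1 - j < L := by omega
    refine Runs.seqInt (T := B * (n * 12 + n ^ (c * k) * (n * 4 + 13) + n ^ (c * (k + 1)) + 22)
      + B * 7 + 10) ?_
    have hσL : σ.ints 0 1 = L := by rw [hA.ints 0 (by decide), hL]
    have hval : (IntExpr.sub (.sub (.read 0 (.const 1)) (.const 1)) (.var vLayerLoop)).eval σ =
        L - 1 - j := by
      simp only [IntExpr.eval, hσL, hij]
    rw [hval]
    have hR' : Ready n (σ.setInt vLayer ((IntExpr.const 0).eval σ) (L - 1 - j)) :=
      hR.congr (by simp [hA.ints 0 (by decide)]) (by simp [hA.ints aPow (by decide)])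
    have hk' : (σ.setInt vLayer ((IntExpr.const 0).eval σ) (L - 1 - j)).ints vOrder 0 = k := by
      simp [hA.ints vOrder (by decide), hk]
    have hcard : (s.biUnion (layerKeys k layers ⟨L - 1 - j, hj'⟩)).card ≤ B := by
      -- Only strings of weight at most k emit anything. The new table is therefore bounded in terms
      -- of all low-weight strings and not of the old table, so that sizes do not multiply from
      -- layer to layer.
      refine le_trans (Finset.card_le_card (?_ : _ ⊆
        (lowStrings (Finset.univ : Finset (Fin n)) k).biUnion
          (layerKeys k layers ⟨L - 1 - j, hj'⟩))) ?_
      · intro Q hQ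
        obtain ⟨P, hP, hQP⟩ := Finset.mem_biUnion.mp hQ
        refine Finset.mem_biUnion.mpr ⟨P, ?_, hQP⟩
        rw [layerKeys] at hQP
        split_ifs at hQP with h
        · exact mem_lowStrings.mpr ⟨h, fun i hi => absurd (Finset.mem_univ i) hi⟩
        · simp at hQP
      · exact (Finset.card_biUnion_le_card_mul _ _ _ fun P _ =>
          card_layerKeys_le hU hn k layers _ P).trans hB
    refine (runs_sweepProg S (by decide) (by decide) (hc.congr (by simp) (by simp) (by simp))
      (hn'.congr (by simp) (by simp) (by simp) (by simp)) (layerTerms k layers ⟨L - 1 - j, hj'⟩)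
      (layerKeys k layers ⟨L - 1 - j, hj'⟩)
      (n * 12 + n ^ (c * k) * (n * 4 + 13) + n ^ (c * (k + 1)) + 12) B hcard ?_).mono ?_ ?_
    · intro P _ σ₁ s₂ f₂ hA₁ hcode hx hN₁
      exact runs_layerBody hU hn hS (hR'.congr (hA₁.ints _ (by decide)) (hA₁.ints _ (by decide)))
        (by rw [hA₁.ints _ (by decide), hk']) (by rw [hA₁.ints _ (by decide)]; simp [IntExpr.eval])
        hcode hx hN₁
    · have := Nat.mul_le_mul_right
        (n * 12 + n ^ (c * k) * (n * 4 + 13) + n ^ (c * (k + 1)) + 22) hsB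
      have e : ∀ X : ℕ, s.card * (X + 12 + 10) = s.card * (X + 22) := fun X => rfl
      rw [e]
      omega
    · rintro σ' - ⟨s', hs', hc', hN'⟩
      refine ⟨s', _, (Finset.card_le_card hs').trans hcard, hc', hN', ?_⟩
      intro r hr
      have hrj : (⟨L - 1 - j, hj'⟩ : Fin L) = ⟨r, by omega⟩ := by
        ext; simp only; omega
      rw [tableOp_sweep_eq k hc.supp (U ⟨r, by omega⟩ : QOp (Fin n))
        (fun P _ => by rw [hrj]; exact tableOp_layerTerms k layers _ P),
        ← propagationEstimate_prefix_succ k U (by omega)]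
      exact hest (r + 1) (by omega)
  · rintro σ - ⟨s, f, h1, h2, -, h3⟩
    exact ⟨s, f, h1, h2, h3 0 (by omega)⟩

end LayerLoop

/-- The sum of the running times of the parts of the general algorithm. -/
theorem general_time_le {y n k e b Λ Θ B L : ℕ} (hy : 1 ≤ y) (hL : 1 ≤ L) (hn : n ≤ y)
    (hk : k ≤ y) (he : e ≤ y) (hb : b ≤ y) (hΛ : Λ ≤ y) (hΘ : Θ ≤ y) (hB : B ≤ y * y) :
    (k * 3 + 3) + ((n * 3 + 3) + (((5 + (13 + ((n * (b * (n * 11 + 47) + b * 7 + 12) + 2) +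
      ((b * (n * 12 + e + 23) + b * 7 + 10) +
        ((L * (B * (n * 12 + Λ * (n * 4 + 13) + Θ + 22) + B * 7 + 13) + 2) +
          (B * (n * 12 + e + 10) + 4)))))) + 1) + 1)) ≤ 512 * (L * y ^ 4) := by
  have hle : (k * 3 + 3) + ((n * 3 + 3) + (((5 + (13 + ((n * (b * (n * 11 + 47) + b * 7 + 12) + 2) +
      ((b * (n * 12 + e + 23) + b * 7 + 10) +
        ((L * (B * (n * 12 + Λ * (n * 4 + 13) + Θ + 22) + B * 7 + 13) + 2) +
          (B * (n * 12 + e + 10) + 4)))))) + 1) + 1)) ≤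
      (y * 3 + 3) + ((y * 3 + 3) + (((5 + (13 + ((y * (y * (y * 11 + 47) + y * 7 + 12) + 2) +
      ((y * (y * 12 + y + 23) + y * 7 + 10) +
        ((L * ((y * y) * (y * 12 + y * (y * 4 + 13) + y + 22) + (y * y) * 7 + 13) + 2) +
          ((y * y) * (y * 12 + y + 10) + 4)))))) + 1) + 1)) := by
    gcongr
  refine hle.trans ?_
  -- Written in z = y - 1 and l = L - 1, both sides are polynomials with nonnegative coefficients,
  -- and the inequality can be checked monomial by monomial.
  obtain ⟨z, rfl⟩ : ∃ z, y = z + 1 := ⟨y - 1, by omega⟩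
  obtain ⟨l, rfl⟩ : ∃ l, L = l + 1 := ⟨L - 1, by omega⟩
  ring_nf
  gcongr <;> norm_num

/-- The power y of n dominates every quantity in the time bound except the table size B, which is at
most y². The leading term is L · B · Λ · n, hence the fourth power. -/
theorem runs_generalProg {n L c : ℕ} {U : Circuit n L} (hn : 2 ≤ n) (hL : 1 ≤ L)
    (hU : HasSparseLayers c U) (layers : LayerAccess c U) {ρ O : QOp (Fin n)}
    (hρ : IsQuantumState ρ) (hO : O.IsHermitian) (state obs : PauliAccess c n) {ε δ : ℝ}
    (hε : 0 < ε) (hδ : 0 < δ) :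
    Runs (generalInstance layers ρ O state obs) generalProg (initialMemory [n, L] [ε, δ])
      (512 * (L * (n ^ ((c + 3) * (truncationOrder ε δ + 1))) ^ 4)) fun σ' =>
        ((σ'.reals 0 0 : ℝ) : ℂ) = propagationEstimate (truncationOrder ε δ) U ρ O := by
  set S := generalInstance layers ρ O state obs with hSdef
  set σ₀ := initialMemory [n, L] [ε, δ] with hσ₀
  set k := truncationOrder ε δ with hk
  set low := lowStrings (Finset.univ : Finset (Fin n)) k with hlow
  set y := n ^ ((c + 3) * (k + 1)) with hy
  have hn1 : 1 ≤ n := by omega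
  have hpow : ∀ e, e ≤ (c + 3) * (k + 1) → n ^ e ≤ y := fun e he => Nat.pow_le_pow_right hn1 he
  have hb : low.card ≤ n ^ (3 * k + 2) := card_lowStrings_univ_le hn k
  obtain ⟨hC₀, hN₀⟩ := initialMemory_tables (n := n) [n, L] [ε, δ]
  refine Runs.le ?_ (general_time_le (y := y) (n := n) (k := k) (e := n ^ c) (b := low.card)
    (Λ := n ^ (c * k)) (Θ := n ^ (c * (k + 1))) (B := low.card * n ^ (c * k))
    (Nat.one_le_pow _ _ hn1) hL ?_ ?_ ?_ ?_ ?_ ?_ ?_)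
  rotate_left
  · calc n = n ^ 1 := (pow_one n).symm
      _ ≤ y := hpow _ (by nlinarith)
  · calc k ≤ n ^ k := (Nat.lt_pow_self hn).le
      _ ≤ y := hpow _ (by nlinarith)
  · exact hpow _ (by nlinarith)
  · exact hb.trans (hpow _ (by nlinarith))
  · exact hpow _ (by nlinarith)
  · exact hpow _ (by nlinarith)
  · exact Nat.mul_le_mul (hb.trans (hpow _ (by nlinarith))) (hpow _ (by nlinarith))
  -- The identity string with coefficient 1, emitted at the beginning, seeds the enumeration.
  have hlow0 : lowStringsBelow n 0 k = {0} := by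
    ext P
    rw [mem_lowStringsBelow, Finset.mem_singleton]
    constructor
    · rintro ⟨-, h⟩
      exact funext fun i => h i (Nat.zero_le _)
    · rintro rfl
      simp [pauliWeight]
  have hB : low.card ≤ low.card * n ^ (c * k) :=
    Nat.le_mul_of_pos_right _ (Nat.pow_pos (by omega))
  refine Runs.seq ((runs_orderProg S hε hδ (by simp [hσ₀, initialMemory])
    (by simp [hσ₀, initialMemory])).mono le_rfl ?_)
  intro σ₁ _ hk₁ hA₁
  refine Runs.seq ((runs_powersProg S (n := n) (by
    rw [hA₁.ints 0 (by decide)]; simp [hσ₀, initialMemory])).mono le_rfl ?_)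
  intro σ₂ _ hR₂ hA₂
  have hC₂ : CurTable σ₂ (∅ : Finset (PauliString n)) 0 :=
    (hC₀.congr (hA₁.ints _ (by decide)) (hA₁.ints _ (by decide)) (hA₁.reals _ (by decide))).congr
      (hA₂.ints _ (by decide)) (hA₂.ints _ (by decide)) (hA₂.reals _ (by decide))
  have hN₂ : NewTable σ₂ (∅ : Finset (PauliString n)) 0 :=
    (hN₀.congr (hA₁.ints _ (by decide)) (hA₁.ints _ (by decide)) (hA₁.reals _ (by decide))
      (hA₁.ints _ (by decide))).congr
      (hA₂.ints _ (by decide)) (hA₂.ints _ (by decide)) (hA₂.reals _ (by decide))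
      (hA₂.ints _ (by decide))
  have hk₂ : σ₂.ints vOrder 0 = k := by rw [hA₂.ints _ (by decide), hk₁]
  have hL₂ : σ₂.ints 0 1 = L := by
    rw [hA₂.ints 0 (by decide), hA₁.ints 0 (by decide)]; simp [hσ₀, initialMemory]
  refine Runs.seqInt (Runs.seqReal ?_)
  set σ₃ := (σ₂.setInt vOut ((IntExpr.const 0).eval σ₂) ((IntExpr.const 0).eval σ₂)).setReal rOut
    ((IntExpr.const 0).eval (σ₂.setInt vOut ((IntExpr.const 0).eval σ₂) ((IntExpr.const 0).eval σ₂)))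
    ((RealExpr.const 1).eval (σ₂.setInt vOut ((IntExpr.const 0).eval σ₂)
      ((IntExpr.const 0).eval σ₂))) with hσ₃
  refine Runs.seq ((runs_emitProg S (σ := σ₃) (Q := (0 : PauliString n)) (x := 1)
    (hN₂.congr (by simp [hσ₃]) (by simp [hσ₃]) (by simp [hσ₃]) (by simp [hσ₃])) ?_ ?_).mono
    le_rfl ?_)
  · simp [hσ₃, IntExpr.eval, PauliString.code, PauliString.partialCode, PauliString.digit]
  · simp [hσ₃, IntExpr.eval, RealExpr.eval]
  intro σ₄ _ hN₄ hA₄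
  have hR₄ : Ready n σ₄ := hR₂.congr (by rw [hA₄.ints _ (by decide)]; simp [hσ₃])
    (by rw [hA₄.ints _ (by decide)]; simp [hσ₃])
  have hC₄ : CurTable σ₄ (∅ : Finset (PauliString n)) 0 :=
    hC₂.congr (by rw [hA₄.ints _ (by decide)]; simp [hσ₃])
    (by rw [hA₄.ints _ (by decide)]; simp [hσ₃]) (by rw [hA₄.reals _ (by decide)]; simp [hσ₃])
  have hk₄ : σ₄.ints vOrder 0 = k := by rw [hA₄.ints _ (by decide)]; simpa [hσ₃] using hk₂
  have hL₄ : σ₄.ints 0 1 = L := by rw [hA₄.ints 0 (by decide)]; simpa [hσ₃] using hL₂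
  refine Runs.seq ((runs_swapProg S hC₄ hN₄).mono (by simp) ?_)
  rintro σ₅ - ⟨hC₅, hN₅⟩ hA₅
  have hC₅' : CurTable σ₅ (lowStringsBelow n 0 k)
      fun P => if P ∈ lowStringsBelow n 0 k then 1 else 0 := by
    rw [hlow0]
    have e : (0 : PauliString n → ℝ) + Pi.single 0 1 =
        fun P : PauliString n => if P ∈ ({0} : Finset (PauliString n)) then (1 : ℝ) else 0 := by
      funext P
      simp [Pi.single_apply]
    rw [e] at hC₅
    exact hC₅
  have hR₅ : Ready n σ₅ := hR₄.congr (hA₅.ints _ (by decide)) (hA₅.ints _ (by decide))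
  have hk₅ : σ₅.ints vOrder 0 = k := by rw [hA₅.ints _ (by decide), hk₄]
  have hL₅ : σ₅.ints 0 1 = L := by rw [hA₅.ints 0 (by decide), hL₄]
  refine Runs.seq ((runs_enumLoop S hR₅ hk₅ hC₅' hN₅ le_rfl).mono le_rfl ?_)
  rintro σ₆ - ⟨hC₆, hN₆⟩ hA₆
  have hR₆ : Ready n σ₆ := hR₅.congr (hA₆.ints _ (by decide)) (hA₆.ints _ (by decide))
  have hk₆ : σ₆.ints vOrder 0 = k := by rw [hA₆.ints _ (by decide), hk₅]
  have hL₆ : σ₆.ints 0 1 = L := by rw [hA₆.ints 0 (by decide), hL₅]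
  refine Runs.seq ((runs_sweepProg S (by decide) (by decide) hC₆ hN₆
    (fun P => Pi.single P (coefG O P).re) (fun P => {P}) (n * 12 + n ^ c + 13) low.card
    (by rw [Finset.biUnion_singleton_eq_self]) ?_).mono le_rfl ?_)
  · intro P _ σ s₂ f₂ hA hcode hx hN
    exact runs_loadBody (S := S) (c := c) (O := O) (obs := obs) (fun q => rfl)
      (hR₆.congr (hA.ints _ (by decide)) (hA.ints _ (by decide))) hcode hx hN
  rintro σ₇ - ⟨s₇, hs₇, hC₇, hN₇⟩ hA₇
  rw [Finset.biUnion_singleton_eq_self] at hs₇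
  have hR₇ : Ready n σ₇ := hR₆.congr (hA₇.ints _ (by decide)) (hA₇.ints _ (by decide))
  have hk₇ : σ₇.ints vOrder 0 = k := by rw [hA₇.ints _ (by decide), hk₆]
  have hL₇ : σ₇.ints 0 1 = L := by rw [hA₇.ints 0 (by decide), hL₆]
  refine Runs.seq ((runs_layerLoop (S := S) hU hn1 (layers := layers)
    (generalInstance_zero layers ρ O state obs) hR₇ hL₇ hk₇ hC₇ hN₇ ρ
    ((Finset.card_le_card hs₇).trans hB) le_rfl).mono le_rfl ?_)
  rintro σ₈ - ⟨s₈, f₈, hs₈, hC₈, hest⟩ hA₈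
  have hR₈ : Ready n σ₈ := hR₇.congr (hA₈.ints _ (by decide)) (hA₈.ints _ (by decide))
  refine (runs_finishProg (S := S) (c := c) (ρ := ρ) (state := state) (fun q => rfl) hR₈ hC₈).mono
    ?_ ?_
  · have := Nat.mul_le_mul_right (n * 12 + n ^ c + 10) hs₈
    omega
  · intro σ' _ h
    rw [h, ← propagationEstimate_zero_tableOp k (prefixCircuit U 0 (Nat.zero_le _)) hρ hC₈.supp,
      hest, tableOp_load k hO, propagationEstimate_lowPart hL]

theorem computesWithin_generalProg {n L c : ℕ} {U : Circuit n L} (hn : 2 ≤ n) (hL : 1 ≤ L)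
    (hU : HasSparseLayers c U) (layers : LayerAccess c U) {ρ O : QOp (Fin n)}
    (hρ : IsQuantumState ρ) (hO : O.IsHermitian) (state obs : PauliAccess c n) {ε δ : ℝ}
    (hε : 0 < ε) (hε' : ε ≤ 1) (hδ : 0 < δ) (hδ' : δ ≤ 1) :
    ComputesWithin generalProg (generalInstance layers ρ O state obs) [n, L] [ε, δ]
      ((L : ℝ) * (n : ℝ) ^ (((7 * (4 * c + 21) : ℕ) : ℝ) * (1 + Real.log (ε⁻¹ * δ⁻¹))))
      (propagationEstimate (truncationOrder ε δ) U ρ O) := by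
  obtain ⟨t, σ, he, ht, hv⟩ := runs_generalProg hn hL hU layers hρ hO state obs hε hδ
  refine ⟨t, σ, he, ?_, hv⟩
  have h1 : t ≤ L * n ^ ((4 * c + 21) * (truncationOrder ε δ + 1)) := by
    refine ht.trans ?_
    rw [mul_left_comm]
    refine Nat.mul_le_mul_left _ ?_
    -- Since n ≥ 2, the constant 512 = 2⁹ is at most n⁹. The exponents add up to 4(c + 3) + 9 = 4c +
    -- 21.
    calc 512 * (n ^ ((c + 3) * (truncationOrder ε δ + 1))) ^ 4
        ≤ n ^ (9 * (truncationOrder ε δ + 1)) * (n ^ ((c + 3) * (truncationOrder ε δ + 1))) ^ 4 := by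
          refine Nat.mul_le_mul_right _ ?_
          calc 512 = 2 ^ 9 := by norm_num
            _ ≤ n ^ 9 := Nat.pow_le_pow_left hn 9
            _ ≤ _ := Nat.pow_le_pow_right (by omega) (by omega)
      _ = _ := by
          rw [← pow_mul, ← pow_add]
          congr 1
          ring
  have h2 := pow_truncationOrder_le_rpow hε hε' hδ hδ' (b := n) (by omega) (4 * c + 21)
  calc (t : ℝ) ≤ ((L * n ^ ((4 * c + 21) * (truncationOrder ε δ + 1)) : ℕ) : ℝ) := by
        exact_mod_cast h1
    _ ≤ _ := by
        rw [Nat.cast_mul]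
        exact mul_le_mul_of_nonneg_left h2 (Nat.cast_nonneg _)

/-! ## A layer of local gates as a product of gates -/

namespace LocalCircuit

variable {n L : ℕ} {G : SimpleGraph (Fin n)} (d : LocalCircuit G L) (j : Fin L)

/-- The factor of a layer that is stored at qubit `q`. -/
noncomputable def factor (q : Fin n) (x y : Fin n → Fin 2) : ℂ :=
  if d.partner j q = q then (d.one j q).1 (x q) (y q)
  else if q < d.partner j q then
    (d.two j q).1 (x q, x (d.partner j q)) (y q, y (d.partner j q))
  else 1

/-- The product of the gates stored at qubits below `t`. -/
noncomputable def prefixLayer (t : ℕ) : QOp (Fin n) :=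
  Matrix.of fun x y => (∏ q : Fin n, if (q : ℕ) < t then d.factor j q x y else 1) *
    -- A gate is stored at the smaller of its qubits. A qubit is thus untouched by the gates stored
    -- below t when neither it nor its partner is below t.
    if ∀ i : Fin n, t ≤ i → t ≤ d.partner j i → x i = y i then 1 else 0

theorem prefixLayer_zero : d.prefixLayer j 0 = 1 := by
  ext x y
  simp [prefixLayer, Matrix.one_apply, funext_iff]

theorem prefixLayer_self : d.prefixLayer j n = d.layer j := by
  ext x y
  simp only [prefixLayer, Matrix.of_apply, layer, Fin.is_lt, if_true]
  rw [if_pos, mul_one]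
  · rfl
  · intro i hi
    exact absurd i.2 (by omega)

variable {d j}

/-- The gate at q is stored at its smaller partner and has already been counted. -/
theorem prefixLayer_succ_of_lt {q : Fin n} (h : d.partner j q < q) :
    d.prefixLayer j (q + 1) = d.prefixLayer j q := by
  ext x y
  simp only [prefixLayer, Matrix.of_apply]
  congr 1
  · refine Finset.prod_congr rfl fun r _ => ?_
    by_cases hr : r = q
    · subst hr
      rw [if_pos (by omega), if_neg (by omega), factor, if_neg h.ne, if_neg (not_lt.mpr h.le)]
    · have : (r : ℕ) ≠ q := fun e => hr (Fin.ext e)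
      by_cases hrq : (r : ℕ) < q
      · rw [if_pos (by omega), if_pos hrq]
      · rw [if_neg (by omega), if_neg hrq]
  · refine if_congr (forall_congr' fun i => ?_) rfl rfl
    have h1 : i = q → (d.partner j i : ℕ) < q := by rintro rfl; exact h
    have h2 : d.partner j i = q → (i : ℕ) < q := by
      intro e
      rw [← d.partner_partner j i, e]
      exact h
    constructor
    · intro H h3 h4
      refine H ?_ ?_
      · have : (i : ℕ) ≠ q := fun e => by have := h1 (Fin.ext e); omega
        omega
      · have : (d.partner j i : ℕ) ≠ q := fun e => by have := h2 (Fin.ext e); omega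
        omega
    · intro H h3 h4
      exact H (by omega) (by omega)

theorem extendOp_apply (A : Finset (Fin n)) (V : QOp {i // i ∈ A}) (x y : Fin n → Fin 2) :
    extendOp A V x y = V (fun i => x i) (fun i => y i) *
      if ∀ i, i ∉ A → x i = y i then 1 else 0 := by
  rw [extendOp, Matrix.submatrix_apply, Matrix.kronecker_apply, Matrix.one_apply]
  congr 1
  refine if_congr ?_ rfl rfl
  constructor
  · intro h i hi
    exact congrFun h ⟨i, hi⟩
  · intro h
    funext i
    exact h i i.2

/-- Gates of one layer act on disjoint sets of qubits, so a gate stored before t does not see the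
qubits of the gate at t. -/
theorem factor_congr {q t : Fin n} (hqt : q < t) (ht : t ≤ d.partner j t) {x y z : Fin n → Fin 2}
    (h : ∀ i, i ≠ t → i ≠ d.partner j t → y i = z i) :
    d.factor j q x y = d.factor j q x z := by
  have h1 : y q = z q := by
    refine h q hqt.ne ?_
    rintro rfl
    exact absurd hqt (not_lt.mpr ht)
  have h2 : q < d.partner j q → y (d.partner j q) = z (d.partner j q) := by
    intro hq
    refine h _ ?_ ?_
    · rintro rfl
      rw [d.partner_partner] at ht
      exact absurd hqt (not_lt.mpr ht)
    · intro e
      have := congrArg (d.partner j) e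
      rw [d.partner_partner, d.partner_partner] at this
      exact hqt.ne this
  unfold factor
  split_ifs with h3 h4
  · rw [h1]
  · rw [h1, h2 h4]
  · rfl

theorem prefixLayer_succ {t : Fin n} (ht : t ≤ d.partner j t) {A : Finset (Fin n)}
    (hA : ∀ i, i ∈ A ↔ i = t ∨ i = d.partner j t) {V : QOp {i // i ∈ A}}
    (hV : ∀ x y : Fin n → Fin 2, V (fun i => x i) (fun i => y i) = d.factor j t x y) :
    d.prefixLayer j (t + 1) = d.prefixLayer j t * extendOp A V := by
  ext x z
  -- In the matrix product only one intermediate basis state survives. The earlier gates fix the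
  -- qubits of A, so it agrees with x there, and the new gate fixes all others, so it agrees with z
  -- there.
  set y₀ : Fin n → Fin 2 := fun i => if i ∈ A then x i else z i with hy₀
  rw [Matrix.mul_apply, Finset.sum_eq_single y₀]
  · rw [extendOp_apply, if_pos (fun i hi => by simp [hy₀, hi]), mul_one]
    have e : V (fun i => y₀ i) (fun i => z i) = V (fun i => x i) fun i => z i := by
      congr 1
      funext i
      simp [hy₀]
    rw [e, hV]
    simp only [prefixLayer, Matrix.of_apply]
    rw [mul_right_comm]
    congr 1
    · rw [← Finset.prod_erase_mul _ _ (Finset.mem_univ t),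
        ← Finset.prod_erase_mul Finset.univ (fun q : Fin n => if (q : ℕ) < t then d.factor j q x y₀ else 1)
          (Finset.mem_univ t), if_pos (by omega), if_neg (lt_irrefl _), mul_one]
      congr 1
      refine Finset.prod_congr rfl fun q hq => ?_
      have hqt : (q : ℕ) ≠ t := fun e => (Finset.mem_erase.mp hq).1 (Fin.ext e)
      by_cases hlt : (q : ℕ) < t
      · rw [if_pos (by omega), if_pos hlt]
        refine (factor_congr hlt ht fun i hi hi' => ?_).symm
        have : i ∉ A := by rw [hA]; tauto
        simp [hy₀, this]
      · rw [if_neg (by omega), if_neg hlt]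
    · refine if_congr (forall_congr' fun i => ?_) rfl rfl
      have h1 : i ∉ A ↔ (i : ℕ) ≠ t ∧ (d.partner j i : ℕ) ≠ t := by
        rw [hA, not_or]
        refine and_congr (not_congr Fin.ext_iff) (not_congr ?_)
        rw [← Fin.ext_iff]
        constructor
        · rintro rfl; exact d.partner_partner j t
        · intro e; rw [← e, d.partner_partner]
      constructor
      · intro H h3 h4
        by_cases hi : i ∈ A
        · simp [hy₀, hi]
        · rw [show y₀ i = z i by simp [hy₀, hi]]
          have := h1.mp hi
          exact H (by omega) (by omega)
      · intro H h3 h4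
        have hi : i ∉ A := h1.mpr ⟨by omega, by omega⟩
        rw [H (by omega) (by omega)]
        simp [hy₀, hi]
  · intro y _ hy
    rw [extendOp_apply]
    simp only [prefixLayer, Matrix.of_apply]
    by_cases h1 : ∀ i, i ∉ A → y i = z i
    · rw [if_neg, mul_zero, zero_mul]
      intro h2
      apply hy
      funext i
      by_cases hi : i ∈ A
      · simp only [hy₀, if_pos hi]
        symm
        rcases (hA i).mp hi with rfl | rfl
        · exact h2 _ le_rfl ht
        · exact h2 _ ht (by rw [d.partner_partner])
      · simp only [hy₀, if_neg hi]
        exact h1 i hi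
    · rw [if_neg h1, mul_zero, mul_zero]
  · simp

end LocalCircuit

/-! ## Conjugation by a single gate -/

section Gate

variable {n : ℕ}

/-- The basis states of a single qubit. -/
def oneEquiv (q : Fin n) : ({i // i ∈ ({q} : Finset (Fin n))} → Fin 2) ≃ Fin 2 where
  toFun x := x ⟨q, by simp⟩
  invFun u _ := u
  left_inv x := by
    funext i
    have : i = ⟨q, by simp⟩ := Subtype.ext (Finset.mem_singleton.mp i.2)
    rw [this]
  right_inv _ := rfl

/-- The basis states of a pair of qubits. -/
def pairEquiv {q p : Fin n} (h : q ≠ p) :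
    ({i // i ∈ ({q, p} : Finset (Fin n))} → Fin 2) ≃ Fin 2 × Fin 2 where
  toFun x := (x ⟨q, by simp⟩, x ⟨p, by simp⟩)
  invFun u i := if (i : Fin n) = q then u.1 else u.2
  left_inv x := by
    funext i
    obtain ⟨i, hi⟩ := i
    rcases Finset.mem_insert.mp hi with rfl | hi'
    · simp
    · rw [Finset.mem_singleton] at hi'
      subst hi'
      simp [h.symm]
  right_inv u := by simp [h.symm]

/-- The Pauli coefficients of a conjugated Pauli operator, in matrix form. -/
noncomputable def conjCoeff {m : Type} [Fintype m] (g A B : Matrix m m ℂ) : ℂ :=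
  (g.conjTranspose * A * g * B).trace / Fintype.card m

theorem conjCoeff_submatrix {m m' : Type} [Fintype m] [Fintype m'] (e : m ≃ m')
    (g A B : Matrix m' m' ℂ) :
    conjCoeff (g.submatrix e e) (A.submatrix e e) (B.submatrix e e) = conjCoeff g A B := by
  rw [conjCoeff, conjCoeff, Matrix.conjTranspose_submatrix, Matrix.submatrix_mul_equiv,
    Matrix.submatrix_mul_equiv, Matrix.submatrix_mul_equiv, Fintype.card_congr e]
  congr 1
  exact trace_submatrix_equiv' _ _

theorem coefG_conj_eq {ι : Type} [Fintype ι] [DecidableEq ι] (V : QOp ι) (a b : ι → Fin 4) :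
    coefG (V.conjTranspose * pauliG a * V) b = conjCoeff V (pauliG a) (pauliG b) := by
  rw [coefG, conjCoeff, Fintype.card_pi]
  simp

/-- Conjugation fixes the identity. For a traceless B this says that a gate creates no letters where
there were none. -/
theorem conjCoeff_one {m : Type} [Fintype m] [DecidableEq m] {g : Matrix m m ℂ}
    (hg : g ∈ Matrix.unitaryGroup m ℂ) (B : Matrix m m ℂ) :
    conjCoeff g 1 B = B.trace / Fintype.card m := by
  rw [conjCoeff, mul_one, ← Matrix.star_eq_conjTranspose, Matrix.mem_unitaryGroup_iff'.mp hg,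
    one_mul]

/-- The Pauli operators of two qubits, in the order of `matrixEntries`. -/
noncomputable def pairPauli (a : Fin 4 × Fin 4) : Matrix (Fin (2 * 2)) (Fin (2 * 2)) ℂ :=
  (sigma a.1 ⊗ₖ sigma a.2).submatrix finProdFinEquiv.symm finProdFinEquiv.symm

theorem pauliG_singleton (q : Fin n) (P : PauliString n) :
    pauliG (restrictString (· ∈ ({q} : Finset (Fin n))) P) =
      (sigma (P q)).submatrix (oneEquiv q) (oneEquiv q) := by
  ext x y
  simp only [pauliG, tensorOp, Matrix.of_apply, Matrix.submatrix_apply]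
  have hu : ∀ i : {i // i ∈ ({q} : Finset (Fin n))}, i = ⟨q, by simp⟩ :=
    fun i => Subtype.ext (Finset.mem_singleton.mp i.2)
  have huniv : (Finset.univ : Finset {i // i ∈ ({q} : Finset (Fin n))}) = {⟨q, by simp⟩} :=
    Finset.eq_singleton_iff_unique_mem.mpr ⟨Finset.mem_univ _, fun i _ => hu i⟩
  rw [huniv, Finset.prod_singleton]
  rfl

theorem pauliG_pair {q p : Fin n} (h : q ≠ p) (P : PauliString n) :
    pauliG (restrictString (· ∈ ({q, p} : Finset (Fin n))) P) =
      (pairPauli (P q, P p)).submatrix ((pairEquiv h).trans finProdFinEquiv)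
        ((pairEquiv h).trans finProdFinEquiv) := by
  ext x y
  simp only [pauliG, tensorOp, Matrix.of_apply, Matrix.submatrix_apply, pairPauli,
    Equiv.trans_apply, Equiv.symm_apply_apply]
  have e : ∏ i : {i // i ∈ ({q, p} : Finset (Fin n))},
      sigma (restrictString (· ∈ ({q, p} : Finset (Fin n))) P i) (x i) (y i) =
      ∏ i ∈ ({q, p} : Finset (Fin n)), if hi : i ∈ ({q, p} : Finset (Fin n)) then
        sigma (P i) (x ⟨i, hi⟩) (y ⟨i, hi⟩) else 1 := by
    rw [← Finset.prod_coe_sort ({q, p} : Finset (Fin n))]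
    refine Finset.prod_congr rfl fun i _ => ?_
    rw [dif_pos i.2]
    rfl
  rw [e, Finset.prod_pair h, dif_pos (by simp), dif_pos (by simp)]
  rfl

theorem restrictString_compl_eq_iff {A : Finset (Fin n)} {P R : PauliString n} :
    restrictString (fun i => ¬ i ∈ A) P = restrictString (fun i => ¬ i ∈ A) R ↔
      ∀ i, i ∉ A → P i = R i := by
  rw [funext_iff, Subtype.forall]
  rfl

theorem trace_sigma (a : Fin 4) : (sigma a).trace = if a = 0 then 2 else 0 := by
  have := trace_sigma_mul a 0
  rwa [sigma_zero, mul_one] at this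

theorem trace_pairPauli (a : Fin 4 × Fin 4) : (pairPauli a).trace = if a = 0 then 4 else 0 := by
  have : (pairPauli a).trace = (sigma a.1 ⊗ₖ sigma a.2).trace :=
    trace_submatrix_equiv' finProdFinEquiv.symm _
  rw [this, Matrix.trace_kronecker, trace_sigma, trace_sigma]
  obtain ⟨a, b⟩ := a
  by_cases ha : a = 0 <;> by_cases hb : b = 0 <;> simp [ha, hb, Prod.ext_iff]
  norm_num

theorem pairPauli_zero : pairPauli 0 = 1 := by
  rw [pairPauli]
  simp only [Prod.fst_zero, Prod.snd_zero, sigma_zero]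
  rw [Matrix.one_kronecker_one, Matrix.submatrix_one_equiv]

theorem coefG_oneGate_conj (q : Fin n) (g : Matrix (Fin 2) (Fin 2) ℂ) (P R : PauliString n) :
    coefG ((extendOp {q} (g.submatrix (oneEquiv q) (oneEquiv q))).conjTranspose * pauliG P *
      extendOp {q} (g.submatrix (oneEquiv q) (oneEquiv q))) R =
      if R = Function.update P q (R q) then conjCoeff g (sigma (P q)) (sigma (R q)) else 0 := by
  rw [coefG_extendOp_conj, coefG_conj_eq, pauliG_singleton, pauliG_singleton, conjCoeff_submatrix]
  have : restrictString (fun i => ¬ i ∈ ({q} : Finset (Fin n))) P =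
      restrictString (fun i => ¬ i ∈ ({q} : Finset (Fin n))) R ↔ R = Function.update P q (R q) := by
    rw [restrictString_compl_eq_iff, eq_comm, Function.update_eq_iff]
    simp
  simp only [this]
  split_ifs <;> simp

/-- Conjugation changes only the letters on the two qubits of the gate, with a coefficient that
depends on these letters alone. The condition on R expresses agreement elsewhere. -/
theorem coefG_twoGate_conj {q p : Fin n} (h : q ≠ p) (g : Matrix (Fin (2 * 2)) (Fin (2 * 2)) ℂ)
    (P R : PauliString n) :
    coefG ((extendOp {q, p} (g.submatrix ((pairEquiv h).trans finProdFinEquiv)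
      ((pairEquiv h).trans finProdFinEquiv))).conjTranspose * pauliG P *
      extendOp {q, p} (g.submatrix ((pairEquiv h).trans finProdFinEquiv)
      ((pairEquiv h).trans finProdFinEquiv))) R =
      if R = Function.update (Function.update P q (R q)) p (R p) then
        conjCoeff g (pairPauli (P q, P p)) (pairPauli (R q, R p)) else 0 := by
  rw [coefG_extendOp_conj, coefG_conj_eq, pauliG_pair h, pauliG_pair h, conjCoeff_submatrix]
  have : restrictString (fun i => ¬ i ∈ ({q, p} : Finset (Fin n))) P =
      restrictString (fun i => ¬ i ∈ ({q, p} : Finset (Fin n))) R ↔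
        R = Function.update (Function.update P q (R q)) p (R p) := by
    rw [restrictString_compl_eq_iff, eq_comm (a := R), Function.update_eq_iff]
    simp only [true_and, Finset.mem_insert, Finset.mem_singleton, not_or, and_imp]
    constructor
    · intro H i hi
      by_cases hiq : i = q
      · subst hiq; simp
      · rw [Function.update_of_ne hiq]; exact H i hiq hi
    · intro H i hiq hi
      have := H i hi
      rwa [Function.update_of_ne hiq] at this
  simp only [this]
  split_ifs <;> simp

end Gate

/-! ## Complex arithmetic in programs -/

/-- A pair of real expressions, for the real and the imaginary part of a complex number. -/
structure ComplexExpr where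
  re : RealExpr
  im : RealExpr

namespace ComplexExpr

/-- Value of a complex expression. -/
noncomputable def eval (σ : Memory) (e : ComplexExpr) : ℂ := ⟨e.re.eval σ, e.im.eval σ⟩

/-- A Gaussian rational. -/
def const (c : ℚ × ℚ) : ComplexExpr := ⟨.const c.1, .const c.2⟩

/-- Complex conjugation. -/
def conj (e : ComplexExpr) : ComplexExpr := ⟨e.re, .sub (.const 0) e.im⟩

/-- Addition. -/
def add (e f : ComplexExpr) : ComplexExpr := ⟨.add e.re f.re, .add e.im f.im⟩

/-- Multiplication. -/
def mul (e f : ComplexExpr) : ComplexExpr :=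
  ⟨.sub (.mul e.re f.re) (.mul e.im f.im), .add (.mul e.re f.im) (.mul e.im f.re)⟩

/-- Sum of a list. -/
def sum : List ComplexExpr → ComplexExpr
  | [] => const 0
  | e :: l => add e (sum l)

variable (σ : Memory)

theorem eval_const (c : ℚ × ℚ) : (const c).eval σ = ⟨(c.1 : ℝ), (c.2 : ℝ)⟩ := rfl

theorem eval_conj (e : ComplexExpr) : e.conj.eval σ = star (e.eval σ) := by
  apply Complex.ext <;> simp [eval, conj, RealExpr.eval]

theorem eval_add (e f : ComplexExpr) : (e.add f).eval σ = e.eval σ + f.eval σ := by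
  apply Complex.ext <;> simp [eval, add, RealExpr.eval]

theorem eval_mul (e f : ComplexExpr) : (e.mul f).eval σ = e.eval σ * f.eval σ := by
  apply Complex.ext <;> simp [eval, mul, RealExpr.eval]

theorem eval_sum (l : List ComplexExpr) : (sum l).eval σ = (l.map (eval σ)).sum := by
  induction l with
  | nil => apply Complex.ext <;> simp [sum, const, eval, RealExpr.eval]
  | cons e l ih => rw [sum, eval_add, ih, List.map_cons, List.sum_cons]

end ComplexExpr

/-! ## Gate entries -/

theorem getD_flatMap_of_length {α β : Type*} (l : List α) (f : α → List β) {c : ℕ}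
    (hf : ∀ a, (f a).length = c) {j : ℕ} (hj : j < l.length) {i : ℕ} (hi : i < c) (x : β) :
    (l.flatMap f).getD (j * c + i) x = (f l[j]).getD i x := by
  induction l generalizing j with
  | nil => simp at hj
  | cons a l ih =>
    rw [List.flatMap_cons]
    cases j with
    | zero =>
      rw [zero_mul, zero_add, List.getD_append _ _ _ _ (by rw [hf]; exact hi)]
      rfl
    | succ j =>
      have e : (j + 1) * c + i = c + (j * c + i) := by ring
      rw [List.getD_append_right _ _ _ _ (by rw [hf]; omega), hf, e, Nat.add_sub_cancel_left,
        ih (by simpa using hj)]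
      rfl

theorem length_flatMap_of_length {α β : Type*} (l : List α) (f : α → List β) {c : ℕ}
    (hf : ∀ a, (f a).length = c) : (l.flatMap f).length = l.length * c := by
  induction l with
  | nil => simp
  | cons a l ih => rw [List.flatMap_cons, List.length_append, ih, hf, List.length_cons]; ring

theorem length_matrixEntries {d : ℕ} (g : Matrix (Fin d) (Fin d) ℂ) :
    (matrixEntries g).length = d * (d * 2) := by
  rw [matrixEntries, length_flatMap_of_length _ _ (c := d * 2), List.length_finRange]
  intro r
  rw [length_flatMap_of_length _ _ (c := 2) fun _ => rfl, List.length_finRange]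

theorem getD_matrixEntries {d : ℕ} (g : Matrix (Fin d) (Fin d) ℂ) (r s : Fin d) {i : ℕ}
    (hi : i < 2) (x : ℝ) : (matrixEntries g).getD (r * (d * 2) + (s * 2 + i)) x =
      [(g r s).re, (g r s).im].getD i x := by
  have hs := s.2
  rw [matrixEntries, getD_flatMap_of_length _ _ (c := d * 2) _ (by simp) (by nlinarith),
    getD_flatMap_of_length _ _ (c := 2) (fun _ => rfl) (by simp) hi]
  · simp
  · intro r
    rw [length_flatMap_of_length _ _ (c := 2) fun _ => rfl, List.length_finRange]

/-- The entries of the gate `g` are in the reply of the circuit subroutine. -/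
structure GateLoaded {d : ℕ} (g : Matrix (Fin d) (Fin d) ℂ) (σ : Memory) : Prop where
  re : ∀ r s : Fin d, σ.reals aLayerReply (r * (d * 2) + (s * 2 + 0)) = (g r s).re
  im : ∀ r s : Fin d, σ.reals aLayerReply (r * (d * 2) + (s * 2 + 1)) = (g r s).im

theorem GateLoaded.congr {d : ℕ} {g : Matrix (Fin d) (Fin d) ℂ} {σ σ' : Memory}
    (h : GateLoaded g σ) (h' : σ'.reals aLayerReply = σ.reals aLayerReply) : GateLoaded g σ' :=
  ⟨by rw [h']; exact h.re, by rw [h']; exact h.im⟩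

/-- An entry of the gate. -/
def gateEntryExpr {d : ℕ} (r s : Fin d) : ComplexExpr :=
  ⟨.read aLayerReply (.const (r * (d * 2) + (s * 2 + 0))),
    .read aLayerReply (.const (r * (d * 2) + (s * 2 + 1)))⟩

theorem GateLoaded.eval {d : ℕ} {g : Matrix (Fin d) (Fin d) ℂ} {σ : Memory} (h : GateLoaded g σ)
    (r s : Fin d) : (gateEntryExpr r s).eval σ = g r s :=
  Complex.ext (h.re r s) (h.im r s)

/-- A matrix of Gaussian rationals. -/
noncomputable def ratMatrix {d : ℕ} (A : Fin d → Fin d → ℚ × ℚ) : Matrix (Fin d) (Fin d) ℂ :=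
  Matrix.of fun r s => ⟨((A r s).1 : ℝ), ((A r s).2 : ℝ)⟩

/-- The coefficient of `B` in the conjugation of `A` by the loaded gate. -/
noncomputable def coefExpr {d : ℕ} (A B : Fin d → Fin d → ℚ × ℚ) : RealExpr :=
  .mul (.const (1 / d)) (ComplexExpr.sum ((Finset.univ :
    Finset (Fin d × Fin d × Fin d × Fin d)).toList.map fun t =>
      ((((gateEntryExpr t.2.2.2 t.1).conj.mul (.const (A t.2.2.2 t.2.2.1))).mul
        (gateEntryExpr t.2.2.1 t.2.1)).mul (.const (B t.2.1 t.1))))).re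

/-- The trace is unrolled into one expression. The programs use it for d = 2 and d = 4 only, so it
is a fixed piece of code. The real part suffices since conjugated Pauli operators are Hermitian. -/
theorem eval_coefExpr {d : ℕ} (A B : Fin d → Fin d → ℚ × ℚ) {g : Matrix (Fin d) (Fin d) ℂ}
    {σ : Memory} (h : GateLoaded g σ) :
    (coefExpr A B).eval σ = (conjCoeff g (ratMatrix A) (ratMatrix B)).re := by
  have e : ∀ e : ComplexExpr, e.re.eval σ = (e.eval σ).re := fun _ => rfl
  rw [coefExpr, RealExpr.eval, e, ComplexExpr.eval_sum, List.map_map, conjCoeff, Fintype.card_fin]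
  have hd : (g.conjTranspose * ratMatrix A * g * ratMatrix B).trace / (d : ℂ) =
      ((1 / d : ℝ) : ℂ) * (g.conjTranspose * ratMatrix A * g * ratMatrix B).trace := by
    push_cast; ring
  rw [hd, Complex.re_ofReal_mul]
  congr 1
  · simp [RealExpr.eval]
  · congr 1
    rw [Finset.sum_map_toList]
    simp only [Fintype.sum_prod_type, Matrix.trace, Matrix.diag, Matrix.mul_apply, Finset.sum_mul]
    refine Finset.sum_congr rfl fun w _ => Finset.sum_congr rfl fun x _ =>
      Finset.sum_congr rfl fun z _ => Finset.sum_congr rfl fun y _ => ?_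
    simp only [Function.comp, ComplexExpr.eval_mul, ComplexExpr.eval_conj, h.eval,
      ComplexExpr.eval_const, Matrix.conjTranspose_apply]
    rfl

/-- The entries of the Pauli matrices. -/
def sigmaRat (a : Fin 4) (r s : Fin 2) : ℚ × ℚ :=
  (![!![(1, 0), (0, 0); (0, 0), (1, 0)], !![(0, 0), (1, 0); (1, 0), (0, 0)],
    !![(0, 0), (0, -1); (0, 1), (0, 0)], !![(1, 0), (0, 0); (0, 0), (-1, 0)]] :
    Fin 4 → Matrix (Fin 2) (Fin 2) (ℚ × ℚ)) a r s

theorem ratMatrix_sigmaRat (a : Fin 4) : ratMatrix (sigmaRat a) = sigma a := by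
  ext r s
  fin_cases a <;> fin_cases r <;> fin_cases s <;>
    apply Complex.ext <;> simp [ratMatrix, sigmaRat, sigma]

/-- The entries of the two-qubit Pauli matrices. -/
def pairRat (a : Fin 4 × Fin 4) (r s : Fin (2 * 2)) : ℚ × ℚ :=
  let u := sigmaRat a.1 (finProdFinEquiv.symm r).1 (finProdFinEquiv.symm s).1
  let v := sigmaRat a.2 (finProdFinEquiv.symm r).2 (finProdFinEquiv.symm s).2
  (u.1 * v.1 - u.2 * v.2, u.1 * v.2 + u.2 * v.1)

theorem ratMatrix_pairRat (a : Fin 4 × Fin 4) : ratMatrix (pairRat a) = pairPauli a := by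
  ext r s
  rw [pairPauli, Matrix.submatrix_apply, Matrix.kronecker_apply, ← ratMatrix_sigmaRat,
    ← ratMatrix_sigmaRat]
  apply Complex.ext <;> simp [ratMatrix, pairRat]

/-! ## Conjugation of table entries by a gate -/

section GateTerms

variable {n : ℕ} {κ : Type} [Fintype κ] [DecidableEq κ] [Zero κ]

/-- The transitions of the letters under a gate; the identity is mapped to itself. -/
def transitions (κ : Type) [Fintype κ] [DecidableEq κ] [Zero κ] : Finset (κ × κ) :=
  Finset.univ.filter fun t => t.1 = 0 → t.2 = 0

/-- The terms of a conjugated Pauli operator whose letters `get` on the qubits of the gate are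
replaced by `put`. -/
noncomputable def gateTerms (get : PauliString n → κ) (put : PauliString n → κ → PauliString n)
    (c : κ → κ → ℂ) (P : PauliString n) : PauliString n → ℝ :=
  ∑ t ∈ transitions κ, if get P = t.1 then Pi.single (put P t.2) (c t.1 t.2).re else 0

/-- The strings that are emitted for `P`. -/
def gateKeys (get : PauliString n → κ) (put : PauliString n → κ → PauliString n)
    (P : PauliString n) : Finset (PauliString n) :=
  (Finset.univ.filter fun b => get P = 0 → b = 0).image (put P)

/-- Transitions from the identity to another letter have coefficient 0 and may be omitted without
changing the operator. Omitting them is essential for the size of the table: otherwise the listed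
strings would spread beyond the light cone. -/
theorem tableOp_gateTerms {get : PauliString n → κ} {put : PauliString n → κ → PauliString n}
    {c : κ → κ → ℂ} (hc : ∀ b, b ≠ 0 → c 0 b = 0) {P : PauliString n}
    (hget : ∀ b, get (put P b) = b) {X : QOp (Fin n)} (hX : X.IsHermitian)
    (hcoef : ∀ R, coefG X R = if R = put P (get R) then c (get P) (get R) else 0) :
    tableOp (gateTerms get put c P) = X := by
  refine tableOp_eq_of_coefG hX fun R => ?_
  rw [hcoef, gateTerms, Finset.sum_apply]
  split_ifs with hR
  · by_cases ht : get P = 0 → get R = 0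
    · rw [Finset.sum_eq_single_of_mem (get P, get R) (by simpa [transitions] using ht)]
      · rw [if_pos rfl, ← hR, Pi.single_eq_same]
      · rintro ⟨a, b⟩ _ hne
        split_ifs with h
        · have hb : R ≠ put P b := by
            intro e
            apply hne
            have h2 : get R = b := by rw [e, hget]
            simp only at h
            rw [h, h2]
          rw [Pi.single_eq_of_ne hb]
        · rfl
    · rw [Classical.not_imp] at ht
      rw [ht.1, hc _ ht.2]
      refine Finset.sum_eq_zero ?_
      rintro ⟨a, b⟩ hab
      split_ifs with h
      · refine Pi.single_eq_of_ne ?_ _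
        intro e
        simp only [transitions, Finset.mem_filter, Finset.mem_univ, true_and] at hab
        simp only at h e
        apply ht.2
        rw [e, hget]
        exact hab h.symm
      · rfl
  · refine Finset.sum_eq_zero ?_
    rintro ⟨a, b⟩ _
    split_ifs with h
    · refine Pi.single_eq_of_ne ?_ _
      intro e
      apply hR
      conv_rhs => rw [e, hget]
      exact e
    · rfl

/-- Emit the string with code `newCode` if `guard` holds. -/
def gateStep (guard : TestExpr) (newCode : IntExpr) (coef : RealExpr) : Program :=
  .ite guard (.assign vOut newCode ;; .assignReal rOut (.mul (.var rVal) coef) ;; emitProg) .skip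

/-- Conjugate the current entry by a gate. -/
noncomputable def gateBody (guard : κ → TestExpr) (newCode : κ × κ → IntExpr)
    (coef : κ × κ → RealExpr) : Program :=
  decodeProg ;; Program.seqAll ((transitions κ).toList.map fun t =>
    gateStep (guard t.1) (newCode t) (coef t))

/-- The list of transitions comes from a noncomputable enumeration of a finite set, so its targets
cannot be evaluated. They are included in an explicit list, to which `decide` applies. -/
theorem intTargets_gateBody (guard : κ → TestExpr) (newCode : κ × κ → IntExpr)
    (coef : κ × κ → RealExpr) : (gateBody guard newCode coef).intTargets ⊆
      decodeProg.intTargets ++ [vOut, aMark, aNew, aNewLen] := by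
  rw [gateBody, Program.intTargets, Program.intTargets_seqAll]
  refine List.append_subset.mpr ⟨List.subset_append_left _ _, ?_⟩
  intro a ha
  rw [List.mem_flatMap] at ha
  obtain ⟨p, hp, ha⟩ := ha
  obtain ⟨t, -, rfl⟩ := List.mem_map.mp hp
  exact List.mem_append_right _ ha

theorem realTargets_gateBody (guard : κ → TestExpr) (newCode : κ × κ → IntExpr)
    (coef : κ × κ → RealExpr) : (gateBody guard newCode coef).realTargets ⊆ [rOut, rNew] := by
  rw [gateBody, Program.realTargets, Program.realTargets_seqAll]
  refine List.append_subset.mpr ⟨List.nil_subset _, ?_⟩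
  intro a ha
  rw [List.mem_flatMap] at ha
  obtain ⟨p, hp, ha⟩ := ha
  obtain ⟨t, -, rfl⟩ := List.mem_map.mp hp
  exact ha

theorem runs_gateBody (S : Subroutines) {guard : κ → TestExpr} {newCode : κ × κ → IntExpr}
    {coef : κ × κ → RealExpr} {get : PauliString n → κ}
    {put : PauliString n → κ → PauliString n} {c : κ → κ → ℂ} {σ₀ : Memory} (hR : Ready n σ₀)
    {P : PauliString n} (hP : σ₀.ints vCode 0 = PauliString.code P) {x : ℝ}
    (hx : σ₀.reals rVal 0 = x) {s : Finset (PauliString n)} {f : PauliString n → ℝ}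
    (hN : NewTable σ₀ s f)
    (hguard : ∀ a σ, Decoded P σ → σ.ints vQubit = σ₀.ints vQubit →
      σ.ints aLayerReply = σ₀.ints aLayerReply → ((guard a).Holds σ ↔ get P = a))
    (hcode : ∀ b σ, σ.ints vCode = σ₀.ints vCode → σ.ints aPow = σ₀.ints aPow →
      σ.ints vQubit = σ₀.ints vQubit → σ.ints aLayerReply = σ₀.ints aLayerReply →
      (newCode (get P, b)).eval σ = PauliString.code (put P b))
    (hcoef : ∀ t σ, σ.reals aLayerReply = σ₀.reals aLayerReply →
      (coef t).eval σ = (c t.1 t.2).re) :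
    Runs S (gateBody guard newCode coef) σ₀
      (n * 11 + 4 + (Fintype.card κ * Fintype.card κ * 8 + 1)) fun σ' => ∃ s',
      s' ⊆ s ∪ gateKeys get put P ∧ NewTable σ' s' (f + x • gateTerms get put c P) := by
  have hlen : (transitions κ).toList.length ≤ Fintype.card κ * Fintype.card κ := by
    rw [Finset.length_toList, ← Fintype.card_prod]
    exact Finset.card_le_univ _
  refine (Runs.seq (T := n * 11 + 4) (T' := (transitions κ).toList.length * 8 + 1)
    ((runs_decodeProg S hR hP).mono le_rfl ?_)).le
      (Nat.add_le_add_left (Nat.add_le_add_right (Nat.mul_le_mul_right _ hlen) _) _)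
  rintro σ₁ - ⟨hD, -⟩ hA₁
  have hN₁ : NewTable σ₁ s f := hN.congr (hA₁.ints _ (by decide)) (hA₁.ints _ (by decide))
    (hA₁.reals _ (by decide)) (hA₁.ints _ (by decide))
  have hsum : x • gateTerms get put c P = ((transitions κ).toList.map fun t =>
      if get P = t.1 then Pi.single (put P t.2) (x * (c t.1 t.2).re) else 0).sum := by
    rw [Finset.sum_map_toList, gateTerms, Finset.smul_sum]
    refine Finset.sum_congr rfl fun t _ => ?_
    split_ifs
    · rw [← Pi.single_smul, smul_eq_mul]
    · simp
  rw [hsum]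
  -- The targets of `gateStep` do not depend on its arguments, so a dummy instance serves as the
  -- common frame.
  refine runs_seqAll_emit S (fun t : κ × κ => gateStep (guard t.1) (newCode t) (coef t)) _ _ 8
    (gateStep (.intLt (.const 0) (.const 0)) (.const 0) (.const 0)) σ₁ _ ?_ ?_ (Agree.refl _ _) hN₁
  · exact fun t _ => ⟨List.Subset.refl _, List.Subset.refl _⟩
  · rintro ⟨a, b⟩ hab σ s₂ f₂ hA hN₂
    have hv : ∀ a ∈ [vQubit, aLayerReply, vCode, aPow], σ.ints a = σ₀.ints a := by
      intro a ha
      simp only [List.mem_cons, List.not_mem_nil, or_false] at ha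
      rcases ha with rfl | rfl | rfl | rfl <;>
        rw [hA.ints _ (by decide), hA₁.ints _ (by decide)]
    have hvr : σ.reals aLayerReply = σ₀.reals aLayerReply := by
      rw [hA.reals _ (by decide), hA₁.reals _ (by decide)]
    have hcond := hguard a σ (hD.congr (hA.ints _ (by decide)) (hA.ints _ (by decide))
      (hA.ints _ (by decide))) (hv _ (by simp)) (hv _ (by simp))
    refine Runs.ite (T := 7) (fun hb => ?_) fun hb => ?_
    · rw [hcond] at hb
      simp only [if_pos hb]
      subst hb
      refine Runs.seqInt (Runs.seqReal ((runs_emitProg S (Q := put P b)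
        (x := x * (c (get P) b).re)
        (hN₂.congr (by simp) (by simp) (by simp) (by simp)) ?_ ?_).mono le_rfl ?_))
      · simp only [IntExpr.eval, Memory.setReal_ints, Memory.setInt_ints, Function.update_self]
        exact hcode b σ (hv _ (by simp)) (hv _ (by simp)) (hv _ (by simp)) (hv _ (by simp))
      · simp only [RealExpr.eval, IntExpr.eval, Memory.setReal_reals, Function.update_self,
          Memory.setInt_reals]
        rw [hA.reals rVal (by decide), hA₁.reals rVal (by decide), hx,
          hcoef (get P, b) _ (by simpa using hvr)]
      · intro σ' _ h
        refine ⟨_, ?_, h⟩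
        rw [Finset.insert_eq, Finset.union_comm]
        refine Finset.union_subset_union le_rfl ?_
        rw [Finset.singleton_subset_iff, gateKeys, Finset.mem_image]
        refine ⟨b, ?_, rfl⟩
        simpa [transitions] using hab
    · rw [hcond] at hb
      simp only [if_neg hb, add_zero]
      exact (Runs.skip ⟨s₂, Finset.subset_union_left, hN₂⟩).le (by norm_num)

end GateTerms

/-! ## Sweeps with single gates -/

/-- The letter at position `i` of the decoded string is `a`. -/
def digitTest (i : IntExpr) (a : ℕ) : TestExpr :=
  .conj (.neg (.intLt (.read aBuf i) (.const a))) (.neg (.intLt (.const a) (.read aBuf i)))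

/-- The code `e` after the letter at position `i` has been changed from `a` to `b`. -/
def shiftCode (e i : IntExpr) (a b : ℕ) : IntExpr :=
  .sub (.add e (IntExpr.times b (.read aPow i))) (IntExpr.times a (.read aPow i))

/-- Conjugation of the current entry by a single-qubit gate. -/
noncomputable def oneGateBody : Program :=
  gateBody (κ := Fin 4) (fun a => digitTest (.var vQubit) a)
    (fun t => shiftCode (.var vCode) (.var vQubit) t.1 t.2)
    (fun t => coefExpr (sigmaRat t.1) (sigmaRat t.2))

/-- Conjugation of the current entry by a two-qubit gate. -/
noncomputable def twoGateBody : Program :=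
  gateBody (κ := Fin 4 × Fin 4)
    (fun a => .conj (digitTest (.var vQubit) a.1) (digitTest (.var aLayerReply) a.2))
    (fun t => shiftCode (shiftCode (.var vCode) (.var vQubit) t.1.1 t.2.1) (.var aLayerReply)
      t.1.2 t.2.2)
    (fun t => coefExpr (pairRat t.1) (pairRat t.2))

/-- Conjugation of the current table by the gate stored at `vQubit` in layer `vLayer`. -/
noncomputable def gateProg : Program :=
  .setInt aQuery (.const 0) (.var vLayer) ;; .setInt aQuery (.const 1) (.var vQubit) ;;
    .call 0 aQuery (.const 2) aLayerReply ;;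
    .ite (.intLt (.var vQubit) (.var aLayerReply)) (sweepProg twoGateBody)
      (.ite (.intLt (.var aLayerReply) (.var vQubit)) .skip (sweepProg oneGateBody))

section GateSweep

variable {n : ℕ} {κ : Type} [Fintype κ] [DecidableEq κ] [Zero κ]

theorem intTargets_sweepProg_gateBody (guard : κ → TestExpr) (newCode : κ × κ → IntExpr)
    (coef : κ × κ → RealExpr) : (sweepProg (gateBody guard newCode coef)).intTargets ⊆
      (vSweepLoop :: (vCode :: (decodeProg.intTargets ++ [vOut, aMark, aNew, aNewLen]) ++
        [vSweepLoop])) ++ swapProg.intTargets := by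
  have hg := intTargets_gateBody guard newCode coef
  rw [intTargets_sweepProg]
  intro a h
  simp only [List.mem_append, List.mem_cons] at h ⊢
  rcases h with (h | (h | h) | h) | h
  · tauto
  · tauto
  · have := hg h
    simp only [List.mem_append, List.mem_cons] at this
    tauto
  · tauto
  · tauto

theorem realTargets_sweepProg_gateBody (guard : κ → TestExpr) (newCode : κ × κ → IntExpr)
    (coef : κ × κ → RealExpr) : (sweepProg (gateBody guard newCode coef)).realTargets ⊆
      (rVal :: [rOut, rNew]) ++ swapProg.realTargets := by
  have hg := realTargets_gateBody guard newCode coef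
  rw [realTargets_sweepProg]
  intro a h
  simp only [List.mem_append, List.mem_cons] at h ⊢
  rcases h with ((h | h) | h) | h
  · tauto
  · have := hg h
    simp only [List.mem_cons] at this
    tauto
  · simp at h
  · tauto

theorem runs_sweepProg_gateBody (S : Subroutines) {guard : κ → TestExpr}
    {newCode : κ × κ → IntExpr} {coef : κ × κ → RealExpr} {get : PauliString n → κ}
    {put : PauliString n → κ → PauliString n} {c : κ → κ → ℂ} {σ₀ : Memory} (hR : Ready n σ₀)
    {s K : Finset (PauliString n)} {f : PauliString n → ℝ} (hC : CurTable σ₀ s f)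
    (hN : NewTable σ₀ (∅ : Finset (PauliString n)) 0) (hK : ∀ P ∈ s, gateKeys get put P ⊆ K)
    {B : ℕ} (hs : s.card ≤ B) (hB : K.card ≤ B) (hκ : Fintype.card κ ≤ 16)
    (hguard : ∀ P a σ, Decoded P σ → σ.ints vQubit = σ₀.ints vQubit →
      σ.ints aLayerReply = σ₀.ints aLayerReply → ((guard a).Holds σ ↔ get P = a))
    (hcode : ∀ P b σ, σ.ints vCode 0 = PauliString.code P → σ.ints aPow = σ₀.ints aPow →
      σ.ints vQubit = σ₀.ints vQubit → σ.ints aLayerReply = σ₀.ints aLayerReply →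
      (newCode (get P, b)).eval σ = PauliString.code (put P b))
    (hcoef : ∀ t σ, σ.reals aLayerReply = σ₀.reals aLayerReply →
      (coef t).eval σ = (c t.1 t.2).re) :
    Runs S (sweepProg (gateBody guard newCode coef)) σ₀ (B * (n * 11 + 2070) + 10) fun σ' =>
      ∃ s' ⊆ K, CurTable σ' s' (∑ P ∈ s, f P • gateTerms get put c P) ∧
        NewTable σ' (∅ : Finset (PauliString n)) 0 := by
  have hsub : ∀ a ∈ [aPow, 0, vQubit, aLayerReply],
      a ∉ (sweepProg (gateBody guard newCode coef)).intTargets := by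
    intro a ha h
    have := intTargets_sweepProg_gateBody guard newCode coef h
    clear * - ha this
    revert a
    decide
  have hsubr : aLayerReply ∉ (sweepProg (gateBody guard newCode coef)).realTargets := fun h =>
    absurd (realTargets_sweepProg_gateBody guard newCode coef h) (by decide)
  have hKs : s.biUnion (gateKeys get put) ⊆ K := Finset.biUnion_subset.mpr hK
  refine (runs_sweepProg S ?_ ?_ hC hN (gateTerms get put c) (gateKeys get put)
    (n * 11 + 4 + (Fintype.card κ * Fintype.card κ * 8 + 1)) B
    ((Finset.card_le_card hKs).trans hB) ?_).mono ?_ ?_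
  · intro a ha h
    have := intTargets_gateBody guard newCode coef h
    clear * - ha this
    revert a
    decide
  · exact fun h => absurd (realTargets_gateBody _ _ _ h) (by decide)
  · intro P _ σ s₂ f₂ hA hP hx hN'
    refine runs_gateBody S (hR.congr (hA.ints _ (hsub _ (by simp)))
      (hA.ints _ (hsub _ (by simp)))) hP hx hN' ?_ ?_ ?_
    · intro a σ' hD h1 h2
      exact hguard P a σ' hD (h1.trans (hA.ints _ (hsub _ (by simp))))
        (h2.trans (hA.ints _ (hsub _ (by simp))))
    · intro b σ' h1 h2 h3 h4
      exact hcode P b σ' (by rw [h1, hP]) (h2.trans (hA.ints _ (hsub _ (by simp))))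
        (h3.trans (hA.ints _ (hsub _ (by simp)))) (h4.trans (hA.ints _ (hsub _ (by simp))))
    · intro t σ' h
      exact hcoef t σ' (h.trans (hA.reals _ hsubr))
  -- At most 16² transitions of cost 8 give 2048. With the decoding and the sweep this makes 2063
  -- per entry, and the exchange of the tables adds 7.
  · have h0 : Fintype.card κ * Fintype.card κ ≤ 16 * 16 := Nat.mul_le_mul hκ hκ
    have h1 : s.card * (n * 11 + 4 + (Fintype.card κ * Fintype.card κ * 8 + 1) + 10) ≤
        B * (n * 11 + 2063) := Nat.mul_le_mul hs (by omega)
    have h2 : B * (n * 11 + 2070) = B * (n * 11 + 2063) + B * 7 := by ring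
    omega
  · rintro σ' - ⟨s', hs', h⟩
    exact ⟨s', hs'.trans hKs, h⟩

end GateSweep

/-! ### Strings within one layer and correctness of a single gate. -/

section

variable {n : ℕ}

theorem holds_digitTest {P : PauliString n} {σ : Memory} (hD : Decoded P σ) {i : IntExpr}
    {q : Fin n} (hi : i.eval σ = q) (a : Fin 4) : (digitTest i a).Holds σ ↔ P q = a := by
  have h : σ.ints aBuf q = P q := by
    rw [hD.buf q q.2, PauliString.digit_val]
  simp only [digitTest, TestExpr.Holds, IntExpr.eval, hi, h, Fin.ext_iff]
  omega

/-- The new digit is added before the old one is removed, because the subtraction of the machine is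
truncated at 0. -/
theorem eval_shiftCode {P : PauliString n} {σ : Memory} {e i : IntExpr} {q : Fin n}
    (he : e.eval σ = PauliString.code P) (hi : i.eval σ = q)
    (hp : σ.ints aPow q = 4 ^ (q : ℕ)) (b : Fin 4) :
    (shiftCode e i (P q) b).eval σ = PauliString.code (Function.update P q b) := by
  have := PauliString.code_update P q b
  simp only [shiftCode, IntExpr.eval, IntExpr.eval_times, he, hi, hp]
  omega

theorem tableOp_sweep_conj {s : Finset (PauliString n)} {f : PauliString n → ℝ}
    (hf : ∀ P, P ∉ s → f P = 0) (V : QOp (Fin n)) {g : PauliString n → PauliString n → ℝ}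
    (hg : ∀ P, tableOp (g P) = V.conjTranspose * pauliG P * V) :
    tableOp (∑ P ∈ s, f P • g P) = V.conjTranspose * tableOp f * V := by
  rw [tableOp_sum_smul, tableOp, Finset.mul_sum, Finset.sum_mul,
    ← Finset.sum_subset (Finset.subset_univ s)]
  · refine Finset.sum_congr rfl fun P _ => ?_
    rw [hg P, Matrix.mul_smul, Matrix.smul_mul]
  · intro P _ hP
    simp [hf P hP]

/-- Strings that can arise from `T` in a layer in which the qubits are paired by `p`. -/
def spread (p : Fin n → Fin n) (T : Finset (PauliString n)) : Finset (PauliString n) :=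
  Finset.univ.filter fun Q => ∃ P ∈ T, ∀ i, Q i ≠ 0 → P i ≠ 0 ∨ P (p i) ≠ 0

theorem mem_spread {p : Fin n → Fin n} {T : Finset (PauliString n)} {Q : PauliString n} :
    Q ∈ spread p T ↔ ∃ P ∈ T, ∀ i, Q i ≠ 0 → P i ≠ 0 ∨ P (p i) ≠ 0 := by
  simp [spread]

theorem subset_spread (p : Fin n → Fin n) (T : Finset (PauliString n)) : T ⊆ spread p T :=
  fun P hP => mem_spread.mpr ⟨P, hP, fun _ h => Or.inl h⟩

/-- The letter on one qubit. -/
def oneGet (q : Fin n) (P : PauliString n) : Fin 4 := P q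

/-- Replace the letter on one qubit. -/
def onePut (q : Fin n) (P : PauliString n) (b : Fin 4) : PauliString n := Function.update P q b

/-- The letters on two qubits. -/
def twoGet (q p : Fin n) (P : PauliString n) : Fin 4 × Fin 4 := (P q, P p)

/-- Replace the letters on two qubits. -/
def twoPut (q p : Fin n) (P : PauliString n) (b : Fin 4 × Fin 4) : PauliString n :=
  Function.update (Function.update P q b.1) p b.2

/-- `spread p T` is closed under every gate of the layer, for single-qubit gates here and for pairs
below. All tables between two gates of a layer thus lie in one set, and their sizes do not multiply
from gate to gate. -/
theorem oneKeys_subset {p : Fin n → Fin n} {T : Finset (PauliString n)} {q : Fin n}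
    {P : PauliString n} (hP : P ∈ spread p T) :
    gateKeys (oneGet q) (onePut q) P ⊆ spread p T := by
  intro Q hQ
  simp only [gateKeys, Finset.mem_image, oneGet,
    onePut] at hQ
  obtain ⟨b, hb', rfl⟩ := hQ
  have hb := (Finset.mem_filter.mp hb').2
  obtain ⟨R, hR, h⟩ := mem_spread.mp hP
  refine mem_spread.mpr ⟨R, hR, fun i hi => h i ?_⟩
  by_cases hiq : i = q
  · subst hiq
    rw [Function.update_self] at hi
    exact fun h0 => hi (hb h0)
  · rwa [Function.update_of_ne hiq] at hi

theorem twoKeys_subset {p : Fin n → Fin n} (hp : ∀ i, p (p i) = i) {T : Finset (PauliString n)}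
    {q : Fin n} {P : PauliString n} (hP : P ∈ spread p T) :
    gateKeys (twoGet q (p q)) (twoPut q (p q)) P ⊆ spread p T := by
  intro Q hQ
  simp only [gateKeys, Finset.mem_image, twoGet,
    twoPut] at hQ
  obtain ⟨b, hb', rfl⟩ := hQ
  have hb := (Finset.mem_filter.mp hb').2
  obtain ⟨R, hR, h⟩ := mem_spread.mp hP
  refine mem_spread.mpr ⟨R, hR, fun i hi => ?_⟩
  -- New letters appear on a pair only if the pair already carried one. That letter comes from R on
  -- the same pair, since the partner map is an involution.
  have hblock : b ≠ 0 → (R q ≠ 0 ∨ R (p q) ≠ 0) := by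
    intro hb0
    have h1 : ¬ (P q = 0 ∧ P (p q) = 0) := by
      rintro ⟨h1, h2⟩
      exact hb0 (hb (Prod.ext h1 h2))
    by_cases h2 : P q = 0
    · have h3 : P (p q) ≠ 0 := fun h3 => h1 ⟨h2, h3⟩
      have := h _ h3
      rw [hp] at this
      exact this.symm
    · exact h _ h2
  by_cases hip : i = p q
  · subst hip
    rw [Function.update_self] at hi
    rw [hp]
    exact (hblock fun h0 => hi (by rw [h0]; rfl)).symm
  · rw [Function.update_of_ne hip] at hi
    by_cases hiq : i = q
    · subst hiq
      rw [Function.update_self] at hi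
      exact hblock fun h0 => hi (by rw [h0]; rfl)
    · rw [Function.update_of_ne hiq] at hi
      exact h i hi

theorem tableOp_oneGate (q : Fin n) {g : Matrix (Fin 2) (Fin 2) ℂ}
    (hg : g ∈ Matrix.unitaryGroup (Fin 2) ℂ) (P : PauliString n) :
    tableOp (gateTerms (oneGet q) (onePut q) (fun a b => conjCoeff g (sigma a) (sigma b)) P) =
      (extendOp {q} (g.submatrix (oneEquiv q) (oneEquiv q))).conjTranspose * pauliG P *
        extendOp {q} (g.submatrix (oneEquiv q) (oneEquiv q)) := by
  refine tableOp_gateTerms ?_ ?_ (isHermitian_conj (isHermitian_pauliG P) _) ?_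
  · intro b hb
    rw [sigma_zero, conjCoeff_one hg, trace_sigma, if_neg hb, zero_div]
  · intro b
    simp [oneGet, onePut]
  · exact coefG_oneGate_conj q g P

theorem tableOp_twoGate {q p : Fin n} (h : q ≠ p) {g : Matrix (Fin (2 * 2)) (Fin (2 * 2)) ℂ}
    (hg : g ∈ Matrix.unitaryGroup (Fin (2 * 2)) ℂ) (P : PauliString n) :
    tableOp (gateTerms (twoGet q p) (twoPut q p)
      (fun a b => conjCoeff g (pairPauli a) (pairPauli b)) P) =
      (extendOp {q, p} (g.submatrix ((pairEquiv h).trans finProdFinEquiv)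
        ((pairEquiv h).trans finProdFinEquiv))).conjTranspose * pauliG P *
        extendOp {q, p} (g.submatrix ((pairEquiv h).trans finProdFinEquiv)
        ((pairEquiv h).trans finProdFinEquiv)) := by
  refine tableOp_gateTerms ?_ ?_ (isHermitian_conj (isHermitian_pauliG P) _) ?_
  · intro b hb
    rw [pairPauli_zero, conjCoeff_one hg, trace_pairPauli, if_neg hb, zero_div]
  · intro b
    simp [twoGet, twoPut, h]
  · exact coefG_twoGate_conj h g P

theorem submatrix_mem_unitaryGroup {m m' : Type} [Fintype m] [DecidableEq m] [Fintype m']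
    [DecidableEq m'] {g : Matrix m m ℂ} (hg : g ∈ Matrix.unitaryGroup m ℂ) (e : m' ≃ m) :
    g.submatrix e e ∈ Matrix.unitaryGroup m' ℂ := by
  rw [Matrix.mem_unitaryGroup_iff] at hg ⊢
  rw [Matrix.star_eq_conjTranspose] at hg ⊢
  rw [Matrix.conjTranspose_submatrix, Matrix.submatrix_mul_equiv, hg, Matrix.submatrix_one_equiv]

theorem prefixLayer_conj_succ {L : ℕ} {G : SimpleGraph (Fin n)} {d : LocalCircuit G L} {j : Fin L}
    {t : Fin n} {V X Y Z : QOp (Fin n)}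
    (hV : d.prefixLayer j (t + 1) = d.prefixLayer j t * V)
    (hY : Y = (d.prefixLayer j t).conjTranspose * X * d.prefixLayer j t)
    (hZ : Z = V.conjTranspose * Y * V) :
    Z = (d.prefixLayer j (t + 1)).conjTranspose * X * d.prefixLayer j (t + 1) := by
  rw [hZ, hY, hV, Matrix.conjTranspose_mul]
  simp only [mul_assoc]

theorem prefixLayer_succ_one {L : ℕ} {G : SimpleGraph (Fin n)} {d : LocalCircuit G L} {j : Fin L}
    {t : Fin n} (ht : d.partner j t = t) : d.prefixLayer j (t + 1) = d.prefixLayer j t *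
      extendOp {t} ((d.one j t).1.submatrix (oneEquiv t) (oneEquiv t)) := by
  refine LocalCircuit.prefixLayer_succ ht.ge (by simp [ht]) fun x y => ?_
  rw [LocalCircuit.factor, if_pos ht]
  rfl

/-- A two-qubit gate in the basis `00, 01, 10, 11`. -/
noncomputable def LocalCircuit.twoMatrix {L : ℕ} {G : SimpleGraph (Fin n)} (d : LocalCircuit G L)
    (j : Fin L) (q : Fin n) : Matrix (Fin (2 * 2)) (Fin (2 * 2)) ℂ :=
  (d.two j q).1.submatrix finProdFinEquiv.symm finProdFinEquiv.symm

theorem prefixLayer_succ_two {L : ℕ} {G : SimpleGraph (Fin n)} {d : LocalCircuit G L} {j : Fin L}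
    {t : Fin n} (ht : t < d.partner j t) : d.prefixLayer j (t + 1) = d.prefixLayer j t *
      extendOp {t, d.partner j t} ((d.twoMatrix j t).submatrix
        ((pairEquiv ht.ne).trans finProdFinEquiv) ((pairEquiv ht.ne).trans finProdFinEquiv)) := by
  refine LocalCircuit.prefixLayer_succ ht.le (by simp) fun x y => ?_
  rw [LocalCircuit.factor, if_neg ht.ne', if_pos ht]
  simp only [LocalCircuit.twoMatrix, Matrix.submatrix_apply, Equiv.trans_apply,
    Equiv.symm_apply_apply]
  rfl

theorem length_gateEntries_le {L : ℕ} {G : SimpleGraph (Fin n)} (d : LocalCircuit G L)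
    (j : Fin L) (q : Fin n) : (d.gateEntries j q).length ≤ 32 := by
  rw [LocalCircuit.gateEntries]
  split_ifs
  · rw [length_matrixEntries]; norm_num
  · exact (length_matrixEntries _).le
  · simp

theorem gateLoaded_of_entries {d : ℕ} {g : Matrix (Fin d) (Fin d) ℂ} {σ : Memory} {h : ℕ → ℝ}
    (hσ : ∀ i, σ.reals aLayerReply i = (matrixEntries g).getD i (h i)) : GateLoaded g σ := by
  constructor <;> intro r s <;> rw [hσ, getD_matrixEntries g r s (by norm_num)] <;> rfl

/-- Comparing q with its partner distinguishes a two-qubit gate stored here, one that was applied at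
the smaller partner, and a single-qubit gate. In each case the table advances from the prefix q of
the layer to the prefix q + 1. -/
theorem runs_gateProg {S : Subroutines} {L : ℕ} {G : SimpleGraph (Fin n)} {d : LocalCircuit G L}
    {j : Fin L} {q : Fin n}
    (hS : S 0 [(j : ℕ), (q : ℕ)] = ⟨[(d.partner j q : ℕ)], d.gateEntries j q, 0⟩) {σ₀ : Memory}
    (hR : Ready n σ₀) (hj : σ₀.ints vLayer 0 = j) (hq : σ₀.ints vQubit 0 = q)
    {s : Finset (PauliString n)} {f : PauliString n → ℝ} (hC : CurTable σ₀ s f)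
    (hN : NewTable σ₀ (∅ : Finset (PauliString n)) 0) {T : Finset (PauliString n)}
    (hs : s ⊆ spread (d.partner j) T) {B : ℕ} (hB : (spread (d.partner j) T).card ≤ B)
    {X : QOp (Fin n)}
    (hX : tableOp f = (d.prefixLayer j q).conjTranspose * X * d.prefixLayer j q) :
    Runs S gateProg σ₀ (B * (n * 11 + 2070) + 50) fun σ' => ∃ s' f', s' ⊆ spread (d.partner j) T ∧
      CurTable σ' s' f' ∧ NewTable σ' (∅ : Finset (PauliString n)) 0 ∧
      tableOp f' = (d.prefixLayer j (q + 1)).conjTranspose * X * d.prefixLayer j (q + 1) := by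
  refine Runs.seqInt (T := B * (n * 11 + 2070) + 49)
    (Runs.seqInt (T := B * (n * 11 + 2070) + 48) ?_)
  set σ₁ := (σ₀.setInt aQuery ((IntExpr.const 0).eval σ₀) ((IntExpr.var vLayer).eval σ₀)).setInt
    aQuery ((IntExpr.const 1).eval (σ₀.setInt aQuery ((IntExpr.const 0).eval σ₀)
      ((IntExpr.var vLayer).eval σ₀))) ((IntExpr.var vQubit).eval (σ₀.setInt aQuery
        ((IntExpr.const 0).eval σ₀) ((IntExpr.var vLayer).eval σ₀))) with hσ₁
  have hi : ∀ a, a ≠ aQuery → σ₁.ints a = σ₀.ints a := by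
    intro a ha
    simp [hσ₁, ha]
  have hr : σ₁.reals = σ₀.reals := rfl
  refine (Runs.seq (T := 36) (T' := (B * (n * 11 + 2070) + 10) + 1 + 1)
    ((Runs.call (T := 36) (r := ⟨[(d.partner j q : ℕ)], d.gateEntries j q, 0⟩)
      (Q := fun σ => σ.ints aLayerReply 0 = d.partner j q ∧
        ∀ i, σ.reals aLayerReply i = (d.gateEntries j q).getD i (σ₁.reals aLayerReply i))
      ?_ ?_ ?_).mono le_rfl ?_)).le (by omega)
  · rw [← hS]
    congr 1
    simp [Memory.readBlock, IntExpr.eval, hσ₁, List.range_succ, hj, hq]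
  · have := length_gateEntries_le d j q
    simp only [IntExpr.eval, List.length_cons, List.length_nil]
    omega
  · refine ⟨by simp [Memory.writeReply], fun i => ?_⟩
    simp only [Memory.writeReply, Function.update_self]
  rintro σ₂ - ⟨hp, he⟩ hA₂
  have hR₂ : Ready n σ₂ := hR.congr (by rw [hA₂.ints _ (by decide), hi _ (by decide)])
    (by rw [hA₂.ints _ (by decide), hi _ (by decide)])
  have hC₂ : CurTable σ₂ s f := hC.congr (by rw [hA₂.ints _ (by decide), hi _ (by decide)])
    (by rw [hA₂.ints _ (by decide), hi _ (by decide)]) (by rw [hA₂.reals _ (by decide), hr])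
  have hN₂ : NewTable σ₂ (∅ : Finset (PauliString n)) 0 :=
    hN.congr (by rw [hA₂.ints _ (by decide), hi _ (by decide)])
    (by rw [hA₂.ints _ (by decide), hi _ (by decide)]) (by rw [hA₂.reals _ (by decide), hr])
    (by rw [hA₂.ints _ (by decide), hi _ (by decide)])
  have hq₂ : σ₂.ints vQubit 0 = q := by rw [hA₂.ints _ (by decide), hi _ (by decide), hq]
  have hpow : ∀ r : Fin n, σ₂.ints aPow r = 4 ^ (r : ℕ) := fun r => hR₂.pow r r.2.le
  have hsB := (Finset.card_le_card hs).trans hB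
  refine Runs.ite (fun hb => (?_ : Runs S _ σ₂ (B * (n * 11 + 2070) + 10) _).le (by omega))
    fun hb => Runs.ite (fun hb' => ?_) fun hb' => ?_
  · simp only [TestExpr.Holds, IntExpr.eval, hp, hq₂] at hb
    have hlt : q < d.partner j q := hb
    have hg : GateLoaded (d.twoMatrix j q) σ₂ := by
      refine gateLoaded_of_entries (h := σ₁.reals aLayerReply) fun i => ?_
      rw [he, LocalCircuit.gateEntries, if_neg hlt.ne', if_pos hlt]
      rfl
    refine (runs_sweepProg_gateBody S (get := twoGet q (d.partner j q))
      (put := twoPut q (d.partner j q)) (c := fun a b =>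
        conjCoeff (d.twoMatrix j q) (pairPauli a) (pairPauli b)) hR₂ hC₂ hN₂
      (fun P hP => twoKeys_subset (d.partner_partner j) (hs hP)) hsB hB (by simp) ?_ ?_ ?_).mono
      le_rfl ?_
    · intro P a σ' hD h1 h2
      have e1 : (IntExpr.var vQubit).eval σ' = q := by
        simp only [IntExpr.eval]
        rw [h1, hq₂]
      have e2 : (IntExpr.var aLayerReply).eval σ' = d.partner j q := by
        simp only [IntExpr.eval]
        rw [h2, hp]
      simp only [TestExpr.Holds, holds_digitTest hD e1, holds_digitTest hD e2, twoGet,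
        Prod.ext_iff]
    · intro P b σ' h1 h2 h3 h4
      have e1 : (IntExpr.var vQubit).eval σ' = q := by
        simp only [IntExpr.eval]
        rw [h3, hq₂]
      have e2 : (IntExpr.var aLayerReply).eval σ' = d.partner j q := by
        simp only [IntExpr.eval]
        rw [h4, hp]
      have e3 : ∀ r : Fin n, σ'.ints aPow r = 4 ^ (r : ℕ) := by
        intro r
        rw [h2, hpow]
      have e4 : (IntExpr.var vCode).eval σ' = PauliString.code P := h1
      -- The second shift starts from the string already changed at q. Its letter at the partner is
      -- still the old one, as the two qubits differ.
      have e5 : P (d.partner j q) = Function.update P q b.1 (d.partner j q) := by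
        rw [Function.update_of_ne hlt.ne']
      simp only [twoGet, twoPut]
      rw [e5]
      exact eval_shiftCode (eval_shiftCode e4 e1 (e3 _) b.1) e2 (e3 _) b.2
    · intro t σ' h
      rw [eval_coefExpr _ _ (hg.congr h), ratMatrix_pairRat, ratMatrix_pairRat]
    · rintro σ' - ⟨s', hs', hC', hN'⟩
      refine ⟨s', _, hs', hC', hN', ?_⟩
      exact prefixLayer_conj_succ (prefixLayer_succ_two hlt) hX
        (tableOp_sweep_conj hC₂.supp _ fun P => tableOp_twoGate hlt.ne
          (submatrix_mem_unitaryGroup (d.two j q).2 _) P)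
  · simp only [TestExpr.Holds, IntExpr.eval, hp, hq₂] at hb'
    have hlt : d.partner j q < q := hb'
    refine (Runs.skip ⟨s, f, hs, hC₂, hN₂, ?_⟩).le (by omega)
    rw [LocalCircuit.prefixLayer_succ_of_lt hlt, hX]
  · simp only [TestExpr.Holds, IntExpr.eval, hp, hq₂] at hb hb'
    have heq : d.partner j q = q := Fin.ext (by omega)
    have hg : GateLoaded (d.one j q).1 σ₂ := by
      refine gateLoaded_of_entries (h := σ₁.reals aLayerReply) fun i => ?_
      rw [he, LocalCircuit.gateEntries, if_pos heq]
    refine (runs_sweepProg_gateBody S (get := oneGet q) (put := onePut q) (c := fun a b =>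
        conjCoeff (d.one j q).1 (sigma a) (sigma b)) hR₂ hC₂ hN₂
      (fun P hP => oneKeys_subset (hs hP)) hsB hB (by simp) ?_ ?_ ?_).mono le_rfl ?_
    · intro P a σ' hD h1 _
      have e1 : (IntExpr.var vQubit).eval σ' = q := by
        simp only [IntExpr.eval]
        rw [h1, hq₂]
      exact holds_digitTest hD e1 a
    · intro P b σ' h1 h2 h3 _
      have e1 : (IntExpr.var vQubit).eval σ' = q := by
        simp only [IntExpr.eval]
        rw [h3, hq₂]
      exact eval_shiftCode (e := .var vCode) h1 e1 (by rw [h2, hpow]) b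
    · intro t σ' h
      rw [eval_coefExpr _ _ (hg.congr h), ratMatrix_sigmaRat, ratMatrix_sigmaRat]
    · rintro σ' - ⟨s', hs', hC', hN'⟩
      refine ⟨s', _, hs', hC', hN', ?_⟩
      exact prefixLayer_conj_succ (prefixLayer_succ_one heq) hX
        (tableOp_sweep_conj hC₂.supp _ fun P => tableOp_oneGate q (d.one j q).2 P)

end

/-! ## Light cones -/

section Cones

variable {n : ℕ}

/-- The qubits that can be reached from `A` in `t` layers with pairings `p`. -/
def cone (p : ℕ → Fin n → Fin n) : ℕ → Finset (Fin n) → Finset (Fin n)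
  | 0, A => A
  | t + 1, A => cone p t A ∪ (cone p t A).image (p t)

/-- In a layer each qubit interacts with at most one neighbour, which is exactly one step of the
growth process defining the geometric dimension. -/
theorem growsTo_cone {G : SimpleGraph (Fin n)} {p : ℕ → Fin n → Fin n}
    (hp : ∀ t i, p t i = i ∨ G.Adj i (p t i)) (x : Fin n) (t : ℕ) :
    GrowsTo G x t (cone p t {x}) := by
  induction t with
  | zero => exact GrowsTo.start
  | succ t ih => exact GrowsTo.step (p t) (fun i _ => hp t i) ih

/-- The geometric dimension speaks of a single starting vertex. Light cones of larger sets are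
unions over their points, which costs a factor equal to the size of the support. -/
theorem cone_eq_biUnion (p : ℕ → Fin n → Fin n) (t : ℕ) (A : Finset (Fin n)) :
    cone p t A = A.biUnion fun x => cone p t {x} := by
  induction t with
  | zero => simp [cone]
  | succ t ih =>
    ext i
    simp only [cone, ih, Finset.mem_union, Finset.mem_biUnion, Finset.mem_image]
    constructor
    · rintro (⟨x, hx, h⟩ | ⟨y, ⟨x, hx, h⟩, rfl⟩)
      · exact ⟨x, hx, Or.inl h⟩
      · exact ⟨x, hx, Or.inr ⟨y, h, rfl⟩⟩
    · rintro ⟨x, hx, h | ⟨y, h, rfl⟩⟩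
      · exact Or.inl ⟨x, hx, h⟩
      · exact Or.inr ⟨y, ⟨x, hx, h⟩, rfl⟩

theorem cone_mono (p : ℕ → Fin n → Fin n) {t t' : ℕ} (h : t ≤ t') (A : Finset (Fin n)) :
    cone p t A ⊆ cone p t' A := by
  induction t', h using Nat.le_induction with
  | base => exact Finset.Subset.refl _
  | succ t' _ ih => exact ih.trans Finset.subset_union_left

theorem card_cone_le {G : SimpleGraph (Fin n)} {D K : ℕ} (hG : HasGeometricDimension G D K)
    {p : ℕ → Fin n → Fin n} (hp : ∀ t i, p t i = i ∨ G.Adj i (p t i)) {t : ℕ} (ht : 1 ≤ t)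
    (A : Finset (Fin n)) : (cone p t A).card ≤ A.card * (K * t ^ D) := by
  rw [cone_eq_biUnion]
  exact Finset.card_biUnion_le_card_mul _ _ _ fun x _ => hG t ht x _ (growsTo_cone hp x t)

/-- The qubits on which a string acts. -/
def stringSupport (P : PauliString n) : Finset (Fin n) := Finset.univ.filter fun i => P i ≠ 0

theorem mem_stringSupport {P : PauliString n} {i : Fin n} : i ∈ stringSupport P ↔ P i ≠ 0 := by
  simp [stringSupport]

/-- Strings of weight at most `w` in the light cone of one of the low-weight strings `Ps`. -/
def reach {m : ℕ} (k w : ℕ) (p : ℕ → Fin n → Fin n) (t : ℕ) (Ps : Fin m → PauliString n) :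
    Finset (PauliString n) :=
  (Finset.univ.filter fun i => pauliWeight (Ps i) ≤ k).biUnion fun i =>
    lowStrings (cone p t (stringSupport (Ps i))) w

theorem mem_reach {m : ℕ} {k w : ℕ} {p : ℕ → Fin n → Fin n} {t : ℕ} {Ps : Fin m → PauliString n}
    {Q : PauliString n} : Q ∈ reach k w p t Ps ↔ ∃ i, pauliWeight (Ps i) ≤ k ∧
      pauliWeight Q ≤ w ∧ ∀ q, Q q ≠ 0 → q ∈ cone p t (stringSupport (Ps i)) := by
  simp only [reach, Finset.mem_biUnion, Finset.mem_filter, Finset.mem_univ, true_and,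
    mem_lowStrings]
  refine exists_congr fun i => and_congr_right fun _ => and_congr_right fun _ =>
    forall_congr' fun q => ?_
  exact not_imp_comm

theorem reach_mono {m : ℕ} (k w : ℕ) (p : ℕ → Fin n → Fin n) {t t' : ℕ} (h : t ≤ t')
    (Ps : Fin m → PauliString n) : reach k w p t Ps ⊆ reach k w p t' Ps := by
  intro Q hQ
  obtain ⟨i, h1, h2, h3⟩ := mem_reach.mp hQ
  exact mem_reach.mpr ⟨i, h1, h2, fun q hq => cone_mono p h _ (h3 q hq)⟩

/-- Every letter of a new string lies on the pair of a letter of the old one. Hence the support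
grows by one step of the light cone and at most doubles, from which the weight 2k arises. -/
theorem spread_subset_reach {m : ℕ} {k : ℕ} {p : ℕ → Fin n → Fin n} {t : ℕ}
    (hp : ∀ i, p t (p t i) = i) {Ps : Fin m → PauliString n} {T : Finset (PauliString n)}
    (hT : T ⊆ reach k k p t Ps) : spread (p t) T ⊆ reach k (2 * k) p (t + 1) Ps := by
  intro Q hQ
  obtain ⟨P, hP, h⟩ := mem_spread.mp hQ
  obtain ⟨i, h1, h2, h3⟩ := mem_reach.mp (hT hP)
  have hsub : ∀ q, Q q ≠ 0 → q ∈ stringSupport P ∪ (stringSupport P).image (p t) := by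
    intro q hq
    rcases h q hq with h | h
    · exact Finset.mem_union_left _ (mem_stringSupport.mpr h)
    · exact Finset.mem_union_right _
        (Finset.mem_image.mpr ⟨p t q, mem_stringSupport.mpr h, hp q⟩)
  have hcone : stringSupport P ⊆ cone p t (stringSupport (Ps i)) := fun q hq =>
    h3 q (mem_stringSupport.mp hq)
  refine mem_reach.mpr ⟨i, h1, ?_, fun q hq =>
    Finset.union_subset_union hcone (Finset.image_subset_image hcone) (hsub q hq)⟩
  calc pauliWeight Q ≤ (stringSupport P ∪ (stringSupport P).image (p t)).card :=
        Finset.card_le_card fun q hq => hsub q (by simpa using hq)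
    _ ≤ (stringSupport P).card + ((stringSupport P).image (p t)).card := Finset.card_union_le _ _
    _ ≤ pauliWeight P + pauliWeight P := Nat.add_le_add le_rfl Finset.card_image_le
    _ ≤ 2 * k := by omega

theorem card_lowStrings_le_pow {A : Finset (Fin n)} {k K M N : ℕ} (hn : A.card ≤ n)
    (hA : A.card ≤ k * (K * N)) (hM : M = min n N) (hM2 : 2 ≤ M) :
    (lowStrings A (2 * k)).card ≤ M ^ ((2 * K + 10) * (k + 1)) := by
  have hcard : A.card ≤ (k + 1) * ((K + 1) * M) := by
    rcases le_total n N with h | h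
    · rw [min_eq_left h] at hM
      subst hM
      nlinarith [Nat.zero_le (k * (K + 1) * M), Nat.zero_le (K * M)]
    · rw [min_eq_right h] at hM
      subst hM
      refine hA.trans (Nat.mul_le_mul (by omega) (Nat.mul_le_mul_right _ (by omega)))
  have hMr : (2 : ℝ) ≤ M := by exact_mod_cast hM2
  -- For x = 3(K+1)M the exponent 3|A|/x is at most k + 1, because |A| ≤ (k+1)(K+1)M. As M ≥ 2, also
  -- e ≤ M² and x ≤ M^(K+4), so the exponents of M are 2(K+4)(k+1) and 2(k+1), in total
  -- (2K+10)(k+1).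
  have hx : (1 : ℝ) ≤ 3 * (K + 1) * M := by
    have : (0 : ℝ) ≤ K := Nat.cast_nonneg _
    nlinarith [mul_nonneg this (show (0 : ℝ) ≤ M by linarith)]
  have h := card_lowStrings_le A (2 * k) hx
  have h1 : 3 * (A.card : ℝ) / (3 * (K + 1) * M) ≤ (k + 1 : ℕ) := by
    rw [div_le_iff₀ (by linarith)]
    have : (A.card : ℝ) ≤ (k + 1 : ℕ) * ((K + 1) * M) := by exact_mod_cast hcard
    linarith
  have h2 : Real.exp (3 * (A.card : ℝ) / (3 * (K + 1) * M)) ≤ (M : ℝ) ^ (2 * (k + 1)) := by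
    calc _ ≤ Real.exp ((k + 1 : ℕ) : ℝ) := Real.exp_le_exp.mpr h1
      _ = Real.exp 1 ^ (k + 1) := by rw [← Real.exp_nat_mul, mul_one]
      _ ≤ ((M : ℝ) ^ 2) ^ (k + 1) := by
          gcongr
          have := Real.exp_one_lt_d9
          nlinarith
      _ = _ := by rw [← pow_mul]
  have h3 : (3 * (K + 1) * M : ℝ) ≤ (M : ℝ) ^ (K + 4) := by
    have e1 : (3 : ℝ) ≤ (M : ℝ) ^ 2 := by nlinarith
    have e2 : ((K + 1 : ℕ) : ℝ) ≤ (M : ℝ) ^ (K + 1) := by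
      exact_mod_cast (Nat.lt_pow_self hM2 (n := K + 1)).le
    push_cast at e2
    calc (3 * (K + 1) * M : ℝ) ≤ (M : ℝ) ^ 2 * (M : ℝ) ^ (K + 1) * M := by gcongr
      _ = _ := by ring
  have h4 : (3 * (K + 1) * M : ℝ) ^ (2 * k) ≤ (M : ℝ) ^ ((K + 4) * (2 * (k + 1))) := by
    calc _ ≤ ((M : ℝ) ^ (K + 4)) ^ (2 * k) := pow_le_pow_left₀ (by linarith) h3 _
      _ = (M : ℝ) ^ ((K + 4) * (2 * k)) := by rw [← pow_mul]
      _ ≤ _ := pow_le_pow_right₀ (by linarith) (Nat.mul_le_mul_left _ (by omega))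
  have h5 : ((lowStrings A (2 * k)).card : ℝ) ≤ (M : ℝ) ^ ((2 * K + 10) * (k + 1)) := by
    refine h.trans ((mul_le_mul h4 h2 (Real.exp_pos _).le (by positivity)).trans_eq ?_)
    rw [← pow_add]
    congr 1
    ring
  exact_mod_cast h5

/-- Each of the m strings of O contributes its own light cone, which is small only because strings
of weight above k have been excluded. -/
theorem card_reach_le {G : SimpleGraph (Fin n)} {D K L m : ℕ} (hG : HasGeometricDimension G D K)
    {p : ℕ → Fin n → Fin n} (hp : ∀ t i, p t i = i ∨ G.Adj i (p t i)) (hL : 1 ≤ L) (k : ℕ)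
    (Ps : Fin m → PauliString n) (hM : 2 ≤ min n (L ^ D)) :
    (reach k (2 * k) p L Ps).card ≤ m * min n (L ^ D) ^ ((2 * K + 10) * (k + 1)) := by
  refine (Finset.card_biUnion_le_card_mul _ _ (min n (L ^ D) ^ ((2 * K + 10) * (k + 1)))
    fun i hi => ?_).trans (Nat.mul_le_mul_right _ ?_)
  · have hw : (stringSupport (Ps i)).card ≤ k := (Finset.mem_filter.mp hi).2
    refine card_lowStrings_le_pow ?_ ((card_cone_le hG hp hL _).trans
      (Nat.mul_le_mul_right _ hw)) rfl hM
    exact (Finset.card_le_univ _).trans_eq (Fintype.card_fin n)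
  · exact (Finset.card_le_univ _).trans_eq (Fintype.card_fin m)

end Cones

/-! ## Low-weight Pauli propagation for geometrically local circuits -/

/-- Keep the current entry if its weight is not too large. -/
def filterBody : Program :=
  decodeProg ;;
  .ite (.intLt (.var vOrder) (.var vWeight)) .skip
    (.assign vOut (.var vCode) ;; .assignReal rOut (.var rVal) ;; emitProg)

/-- Conjugate the low-weight part of the current table by a layer. -/
noncomputable def localLayerProg : Program :=
  .assign vLayer (.sub (.sub (.read 0 (.const 1)) (.const 1)) (.var vLayerLoop)) ;;
    sweepProg filterBody ;; .forUp vQubit qubitsExpr gateProg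

/-- Emit the item `vTermLoop` of the list that specifies the observable. -/
def loadItemProg : Program :=
  .setInt aQuery (.const 0) (.var vTermLoop) ;; .call 2 aQuery (.const 1) aObsReply ;;
    .assign vOffset (.const 0) ;; encodeProg aObsReply ;;
    .assignReal rOut (.var aObsReply) ;; emitProg

/-- Low-weight Pauli propagation for geometrically local circuits. -/
noncomputable def localProg : Program :=
  orderProg ;; powersProg ;;
  .forUp vTermLoop (.read 0 (.const 2)) loadItemProg ;; swapProg ;;
  .forUp vLayerLoop (.read 0 (.const 1)) localLayerProg ;;
  finishProg

/-- The gate sweeps have no computable target list. The explicit list that contains it can be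
decided, and likewise for the enclosing loops. -/
theorem notMem_intTargets_gateProg : ∀ a ∈ [0, aPow, vOrder, vLayer, vLayerLoop, vQubit],
    a ∉ gateProg.intTargets := by
  intro a ha h
  have h' : a ∈ [aQuery, aLayerReply] ++ ((vSweepLoop :: (vCode :: (decodeProg.intTargets ++
      [vOut, aMark, aNew, aNewLen]) ++ [vSweepLoop])) ++ swapProg.intTargets) := by
    simp only [gateProg, Program.intTargets, List.mem_append] at h
    rcases h with h | h | h | h | h | h
    · exact List.mem_append_left _ (List.mem_cons.mpr (Or.inl (List.mem_singleton.mp h)))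
    · exact List.mem_append_left _ (List.mem_cons.mpr (Or.inl (List.mem_singleton.mp h)))
    · exact List.mem_append_left _ (List.mem_cons_of_mem _ h)
    · exact List.mem_append_right _ (intTargets_sweepProg_gateBody _ _ _ h)
    · simp at h
    · exact List.mem_append_right _ (intTargets_sweepProg_gateBody _ _ _ h)
  clear h
  revert a
  decide

theorem notMem_intTargets_gateLoop : ∀ a ∈ [0, aPow, vOrder, vLayer, vLayerLoop],
    a ∉ (Program.forUp vQubit qubitsExpr gateProg).intTargets := by
  intro a ha h
  rw [Program.intTargets_forUp, List.mem_cons, List.mem_append, List.mem_singleton] at h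
  have h1 := notMem_intTargets_gateProg a
    (by simp only [List.mem_cons, List.not_mem_nil, or_false] at ha ⊢; tauto)
  have h2 : a = vQubit := by tauto
  subst h2
  revert ha
  decide

theorem notMem_intTargets_localLayerProg : ∀ a ∈ [0, aPow, vOrder, vLayerLoop],
    a ∉ localLayerProg.intTargets := by
  intro a ha h
  simp only [localLayerProg, Program.intTargets, List.mem_append] at h
  have h1 := notMem_intTargets_gateLoop a
    (by simp only [List.mem_cons, List.not_mem_nil, or_false] at ha ⊢; tauto)
  have h2 : a ∈ [vLayer] ++ (sweepProg filterBody).intTargets := by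
    rw [List.mem_append]
    exact h.imp_right fun h => h.resolve_right h1
  clear h h1
  revert a
  decide

theorem notMem_intTargets_localLayerLoop : ∀ a ∈ [0, aPow, vOrder],
    a ∉ (Program.forUp vLayerLoop (.read 0 (.const 1)) localLayerProg).intTargets := by
  intro a ha h
  rw [Program.intTargets_forUp, List.mem_cons, List.mem_append, List.mem_singleton] at h
  have h1 := notMem_intTargets_localLayerProg a
    (by simp only [List.mem_cons, List.not_mem_nil, or_false] at ha ⊢; tauto)
  have h2 : a = vLayerLoop := by tauto
  subst h2
  revert ha
  decide

/-! ### Truncation, the layer loop and loading of sparse observables. -/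

section

variable {n : ℕ}

/-- The strings that are kept by the truncation. -/
def filterKeys (k : ℕ) (P : PauliString n) : Finset (PauliString n) :=
  if pauliWeight P ≤ k then {P} else ∅

/-- The terms that are kept by the truncation. -/
noncomputable def filterTerms (k : ℕ) (P : PauliString n) : PauliString n → ℝ :=
  if pauliWeight P ≤ k then Pi.single P 1 else 0

theorem mem_biUnion_filterKeys {k : ℕ} {s : Finset (PauliString n)} {Q : PauliString n} :
    Q ∈ s.biUnion (filterKeys k) ↔ Q ∈ s ∧ pauliWeight Q ≤ k := by
  simp only [Finset.mem_biUnion, filterKeys]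
  constructor
  · rintro ⟨P, hP, h⟩
    split_ifs at h with hk
    · rw [Finset.mem_singleton] at h
      subst h
      exact ⟨hP, hk⟩
    · simp at h
  · rintro ⟨h, hk⟩
    exact ⟨Q, h, by simp [hk]⟩

theorem tableOp_filter (k : ℕ) {s : Finset (PauliString n)} {f : PauliString n → ℝ}
    (hf : ∀ P, P ∉ s → f P = 0) :
    tableOp (∑ P ∈ s, f P • filterTerms k P) = lowPart k (tableOp f) := by
  rw [tableOp_sweep_eq k hf 1, Matrix.conjTranspose_one, one_mul, mul_one]
  intro P _
  rw [filterTerms, Matrix.conjTranspose_one, one_mul, mul_one]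
  split_ifs
  · rw [tableOp_single]; simp
  · simp [tableOp]

theorem runs_filterBody (S : Subroutines) {σ₀ : Memory} (hR : Ready n σ₀) {k : ℕ}
    (hk : σ₀.ints vOrder 0 = k) {P : PauliString n}
    (hP : σ₀.ints vCode 0 = PauliString.code P) {x : ℝ} (hx : σ₀.reals rVal 0 = x)
    {s : Finset (PauliString n)} {f : PauliString n → ℝ} (hN : NewTable σ₀ s f) :
    Runs S filterBody σ₀ (n * 11 + 12) fun σ' => ∃ s', s' ⊆ s ∪ filterKeys k P ∧
      NewTable σ' s' (f + x • filterTerms k P) := by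
  refine (Runs.seq (T := n * 11 + 4) (T' := 7 + 1) ((runs_decodeProg S hR hP).mono le_rfl ?_))
  rintro σ₁ - ⟨hD, -⟩ hA₁
  have hN₁ : NewTable σ₁ s f := hN.congr (hA₁.ints _ (by decide)) (hA₁.ints _ (by decide))
    (hA₁.reals _ (by decide)) (hA₁.ints _ (by decide))
  have hk₁ : σ₁.ints vOrder 0 = k := by rw [hA₁.ints _ (by decide), hk]
  have hcond : (TestExpr.intLt (.var vOrder) (.var vWeight)).Holds σ₁ ↔ ¬ pauliWeight P ≤ k := by
    simp only [TestExpr.Holds, IntExpr.eval, hk₁, hD.weight]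
    omega
  refine Runs.ite (fun hb => ?_) fun hb => ?_
  · rw [hcond] at hb
    rw [filterTerms, if_neg hb, filterKeys, if_neg hb, smul_zero, add_zero, Finset.union_empty]
    exact (Runs.skip ⟨s, Finset.Subset.refl _, hN₁⟩).le (by omega)
  · rw [hcond, not_not] at hb
    rw [filterTerms, if_pos hb, filterKeys, if_pos hb]
    refine Runs.seqInt (Runs.seqReal ((runs_emitProg S (Q := P) (x := x)
      (hN₁.congr (by simp) (by simp) (by simp) (by simp)) ?_ ?_).mono le_rfl ?_))
    · simp only [IntExpr.eval, Memory.setReal_ints, Memory.setInt_ints, Function.update_self]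
      rw [hA₁.ints vCode (by decide), hP]
    · simp only [RealExpr.eval, IntExpr.eval, Memory.setReal_reals, Function.update_self,
        Memory.setInt_reals]
      rw [hA₁.reals rVal (by decide), hx]
    · intro σ' _ h
      refine ⟨insert P s, ?_, ?_⟩
      · rw [Finset.insert_eq, Finset.union_comm]
      · rw [← Pi.single_smul, smul_eq_mul, mul_one]
        exact h

/-- The pairing of the qubits in the `t`-th layer from the end. -/
def LocalCircuit.pairing {L : ℕ} {G : SimpleGraph (Fin n)} (d : LocalCircuit G L) (t : ℕ)
    (i : Fin n) : Fin n :=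
  if h : L - 1 - t < L then d.partner ⟨L - 1 - t, h⟩ i else i

theorem LocalCircuit.pairing_eq {L : ℕ} {G : SimpleGraph (Fin n)} (d : LocalCircuit G L) {t : ℕ}
    (h : L - 1 - t < L) : d.pairing t = d.partner ⟨L - 1 - t, h⟩ := by
  funext i
  rw [pairing, dif_pos h]

theorem LocalCircuit.pairing_eq_or_adj {L : ℕ} {G : SimpleGraph (Fin n)} (d : LocalCircuit G L)
    (t : ℕ) (i : Fin n) : d.pairing t i = i ∨ G.Adj i (d.pairing t i) := by
  rw [pairing]
  split_ifs with h
  · by_cases hi : d.partner ⟨L - 1 - t, h⟩ i = i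
    · exact Or.inl hi
    · exact Or.inr (d.adj _ _ hi)
  · exact Or.inl rfl

theorem runs_gateLoop {S : Subroutines} {L : ℕ} {G : SimpleGraph (Fin n)} {d : LocalCircuit G L}
    (hS : ∀ (j : Fin L) (q : Fin n),
      S 0 [(j : ℕ), (q : ℕ)] = ⟨[(d.partner j q : ℕ)], d.gateEntries j q, 0⟩) {j : Fin L}
    {σ₀ : Memory} (hR : Ready n σ₀) (hj : σ₀.ints vLayer 0 = j) {T : Finset (PauliString n)}
    {f : PauliString n → ℝ} (hC : CurTable σ₀ T f)
    (hN : NewTable σ₀ (∅ : Finset (PauliString n)) 0) {B : ℕ}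
    (hB : (spread (d.partner j) T).card ≤ B) :
    Runs S (.forUp vQubit qubitsExpr gateProg) σ₀ (n * (B * (n * 11 + 2070) + 52) + 2) fun σ' =>
      ∃ s' f', s' ⊆ spread (d.partner j) T ∧ CurTable σ' s' f' ∧
        NewTable σ' (∅ : Finset (PauliString n)) 0 ∧
        tableOp f' = (d.layer j).conjTranspose * tableOp f * d.layer j := by
  refine (Runs.forUp (I := fun q σ => ∃ s' f', s' ⊆ spread (d.partner j) T ∧ CurTable σ s' f' ∧
    NewTable σ (∅ : Finset (PauliString n)) 0 ∧
    tableOp f' = (d.prefixLayer j q).conjTranspose * tableOp f * d.prefixLayer j q) n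
    (B * (n * 11 + 2070) + 50) (notMem_intTargets_gateProg _ (by simp)) ?_ ?_ ?_ ?_).mono le_rfl ?_
  · rintro q σ v ⟨s', f', h1, h2, h3, h4⟩
    exact ⟨s', f', h1, h2.congr (by simp) (by simp) (by simp),
      h3.congr (by simp) (by simp) (by simp) (by simp), h4⟩
  · refine ⟨T, f, subset_spread _ _, hC, hN, ?_⟩
    rw [LocalCircuit.prefixLayer_zero, Matrix.conjTranspose_one, one_mul, mul_one]
  · intro σ hA
    simp only [IntExpr.eval]
    rw [hA.ints _ (notMem_intTargets_gateLoop _ (by simp)), hR.qubits]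
  · rintro q hq σ hA ⟨s', f', h1, h2, h3, h4⟩ hij
    exact runs_gateProg (q := ⟨q, hq⟩) (hS j ⟨q, hq⟩)
      (hR.congr (hA.ints _ (notMem_intTargets_gateLoop _ (by simp)))
        (hA.ints _ (notMem_intTargets_gateLoop _ (by simp))))
      (by rw [hA.ints _ (notMem_intTargets_gateLoop _ (by simp)), hj]) hij h2 h3 h1 hB h4
  · rintro σ - h
    rwa [LocalCircuit.prefixLayer_self] at h

/-- The invariant places only the low-weight strings of the table in the light cone after j layers.
The others are removed by the next truncation and count merely for the size. In the first round they
are strings of O that are too heavy, for which `hB₀` is a separate bound. -/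
theorem runs_localLayerLoop {S : Subroutines} {L : ℕ} {G : SimpleGraph (Fin n)}
    {d : LocalCircuit G L} {U : Circuit n L} (hd : d.Describes U)
    (hS : ∀ (j : Fin L) (q : Fin n),
      S 0 [(j : ℕ), (q : ℕ)] = ⟨[(d.partner j q : ℕ)], d.gateEntries j q, 0⟩)
    {σ₀ : Memory} (hR : Ready n σ₀) (hL : σ₀.ints 0 1 = L) {k : ℕ} (hk : σ₀.ints vOrder 0 = k)
    {s₀ : Finset (PauliString n)} {f₀ : PauliString n → ℝ} (hC : CurTable σ₀ s₀ f₀)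
    (hN : NewTable σ₀ (∅ : Finset (PauliString n)) 0) (ρ : QOp (Fin n)) {m : ℕ}
    {Ps : Fin m → PauliString n} (hs₀ : ∀ Q ∈ s₀, ∃ i, Ps i = Q) {B : ℕ} (hB₀ : s₀.card ≤ B)
    (hB : (reach k (2 * k) d.pairing L Ps).card ≤ B) :
    Runs S (.forUp vLayerLoop (.read 0 (.const 1)) localLayerProg) σ₀
      (L * (B * (n * 11 + 29) + n * (B * (n * 11 + 2070) + 52) + 15) + 2) fun σ' =>
      ∃ (s : Finset (PauliString n)) (f : PauliString n → ℝ), s.card ≤ B ∧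
        CurTable σ' s f ∧ propagationEstimate k (prefixCircuit U 0 (Nat.zero_le _)) ρ (tableOp f) =
          propagationEstimate k U ρ (tableOp f₀) := by
  refine (Runs.forUp (I := fun j σ => ∃ (s : Finset (PauliString n)) (f : PauliString n → ℝ),
    s.card ≤ B ∧ (∀ Q ∈ s, pauliWeight Q ≤ k → Q ∈ reach k k d.pairing j Ps) ∧
    CurTable σ s f ∧ NewTable σ (∅ : Finset (PauliString n)) 0 ∧
    ∀ r (h : r + j = L), propagationEstimate k (prefixCircuit U r (by omega)) ρ (tableOp f) =
      propagationEstimate k U ρ (tableOp f₀)) L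
    (B * (n * 11 + 29) + n * (B * (n * 11 + 2070) + 52) + 13)
    (notMem_intTargets_localLayerProg _ (by simp)) ?_ ⟨s₀, f₀, hB₀, ?_, hC, hN, ?_⟩ ?_ ?_).mono
    le_rfl ?_
  · rintro j σ v ⟨s, f, h0, h1, h2, h3, h4⟩
    exact ⟨s, f, h0, h1, h2.congr (by simp) (by simp) (by simp),
      h3.congr (by simp) (by simp) (by simp) (by simp), h4⟩
  · rintro Q hQ hw
    obtain ⟨i, rfl⟩ := hs₀ Q hQ
    exact mem_reach.mpr ⟨i, hw, hw, fun q hq => mem_stringSupport.mpr hq⟩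
  · rintro r h
    obtain rfl : r = L := by omega
    rfl
  · intro σ hA
    simp only [IntExpr.eval]
    rw [hA.ints 0 (notMem_intTargets_localLayerLoop _ (by simp)), hL]
  · rintro j hj σ hA ⟨s, f, hsB, hsr, hc, hn, hest⟩ hij
    have hj' : L - 1 - j < L := by omega
    have hA' : ∀ a ∈ [0, aPow, vOrder], σ.ints a = σ₀.ints a := fun a ha =>
      hA.ints a (notMem_intTargets_localLayerLoop a ha)
    refine (Runs.seqInt (T := (B * (n * 11 + 29) + 10) + (n * (B * (n * 11 + 2070) + 52) + 2))
      ?_).le (by omega)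
    have hval : (IntExpr.sub (.sub (.read 0 (.const 1)) (.const 1)) (.var vLayerLoop)).eval σ =
        L - 1 - j := by
      simp only [IntExpr.eval, hA' 0 (by simp), hL, hij]
    rw [hval]
    set σ₁ := σ.setInt vLayer ((IntExpr.const 0).eval σ) (L - 1 - j) with hσ₁
    have hR₁ : Ready n σ₁ := hR.congr (by simp [hσ₁, hA' 0 (by simp)])
      (by simp [hσ₁, hA' aPow (by simp)])
    have hk₁ : σ₁.ints vOrder 0 = k := by simp [hσ₁, hA' vOrder (by simp), hk]
    have hl₁ : σ₁.ints vLayer 0 = L - 1 - j := by simp [hσ₁, IntExpr.eval]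
    have hsub : s.biUnion (filterKeys k) ⊆ s := fun Q hQ => (mem_biUnion_filterKeys.mp hQ).1
    refine Runs.seq ((runs_sweepProg S (by decide) (by decide)
      (hc.congr (by simp [hσ₁]) (by simp [hσ₁]) (by simp [hσ₁]))
      (hn.congr (by simp [hσ₁]) (by simp [hσ₁]) (by simp [hσ₁]) (by simp [hσ₁]))
      (filterTerms k) (filterKeys k) (n * 11 + 12) B ((Finset.card_le_card hsub).trans hsB)
      ?_).mono ?_ ?_)
    · intro P _ σ₂ s₂ f₂ hA₂ hcode hx hN₂
      exact runs_filterBody S (hR₁.congr (hA₂.ints _ (by decide)) (hA₂.ints _ (by decide)))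
        (by rw [hA₂.ints _ (by decide), hk₁]) hcode hx hN₂
    · have h1 : s.card * (n * 11 + 12 + 10) ≤ B * (n * 11 + 22) := Nat.mul_le_mul_right _ hsB
      have h2 : B * (n * 11 + 29) = B * (n * 11 + 22) + B * 7 := by ring
      omega
    rintro σ₂ - ⟨T, hT, hC₂, hN₂⟩ hA₂
    have hTr : T ⊆ reach k k d.pairing j Ps := fun Q hQ => by
      obtain ⟨h1, h2⟩ := mem_biUnion_filterKeys.mp (hT hQ)
      exact hsr Q h1 h2
    have hpair := d.pairing_eq hj'
    have hspread : spread (d.partner ⟨L - 1 - j, hj'⟩) T ⊆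
        reach k (2 * k) d.pairing (j + 1) Ps := by
      have := spread_subset_reach (p := d.pairing) (t := j)
        (by rw [hpair]; exact d.partner_partner _) hTr
      rwa [hpair] at this
    have hcard : (spread (d.partner ⟨L - 1 - j, hj'⟩) T).card ≤ B :=
      (Finset.card_le_card (hspread.trans (reach_mono k _ d.pairing hj Ps))).trans hB
    refine (runs_gateLoop hS (j := ⟨L - 1 - j, hj'⟩)
      (hR₁.congr (hA₂.ints _ (by decide)) (hA₂.ints _ (by decide)))
      (by rw [hA₂.ints _ (by decide), hl₁]) hC₂ hN₂ hcard).mono le_rfl ?_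
    rintro σ₃ - ⟨s', f', hs', hC₃, hN₃, htab⟩
    refine ⟨s', f', (Finset.card_le_card hs').trans hcard, fun Q hQ hw => ?_, hC₃, hN₃, ?_⟩
    · obtain ⟨i, h1, -, h3⟩ := mem_reach.mp (hspread (hs' hQ))
      exact mem_reach.mpr ⟨i, h1, hw, h3⟩
    · intro r hr
      have hrj : (⟨L - 1 - j, hj'⟩ : Fin L) = ⟨r, by omega⟩ := by
        ext; simp only; omega
      rw [htab, tableOp_filter k hc.supp, hrj, ← hd ⟨r, by omega⟩,
        ← propagationEstimate_prefix_succ k U (by omega)]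
      exact hest (r + 1) (by omega)
  · rintro σ - ⟨s, f, h1, -, h2, -, h3⟩
    exact ⟨s, f, h1, h2, h3 0 (by omega)⟩

theorem runs_loadItemProg {S : Subroutines} {σ₀ : Memory} (hn : σ₀.ints 0 0 = n) {i : ℕ}
    (hi : σ₀.ints vTermLoop 0 = i) {P : PauliString n} {a : ℝ}
    (hS : S 2 [i] = ⟨encodePauli P, [a], 0⟩) {s : Finset (PauliString n)}
    {f : PauliString n → ℝ} (hN : NewTable σ₀ s f) :
    Runs S loadItemProg σ₀ (n * 4 + 14) fun σ' =>
      NewTable σ' (insert P s) (f + Pi.single P a) := by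
  refine (Runs.seqInt (T := (n + 3) + ((n * 3 + 3) + (5 + 1) + 1)) ?_).le (by omega)
  set σ₁ := σ₀.setInt aQuery ((IntExpr.const 0).eval σ₀) ((IntExpr.var vTermLoop).eval σ₀)
    with hσ₁
  refine Runs.seq ((Runs.call (T := n + 3) (r := ⟨encodePauli P, [a], 0⟩)
    (Q := fun σ => (∀ r < n, σ.ints aObsReply (0 + r) = PauliString.digit P r) ∧
      σ.reals aObsReply 0 = a) ?_ ?_ ?_).mono le_rfl ?_)
  · rw [← hS]
    congr 1
    simp [Memory.readBlock, IntExpr.eval, hσ₁, hi]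
  · simp only [IntExpr.eval, encodePauli, List.length_ofFn, List.length_cons, List.length_nil]
    omega
  · refine ⟨fun r hr => ?_, by simp [Memory.writeReply]⟩
    simp only [Memory.writeReply, Function.update_self, PauliString.encodePauli_eq]
    simp [hr]
  rintro σ₂ - ⟨h1, h2⟩ hA₂
  have hN₂ : NewTable σ₂ s f := hN.congr (by rw [hA₂.ints _ (by decide)]; simp [hσ₁])
    (by rw [hA₂.ints _ (by decide)]; simp [hσ₁]) (by rw [hA₂.reals _ (by decide)]; simp [hσ₁])
    (by rw [hA₂.ints _ (by decide)]; simp [hσ₁])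
  have hn₂ : σ₂.ints 0 0 = n := by rw [hA₂.ints _ (by decide)]; simpa [hσ₁] using hn
  refine Runs.seqInt (T := (n * 3 + 3) + (5 + 1)) ?_
  set σ₃ := σ₂.setInt vOffset ((IntExpr.const 0).eval σ₂) ((IntExpr.const 0).eval σ₂) with hσ₃
  refine Runs.seq (T := n * 3 + 3) (T' := 5 + 1) ((runs_encodeProg S (σ₀ := σ₃) (o := 0) (by simpa [hσ₃] using hn₂) (by decide)
    (by decide) (by simp [hσ₃, IntExpr.eval]) (by simpa [hσ₃] using h1)).mono le_rfl ?_)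
  intro σ₄ _ hout hA₄
  refine Runs.seqReal (runs_emitProg S (hN₂.congr ?_ ?_ ?_ ?_) ?_ ?_)
  · rw [Memory.setReal_ints, hA₄.ints aNew (by decide)]; simp [hσ₃]
  · rw [Memory.setReal_ints, hA₄.ints aNewLen (by decide)]; simp [hσ₃]
  · have h := hA₄.reals rNew (by decide)
    simpa [hσ₃] using h
  · rw [Memory.setReal_ints, hA₄.ints aMark (by decide)]; simp [hσ₃]
  · simpa using hout
  · simp only [RealExpr.eval, IntExpr.eval, Memory.setReal_reals, Function.update_self]
    rw [hA₄.reals aObsReply (by decide), hσ₃, Memory.setInt_reals, h2]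

/-- The list may contain a string several times, since emitting adds up coefficients. -/
theorem runs_loadLoop {S : Subroutines} {m : ℕ} {O : Fin m → PauliString n × ℝ}
    (hS : ∀ i : Fin m, S 2 [(i : ℕ)] = ⟨encodePauli (O i).1, [(O i).2], 0⟩) {σ₀ : Memory}
    (hn : σ₀.ints 0 0 = n) (hm : σ₀.ints 0 2 = m)
    (hN : NewTable σ₀ (∅ : Finset (PauliString n)) 0) :
    Runs S (.forUp vTermLoop (.read 0 (.const 2)) loadItemProg) σ₀ (m * (n * 4 + 16) + 2)
      fun σ' => ∃ s f, (∀ Q ∈ s, ∃ i, (O i).1 = Q) ∧ NewTable σ' s f ∧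
        tableOp f = sparseObservable O := by
  refine (Runs.forUp (I := fun j σ => ∃ s f, (∀ Q ∈ s, ∃ i, (O i).1 = Q) ∧ NewTable σ s f ∧
    tableOp f = ∑ i : Fin m, if (i : ℕ) < j then ((O i).2 : ℂ) • pauliOp (O i).1 else 0) m
    (n * 4 + 14) (by decide) ?_ ?_ ?_ ?_).mono le_rfl ?_
  · rintro j σ v ⟨s, f, h1, h2, h3⟩
    exact ⟨s, f, h1, h2.congr (by simp) (by simp) (by simp) (by simp), h3⟩
  · exact ⟨∅, 0, by simp, hN, by simp [tableOp]⟩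
  · intro σ hA
    simp only [IntExpr.eval]
    rw [hA.ints 0 (by decide), hm]
  · rintro j hj σ hA ⟨s, f, h1, h2, h3⟩ hij
    refine (runs_loadItemProg (by rw [hA.ints 0 (by decide), hn]) hij (hS ⟨j, hj⟩) h2).mono le_rfl
      fun σ' _ h => ⟨_, _, ?_, h, ?_⟩
    · intro Q hQ
      rcases Finset.mem_insert.mp hQ with rfl | hQ
      · exact ⟨_, rfl⟩
      · exact h1 Q hQ
    · have hadd : tableOp (f + Pi.single (O ⟨j, hj⟩).1 (O ⟨j, hj⟩).2) =
          tableOp f + tableOp (Pi.single (O ⟨j, hj⟩).1 (O ⟨j, hj⟩).2) := by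
        refine ext_coefG fun P => ?_
        rw [coefG_add, coefG_tableOp, coefG_tableOp, coefG_tableOp, Pi.add_apply]
        push_cast
        rfl
      rw [hadd, h3, tableOp_single, ← Finset.add_sum_erase _ _ (Finset.mem_univ (⟨j, hj⟩ : Fin m)),
        ← Finset.add_sum_erase _ (fun i : Fin m => if (i : ℕ) < j + 1 then
          ((O i).2 : ℂ) • pauliOp (O i).1 else 0) (Finset.mem_univ (⟨j, hj⟩ : Fin m)),
        if_neg (lt_irrefl _), if_pos (by simp), zero_add, add_comm, pauliOp_eq_pauliG]
      congr 1
      refine Finset.sum_congr rfl fun i hi => ?_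
      have : (i : ℕ) ≠ j := fun e => (Finset.mem_erase.mp hi).1 (Fin.ext e)
      refine if_congr ?_ rfl rfl
      omega
  · rintro σ - ⟨s, f, h1, h2, h3⟩
    refine ⟨s, f, h1, h2, ?_⟩
    rw [h3, sparseObservable]
    exact Finset.sum_congr rfl fun i _ => if_pos i.2

end

theorem localInstance_zero {n L m c : ℕ} {G : SimpleGraph (Fin n)} (d : LocalCircuit G L)
    (ρ : QOp (Fin n)) (O : Fin m → PauliString n × ℝ) (state : PauliAccess c n) (j : Fin L)
    (q : Fin n) : localInstance d ρ O state 0 [(j : ℕ), (q : ℕ)] =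
      ⟨[(d.partner j q : ℕ)], d.gateEntries j q, 0⟩ := by
  have h : ([(j : ℕ), (q : ℕ)].headD 0) < L ∧ ([(j : ℕ), (q : ℕ)].tail.headD 0) < n := ⟨j.2, q.2⟩
  simp only [localInstance]
  rw [dif_pos h]
  rfl

theorem localInstance_two {n L m c : ℕ} {G : SimpleGraph (Fin n)} (d : LocalCircuit G L)
    (ρ : QOp (Fin n)) (O : Fin m → PauliString n × ℝ) (state : PauliAccess c n) (i : Fin m) :
    localInstance d ρ O state 2 [(i : ℕ)] = ⟨encodePauli (O i).1, [(O i).2], 0⟩ := by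
  have h : ([(i : ℕ)].headD 0) < m := i.2
  simp only [localInstance]
  rw [dif_pos h]
  rfl

/-- The sum of the running times of the parts of the algorithm for local circuits. -/
theorem local_time_le {k n e w b m L : ℕ} (hn : 1 ≤ n) (he : 1 ≤ e) (hw : 1 ≤ w) (hb : 1 ≤ b)
    (hL : 1 ≤ L) (hk : k ≤ b) (hm : m ≤ w) :
    (k * 3 + 3) + ((n * 3 + 3) + ((m * (n * 4 + 16) + 2) + ((m * 7 + 6) +
      ((L * (w * b * (n * 11 + 29) + n * (w * b * (n * 11 + 2070) + 52) + 15) + 2) +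
        (w * b * (n * 12 + e + 10) + 4))))) ≤ 8192 * (L * (n * n * e * w * b)) := by
  -- Each monomial of the total time is padded with ones to match the factors of one common product.
  -- What remains is a linear inequality in this product.
  have h1 : 1 * (1 * 1 * 1 * 1 * k) ≤ L * (n * n * e * w * b) := by gcongr
  have h2 : 1 * (n * 1 * 1 * 1 * 1) ≤ L * (n * n * e * w * b) := by gcongr
  have h3 : 1 * (n * 1 * 1 * m * 1) ≤ L * (n * n * e * w * b) := by gcongr
  have h4 : 1 * (1 * 1 * 1 * m * 1) ≤ L * (n * n * e * w * b) := by gcongr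
  have h5 : L * (n * n * 1 * w * b) ≤ L * (n * n * e * w * b) := by gcongr
  have h6 : L * (n * 1 * 1 * w * b) ≤ L * (n * n * e * w * b) := by gcongr
  have h7 : L * (1 * 1 * 1 * w * b) ≤ L * (n * n * e * w * b) := by gcongr
  have h8 : L * (n * 1 * 1 * 1 * 1) ≤ L * (n * n * e * w * b) := by gcongr
  have h9 : L * (1 * 1 * 1 * 1 * 1) ≤ L * (n * n * e * w * b) := by gcongr
  have h10 : 1 * (n * 1 * 1 * w * b) ≤ L * (n * n * e * w * b) := by gcongr
  have h11 : 1 * (1 * 1 * e * w * b) ≤ L * (n * n * e * w * b) := by gcongr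
  have h12 : 1 * (1 * 1 * 1 * w * b) ≤ L * (n * n * e * w * b) := by gcongr
  have h13 : 1 * (1 * 1 * 1 * 1 * 1) ≤ L * (n * n * e * w * b) := by gcongr
  generalize L * (n * n * e * w * b) = Y at *
  linarith

theorem runs_localProg {n L m a c D K : ℕ} {U : Circuit n L} (hn : 2 ≤ n) (hL : 2 ≤ L)
    (hD : 1 ≤ D) (hm : m ≤ n ^ a) {G : SimpleGraph (Fin n)} (hG : HasGeometricDimension G D K)
    {d : LocalCircuit G L} (hd : d.Describes U) {ρ : QOp (Fin n)} (hρ : IsQuantumState ρ)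
    (O : Fin m → PauliString n × ℝ) (state : PauliAccess c n) {ε δ : ℝ} (hε : 0 < ε)
    (hδ : 0 < δ) :
    Runs (localInstance d ρ O state) localProg (initialMemory [n, L, m] [ε, δ])
      (8192 * (L * (n * n * n ^ c * n ^ a *
        min n (L ^ D) ^ ((2 * K + 10) * (truncationOrder ε δ + 1))))) fun σ' =>
        ((σ'.reals 0 0 : ℝ) : ℂ) =
          propagationEstimate (truncationOrder ε δ) U ρ (sparseObservable O) := by
  set S := localInstance d ρ O state with hSdef
  set σ₀ := initialMemory [n, L, m] [ε, δ] with hσ₀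
  set k := truncationOrder ε δ with hk
  set M := min n (L ^ D) with hM
  set b := M ^ ((2 * K + 10) * (k + 1)) with hb
  -- M ≥ 2 needs n ≥ 2, L ≥ 2 and D ≥ 1. It allows constants to be absorbed into powers of M.
  have hM2 : 2 ≤ M := le_min hn (hL.trans (Nat.le_self_pow (by omega) L))
  have hb1 : 1 ≤ b := Nat.one_le_pow _ _ (by omega)
  have hkb : k ≤ b := (Nat.lt_pow_self hM2 (n := k)).le.trans
    (Nat.pow_le_pow_right (by omega) (by nlinarith))
  obtain ⟨hC₀, hN₀⟩ := initialMemory_tables (n := n) [n, L, m] [ε, δ]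
  refine Runs.le ?_ (local_time_le (k := k) (n := n) (e := n ^ c) (w := n ^ a) (b := b) (m := m)
    (L := L) (by omega) (Nat.one_le_pow _ _ (by omega)) (Nat.one_le_pow _ _ (by omega)) hb1
    (by omega) hkb hm)
  have hmB : m ≤ n ^ a * b := hm.trans (Nat.le_mul_of_pos_right _ hb1)
  have hreach : (reach k (2 * k) d.pairing L fun i => (O i).1).card ≤ n ^ a * b :=
    (card_reach_le hG d.pairing_eq_or_adj (by omega) k _ hM2).trans (Nat.mul_le_mul_right _ hm)
  refine Runs.seq ((runs_orderProg S hε hδ (by simp [hσ₀, initialMemory])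
    (by simp [hσ₀, initialMemory])).mono le_rfl ?_)
  intro σ₁ _ hk₁ hA₁
  refine Runs.seq ((runs_powersProg S (n := n) (by
    rw [hA₁.ints 0 (by decide)]; simp [hσ₀, initialMemory])).mono le_rfl ?_)
  intro σ₂ _ hR₂ hA₂
  have hC₂ : CurTable σ₂ (∅ : Finset (PauliString n)) 0 :=
    (hC₀.congr (hA₁.ints _ (by decide)) (hA₁.ints _ (by decide)) (hA₁.reals _ (by decide))).congr
      (hA₂.ints _ (by decide)) (hA₂.ints _ (by decide)) (hA₂.reals _ (by decide))
  have hN₂ : NewTable σ₂ (∅ : Finset (PauliString n)) 0 :=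
    (hN₀.congr (hA₁.ints _ (by decide)) (hA₁.ints _ (by decide)) (hA₁.reals _ (by decide))
      (hA₁.ints _ (by decide))).congr
      (hA₂.ints _ (by decide)) (hA₂.ints _ (by decide)) (hA₂.reals _ (by decide))
      (hA₂.ints _ (by decide))
  have hk₂ : σ₂.ints vOrder 0 = k := by rw [hA₂.ints _ (by decide), hk₁]
  have h0 : σ₂.ints 0 = σ₀.ints 0 := by rw [hA₂.ints 0 (by decide), hA₁.ints 0 (by decide)]
  have hL₂ : σ₂.ints 0 1 = L := by rw [h0]; simp [hσ₀, initialMemory]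
  have hm₂ : σ₂.ints 0 2 = m := by rw [h0]; simp [hσ₀, initialMemory]
  refine Runs.seq ((runs_loadLoop (localInstance_two d ρ O state) hR₂.qubits hm₂ hN₂).mono
    le_rfl ?_)
  rintro σ₃ - ⟨s, f, hs, hN₃, hf⟩ hA₃
  have hR₃ : Ready n σ₃ := hR₂.congr (hA₃.ints _ (by decide)) (hA₃.ints _ (by decide))
  have hC₃ : CurTable σ₃ (∅ : Finset (PauliString n)) 0 :=
    hC₂.congr (hA₃.ints _ (by decide)) (hA₃.ints _ (by decide)) (hA₃.reals _ (by decide))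
  have hk₃ : σ₃.ints vOrder 0 = k := by rw [hA₃.ints _ (by decide), hk₂]
  have hL₃ : σ₃.ints 0 1 = L := by rw [hA₃.ints 0 (by decide), hL₂]
  have hsm : s.card ≤ m := by
    have : s ⊆ Finset.univ.image fun i => (O i).1 := fun Q hQ => by
      obtain ⟨i, hi⟩ := hs Q hQ
      exact Finset.mem_image.mpr ⟨i, Finset.mem_univ _, hi⟩
    exact (Finset.card_le_card this).trans
      (Finset.card_image_le.trans_eq (by rw [Finset.card_univ, Fintype.card_fin]))
  refine Runs.seq ((runs_swapProg S hC₃ hN₃).mono (by rw [Finset.card_empty]; omega) ?_)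
  rintro σ₄ - ⟨hC₄, hN₄⟩ hA₄
  have hR₄ : Ready n σ₄ := hR₃.congr (hA₄.ints _ (by decide)) (hA₄.ints _ (by decide))
  have hk₄ : σ₄.ints vOrder 0 = k := by rw [hA₄.ints _ (by decide), hk₃]
  have hL₄ : σ₄.ints 0 1 = L := by rw [hA₄.ints 0 (by decide), hL₃]
  refine Runs.seq ((runs_localLayerLoop hd (localInstance_zero d ρ O state) hR₄ hL₄ hk₄ hC₄ hN₄ ρ
    hs (hsm.trans hmB) hreach).mono le_rfl ?_)
  rintro σ₅ - ⟨s₅, f₅, hs₅, hC₅, hest⟩ hA₅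
  have hR₅ : Ready n σ₅ := hR₄.congr (hA₅.ints _ (notMem_intTargets_localLayerLoop _ (by simp)))
    (hA₅.ints _ (notMem_intTargets_localLayerLoop _ (by simp)))
  refine (runs_finishProg (S := S) (c := c) (ρ := ρ) (state := state) (fun q => rfl) hR₅ hC₅).mono
    (Nat.add_le_add_right (Nat.mul_le_mul_right _ hs₅) _) ?_
  intro σ' _ h
  rw [h, ← propagationEstimate_zero_tableOp k (prefixCircuit U 0 (Nat.zero_le _)) hρ hC₅.supp,
    hest, hf]

theorem computesWithin_localProg {n L m a c D K : ℕ} {U : Circuit n L} (hn : 2 ≤ n) (hL : 2 ≤ L)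
    (hD : 1 ≤ D) (hm : m ≤ n ^ a) {G : SimpleGraph (Fin n)} (hG : HasGeometricDimension G D K)
    {d : LocalCircuit G L} (hd : d.Describes U) {ρ : QOp (Fin n)} (hρ : IsQuantumState ρ)
    (O : Fin m → PauliString n × ℝ) (state : PauliAccess c n) {ε δ : ℝ} (hε : 0 < ε)
    (hε' : ε ≤ 1) (hδ : 0 < δ) (hδ' : δ ≤ 1) :
    ComputesWithin localProg (localInstance d ρ O state) [n, L, m] [ε, δ]
      ((n : ℝ) ^ (a + c + 14 * K + 85) * (L : ℝ) * ((min n (L ^ D) : ℕ) : ℝ) ^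
        (((a + c + 14 * K + 85 : ℕ) : ℝ) * (1 + Real.log (ε⁻¹ * δ⁻¹))))
      (propagationEstimate (truncationOrder ε δ) U ρ (sparseObservable O)) := by
  obtain ⟨t, σ, he, ht, hv⟩ := runs_localProg hn hL hD hm hG hd hρ O state hε hδ
  refine ⟨t, σ, he, ?_, hv⟩
  have hy := Real.log_nonneg (one_le_inv_mul_inv hε hε' hδ hδ')
  set M := min n (L ^ D) with hM
  have hM2 : 2 ≤ M := le_min hn (hL.trans (Nat.le_self_pow (by omega) L))
  -- The constant 8192 = 2¹³ is at most n¹³, which with n · n · n^c · n^a gives n^(a+c+15). The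
  -- exponent of M is multiplied by 7 in passing from k + 1 to the logarithm, and 7(2K+10) = 14K +
  -- 70. The constant a + c + 14K + 85 is the sum of both.
  have h1 : t ≤ n ^ (a + c + 15) * L * M ^ ((2 * K + 10) * (truncationOrder ε δ + 1)) := by
    refine ht.trans ?_
    calc _ = (8192 * (n * n * n ^ c * n ^ a)) * L *
          M ^ ((2 * K + 10) * (truncationOrder ε δ + 1)) := by ring
      _ ≤ _ := by
        gcongr
        calc 8192 * (n * n * n ^ c * n ^ a) ≤ n ^ 13 * (n * n * n ^ c * n ^ a) := by
              gcongr
              calc 8192 = 2 ^ 13 := by norm_num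
                _ ≤ n ^ 13 := Nat.pow_le_pow_left hn 13
          _ = _ := by ring
  have h2 := pow_truncationOrder_le_rpow hε hε' hδ hδ' (b := M) (by omega) (2 * K + 10)
  have h3 : (M : ℝ) ^ (((7 * (2 * K + 10) : ℕ) : ℝ) * (1 + Real.log (ε⁻¹ * δ⁻¹))) ≤
      (M : ℝ) ^ (((a + c + 14 * K + 85 : ℕ) : ℝ) * (1 + Real.log (ε⁻¹ * δ⁻¹))) := by
    refine Real.rpow_le_rpow_of_exponent_le (by exact_mod_cast (by omega : 1 ≤ M))
      (mul_le_mul_of_nonneg_right ?_ (by linarith))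
    exact_mod_cast (by omega : 7 * (2 * K + 10) ≤ a + c + 14 * K + 85)
  have h4 : (n : ℝ) ^ (a + c + 15) ≤ (n : ℝ) ^ (a + c + 14 * K + 85) :=
    pow_le_pow_right₀ (by exact_mod_cast (by omega : 1 ≤ n)) (by omega)
  calc (t : ℝ) ≤ ((n ^ (a + c + 15) * L *
        M ^ ((2 * K + 10) * (truncationOrder ε δ + 1)) : ℕ) : ℝ) := by exact_mod_cast h1
    _ ≤ _ := by
        rw [Nat.cast_mul, Nat.cast_mul, Nat.cast_pow]
        exact mul_le_mul (mul_le_mul_of_nonneg_right h4 (Nat.cast_nonneg _)) (h2.trans h3)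
          (Nat.cast_nonneg _) (by positivity)

/-! ## The main theorem -/

theorem le_circuitLaw_error_le_of_operatorNorm_le_one {n L : ℕ}
    {μ : Fin L → Measure (QUnitary (Fin n))} (hμ : IsLocallyScramblingEnsemble μ)
    {ρ : QOp (Fin n)} (hρ : IsQuantumState ρ) {O : QOp (Fin n)} (hO : operatorNorm O ≤ 1)
    {ε δ : ℝ} (hε : 0 < ε) (hδ : 0 < δ) :
    ENNReal.ofReal (1 - δ) ≤ circuitLaw μ {U |
      ‖propagationEstimate (truncationOrder ε δ) U ρ O - expectationValue U ρ O‖ ≤ ε} := by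
  refine (le_circuitLaw_error_le hμ hρ O hε hδ).trans (measure_mono fun U hU => ?_)
  rw [Set.mem_ofPred_eq] at hU ⊢
  have := (pauliTwoNorm_le_operatorNorm O).trans hO
  nlinarith

theorem theorem2 :
    -- the truncation order is O(log(1/(εδ)))
    (∃ C : ℕ, ∀ ε δ : ℝ, 0 < ε → ε ≤ 1 → 0 < δ → δ ≤ 1 →
      (truncationOrder ε δ : ℝ) ≤ C * (1 + Real.log (ε⁻¹ * δ⁻¹))) ∧
    -- accuracy of low-weight Pauli propagation
    (∀ (n L : ℕ) (μ : Fin L → Measure (QUnitary (Fin n))), IsLocallyScramblingEnsemble μ →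
      ∀ ρ O : QOp (Fin n), IsQuantumState ρ → O.IsHermitian →
      ∀ ε δ : ℝ, 0 < ε → 0 < δ →
        ENNReal.ofReal (1 - δ) ≤ circuitLaw μ {U |
          ‖propagationEstimate (truncationOrder ε δ) U ρ O - expectationValue U ρ O‖
            ≤ ε * pauliTwoNorm O} ∧
        pauliTwoNorm O ≤ operatorNorm O) ∧
    -- general circuits
    (∃ A : Program, ∀ c : ℕ, ∃ C : ℕ, ∀ n L : ℕ, 2 ≤ n → 1 ≤ L →
      ∀ μ : Fin L → Measure (QUnitary (Fin n)), IsLocallyScramblingEnsemble μ →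
      (∀ᵐ U ∂(circuitLaw μ), HasSparseLayers c U) →
      ∀ ρ O : QOp (Fin n), IsQuantumState ρ → O.IsHermitian → operatorNorm O ≤ 1 →
      ∀ ε δ : ℝ, 0 < ε → ε ≤ 1 → 0 < δ → δ ≤ 1 →
        (∀ᵐ U ∂(circuitLaw μ), ∀ (layers : LayerAccess c U) (state obs : PauliAccess c n),
          ComputesWithin A (generalInstance layers ρ O state obs) [n, L] [ε, δ]
            ((L : ℝ) * (n : ℝ) ^ ((C : ℝ) * (1 + Real.log (ε⁻¹ * δ⁻¹))))
            (propagationEstimate (truncationOrder ε δ) U ρ O)) ∧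
        ENNReal.ofReal (1 - δ) ≤ circuitLaw μ {U |
          ‖propagationEstimate (truncationOrder ε δ) U ρ O - expectationValue U ρ O‖ ≤ ε}) ∧
    -- geometrically local circuits and polynomially sparse observables
    (∃ A : Program, ∀ a c K : ℕ, ∃ C : ℕ, ∀ D n L m : ℕ, 1 ≤ D → 2 ≤ n → 2 ≤ L → m ≤ n ^ a →
      ∀ G : SimpleGraph (Fin n), HasGeometricDimension G D K →
      ∀ μ : Fin L → Measure (QUnitary (Fin n)), IsLocallyScramblingEnsemble μ →
      (∀ᵐ U ∂(circuitLaw μ), ∃ d : LocalCircuit G L, d.Describes U) →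
      ∀ (ρ : QOp (Fin n)) (O : Fin m → PauliString n × ℝ), IsQuantumState ρ →
      operatorNorm (sparseObservable O) ≤ 1 →
      ∀ ε δ : ℝ, 0 < ε → ε ≤ 1 → 0 < δ → δ ≤ 1 →
        (∀ᵐ U ∂(circuitLaw μ), ∀ d : LocalCircuit G L, d.Describes U →
          ∀ state : PauliAccess c n,
          ComputesWithin A (localInstance d ρ O state) [n, L, m] [ε, δ]
            ((n : ℝ) ^ C * (L : ℝ) *
              ((min n (L ^ D) : ℕ) : ℝ) ^ ((C : ℝ) * (1 + Real.log (ε⁻¹ * δ⁻¹))))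
            (propagationEstimate (truncationOrder ε δ) U ρ (sparseObservable O))) ∧
        ENNReal.ofReal (1 - δ) ≤ circuitLaw μ {U |
          ‖propagationEstimate (truncationOrder ε δ) U ρ (sparseObservable O)
            - expectationValue U ρ (sparseObservable O)‖ ≤ ε}) := by
  refine ⟨⟨6, fun ε δ hε hε' hδ hδ' => truncationOrder_le hε hε' hδ hδ'⟩, ?_, ?_, ?_⟩
  · intro n L μ hμ ρ O hρ _ ε δ hε hδ
    exact ⟨le_circuitLaw_error_le hμ hρ O hε hδ, pauliTwoNorm_le_operatorNorm O⟩
  · refine ⟨generalProg, fun c => ⟨7 * (4 * c + 21), ?_⟩⟩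
    intro n L hn hL μ hμ hsparse ρ O hρ hO hO1 ε δ hε hε' hδ hδ'
    refine ⟨?_, le_circuitLaw_error_le_of_operatorNorm_le_one hμ hρ hO1 hε hδ⟩
    filter_upwards [hsparse] with U hU layers state obs
    exact computesWithin_generalProg hn hL hU layers hρ hO state obs hε hε' hδ hδ'
  · refine ⟨localProg, fun a c K => ⟨a + c + 14 * K + 85, ?_⟩⟩
    intro D n L m hD hn hL hm G hG μ hμ _ ρ O hρ hO1 ε δ hε hε' hδ hδ'
    refine ⟨Filter.Eventually.of_forall fun U d hd state => ?_,
      le_circuitLaw_error_le_of_operatorNorm_le_one hμ hρ hO1 hε hδ⟩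
    exact computesWithin_localProg hn hL hD hm hG hd hρ O state hε hε' hδ hδ'
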